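/- **Setting.** All logarithms are to base $2$. For $n\ge 1$ put $N=2n$. Let $u,v\in\mathbb Z^n$ and let $x,y\in\mathbb Z^N$ be $u,v$ padded by $n$ zeros. Vectors are indexed from $0$; $\|x\|_0$ is the number of nonzero coordinates, and $(x\star y)_i=\sum_{(j+j')\bmod N=i}x_jy_{j'}$. Vectors are given, and returned, as lists of their nonzero coordinates with their values. The machine has words of $\lceil\log N\rceil$ bits; elementary operations ($+,-,\cdot$, integer division, remainder, comparison, memory access, drawing a uniform random integer below a given bound) on integers of $O(1)$ words take $O(1)$ time. All inputs fit into $O(1)$ words: for a constant $\kappa$, $|u_i|,|v_i|\le N^\kappa$ and $B\le N^\kappa$. Let $\omega=e^{i\pi/N}$, a $2N$-th root of unity, and for $z\in\mathbb Z^N$, $m\ge1$ let $(\mathcal P_m z)_b=\sum_{j\bmod m=b}z_j\,\omega^j$ for $0\le b<m$. Complex numbers are kept in fixed point with $c\lceil\log N\rceil$ binary digits; powers of $\omega$ come from Taylor expansion. $\textsc{Locate}(x,y,w,B,\delta)$: let $m=\lceil\log(1/\delta)\rceil$. Repeat $5m$ times: pick a uniformly random prime $p<CB\lceil\log N\rceil^2$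 (all such primes being found by Eratosthenes' sieve); compute (approximately) $\mathcal P_p(x\star y-w)=\mathcal P_p(x)\star\mathcal P_p(y)-\mathcal P_p(w)$, the cyclic convolution of length $p$ by FFT; if more than $B$ entries have absolute value at least $1/N$, return the zero vector; otherwise, for each such entry, let $v$ be its absolute value rounded to the nearest integer and $i\in\{0,\dots,2N-1\}$ the exponent, found by binary search, for which $\omega^i$ is closest to its phase; if $i\ge N$, replace $(i,v)$ by $(i-N,-v)$; record $(i,v)$. Finally keep the pairs recorded at least $\frac34\cdot5m$ times, and return the vector $z$ with $z_i=v$ for the kept pairs (the last one, if several have the same $i$) and $0$ elsewhere. $\textsc{HashAndIterate}(x,y,B,\delta)$: start with $w=0$; for $r=1,\dots,\lceil\log B\rceil$ replace $w$ by $w+\textsc{Locate}(x,y,w,\lceil B2^{-r+1}\rceil,\delta/\lceil\log B\rceil)$; return $w$. **Lemma.** For every sufficiently large absolute constant $C$, every $\kappa$, and every $c$ that is sufficiently large in terms of $C,\kappa$, there is a constant $K=K(C,\kappa,c)$ such that the following holds for all $n\ge1$, all $u,v$ as above, all $0<\delta<1$ and all integers $B\le N^\kappa$ with $B>C\|x\star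 y\|_0$. 1. With probability at least $1-\delta$, $\textsc{HashAndIterate}(x,y,B,\delta)$ returns exactly $x\star y$, as the list of its $\|x\star y\|_0$ nonzero coordinates. 2. If $B\ge3$ and $\log(1/\delta)\le N^\kappa$ (so that the number of repetitions fits into $O(1)$ words), then on every outcome of the random choices the running time is at most $$K\cdot\bigl(B\log^2N\cdot\log(B\log^2N)+(\|x\|_0+\|y\|_0)\log N\log B\bigr)\cdot\log\bigl(\log B/\delta\bigr).$$ -/

import Mathlib

namespace SparseConv

/-! ### Vectors, cyclic convolution, sparse lists -/

/-- The cyclic convolution of two integer vectors of length `N`. -/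
def cyclicConv {N : ℕ} (x y : Fin N → ℤ) : Fin N → ℤ := fun i =>
  ∑ j : Fin N, ∑ j' : Fin N, if ((j : ℕ) + (j' : ℕ)) % N = (i : ℕ) then x j * y j' else 0

/-- The number of nonzero coordinates. -/
def norm0 {N : ℕ} (x : Fin N → ℤ) : ℕ := (Finset.univ.filter fun i => x i ≠ 0).card

/-- A vector of length `n`, padded by `n` zeros to length `N = 2 n`. -/
def zeroPad {n : ℕ} (u : Fin n → ℤ) : Fin (2 * n) → ℤ := fun i =>
  if h : (i : ℕ) < n then u ⟨i, h⟩ else 0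

/-- `L` lists every nonzero coordinate of `x` exactly once, as a pair (index, value),
in some order, and lists nothing else. -/
def Represents {N : ℕ} (L : List (ℤ × ℤ)) (x : Fin N → ℤ) : Prop :=
  (L.map Prod.fst).Nodup ∧
    ∀ i v : ℤ, (i, v) ∈ L ↔ ∃ k : Fin N, ((k : ℕ) : ℤ) = i ∧ x k = v ∧ v ≠ 0

/-! ### Computations with a step count -/

/-- The result of a deterministic computation together with the number of steps it took. -/
structure Timed (α : Type) where
  val : α
  time : ℕ

instance : Monad Timed where
  pure a := ⟨a, 0⟩
  bind m f := ⟨(f m.val).val, m.time + (f m.val).time⟩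

/-- Spend `t` steps. -/
def tick (t : ℕ) : Timed Unit := ⟨(), t⟩

/-- A randomized computation: the joint law of its result and its number of steps. -/
def Rnd (α : Type) := PMF (Timed α)

noncomputable instance : Monad Rnd where
  pure a := PMF.pure ⟨a, 0⟩
  bind m f := PMF.bind m fun t => PMF.map (fun s => ⟨s.val, t.time + s.time⟩) (f t.val)

noncomputable instance : MonadLift Timed Rnd where
  monadLift t := PMF.pure t

/-- The law of the result and the number of steps. -/
def Rnd.law {α : Type} (m : Rnd α) : PMF (Timed α) := m

/-- The number of machine words, of `W` bits each, that the integer `z` occupies. -/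
def words (W : ℕ) (z : ℤ) : ℕ := z.natAbs.size / W + 1

/-- Arithmetic expressions, the leaves being integers held in registers. -/
inductive Exp where
  | lit : ℤ → Exp
  | add : Exp → Exp → Exp
  | sub : Exp → Exp → Exp
  | mul : Exp → Exp → Exp
  | div : Exp → Exp → Exp
  | mod : Exp → Exp → Exp

instance : Coe ℤ Exp := ⟨Exp.lit⟩
instance (k : ℕ) : OfNat Exp k := ⟨Exp.lit (k : ℤ)⟩
instance : Add Exp := ⟨Exp.add⟩
instance : Sub Exp := ⟨Exp.sub⟩
instance : Mul Exp := ⟨Exp.mul⟩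
instance : Div Exp := ⟨Exp.div⟩
instance : Mod Exp := ⟨Exp.mod⟩

def Exp.eval : Exp → ℤ
  | .lit a => a
  | .add a b => a.eval + b.eval
  | .sub a b => a.eval - b.eval
  | .mul a b => a.eval * b.eval
  | .div a b => a.eval / b.eval
  | .mod a b => a.eval % b.eval

/-- The cost of one elementary operation on two integers: constant if both fit into `O(1)` words,
and the cost of schoolbook arithmetic in general. -/
def opCost (W : ℕ) (a b : ℤ) : ℕ := (words W a + words W b) ^ 2

def Exp.cost (W : ℕ) : Exp → ℕ
  | .lit _ => 0
  | .add a b => a.cost W + b.cost W + opCost W a.eval b.eval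
  | .sub a b => a.cost W + b.cost W + opCost W a.eval b.eval
  | .mul a b => a.cost W + b.cost W + opCost W a.eval b.eval
  | .div a b => a.cost W + b.cost W + opCost W a.eval b.eval
  | .mod a b => a.cost W + b.cost W + opCost W a.eval b.eval

/-- Evaluate an expression. -/
def ev (W : ℕ) (e : Exp) : Timed ℤ := ⟨e.eval, e.cost W⟩

/-- The test `a ≤ b`. -/
def leT (W : ℕ) (a b : Exp) : Timed Bool :=
  ⟨decide (a.eval ≤ b.eval), a.cost W + b.cost W + opCost W a.eval b.eval⟩

/-- The test `a = b`. -/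
def eqT (W : ℕ) (a b : Exp) : Timed Bool :=
  ⟨decide (a.eval = b.eval), a.cost W + b.cost W + opCost W a.eval b.eval⟩

/-- Allocate an array of `k` zeros. -/
def newArray (k : ℤ) : Timed (Array ℤ) := ⟨Array.replicate k.toNat 0, k.toNat + 1⟩

/-- Read one array cell. -/
def readA (W : ℕ) (A : Array ℤ) (i : ℤ) : Timed ℤ :=
  ⟨A.getD i.toNat 0, words W i + words W (A.getD i.toNat 0)⟩

/-- Overwrite one array cell. -/
def writeA (W : ℕ) (A : Array ℤ) (i a : ℤ) : Timed (Array ℤ) :=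
  ⟨A.setIfInBounds i.toNat a, words W i + words W a⟩

/-- `for i = 0, …, k - 1 do f i`, acting on a state. -/
def forLoop {σ : Type} : ℕ → (ℕ → σ → Timed σ) → σ → Timed σ
  | 0, _, s => pure s
  | k + 1, f, s => do
    let s' ← forLoop k f s
    tick 1
    f k s'

/-! Linked lists: every cell that is visited or created costs a step. -/

def lengthT {α : Type} : List α → Timed ℤ
  | [] => do tick 1; pure 0
  | _ :: l => do tick 1; let k ← lengthT l; pure (k + 1)

def appendT {α : Type} : List α → List α → Timed (List α)
  | [], l => do tick 1; pure l
  | a :: k, l => do tick 1; let r ← appendT k l; pure (a :: r)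

def mapT {α β : Type} (f : α → Timed β) : List α → Timed (List β)
  | [] => do tick 1; pure []
  | a :: l => do tick 1; let b ← f a; let r ← mapT f l; pure (b :: r)

def zipT {α β γ : Type} (f : α → β → Timed γ) : List α → List β → Timed (List γ)
  | a :: k, b :: l => do tick 1; let c ← f a b; let r ← zipT f k l; pure (c :: r)
  | _, _ => do tick 1; pure []

/-- The entries at even positions and those at odd positions. -/
def splitT {α : Type} : List α → Timed (List α × List α)
  | [] => do tick 1; pure ([], [])
  | a :: l => do tick 1; let r ← splitT l; pure (a :: r.2, r.1)

/-- The first `k` entries and the remaining ones. -/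
def cutT {α : Type} : ℕ → List α → Timed (List α × List α)
  | 0, l => do tick 1; pure ([], l)
  | _ + 1, [] => do tick 1; pure ([], [])
  | k + 1, a :: l => do tick 1; let r ← cutT k l; pure (a :: r.1, r.2)

def replicateT {α : Type} (a : α) : ℕ → Timed (List α)
  | 0 => do tick 1; pure []
  | k + 1 => do tick 1; let r ← replicateT a k; pure (a :: r)

/-! ### Integer logarithm and square root -/

def log2Loop (W : ℕ) (v : ℤ) : ℕ → ℕ → ℤ → Timed (ℕ × ℤ)
  | 0, t, P => pure (t, P)
  | fuel + 1, t, P => do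
    let b ← leT W v P
    if b then pure (t, P) else do
      tick 1
      let P' ← ev W (2 * P)
      log2Loop W v fuel (t + 1) P'

/-- The least `t` with `v ≤ 2 ^ t`, and `2 ^ t`, by doubling. -/
def log2up (W : ℕ) (v : ℤ) : Timed (ℕ × ℤ) := log2Loop W v v.toNat 0 1

/-- The integer part of the square root of `v ≥ 0`, bit by bit. -/
def isqrt (W : ℕ) (v : ℤ) : Timed ℤ := do
  let t ← log2up W v
  let r ← forLoop (t.1 + 1) (fun _ (st : ℤ × ℤ) => do
      let a ← ev W (st.1 + st.2)
      let b ← leT W (a * a) v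
      let h ← ev W (st.2 / 2)
      pure (if b then a else st.1, h)) ((0 : ℤ), t.2)
  pure r.1

/-! ### Fixed-point complex arithmetic

The pair `(a, b)` of integers stands for the complex number `(a + b i) / S`, where `S` is a power
of two. -/

/-- What the subroutines share: the word size `W`, the numbers `n` and `N = 2 n`, the number
`len = ⌈log N⌉`, the scale `S`, the number of Taylor terms, and the fixed-point
approximation `pi` of `π`. -/
structure Ctx where
  W : ℕ
  n : ℤ
  N : ℤ
  len : ℕ
  S : ℤ
  terms : ℕ
  pi : ℤ

def caddT (W : ℕ) (x y : ℤ × ℤ) : Timed (ℤ × ℤ) := do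
  let a ← ev W (x.1 + y.1)
  let b ← ev W (x.2 + y.2)
  pure (a, b)

def csubT (W : ℕ) (x y : ℤ × ℤ) : Timed (ℤ × ℤ) := do
  let a ← ev W (x.1 - y.1)
  let b ← ev W (x.2 - y.2)
  pure (a, b)

def cmulT (W : ℕ) (S : ℤ) (x y : ℤ × ℤ) : Timed (ℤ × ℤ) := do
  let a ← ev W ((x.1 * y.1 - x.2 * y.2) / S)
  let b ← ev W ((x.1 * y.2 + x.2 * y.1) / S)
  pure (a, b)

/-- Fixed-point `arctan (1 / q)` from `K` terms of its power series. -/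
def arctanInv (W : ℕ) (S : ℤ) (K : ℕ) (q : ℤ) : Timed ℤ := do
  let p0 ← ev W (S / q)
  let r ← forLoop K (fun k (st : ℤ × ℤ × ℤ) => do
      -- the state: `± 1`, the power `S / q ^ (2 k + 1)`, the partial sum
      let s ← ev W (st.2.2 + st.1 * (st.2.1 / (2 * (k : ℤ) + 1)))
      let p ← ev W (st.2.1 / (q * q))
      let e ← ev W (0 - st.1)
      pure (e, p, s)) ((1 : ℤ), p0, (0 : ℤ))
  pure r.2.2

/-- Fixed-point `π` by Machin's formula `π = 16 arctan (1 / 5) - 4 arctan (1 / 239)`. -/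
def piT (W : ℕ) (S : ℤ) (K : ℕ) : Timed ℤ := do
  let a ← arctanInv W S K 5
  let b ← arctanInv W S K 239
  ev W (16 * a - 4 * b)

/-- Fixed-point `exp (i π a / b)` by Taylor expansion. With `b = N` this is `ω ^ a`, where
`ω = exp (i π / N)` is a primitive `2 N`-th root of unity. -/
def cisT (X : Ctx) (a b : ℤ) : Timed (ℤ × ℤ) := do
  let θ ← ev X.W (X.pi * a / b)
  let r ← forLoop X.terms (fun k (st : (ℤ × ℤ) × (ℤ × ℤ)) => do
      -- the state: the `k`-th Taylor term, the partial sum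
      let s ← caddT X.W st.2 st.1
      let re ← ev X.W (0 - st.1.2 * θ / (X.S * ((k : ℤ) + 1)))
      let im ← ev X.W (st.1.1 * θ / (X.S * ((k : ℤ) + 1)))
      pure ((re, im), s)) ((X.S, (0 : ℤ)), ((0 : ℤ), (0 : ℤ)))
  pure r.2

/-! ### Convolution by the fast Fourier transform -/

/-- The lists of all `e_k + t_k o_k` and of all `e_k - t_k o_k`. -/
def butterfly (X : Ctx) : List (ℤ × ℤ) → List (ℤ × ℤ) → List (ℤ × ℤ) →
    Timed (List (ℤ × ℤ) × List (ℤ × ℤ))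
  | t :: ts, e :: es, o :: os => do
    tick 1
    let m ← cmulT X.W X.S t o
    let a ← caddT X.W e m
    let b ← csubT X.W e m
    let r ← butterfly X ts es os
    pure (a :: r.1, b :: r.2)
  | _, _, _ => do tick 1; pure ([], [])

/-- The discrete Fourier transform of length `2 ^ q`; the list `tw` holds the first `2 ^ (q - 1)`
powers of the root of unity. -/
def fft (X : Ctx) : ℕ → List (ℤ × ℤ) → List (ℤ × ℤ) → Timed (List (ℤ × ℤ))
  | 0, _, a => do tick 1; pure a
  | q + 1, tw, a => do
    let s ← splitT a
    let tw' ← splitT tw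
    let e ← fft X q tw'.1 s.1
    let o ← fft X q tw'.1 s.2
    let r ← butterfly X tw e o
    appendT r.1 r.2

/-- The list `cur, cur z, …, cur z ^ (k - 1)`. -/
def powersT (X : Ctx) (z : ℤ × ℤ) : ℕ → ℤ × ℤ → Timed (List (ℤ × ℤ))
  | 0, _ => do tick 1; pure []
  | k + 1, cur => do
    tick 1
    let nxt ← cmulT X.W X.S cur z
    let r ← powersT X z k nxt
    pure (cur :: r)

/-- The cyclic convolution of two lists of length `p ≥ 1`: both are padded by zeros to length
`2 ^ q ≥ 2 p`, multiplied through the Fourier transform, and the result is folded modulo `p`. -/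
def convT (X : Ctx) (p : ℤ) (a b : List (ℤ × ℤ)) : Timed (List (ℤ × ℤ)) := do
  let p2 ← ev X.W (2 * p)
  let q ← log2up X.W p2
  let z ← cisT X 2 q.2
  let half ← ev X.W (q.2 / 2)
  let tw ← powersT X z half.toNat (X.S, 0)
  let twc ← mapT (fun t : ℤ × ℤ => do let c ← ev X.W (0 - t.2); pure (t.1, c)) tw
  let gap ← ev X.W (q.2 - p)
  let zs ← replicateT ((0 : ℤ), (0 : ℤ)) gap.toNat
  let a' ← appendT a zs
  let b' ← appendT b zs
  let fa ← fft X q.1 tw a'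
  let fb ← fft X q.1 tw b'
  let fc ← zipT (cmulT X.W X.S) fa fb
  let c ← fft X q.1 twc fc
  let c' ← mapT (fun t : ℤ × ℤ => do
      let re ← ev X.W (t.1 / q.2)
      let im ← ev X.W (t.2 / q.2)
      pure (re, im)) c
  let s ← cutT p.toNat c'
  zipT (caddT X.W) s.1 s.2

/-! ### Hashing -/

def foldLoop (X : Ctx) (p : ℤ) : List (ℤ × ℤ) → Array ℤ × Array ℤ → Timed (Array ℤ × Array ℤ)
  | [], st => do tick 1; pure st
  | (j, v) :: l, st => do
    tick 1
    let z ← cisT X j X.N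
    let i ← ev X.W (j % p)
    let a ← readA X.W st.1 i
    let b ← readA X.W st.2 i
    let a' ← ev X.W (a + v * z.1)
    let b' ← ev X.W (b + v * z.2)
    let A ← writeA X.W st.1 i a'
    let B ← writeA X.W st.2 i b'
    foldLoop X p l (A, B)

/-- The hashed vector with the entries `∑_{j mod p = i} x_j ω ^ j`, `0 ≤ i < p`, of a vector `x`
given by the list of its nonzero coordinates. -/
def foldT (X : Ctx) (p : ℤ) (L : List (ℤ × ℤ)) : Timed (List (ℤ × ℤ)) := do
  let A ← newArray p
  let B ← newArray p
  let st ← foldLoop X p L (A, B)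
  zipT (fun a b => pure (a, b)) st.1.toList st.2.toList

/-- The hashed vector of `x ⋆ y - w`. -/
def hashT (X : Ctx) (p : ℤ) (xs ys ws : List (ℤ × ℤ)) : Timed (List (ℤ × ℤ)) := do
  let a ← foldT X p xs
  let b ← foldT X p ys
  let w ← foldT X p ws
  let c ← convT X p a b
  zipT (csubT X.W) c w

/-! ### Reading a bucket -/

/-- Whether the absolute value of a bucket is at least `1 / N`. -/
def heavyT (X : Ctx) (z : ℤ × ℤ) : Timed Bool :=
  leT X.W (X.S * X.S) (X.N * X.N * (z.1 * z.1 + z.2 * z.2))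

/-- The heavy buckets. -/
def heavies (X : Ctx) : List (ℤ × ℤ) → Timed (List (ℤ × ℤ))
  | [] => do tick 1; pure []
  | z :: l => do
    tick 1
    let b ← heavyT X z
    let r ← heavies X l
    pure (if b then z :: r else r)

def distSq (X : Ctx) (z w : ℤ × ℤ) : Timed ℤ :=
  ev X.W ((z.1 - w.1) * (z.1 - w.1) + (z.2 - w.2) * (z.2 - w.2))

/-- The exponent `j`, `0 ≤ j < 2 N`, for which `ω ^ j` is closest to the complex number `z` of
absolute value about 1. First `z` is turned into the first quadrant, by steps of a quarter turn
`ω ^ n = i`; there, a binary search over `0, …, n` finds the last `ω ^ l` up to `z`, and one of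
`l`, `l + 1` is chosen by distance. -/
def phaseT (X : Ctx) (z : ℤ × ℤ) : Timed ℤ := do
  let st ← forLoop 3 (fun _ (st : (ℤ × ℤ) × ℤ) => do
      let b1 ← leT X.W 1 st.1.1
      let b2 ← leT X.W 0 st.1.2
      if b1 && b2 then pure st else do
        let im ← ev X.W (0 - st.1.1)
        let base ← ev X.W (st.2 + X.n)
        pure ((st.1.2, im), base)) (z, (0 : ℤ))
  let hi ← ev X.W (X.n + 1)
  let r ← forLoop (X.len + 1) (fun _ (lh : ℤ × ℤ) => do
      let mid ← ev X.W ((lh.1 + lh.2) / 2)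
      let c ← cisT X mid X.N
      let b ← leT X.W 0 (c.1 * st.1.2 - c.2 * st.1.1)
      pure (if b then (mid, lh.2) else (lh.1, mid))) ((0 : ℤ), hi)
  let nxt ← ev X.W (r.1 + 1)
  let c0 ← cisT X r.1 X.N
  let c1 ← cisT X nxt X.N
  let d0 ← distSq X c0 st.1
  let d1 ← distSq X c1 st.1
  let b ← leT X.W d0 d1
  ev X.W ((st.2 + (if b then r.1 else nxt)) % (2 * X.N))

/-- The pair (index, value) read off a heavy bucket: its absolute value is rounded to the nearest
integer, and its phase gives the index and the sign. -/
def decodeT (X : Ctx) (z : ℤ × ℤ) : Timed (ℤ × ℤ) := do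
  let q ← ev X.W (z.1 * z.1 + z.2 * z.2)
  let g ← isqrt X.W q
  let v ← ev X.W ((2 * g + X.S) / (2 * X.S))
  let re ← ev X.W (z.1 * X.S / g)
  let im ← ev X.W (z.2 * X.S / g)
  let j ← phaseT X (re, im)
  let b ← leT X.W X.N j
  if b then do
    let i ← ev X.W (j - X.N)
    let v' ← ev X.W (0 - v)
    pure (i, v')
  else pure (j, v)

/-- One repetition with the prime `p`: the pairs read off all heavy buckets, or `none` if more
than `B` buckets are heavy. -/
def repetition (X : Ctx) (xs ys ws : List (ℤ × ℤ)) (B p : ℤ) :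
    Timed (Option (List (ℤ × ℤ))) := do
  let h ← hashT X p xs ys ws
  let hs ← heavies X h
  let k ← lengthT hs
  let b ← leT X.W k B
  if b then do
    let r ← mapT (decodeT X) hs
    pure (some r)
  else pure none

/-! ### Random primes -/

/-- The array of all primes `p < M`, by the sieve of Eratosthenes. -/
def sieve (W : ℕ) (M : ℤ) : Timed (Array ℤ) := do
  let A ← newArray M
  let cnt ← ev W (M - 2)
  let r ← forLoop cnt.toNat (fun k (st : Array ℤ × List ℤ) => do
      let i ← ev W ((k : ℤ) + 2)
      let c ← readA W st.1 i
      let isPrime ← eqT W c 0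
      if isPrime then do
        let m ← ev W ((M - 1) / i - 1)
        let A' ← forLoop m.toNat (fun l (D : Array ℤ) => do
            let idx ← ev W (((l : ℤ) + 2) * i)
            writeA W D idx 1) st.1
        pure (A', i :: st.2)
      else pure st) (A, ([] : List ℤ))
  let len ← lengthT r.2
  tick len.toNat
  pure r.2.toArray

/-- A uniformly random integer `i` with `0 ≤ i < k`, for `k ≥ 1`. -/
noncomputable def draw (W : ℕ) (k : ℤ) : Rnd ℤ :=
  PMF.map (fun i : ℕ => ⟨(i : ℤ), words W k⟩)
    (PMF.uniformOfFinset (Finset.range (max k.toNat 1)) ⟨0, by simp⟩)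

/-- A uniformly random entry of an array. -/
noncomputable def pick (W : ℕ) (A : Array ℤ) : Rnd ℤ := do
  let i ← draw W (A.size : ℤ)
  readA W A i

/-! ### Sorting and pruning -/

/-- The lexicographic order on pairs. -/
def lePair (W : ℕ) (a b : ℤ × ℤ) : Timed Bool := do
  let e ← eqT W a.1 b.1
  if e then leT W a.2 b.2 else leT W a.1 b.1

def mergeT (W : ℕ) : List (ℤ × ℤ) → List (ℤ × ℤ) → Timed (List (ℤ × ℤ))
  | [], l => do tick 1; pure l
  | k, [] => do tick 1; pure k
  | a :: k, b :: l => do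
    tick 1
    let c ← lePair W a b
    if c then do
      let r ← mergeT W k (b :: l)
      pure (a :: r)
    else do
      let r ← mergeT W (a :: k) l
      pure (b :: r)
termination_by k l => k.length + l.length

/-- Merge sort of a list of length at most `2 ^ d`. -/
def msort (W : ℕ) : ℕ → List (ℤ × ℤ) → Timed (List (ℤ × ℤ))
  | 0, l => do tick 1; pure l
  | d + 1, l => do
    let s ← splitT l
    let a ← msort W d s.1
    let b ← msort W d s.2
    mergeT W a b

/-- In a sorted list, keep one copy of each pair that occurs at least `(3 / 4) * 5 * m` times;
`cur` is the pair being counted and `cnt` the number of its occurrences so far. -/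
def prune (W : ℕ) (m : ℤ) : ℤ × ℤ → ℤ → List (ℤ × ℤ) → Timed (List (ℤ × ℤ))
  | cur, cnt, [] => do
    tick 1
    let b ← leT W (3 * (5 * m)) (4 * cnt)
    pure (if b then [cur] else [])
  | cur, cnt, a :: l => do
    tick 1
    let e1 ← eqT W cur.1 a.1
    let e2 ← eqT W cur.2 a.2
    if e1 && e2 then do
      let cnt' ← ev W (cnt + 1)
      prune W m cur cnt' l
    else do
      let b ← leT W (3 * (5 * m)) (4 * cnt)
      let r ← prune W m a 1 l
      pure (if b then cur :: r else r)

/-- The result of the successive assignments `z_i ← v`, for the pairs `(i, v)` of a sorted list: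
of several pairs with the same index the last one counts. -/
def assign (W : ℕ) : List (ℤ × ℤ) → Timed (List (ℤ × ℤ))
  | [] => do tick 1; pure []
  | [a] => do tick 1; pure [a]
  | a :: b :: l => do
    tick 1
    let e ← eqT W a.1 b.1
    let r ← assign W (b :: l)
    pure (if e then r else a :: r)

/-- The sum of two vectors given by lists of pairs (index, value) sorted by index; entries that
are zero are dropped. -/
def addSparse (W : ℕ) : List (ℤ × ℤ) → List (ℤ × ℤ) → Timed (List (ℤ × ℤ))
  | [], [] => do tick 1; pure []
  | a :: k, [] => do
    tick 1
    let z ← eqT W a.2 0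
    let r ← addSparse W k []
    pure (if z then r else a :: r)
  | [], b :: l => do
    tick 1
    let z ← eqT W b.2 0
    let r ← addSparse W [] l
    pure (if z then r else b :: r)
  | a :: k, b :: l => do
    tick 1
    let e ← eqT W a.1 b.1
    if e then do
      let s ← ev W (a.2 + b.2)
      let z ← eqT W s 0
      let r ← addSparse W k l
      pure (if z then r else (a.1, s) :: r)
    else do
      let c ← leT W a.1 b.1
      if c then do
        let z ← eqT W a.2 0
        let r ← addSparse W k (b :: l)
        pure (if z then r else a :: r)
      else do
        let z ← eqT W b.2 0
        let r ← addSparse W (a :: k) l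
        pure (if z then r else b :: r)
termination_by k l => k.length + l.length

/-- From the pairs collected in all repetitions to the vector `z`. -/
def collect (W : ℕ) (m : ℤ) (L : List (ℤ × ℤ)) : Timed (List (ℤ × ℤ)) := do
  let k ← lengthT L
  let d ← log2up W k
  let s ← msort W d.1 L
  match s with
  | [] => pure []
  | a :: l => do
    let r ← prune W m a 1 l
    assign W r

/-! ### The two routines -/

/-- `k` repetitions, each with a fresh random prime; `none` as soon as one of them gives `none`. -/
noncomputable def repeatLoop (X : Ctx) (xs ys ws : List (ℤ × ℤ)) (B : ℤ) (primes : Array ℤ) :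
    ℕ → List (ℤ × ℤ) → Rnd (Option (List (ℤ × ℤ)))
  | 0, L => pure (some L)
  | k + 1, L => do
    let p ← pick X.W primes
    let r ← (repetition X xs ys ws B p : Timed _)
    match r with
    | none => pure none
    | some new => do
      let L' ← (appendT new L : Timed _)
      let _ ← (tick 1 : Timed _)
      repeatLoop X xs ys ws B primes k L'

/-- The routine `Locate(x, y, w, B, δ)`, with `m = ⌈log (1 / δ)⌉`: `5 m` repetitions with random
primes `p < C B ⌈log N⌉ ^ 2`. -/
noncomputable def locate (C : ℕ) (X : Ctx) (xs ys ws : List (ℤ × ℤ)) (B : ℤ) (m : ℕ) :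
    Rnd (List (ℤ × ℤ)) := do
  let M ← ev X.W ((C : ℤ) * B * (X.len : ℤ) * (X.len : ℤ))
  let primes ← (sieve X.W M : Timed _)
  let r ← repeatLoop X xs ys ws B primes (5 * m) []
  match r with
  | none => pure []
  | some L => (collect X.W (m : ℤ) L : Timed _)

/-- The rounds of the main loop; `P` is `2 ^ (r - 1)` in round `r`, so that the parameter of
`locate` is `B * 2 ^ (-r + 1)`, rounded up. -/
noncomputable def rounds (C : ℕ) (X : Ctx) (xs ys : List (ℤ × ℤ)) (B : ℤ) (m : ℕ) :
    ℕ → ℤ → List (ℤ × ℤ) → Rnd (List (ℤ × ℤ))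
  | 0, _, w => pure w
  | k + 1, P, w => do
    let Br ← ev X.W ((B + P - 1) / P)
    let z ← locate C X xs ys w Br m
    let w' ← (addSparse X.W w z : Timed _)
    let P' ← ev X.W (2 * P)
    rounds C X xs ys B m k P' w'

/-- How often the real number `d > 0` has to be doubled until it is at least `R`. -/
noncomputable def doublings (R : ℕ) : ℕ → ℝ → Timed ℕ
  | 0, _ => pure 0
  | fuel + 1, d => do
    tick 1
    if (R : ℝ) ≤ d then pure 0 else do
      let t ← doublings R fuel (2 * d)
      pure (t + 1)

/-- The shared data: the precision is `c * ⌈log N⌉` binary digits. -/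
def setup (c : ℕ) (W : ℕ) (n : ℤ) : Timed Ctx := do
  let N ← ev W (2 * n)
  let l ← log2up W N
  let s ← ev W ((c : ℤ) * (l.1 : ℤ))
  let S ← forLoop s.toNat (fun _ (P : ℤ) => ev W (2 * P)) 1
  let K ← ev W (s + 40)
  let pi ← piT W S K.toNat
  pure ⟨W, n, N, l.1, S, K.toNat, pi⟩

/-- The routine `HashAndIterate(x, y, B, δ)` for vectors of length `N = 2 n`, given by the lists
`xs`, `ys` of their nonzero coordinates, on a machine with words of `⌈log N⌉` bits. There are
`R = ⌈log B⌉` rounds, and each calls `locate` with failure probability `δ / R`, that is, with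
`m = ⌈log (R / δ)⌉`. -/
noncomputable def hashAndIterate (C c n : ℕ) (xs ys : List (ℤ × ℤ)) (B : ℕ) (δ : ℝ) :
    Rnd (List (ℤ × ℤ)) := do
  let X ← (setup c (Nat.clog 2 (2 * n)) (n : ℤ) : Timed _)
  let R ← (log2up X.W (B : ℤ) : Timed _)
  let m ← (doublings R.1 ⌈(R.1 : ℝ) / δ⌉₊ δ : Timed _)
  rounds C X xs ys (B : ℤ) m R.1 1 []

end SparseConv

/-! Correctness. Because of the padding the cyclic convolution h of x and y is the ordinary one,
with all indices below N. Put g = h - w for what a round still has to find and k for the size of its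
support. The hash v ↦ (∑_{j mod p = b} v_j ω^j)_b is additive, and it turns convolution into cyclic
convolution of length p because ω^(i+j) = ω^i ω^j (`cconv_hashHom`); so the hash of g is computed
from those of x, y and w. A coordinate c at an index i that is alone in its residue class modulo p
leaves c ω^i in its bucket: the absolute value yields |c|, the phase yields i, and also the sign, as
ω^N = -1 (`decodeT_runs`). An empty bucket is never heavy. Hence in one repetition the coordinates
missed, and likewise the wrong pairs recorded, are at most as many as the non-isolated coordinates
(`records_of_approx`).

Probability. Put L = ⌈log N⌉. Two indices differ by less than 2^L, so at most L primes divide their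
difference; as there are at least 150 k L primes below C B L² (Chebyshev, `mul_le_primeCounting`), a
random prime leaves on average at most k / 150 coordinates non-isolated. Let s be the total of these
numbers over the 5 m repetitions. A double count shows that more than half of the coordinates can
stay wrong after pruning only if s ≥ (15/32) m k (`card_support_sub_collect_le`). The exponential
moment 16^(s/k) grows by a factor of at most 11/10 per repetition on average, so this has
probability at most ((11/10)^5 / 2^(15/8))^m ≤ 2^(-m) (`repeatLoop_ex`). Each successful round
halves k while the parameter is halved too, so C k 2^r < B is preserved, and after R = ⌈log B⌉
rounds k = 0. A union bound gives failure probability R 2^(-m) ≤ δ (`rounds_ex`).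

Running time. It has to be bounded on every outcome, including failed rounds, so the size bounds may
not depend on luck. Any result of `locate` has at most 4/3 as many entries as its parameter, and
norm at most 4 times that of g; thus the remaining vector grows at most fivefold per round and stays
polynomial in N, and w has O(B) entries. The parameters form a geometric series up to rounding, with
sum at most 2 B + R, and a repetition costs a Fourier transform of length O(C B L²), the hashing of
the lists, and the decoding of at most B buckets.

Precision. A = 2^(g L), with a new g = `boundExp C κ`, bounds all quantities in play, and the scale
is S = 2^(c L). Every numerical stage loses a fixed power of A times the error τ of the roots of
unity; c ≥ 60 g gives A^30 τ ≤ 1, which leaves buckets accurate to A^(-4), while distinct powers of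
ω are at least 2 / N apart. All numbers fit into a constant number D of words, so an elementary
expression has bounded cost. -/

open scoped ENNReal

namespace SparseConv

/-! ### Reasoning about step counts -/

/-- The computation `m` takes at most `t` steps and its result satisfies `P`. -/
def Runs {α : Type} (m : Timed α) (t : ℕ) (P : α → Prop) : Prop := P m.val ∧ m.time ≤ t

section Runs
variable {α β : Type} {m : Timed α} {f : α → Timed β} {t t' : ℕ} {P : α → Prop} {Q : β → Prop}

@[simp] theorem pure_val (a : α) : (pure a : Timed α).val = a := rfl
@[simp] theorem pure_time (a : α) : (pure a : Timed α).time = 0 := rfl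
@[simp] theorem bind_val (m : Timed α) (f : α → Timed β) : (m >>= f).val = (f m.val).val := rfl
@[simp] theorem bind_time (m : Timed α) (f : α → Timed β) :
    (m >>= f).time = m.time + (f m.val).time := rfl
@[simp] theorem tick_val (t : ℕ) : (tick t).val = () := rfl
@[simp] theorem tick_time (t : ℕ) : (tick t).time = t := rfl

theorem Runs.bind (h : Runs m t P) (h' : ∀ a, P a → Runs (f a) t' Q) :
    Runs (m >>= f) (t + t') Q :=
  ⟨(h' _ h.1).1, Nat.add_le_add h.2 (h' _ h.1).2⟩

theorem Runs.pure {a : α} (h : P a) : Runs (pure a) 0 P := ⟨h, le_rfl⟩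

theorem Runs.tick_bind {f : Unit → Timed β} {k : ℕ} (h : Runs (f ()) t' Q) :
    Runs (tick k >>= f) (k + t') Q :=
  ⟨h.1, Nat.add_le_add le_rfl h.2⟩

theorem Runs.mono (h : Runs m t P) (ht : t ≤ t') : Runs m t' P := ⟨h.1, h.2.trans ht⟩

theorem Runs.imp {P' : α → Prop} (h : Runs m t P) (hP : ∀ a, P a → P' a) : Runs m t P' :=
  ⟨hP _ h.1, h.2⟩

theorem Runs.ite {b : Bool} {m₁ m₂ : Timed α} (h₁ : b = true → Runs m₁ t P)
    (h₂ : b = false → Runs m₂ t P) : Runs (if b = true then m₁ else m₂) t P := by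
  cases b
  · simpa using h₂ rfl
  · simpa using h₁ rfl

end Runs

/-! ### The cost of arithmetic -/

/-- The integer `z` fits into about `D` words of `W` bits. -/
def Small (D W : ℕ) (z : ℤ) : Prop := z.natAbs ≤ 2 ^ (D * W)

/-- The number of leaves of an expression. -/
def Exp.leaves : Exp → ℕ
  | .lit _ => 1
  | .add a b => a.leaves + b.leaves
  | .sub a b => a.leaves + b.leaves
  | .mul a b => a.leaves + b.leaves
  | .div a b => a.leaves + b.leaves
  | .mod a b => a.leaves + b.leaves

/-- All leaves of an expression are small. -/
def Exp.Fits (D W : ℕ) : Exp → Prop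
  | .lit a => Small D W a
  | .add a b => a.Fits D W ∧ b.Fits D W
  | .sub a b => a.Fits D W ∧ b.Fits D W
  | .mul a b => a.Fits D W ∧ b.Fits D W
  | .div a b => a.Fits D W ∧ b.Fits D W
  | .mod a b => a.Fits D W ∧ b.Fits D W

section ExpSimp
variable (a b : Exp) (z : ℤ)
@[simp] theorem Exp.eval_lit : (Exp.lit z).eval = z := rfl
@[simp] theorem Exp.eval_two : (2 : Exp).eval = 2 := rfl
@[simp] theorem Exp.eval_three : (3 : Exp).eval = 3 := rfl
@[simp] theorem Exp.eval_four : (4 : Exp).eval = 4 := rfl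
@[simp] theorem Exp.eval_five : (5 : Exp).eval = 5 := rfl
@[simp] theorem Exp.eval_sixteen : (16 : Exp).eval = 16 := rfl
@[simp] theorem Exp.eval_forty : (40 : Exp).eval = 40 := rfl
@[simp] theorem Exp.eval_zero : (0 : Exp).eval = 0 := rfl
@[simp] theorem Exp.eval_one : (1 : Exp).eval = 1 := rfl
@[simp] theorem Exp.eval_add : (a + b).eval = a.eval + b.eval := rfl
@[simp] theorem Exp.eval_sub : (a - b).eval = a.eval - b.eval := rfl
@[simp] theorem Exp.eval_mul : (a * b).eval = a.eval * b.eval := rfl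
@[simp] theorem Exp.eval_div : (a / b).eval = a.eval / b.eval := rfl
@[simp] theorem Exp.eval_mod : (a % b).eval = a.eval % b.eval := rfl
end ExpSimp

theorem Exp.one_le_leaves (e : Exp) : 1 ≤ e.leaves := by
  induction e <;> simp only [Exp.leaves] <;> omega

/-- Numbers of bits add over the leaves: 2^a + 2^b ≤ 2^(a+b) for a, b ≥ 1 covers sums as well as
products, a quotient is no larger than its numerator, and a remainder no larger than its divisor (or
than its numerator, if the divisor is 0). -/
theorem Exp.natAbs_eval_le {D W : ℕ} (h : 1 ≤ D * W) (e : Exp) (he : e.Fits D W) :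
    e.eval.natAbs ≤ 2 ^ (D * W * e.leaves) := by
  have key : ∀ a b : Exp, 2 ^ (D * W * a.leaves) + 2 ^ (D * W * b.leaves)
      ≤ 2 ^ (D * W * (a.leaves + b.leaves)) := by
    intro a b
    have ha := a.one_le_leaves
    have hb := b.one_le_leaves
    rw [mul_add, pow_add]
    have h1 : 2 ≤ 2 ^ (D * W * a.leaves) := by
      calc 2 = 2 ^ 1 := rfl
        _ ≤ _ := Nat.pow_le_pow_right (by norm_num) (Nat.one_le_iff_ne_zero.2 (by positivity))
    have h2 : 2 ≤ 2 ^ (D * W * b.leaves) := by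
      calc 2 = 2 ^ 1 := rfl
        _ ≤ _ := Nat.pow_le_pow_right (by norm_num) (Nat.one_le_iff_ne_zero.2 (by positivity))
    nlinarith
  induction e with
  | lit a => simpa [Exp.leaves, Exp.eval, Exp.Fits, Small] using he
  | add a b iha ihb =>
    exact (Int.natAbs_add_le _ _).trans ((Nat.add_le_add (iha he.1) (ihb he.2)).trans (key a b))
  | sub a b iha ihb =>
    exact (Int.natAbs_sub_le _ _).trans ((Nat.add_le_add (iha he.1) (ihb he.2)).trans (key a b))
  | mul a b iha ihb =>
    simp only [Exp.eval, Exp.leaves, Int.natAbs_mul, mul_add, pow_add]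
    exact Nat.mul_le_mul (iha he.1) (ihb he.2)
  | div a b iha ihb =>
    have : (a.eval / b.eval).natAbs ≤ a.eval.natAbs := Int.natAbs_ediv_le_natAbs _ _
    exact this.trans ((iha he.1).trans ((Nat.le_add_right _ _).trans (key a b)))
  | mod a b iha ihb =>
    simp only [Exp.eval]
    rcases eq_or_ne b.eval 0 with h0 | h0
    · rw [h0, Int.emod_zero]
      exact (iha he.1).trans ((Nat.le_add_right _ _).trans (key a b))
    · have h1 := Int.emod_nonneg a.eval h0
      have h2 := Int.emod_lt_abs a.eval h0
      have : (a.eval % b.eval).natAbs ≤ b.eval.natAbs := by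
        zify
        rw [abs_of_nonneg h1]
        exact h2.le
      exact this.trans ((ihb he.2).trans ((Nat.le_add_left _ _).trans (key a b)))

theorem words_le {W k : ℕ} (hW : 1 ≤ W) {z : ℤ} (h : z.natAbs ≤ 2 ^ (k * W)) :
    words W z ≤ k + 2 := by
  have h1 : z.natAbs.size ≤ k * W + 1 := by
    rw [Nat.size_le, pow_succ]
    have : 0 < 2 ^ (k * W) := by positivity
    omega
  have h2 : z.natAbs.size / W ≤ k + 1 := by
    apply Nat.div_le_of_le_mul
    nlinarith
  unfold words
  omega

theorem opCost_le {W k : ℕ} (hW : 1 ≤ W) {a b : ℤ} (ha : a.natAbs ≤ 2 ^ (k * W))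
    (hb : b.natAbs ≤ 2 ^ (k * W)) : opCost W a b ≤ (2 * (k + 2)) ^ 2 := by
  have := words_le hW ha
  have := words_le hW hb
  exact Nat.pow_le_pow_left (by omega) 2

/-- A bound for the cost of evaluating a short expression whose leaves are `Small D`. -/
def unitCost (D : ℕ) : ℕ := 24 * (2 * (24 * D + 2)) ^ 2

/-- There is one operation fewer than there are leaves, and every operand has at most k leaves,
hence about k D words. Keeping k fixed in the induction gives all operations the same price. -/
theorem Exp.cost_le {D W : ℕ} (hW : 1 ≤ W) (hD : 1 ≤ D) (k : ℕ) (e : Exp) (he : e.Fits D W)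
    (hk : e.leaves ≤ k) : e.cost W ≤ (e.leaves - 1) * (2 * (k * D + 2)) ^ 2 := by
  have hDW : 1 ≤ D * W := Nat.mul_pos hD hW
  have key : ∀ a b : Exp, a.Fits D W → b.Fits D W → a.leaves + b.leaves ≤ k →
      a.cost W ≤ (a.leaves - 1) * (2 * (k * D + 2)) ^ 2 →
      b.cost W ≤ (b.leaves - 1) * (2 * (k * D + 2)) ^ 2 →
      a.cost W + b.cost W + opCost W a.eval b.eval ≤
        (a.leaves + b.leaves - 1) * (2 * (k * D + 2)) ^ 2 := by
    intro a b ha hb hab h1 h2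
    have h3 : ∀ e : Exp, e.Fits D W → e.leaves ≤ k → e.eval.natAbs ≤ 2 ^ (k * D * W) := by
      intro e he hk
      refine (e.natAbs_eval_le hDW he).trans (Nat.pow_le_pow_right (by norm_num) ?_)
      calc D * W * e.leaves ≤ D * W * k := Nat.mul_le_mul_left _ hk
        _ = k * D * W := by ring
    have h4 := opCost_le hW (h3 a ha (by omega)) (h3 b hb (by omega))
    have h5 : a.leaves + b.leaves - 1 = (a.leaves - 1) + (b.leaves - 1) + 1 := by
      have := a.one_le_leaves
      have := b.one_le_leaves
      omega
    rw [h5, add_mul, add_mul, one_mul]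
    omega
  induction e with
  | lit a => simp [Exp.cost]
  | add a b iha ihb | sub a b iha ihb | mul a b iha ihb | div a b iha ihb | mod a b iha ihb =>
    simp only [Exp.leaves] at hk
    exact key a b he.1 he.2 hk (iha he.1 (by omega)) (ihb he.2 (by omega))

/-- The machine has words of `W ≥ 1` bits, and `D` is large enough for the numerals in use. -/
structure Machine (D W : ℕ) : Prop where
  one_le_W : 1 ≤ W
  eight_le_D : 8 ≤ D

section Machine
variable {D W : ℕ}

theorem Machine.small_nat (h : Machine D W) {k : ℕ} (hk : k ≤ 256) : Small D W (k : ℤ) := by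
  unfold Small
  rw [Int.natAbs_natCast]
  calc k ≤ 2 ^ 8 := hk
    _ ≤ _ := Nat.pow_le_pow_right (by norm_num) (by nlinarith [h.1, h.2])

theorem Machine.small_zero (h : Machine D W) : Small D W 0 := h.small_nat (k := 0) (by norm_num)
theorem Machine.small_one (h : Machine D W) : Small D W 1 := h.small_nat (k := 1) (by norm_num)
theorem Machine.small_two (h : Machine D W) : Small D W 2 :=
  h.small_nat (k := 2) (by norm_num)
theorem Machine.small_three (h : Machine D W) : Small D W 3 :=
  h.small_nat (k := 3) (by norm_num)
theorem Machine.small_four (h : Machine D W) : Small D W 4 :=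
  h.small_nat (k := 4) (by norm_num)
theorem Machine.small_five (h : Machine D W) : Small D W 5 :=
  h.small_nat (k := 5) (by norm_num)
theorem Machine.small_sixteen (h : Machine D W) : Small D W 16 :=
  h.small_nat (k := 16) (by norm_num)
theorem Machine.small_forty (h : Machine D W) : Small D W 40 :=
  h.small_nat (k := 40) (by norm_num)

theorem Exp.cost_le_unitCost (h : Machine D W) {e : Exp} (he : e.Fits D W) (hk : e.leaves ≤ 24) :
    e.cost W ≤ unitCost D :=
  (e.cost_le h.1 (by have := h.2; omega) 24 he hk).trans
    (Nat.mul_le_mul_right _ (by omega))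

/-- The default argument counts the leaves by evaluation, so the length of a concrete expression
never has to be discussed; 24 is enough for all expressions in the routines. -/
theorem ev_runs (h : Machine D W) (e : Exp) (he : e.Fits D W)
    (hk : e.leaves ≤ 24 := by exact Nat.le_of_ble_eq_true rfl) :
    Runs (ev W e) (unitCost D) (fun a => a = e.eval) :=
  ⟨rfl, Exp.cost_le_unitCost h he hk⟩

theorem leT_runs (h : Machine D W) (a b : Exp) (ha : a.Fits D W) (hb : b.Fits D W)
    (hk : a.leaves + b.leaves ≤ 24 := by exact Nat.le_of_ble_eq_true rfl) :
    Runs (leT W a b) (unitCost D) (fun r => r = decide (a.eval ≤ b.eval)) :=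
  ⟨rfl, Exp.cost_le_unitCost h (e := .add a b) ⟨ha, hb⟩ hk⟩

theorem eqT_runs (h : Machine D W) (a b : Exp) (ha : a.Fits D W) (hb : b.Fits D W)
    (hk : a.leaves + b.leaves ≤ 24 := by exact Nat.le_of_ble_eq_true rfl) :
    Runs (eqT W a b) (unitCost D) (fun r => r = decide (a.eval = b.eval)) :=
  ⟨rfl, Exp.cost_le_unitCost h (e := .add a b) ⟨ha, hb⟩ hk⟩

theorem Small.words_le (h : Machine D W) {z : ℤ} (hz : Small D W z) : words W z ≤ D + 2 :=
  SparseConv.words_le h.1 hz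

theorem words_add_le_unitCost (h : Machine D W) {a b : ℤ} (ha : Small D W a) (hb : Small D W b) :
    words W a + words W b ≤ unitCost D := by
  have := ha.words_le h
  have := hb.words_le h
  unfold unitCost
  nlinarith

theorem readA_runs (h : Machine D W) (A : Array ℤ) (i : ℤ) (hi : Small D W i)
    (hA : Small D W (A.getD i.toNat 0)) :
    Runs (readA W A i) (unitCost D) (fun a => a = A.getD i.toNat 0) :=
  ⟨rfl, words_add_le_unitCost h hi hA⟩

theorem writeA_runs (h : Machine D W) (A : Array ℤ) (i a : ℤ) (hi : Small D W i)
    (ha : Small D W a) :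
    Runs (writeA W A i a) (unitCost D) (fun B => B = A.setIfInBounds i.toNat a) :=
  ⟨rfl, words_add_le_unitCost h hi ha⟩

end Machine

theorem one_le_unitCost (D : ℕ) : 1 ≤ unitCost D :=
  Nat.one_le_iff_ne_zero.2 (by unfold unitCost; positivity)

theorem Small.of_abs_le {D W : ℕ} {z : ℤ} (h : |z| ≤ 2 ^ (D * W)) : Small D W z := by
  unfold Small
  zify
  exact h

theorem Small.abs_le {D W : ℕ} {z : ℤ} (h : Small D W z) : |z| ≤ 2 ^ (D * W) := by
  unfold Small at h
  zify at h
  exact h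

theorem Small.of_abs_le_abs {D W : ℕ} {z w : ℤ} (hw : Small D W w) (h : |z| ≤ |w|) :
    Small D W z :=
  .of_abs_le (h.trans hw.abs_le)

theorem Small.of_nonneg_le {D W : ℕ} {z w : ℤ} (hw : Small D W w) (h0 : 0 ≤ z) (h : z ≤ w) :
    Small D W z :=
  hw.of_abs_le_abs (by rwa [abs_of_nonneg h0, abs_of_nonneg (h0.trans h)])

theorem Small.of_real {D W : ℕ} {z : ℤ} (h : |(z : ℝ)| ≤ 2 ^ (D * W)) : Small D W z :=
  .of_abs_le (by exact_mod_cast h)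

theorem Small.mono {D D' W : ℕ} {z : ℤ} (h : Small D W z) (hD : D ≤ D') : Small D' W z :=
  h.trans (Nat.pow_le_pow_right (by norm_num) (Nat.mul_le_mul_right _ hD))

theorem Machine.mono {D D' W : ℕ} (h : Machine D W) (hD : D ≤ D') : Machine D' W :=
  ⟨h.1, h.2.trans hD⟩

theorem unitCost_mono {D D' : ℕ} (hD : D ≤ D') : unitCost D ≤ unitCost D' := by
  unfold unitCost
  gcongr

theorem Small.two_mul {D W : ℕ} (hM : Machine D W) {z : ℤ} (h : Small D W z) :
    Small (D + 1) W (2 * z) := by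
  unfold Small at *
  rw [Int.natAbs_mul, add_mul, pow_add, mul_comm]
  refine Nat.mul_le_mul h ?_
  calc Int.natAbs 2 = 2 ^ 1 := rfl
    _ ≤ _ := Nat.pow_le_pow_right (by norm_num) (by have := hM.1; omega)

/-! ### Loops and lists -/

/-- The invariant rule with a cost that depends on the iteration. This generality serves the sieve,
whose cost is a harmonic sum. -/
theorem forLoop_runs_sum {σ : Type} (I : ℕ → σ → Prop) (t : ℕ → ℕ) (f : ℕ → σ → Timed σ) (s : σ)
    (k : ℕ) (h0 : I 0 s) (hs : ∀ i < k, ∀ s, I i s → Runs (f i s) (t i) (I (i + 1))) :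
    Runs (forLoop k f s) (∑ i ∈ Finset.range k, (t i + 1)) (I k) := by
  induction k with
  | zero => exact Runs.pure h0
  | succ k ih =>
    rw [Finset.sum_range_succ, add_comm (t k)]
    exact (ih fun i hi => hs i (by omega)).bind fun s' hs' =>
      Runs.tick_bind (hs k (by omega) s' hs')

theorem forLoop_runs {σ : Type} (I : ℕ → σ → Prop) (t : ℕ) (f : ℕ → σ → Timed σ) (s : σ)
    (k : ℕ) (h0 : I 0 s) (hs : ∀ i < k, ∀ s, I i s → Runs (f i s) t (I (i + 1))) :
    Runs (forLoop k f s) (k * (t + 1)) (I k) := by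
  simpa using forLoop_runs_sum I (fun _ => t) f s k h0 hs

section Lists
variable {α β γ : Type}

theorem lengthT_runs (l : List α) : Runs (lengthT l) (l.length + 1) (fun k => k = l.length) := by
  induction l with
  | nil => exact ⟨rfl, le_rfl⟩
  | cons a l ih =>
    refine Runs.mono (Runs.tick_bind (ih.bind (t' := 0) fun k hk => ?_)) ?_
    · subst hk
      exact Runs.pure (by simp)
    · simp only [List.length_cons]
      omega

theorem appendT_runs (k l : List α) :
    Runs (appendT k l) (k.length + 1) (fun r => r = k ++ l) := by
  induction k with
  | nil => exact ⟨rfl, le_rfl⟩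
  | cons a k ih =>
    refine Runs.mono (Runs.tick_bind (ih.bind (t' := 0) fun r hr => ?_)) ?_
    · subst hr
      exact Runs.pure rfl
    · simp only [List.length_cons]
      omega

theorem mapT_val (f : α → Timed β) (l : List α) :
    (mapT f l).val = l.map fun a => (f a).val := by
  induction l with
  | nil => rfl
  | cons a l ih => simp [mapT, ih]

theorem mapT_time (f : α → Timed β) (l : List α) (t : ℕ) (h : ∀ a ∈ l, (f a).time ≤ t) :
    (mapT f l).time ≤ l.length * (t + 1) + 1 := by
  induction l with
  | nil => simp [mapT]
  | cons a l ih =>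
    have h1 := ih fun b hb => h b (by simp [hb])
    have h2 := h a (by simp)
    simp only [mapT, bind_time, tick_time, pure_time, List.length_cons, add_mul]
    omega

theorem zipT_val (f : α → β → Timed γ) (k : List α) (l : List β) :
    (zipT f k l).val = List.zipWith (fun a b => (f a b).val) k l := by
  induction k generalizing l with
  | nil => simp [zipT]
  | cons a k ih =>
    cases l with
    | nil => simp [zipT]
    | cons b l => simp [zipT, ih]

theorem zipT_time (f : α → β → Timed γ) (k : List α) (l : List β) (t : ℕ)
    (h : ∀ a ∈ k, ∀ b ∈ l, (f a b).time ≤ t) :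
    (zipT f k l).time ≤ k.length * (t + 1) + 1 := by
  induction k generalizing l with
  | nil => simp [zipT]
  | cons a k ih =>
    cases l with
    | nil => simp [zipT]
    | cons b l =>
      have h1 := ih l fun a ha b hb => h a (by simp [ha]) b (by simp [hb])
      have h2 := h a (by simp) b (by simp)
      simp only [zipT, bind_time, tick_time, pure_time, List.length_cons, add_mul]
      omega

theorem splitT_time (l : List α) : (splitT l).time = l.length + 1 := by
  induction l with
  | nil => rfl
  | cons a l ih => simp [splitT, ih]; omega

theorem splitT_length (l : List α) :
    (splitT l).val.1.length = (l.length + 1) / 2 ∧ (splitT l).val.2.length = l.length / 2 := by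
  induction l with
  | nil => simp [splitT]
  | cons a l ih => simp [splitT, ih]; omega

/-- Both halves are treated at once because `splitT` exchanges them whenever a new head is put in
front. -/
theorem splitT_getD (l : List α) (d : α) (k : ℕ) :
    (splitT l).val.1.getD k d = l.getD (2 * k) d ∧
      (splitT l).val.2.getD k d = l.getD (2 * k + 1) d := by
  induction l generalizing k with
  | nil => simp [splitT]
  | cons a l ih =>
    simp only [splitT, bind_val, pure_val]
    refine ⟨?_, ?_⟩
    · cases k with
      | zero => simp
      | succ k => simpa [mul_add] using (ih k).2
    · simpa using (ih k).1

theorem splitT_perm (l : List α) : ((splitT l).val.1 ++ (splitT l).val.2).Perm l := by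
  induction l with
  | nil => simp [splitT]
  | cons a l ih =>
    simp only [splitT, bind_val, pure_val, List.cons_append]
    exact (List.perm_append_comm.trans ih).cons a

theorem cutT_val (k : ℕ) (l : List α) : (cutT k l).val = (l.take k, l.drop k) := by
  induction k generalizing l with
  | zero => simp [cutT]
  | succ k ih => cases l <;> simp [cutT, ih]

theorem cutT_time (k : ℕ) (l : List α) : (cutT k l).time ≤ l.length + 1 := by
  induction k generalizing l with
  | zero => simp [cutT]
  | succ k ih =>
    cases l with
    | nil => simp [cutT]
    | cons a l => have := ih l; simp [cutT]; omega

theorem replicateT_runs (a : α) (k : ℕ) :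
    Runs (replicateT a k) (k + 1) (fun r => r = List.replicate k a) := by
  induction k with
  | zero => exact ⟨rfl, le_rfl⟩
  | succ k ih =>
    refine ⟨?_, ?_⟩
    · simp [replicateT, ih.1, List.replicate_succ]
    · have := ih.2
      simp [replicateT]
      omega

end Lists

/-! ### Integer logarithm and square root -/

theorem log2Loop_val (W : ℕ) (v : ℤ) (fuel t : ℕ) (h : v ≤ 2 ^ (t + fuel)) :
    ∃ s, t ≤ s ∧ (log2Loop W v fuel t (2 ^ t)).val = (s, 2 ^ s) ∧ v ≤ 2 ^ s ∧
      ∀ r, t ≤ r → r < s → (2 : ℤ) ^ r < v := by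
  induction fuel generalizing t with
  | zero => exact ⟨t, le_rfl, rfl, by simpa using h, fun r h1 h2 => by omega⟩
  | succ fuel ih =>
    by_cases hv : v ≤ 2 ^ t
    · exact ⟨t, le_rfl, by simp [log2Loop, leT, hv], hv, fun r h1 h2 => by omega⟩
    · obtain ⟨s, hs, h1, h2, h3⟩ := ih (t + 1) (by rwa [add_right_comm, add_assoc])
      refine ⟨s, by omega, ?_, h2, fun r hr hr' => ?_⟩
      · rw [← h1]
        simp [log2Loop, leT, hv, ev, pow_succ, mul_comm]
      · rcases hr.eq_or_lt with rfl | hr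
        · exact not_le.1 hv
        · exact h3 r hr hr'

/-- The term with the factor t on the left is a potential: the t doublings already made are charged
to the final exponent, which makes the estimate stable under the recursion. One extra word suffices,
since only powers below v are doubled. -/
theorem log2Loop_time {D W : ℕ} (hM : Machine D W) (v : ℤ) (hv : Small D W v) (fuel t : ℕ)
    (hP : Small (D + 1) W (2 ^ t)) :
    (log2Loop W v fuel t (2 ^ t)).time + t * (2 * unitCost (D + 1) + 1) ≤
      ((log2Loop W v fuel t (2 ^ t)).val.1 + 1) * (2 * unitCost (D + 1) + 1) := by
  have hM' : Machine (D + 1) W := ⟨hM.1, by have := hM.2; omega⟩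
  have hv' : Small (D + 1) W v :=
    hv.trans (Nat.pow_le_pow_right (by norm_num) (Nat.mul_le_mul_right _ (by omega)))
  induction fuel generalizing t with
  | zero => simp [log2Loop, add_mul]
  | succ fuel ih =>
    have h1 := (leT_runs hM' v (2 ^ t : ℤ) hv' hP).2
    have h2 := (ev_runs hM' (2 * (Exp.lit (2 ^ t : ℤ))) ⟨hM'.small_two, hP⟩).2
    by_cases hle : v ≤ 2 ^ t
    · have h3 : (leT W v (2 ^ t : ℤ)).val = true := by simp [leT, hle]
      simp only [log2Loop, bind_time, bind_val, h3, if_true, pure_time, pure_val, add_mul]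
      omega
    · have h3 : (leT W v (2 ^ t : ℤ)).val = false := by simp [leT, hle]
      have h4 : (ev W (2 * (Exp.lit (2 ^ t : ℤ)))).val = 2 ^ (t + 1) := by
        simp [ev, pow_succ, mul_comm]
      have h5 := ih (t + 1) (by
        apply Small.of_abs_le
        rw [abs_of_pos (by positivity), pow_succ]
        have h6 := hv.abs_le
        have h7 : (2 : ℤ) ^ (D * W) * 2 ≤ 2 ^ ((D + 1) * W) := by
          rw [← pow_succ]
          exact pow_le_pow_right₀ (by norm_num) (by nlinarith [hM.1])
        have := (le_abs_self v)
        linarith [not_le.1 hle])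
      simp only [log2Loop, bind_time, bind_val, h3, Bool.false_eq_true, if_false, h4, tick_time]
      rw [add_mul] at h5
      omega

/-- The exponent and the power found by doubling. -/
theorem log2up_val (W : ℕ) (v : ℤ) (h1 : 1 ≤ v) :
    (log2up W v).val = (Nat.clog 2 v.toNat, 2 ^ Nat.clog 2 v.toNat) := by
  have hvt : v = (v.toNat : ℤ) := by omega
  obtain ⟨s, -, h2, h3, h4⟩ := log2Loop_val W v v.toNat 0 (by
    rw [zero_add]
    have : v.toNat < 2 ^ v.toNat := Nat.lt_two_pow_self
    calc v = (v.toNat : ℤ) := hvt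
      _ ≤ ((2 ^ v.toNat : ℕ) : ℤ) := by exact_mod_cast this.le
      _ = _ := by push_cast; rfl)
  have hs : s = Nat.clog 2 v.toNat := by
    apply le_antisymm
    · by_contra hlt
      have h5 := h4 _ (Nat.zero_le _) (not_le.1 hlt)
      have h6 : v.toNat ≤ 2 ^ Nat.clog 2 v.toNat := Nat.le_pow_clog (by norm_num) _
      have : (2 : ℤ) ^ Nat.clog 2 v.toNat < (v.toNat : ℤ) := lt_of_lt_of_eq h5 hvt
      exact absurd h6 (not_le.2 (by exact_mod_cast this))
    · apply (Nat.clog_le_iff_le_pow (by norm_num)).2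
      have : (v.toNat : ℤ) ≤ 2 ^ s := hvt ▸ h3
      exact_mod_cast this
  rw [← hs, ← h2]
  rfl

theorem log2up_runs {D W : ℕ} (hM : Machine D W) (v : ℤ) (hv : Small D W v) (h1 : 1 ≤ v) :
    Runs (log2up W v) ((Nat.clog 2 v.toNat + 1) * (3 * unitCost (D + 1)))
      (fun r => r = (Nat.clog 2 v.toNat, 2 ^ Nat.clog 2 v.toNat)) := by
  have hval := log2up_val W v h1
  refine ⟨hval, ?_⟩
  have h2 := log2Loop_time hM v hv v.toNat 0 (by
    simpa using (⟨hM.1, by have := hM.2; omega⟩ : Machine (D + 1) W).small_one)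
  have h3 : (log2Loop W v v.toNat 0 (2 ^ 0)).val.1 = Nat.clog 2 v.toNat := by
    have : (log2up W v).val.1 = _ := congrArg Prod.fst hval
    exact this
  rw [h3] at h2
  have h4 : (log2up W v).time = (log2Loop W v v.toNat 0 (2 ^ 0)).time := rfl
  rw [h4]
  refine (Nat.le_of_add_right_le h2).trans (Nat.mul_le_mul_left _ ?_)
  have := one_le_unitCost (D + 1)
  omega

theorem isqrt_runs {D W : ℕ} (hM : Machine D W) (v : ℤ) (hv : Small D W v) (h1 : 1 ≤ v) :
    Runs (isqrt W v) ((Nat.clog 2 v.toNat + 1) * (7 * unitCost (D + 3)))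
      (fun g => 0 ≤ g ∧ g * g ≤ v ∧ v < (g + 1) * (g + 1)) := by
  set t := Nat.clog 2 v.toNat with ht
  have hle : v ≤ 2 ^ t := by
    have h6 : v.toNat ≤ 2 ^ t := Nat.le_pow_clog (by norm_num) _
    calc v = (v.toNat : ℤ) := by omega
      _ ≤ ((2 ^ t : ℕ) : ℤ) := by exact_mod_cast h6
      _ = _ := by push_cast; rfl
  -- The power found by doubling overshoots v by at most a factor 2, so all trial roots stay small.
  have hge : (2 : ℤ) ^ t ≤ 2 * v := by
    rcases Nat.eq_zero_or_pos t with h0 | h0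
    · rw [h0]
      omega
    · have h6 : 2 ^ (t - 1) < v.toNat := by
        rw [← not_le, ← Nat.clog_le_iff_le_pow (by norm_num)]
        omega
      obtain ⟨r, hr⟩ : ∃ r, t = r + 1 := ⟨t - 1, by omega⟩
      rw [hr, Nat.add_sub_cancel] at h6
      rw [hr, pow_succ]
      have : ((2 ^ r : ℕ) : ℤ) < (v.toNat : ℤ) := by exact_mod_cast h6
      push_cast at this
      omega
  have hM3 : Machine (D + 3) W := hM.mono (by omega)
  have hv2 : Small (D + 3) W (4 * v) := by
    have := (hv.two_mul hM).two_mul (hM.mono (by omega))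
    rw [← mul_assoc] at this
    exact this.mono (by omega)
  have hv1 : Small (D + 3) W v := hv.mono (by omega)
  refine Runs.mono (Runs.bind (log2up_runs hM v hv h1) fun r hr => ?_)
    (t := (t + 1) * (3 * unitCost (D + 1)) + ((t + 1) * (3 * unitCost (D + 3) + 1) + 0)) ?_
  · subst hr
    -- The root is confined to the interval from `st.1` to `st.1 + 2 ^ (t + 1 - i)`, and `st.2` is
    -- half its length, the next bit to be tried. After t + 1 steps the length is 1.
    refine Runs.bind (forLoop_runs (fun i (st : ℤ × ℤ) => 0 ≤ st.1 ∧ st.1 * st.1 ≤ v ∧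
      v < (st.1 + 2 ^ (t + 1 - i)) * (st.1 + 2 ^ (t + 1 - i)) ∧ st.2 = 2 ^ (t + 1 - i) / 2)
      (3 * unitCost (D + 3)) _ _ _ ?_ ?_) fun st hst => Runs.pure ⟨hst.1, hst.2.1, by
        simpa [← ht] using hst.2.2.1⟩
    · refine ⟨le_rfl, by simp; omega, ?_, by simp [pow_succ]; rfl⟩
      have : (1 : ℤ) ≤ 2 ^ t := one_le_pow₀ (by norm_num)
      simp only [zero_add, Nat.sub_zero, pow_succ]
      nlinarith
    · rintro i hi ⟨r, h⟩ ⟨h2, h3, h4, h5⟩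
      obtain ⟨j, hj⟩ : ∃ j, t + 1 - i = j + 1 := ⟨t - i, by omega⟩
      have hj' : t + 1 - (i + 1) = j := by omega
      have hjt : j ≤ t := by omega
      simp only at h2 h3 h4 h5
      rw [hj, pow_succ, Int.mul_ediv_cancel _ (by norm_num)] at h5
      rw [hj, pow_succ] at h4
      subst h5
      have hjp : (1 : ℤ) ≤ 2 ^ j := one_le_pow₀ (by norm_num)
      have hjv : (2 : ℤ) ^ j ≤ 2 * v := le_trans (pow_le_pow_right₀ (by norm_num) hjt) hge
      have hrv : r ≤ v := by nlinarith
      have hs1 : Small (D + 3) W r := hv1.of_nonneg_le h2 hrv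
      have hs2 : Small (D + 3) W (2 ^ j) := hv2.of_nonneg_le (by omega) (by omega)
      have hs3 : Small (D + 3) W (r + 2 ^ j) := hv2.of_nonneg_le (by omega) (by omega)
      refine Runs.mono (t := unitCost (D + 3) + (unitCost (D + 3) + (unitCost (D + 3) + 0)))
        ?_ (by omega)
      refine Runs.bind (ev_runs hM3 _ ⟨hs1, hs2⟩) fun a ha => ?_
      simp only [Exp.eval_add, Exp.eval_lit] at ha
      subst ha
      refine Runs.bind (leT_runs hM3 _ _ ⟨hs3, hs3⟩ hv1) fun b hb => ?_
      refine Runs.bind (ev_runs hM3 _ ⟨hs2, hM3.small_two⟩) fun a ha => ?_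
      simp only [Exp.eval_div, Exp.eval_lit, Exp.eval_two] at ha
      simp only [Exp.eval_mul, Exp.eval_lit] at hb
      refine Runs.pure ?_
      rw [hj']
      dsimp only
      subst hb
      by_cases hc : (r + 2 ^ j) * (r + 2 ^ j) ≤ v
      · simp only [hc, decide_true, if_true]
        exact ⟨by omega, trivial, by linarith, ha⟩
      · simp only [hc, decide_false, Bool.false_eq_true, if_false]
        exact ⟨h2, h3, by linarith, ha⟩
  · have h2 : unitCost (D + 1) ≤ unitCost (D + 3) := unitCost_mono (by omega)
    have h3 := one_le_unitCost (D + 3)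
    rw [add_zero, ← mul_add]
    exact Nat.mul_le_mul_left _ (by omega)

/-! ### Fixed-point complex numbers -/

/-- The complex number `(a + b i) / S` for which the pair `(a, b)` stands. -/
noncomputable def cv (S : ℤ) (z : ℤ × ℤ) : ℂ := ((z.1 : ℂ) + (z.2 : ℂ) * Complex.I) / (S : ℂ)

theorem cv_re (S : ℤ) (z : ℤ × ℤ) : (cv S z).re = (z.1 : ℝ) / S := by
  unfold cv
  rw [← Complex.ofReal_intCast S, Complex.div_ofReal_re]
  simp

theorem cv_im (S : ℤ) (z : ℤ × ℤ) : (cv S z).im = (z.2 : ℝ) / S := by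
  unfold cv
  rw [← Complex.ofReal_intCast S, Complex.div_ofReal_im]
  simp

theorem norm_le_two_mul {w : ℂ} {e : ℝ} (h1 : |w.re| ≤ e) (h2 : |w.im| ≤ e) : ‖w‖ ≤ 2 * e :=
  (Complex.norm_le_abs_re_add_abs_im w).trans (by linarith)

theorem abs_fst_le {S : ℤ} (hS : 0 < S) {z : ℤ × ℤ} {r : ℝ} (h : ‖cv S z‖ ≤ r) :
    |(z.1 : ℝ)| ≤ r * S := by
  have hS' : (0 : ℝ) < S := by exact_mod_cast hS
  have := (Complex.abs_re_le_norm (cv S z)).trans h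
  rwa [cv_re, abs_div, abs_of_pos hS', div_le_iff₀ hS'] at this

theorem abs_snd_le {S : ℤ} (hS : 0 < S) {z : ℤ × ℤ} {r : ℝ} (h : ‖cv S z‖ ≤ r) :
    |(z.2 : ℝ)| ≤ r * S := by
  have hS' : (0 : ℝ) < S := by exact_mod_cast hS
  have := (Complex.abs_im_le_norm (cv S z)).trans h
  rwa [cv_im, abs_div, abs_of_pos hS', div_le_iff₀ hS'] at this

theorem abs_ediv_sub_le (a : ℤ) {d : ℤ} (hd : 0 < d) :
    |((a / d : ℤ) : ℝ) - (a : ℝ) / d| ≤ 1 := by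
  have hd' : (0 : ℝ) < d := by exact_mod_cast hd
  have h1 : (d : ℝ) * ((a / d : ℤ) : ℝ) + ((a % d : ℤ) : ℝ) = a := by
    exact_mod_cast Int.mul_ediv_add_emod a d
  have h2 : (0 : ℝ) ≤ ((a % d : ℤ) : ℝ) := by exact_mod_cast Int.emod_nonneg a hd.ne'
  have h3 : ((a % d : ℤ) : ℝ) ≤ d := by exact_mod_cast (Int.emod_lt_of_pos a hd).le
  have h4 : (a : ℝ) / d = ((a / d : ℤ) : ℝ) + ((a % d : ℤ) : ℝ) / d := by
    rw [← h1]
    field_simp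
  rw [h4, sub_add_cancel_left, abs_neg, abs_of_nonneg (by positivity)]
  exact (div_le_one hd').2 h3

theorem norm_cv_sub_le {S : ℤ} (hS : 0 < S) {z : ℤ × ℤ} {w : ℂ}
    (h1 : |(z.1 : ℝ) - w.re * S| ≤ 1) (h2 : |(z.2 : ℝ) - w.im * S| ≤ 1) :
    ‖cv S z - w‖ ≤ 2 / S := by
  have hS' : (0 : ℝ) < S := by exact_mod_cast hS
  have key : ∀ a b : ℝ, |a - b * S| ≤ 1 → |a / S - b| ≤ 1 / S := by
    intro a b h
    have : a / S - b = (a - b * S) / S := by field_simp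
    rw [this, abs_div, abs_of_pos hS']
    gcongr
  have := norm_le_two_mul (w := cv S z - w) (e := 1 / S)
    (by rw [Complex.sub_re, cv_re]; exact key _ _ h1)
    (by rw [Complex.sub_im, cv_im]; exact key _ _ h2)
  calc _ ≤ _ := this
    _ = _ := by ring

theorem cv_add (S : ℤ) (x y : ℤ × ℤ) : cv S (x.1 + y.1, x.2 + y.2) = cv S x + cv S y := by
  unfold cv
  push_cast
  ring

theorem cv_sub (S : ℤ) (x y : ℤ × ℤ) : cv S (x.1 - y.1, x.2 - y.2) = cv S x - cv S y := by
  unfold cv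
  push_cast
  ring

@[simp] theorem caddT_val (W : ℕ) (x y : ℤ × ℤ) :
    (caddT W x y).val = (x.1 + y.1, x.2 + y.2) := rfl

@[simp] theorem csubT_val (W : ℕ) (x y : ℤ × ℤ) :
    (csubT W x y).val = (x.1 - y.1, x.2 - y.2) := rfl

theorem cmulT_val (W : ℕ) (S : ℤ) (x y : ℤ × ℤ) :
    (cmulT W S x y).val =
      ((x.1 * y.1 - x.2 * y.2) / S, (x.1 * y.2 + x.2 * y.1) / S) := rfl

/-- Two floor divisions, each off by at most one unit 1 / S. This 2 / S is the basic rounding error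
of the transform. -/
theorem norm_cv_cmulT_sub_le (W : ℕ) {S : ℤ} (hS : 0 < S) (x y : ℤ × ℤ) :
    ‖cv S (cmulT W S x y).val - cv S x * cv S y‖ ≤ 2 / S := by
  have hS' : (S : ℝ) ≠ 0 := by exact_mod_cast hS.ne'
  apply norm_cv_sub_le hS
  · rw [Complex.mul_re, cv_re, cv_re, cv_im, cv_im, cmulT_val]
    convert abs_ediv_sub_le (x.1 * y.1 - x.2 * y.2) hS using 3
    push_cast
    field_simp
  · rw [Complex.mul_im, cv_re, cv_re, cv_im, cv_im, cmulT_val]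
    convert abs_ediv_sub_le (x.1 * y.2 + x.2 * y.1) hS using 3
    push_cast
    field_simp

/-- Both coordinates are small. -/
def SmallC (D W : ℕ) (z : ℤ × ℤ) : Prop := Small D W z.1 ∧ Small D W z.2

section
variable {D W : ℕ} (hM : Machine D W) {x y : ℤ × ℤ} {S : ℤ}
include hM

theorem caddT_time (hx : SmallC D W x) (hy : SmallC D W y) :
    (caddT W x y).time ≤ 2 * unitCost D := by
  have h1 := (ev_runs hM (x.1 + y.1 : Exp) ⟨hx.1, hy.1⟩).2
  have h2 := (ev_runs hM (x.2 + y.2 : Exp) ⟨hx.2, hy.2⟩).2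
  simp only [caddT, bind_time, pure_time]
  omega

theorem csubT_time (hx : SmallC D W x) (hy : SmallC D W y) :
    (csubT W x y).time ≤ 2 * unitCost D := by
  have h1 := (ev_runs hM (x.1 - y.1 : Exp) ⟨hx.1, hy.1⟩).2
  have h2 := (ev_runs hM (x.2 - y.2 : Exp) ⟨hx.2, hy.2⟩).2
  simp only [csubT, bind_time, pure_time]
  omega

theorem cmulT_time (hx : SmallC D W x) (hy : SmallC D W y) (hS : Small D W S) :
    (cmulT W S x y).time ≤ 2 * unitCost D := by
  have h1 := (ev_runs hM ((x.1 * y.1 - x.2 * y.2) / S : Exp)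
    ⟨⟨⟨hx.1, hy.1⟩, ⟨hx.2, hy.2⟩⟩, hS⟩).2
  have h2 := (ev_runs hM ((x.1 * y.2 + x.2 * y.1) / S : Exp)
    ⟨⟨⟨hx.1, hy.2⟩, ⟨hx.2, hy.1⟩⟩, hS⟩).2
  simp only [cmulT, bind_time, pure_time]
  omega

end

/-! ### The number `π` -/

/-- The tail of the series is compared with a geometric series of ratio 1/4 ≥ x², whose sum is
4^(-K) (1/2) (4/3). -/
theorem abs_arctan_sub_sum_le {x : ℝ} (hx0 : 0 ≤ x) (hx : x ≤ 1 / 2) (K : ℕ) :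
    |Real.arctan x - ∑ k ∈ Finset.range K, (-1) ^ k * x ^ (2 * k + 1) / ((2 * k + 1 : ℕ) : ℝ)| ≤
      (1 / 4) ^ K := by
  have h1 := Real.hasSum_arctan (x := x) (by
    rw [Real.norm_eq_abs, abs_of_nonneg hx0]
    linarith)
  have h2 := (hasSum_nat_add_iff' K).2 h1
  have h3 : HasSum (fun i : ℕ => (1 / 4 : ℝ) ^ K * (1 / 2) * (1 / 4) ^ i)
      ((1 / 4 : ℝ) ^ K * (1 / 2) * (1 - 1 / 4)⁻¹) :=
    (hasSum_geometric_of_lt_one (by norm_num) (by norm_num)).mul_left _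
  have h4 := tsum_of_norm_bounded h3 (f := fun i =>
    (-1) ^ (i + K) * x ^ (2 * (i + K) + 1) / ((2 * (i + K) + 1 : ℕ) : ℝ)) (fun i => by
      rw [norm_div, norm_mul, norm_pow, norm_neg, norm_one, one_pow, one_mul, norm_pow,
        Real.norm_of_nonneg hx0, Real.norm_natCast]
      calc x ^ (2 * (i + K) + 1) / ((2 * (i + K) + 1 : ℕ) : ℝ) ≤ x ^ (2 * (i + K) + 1) :=
            div_le_self (by positivity) (by exact_mod_cast Nat.le_add_left 1 _)
        _ ≤ (1 / 2) ^ (2 * (i + K) + 1) := by gcongr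
        _ = _ := by
          rw [pow_succ, pow_mul, pow_add]
          norm_num
          ring)
  rw [h2.tsum_eq] at h4
  refine h4.trans ?_
  have : (0 : ℝ) ≤ (1 / 4) ^ K := by positivity
  nlinarith

theorem arctanInv_runs {D W : ℕ} (hM : Machine D W) {S : ℤ} (hS : 0 < S) {K : ℕ} {q : ℤ}
    (hq : 2 ≤ q) (hq' : Small D W q) (hSK : Small D W (S * (K + 1)))
    (htr : (S : ℝ) ≤ 4 ^ K) :
    Runs (arctanInv W S K q) (4 * unitCost D * (K + 1))
      (fun a => |(a : ℝ) / S - Real.arctan ((q : ℝ)⁻¹)| ≤ (K + 1) / S ∧ |a| ≤ S * K) := by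
  have hS' : (0 : ℝ) < S := by exact_mod_cast hS
  have hqr : (2 : ℝ) ≤ q := by exact_mod_cast hq
  have hsS : Small D W S := hSK.of_nonneg_le hS.le (by nlinarith)
  refine Runs.mono (t := unitCost D + (K * (3 * unitCost D + 1) + 0)) ?_ (by
    have := one_le_unitCost D
    nlinarith)
  refine Runs.bind (ev_runs hM _ ⟨hsS, hq'⟩) fun p0 hp0 => ?_
  simp only [Exp.eval_div, Exp.eval_lit] at hp0
  -- The power in the state is an exact floor of S / q^(2k+1), as successive integer divisions
  -- compose. Hence each summand is a single floor as well, and k summands are off by at most k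
  -- units.
  refine Runs.bind (forLoop_runs (fun k (st : ℤ × ℤ × ℤ) =>
    st.1 = (-1) ^ k ∧ st.2.1 = S / q ^ (2 * k + 1) ∧ |st.2.2| ≤ S * k ∧
    |(st.2.2 : ℝ) - S * ∑ i ∈ Finset.range k,
      (-1) ^ i * (q : ℝ)⁻¹ ^ (2 * i + 1) / ((2 * i + 1 : ℕ) : ℝ)| ≤ k)
    (3 * unitCost D) _ _ _ ?_ ?_) fun st hst => Runs.pure ⟨?_, hst.2.2.1⟩
  · simp [hp0]
  · rintro k hk ⟨e, p, s⟩ ⟨h1, h2, h3, h4⟩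
    simp only at h1 h2 h3 h4
    have hqp : 0 < q ^ (2 * k + 1) := by positivity
    have hp : 0 ≤ p := by rw [h2]; positivity
    have hpS : p ≤ S := by
      rw [h2]
      exact Int.ediv_le_self _ hS.le
    have hse : Small D W e := by
      have : |e| = 1 := by rw [h1, abs_pow, abs_neg, abs_one, one_pow]
      exact hM.small_one.of_abs_le_abs (by simp [this])
    have hss : Small D W s := hSK.of_abs_le_abs (by
      rw [abs_of_pos (show 0 < S * ((K : ℤ) + 1) by positivity)]
      refine h3.trans ?_
      gcongr
      exact_mod_cast (by omega : k ≤ K + 1))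
    have hsk : Small D W (k : ℤ) := hSK.of_nonneg_le (by positivity) (by
      have : (k : ℤ) ≤ K := by exact_mod_cast hk.le
      nlinarith)
    have hsp : Small D W p := hsS.of_nonneg_le hp hpS
    refine Runs.mono (t := unitCost D + (unitCost D + (unitCost D + 0))) ?_ (by omega)
    refine Runs.bind (ev_runs hM _
      ⟨hss, hse, hsp, ⟨hM.small_two, hsk⟩, hM.small_one⟩) fun s' hs' => ?_
    refine Runs.bind (ev_runs hM _ ⟨hsp, hq', hq'⟩) fun p' hp' => ?_
    refine Runs.bind (ev_runs hM _ ⟨hM.small_zero, hse⟩) fun e' he' => ?_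
    simp only [Exp.eval_sub, Exp.eval_zero, Exp.eval_div, Exp.eval_mul, Exp.eval_add,
      Exp.eval_lit, Exp.eval_one, Exp.eval_two] at hs' hp' he'
    have hk1 : (0 : ℤ) < 2 * k + 1 := by positivity
    have hfl : |((p / (2 * k + 1) : ℤ) : ℝ) -
        S * ((q : ℝ)⁻¹ ^ (2 * k + 1) / ((2 * k + 1 : ℕ) : ℝ))| ≤ 1 := by
      rw [h2, Int.ediv_ediv_of_nonneg (by positivity)]
      convert abs_ediv_sub_le S (mul_pos hqp hk1) using 3
      push_cast
      rw [inv_pow]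
      field_simp
    have hdiv : |p / (2 * k + 1)| ≤ S := by
      rw [abs_of_nonneg (by positivity)]
      exact (Int.ediv_le_self _ hp).trans hpS
    refine Runs.pure ⟨?_, ?_, ?_, ?_⟩
    · simp [he', h1, pow_succ]
    · simp only [hp', h2]
      rw [Int.ediv_ediv_of_nonneg (by positivity)]
      congr 1
      ring
    · simp only [hs']
      refine (abs_add_le _ _).trans ?_
      rw [abs_mul, h1, abs_pow, abs_neg, abs_one, one_pow, one_mul]
      push_cast
      linarith
    · simp only [hs', Finset.sum_range_succ, mul_add]
      push_cast
      have h5 : (s : ℝ) + (e : ℝ) * ((p / (2 * k + 1) : ℤ) : ℝ) -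
          (S * ∑ i ∈ Finset.range k, (-1) ^ i * (q : ℝ)⁻¹ ^ (2 * i + 1) / (2 * (i : ℝ) + 1) +
          S * ((-1) ^ k * (q : ℝ)⁻¹ ^ (2 * k + 1) / (2 * (k : ℝ) + 1))) =
          (s - S * ∑ i ∈ Finset.range k, (-1) ^ i * (q : ℝ)⁻¹ ^ (2 * i + 1) / (2 * (i : ℝ) + 1)) +
          (-1) ^ k * (((p / (2 * k + 1) : ℤ) : ℝ) -
            S * ((q : ℝ)⁻¹ ^ (2 * k + 1) / (2 * (k : ℝ) + 1))) := by
        rw [h1]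
        push_cast
        ring
      push_cast at h4 hfl
      rw [h5]
      refine (abs_add_le _ _).trans ?_
      rw [abs_mul, abs_pow, abs_neg, abs_one, one_pow, one_mul]
      linarith
  · obtain ⟨-, -, -, h⟩ := hst
    have h2 := abs_arctan_sub_sum_le (x := (q : ℝ)⁻¹) (by positivity) (by
      rw [one_div]
      gcongr) K
    set Z := ∑ i ∈ Finset.range K, (-1) ^ i * (q : ℝ)⁻¹ ^ (2 * i + 1) / ((2 * i + 1 : ℕ) : ℝ)
    -- The truncation error is at most one unit, which accounts for the 1 in K + 1.
    have h3 : (1 / 4 : ℝ) ^ K ≤ 1 / S := by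
      rw [one_div_pow]
      gcongr
    have h4 : |(st.2.2 : ℝ) / S - Z| ≤ K / S := by
      have : (st.2.2 : ℝ) / S - Z = (st.2.2 - S * Z) / S := by field_simp
      rw [this, abs_div, abs_of_pos hS']
      gcongr
    have h5 := abs_sub_le ((st.2.2 : ℝ) / S) Z (Real.arctan (q : ℝ)⁻¹)
    rw [abs_sub_comm Z] at h5
    rw [add_div]
    linarith

/-- In Machin's formula the errors (K + 1) / S of the two arctangents enter with the factors 16 and
4. -/
theorem piT_runs {D W : ℕ} (hM : Machine D W) {S : ℤ} (hS : 0 < S) {K : ℕ}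
    (hSK : Small D W (S * (K + 1))) (htr : (S : ℝ) ≤ 4 ^ K) :
    Runs (piT W S K) (9 * unitCost D * (K + 1))
      (fun a => |(a : ℝ) / S - Real.pi| ≤ 20 * (K + 1) / S) := by
  have hS' : (0 : ℝ) < S := by exact_mod_cast hS
  have hs : ∀ a : ℤ, |a| ≤ S * K → Small D W a := fun a ha => hSK.of_abs_le_abs (by
    rw [abs_of_pos (show 0 < S * ((K : ℤ) + 1) by positivity)]
    linarith)
  have h239 : Small D W 239 := by exact_mod_cast hM.small_nat (k := 239) (by norm_num)
  refine Runs.mono (t := 4 * unitCost D * (K + 1) + (4 * unitCost D * (K + 1) + unitCost D)) ?_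
    (by generalize unitCost D = u; linarith [Nat.zero_le (u * K)])
  refine Runs.bind (arctanInv_runs (q := 5) hM hS (by norm_num) hM.small_five hSK htr)
    fun a ha => ?_
  refine Runs.bind (arctanInv_runs (q := 239) hM hS (by norm_num) h239 hSK htr) fun b hb => ?_
  refine Runs.imp (ev_runs hM _ ⟨⟨hM.small_sixteen, hs a ha.2⟩, hM.small_four, hs b hb.2⟩)
    fun r hr => ?_
  simp only [Exp.eval_sub, Exp.eval_mul, Exp.eval_lit, Exp.eval_sixteen, Exp.eval_four] at hr
  have h1 := ha.1
  have h2 := hb.1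
  have h3 := Real.four_mul_arctan_inv_5_sub_arctan_inv_239
  have h4 : (r : ℝ) / S - Real.pi = 16 * ((a : ℝ) / S - Real.arctan (((5 : ℤ) : ℝ)⁻¹)) -
      4 * ((b : ℝ) / S - Real.arctan (((239 : ℤ) : ℝ)⁻¹)) := by
    rw [hr]
    push_cast
    rw [show Real.pi = 4 * (Real.pi / 4) by ring, ← h3]
    ring
  rw [h4, mul_div_assoc]
  rw [abs_le] at *
  constructor <;> linarith

/-! ### Roots of unity -/

/-- What the routines rely on: `A` bounds the lengths and values in the input, and `D` words hold
every number that occurs. -/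
structure GoodCtx (X : Ctx) (A : ℝ) (D : ℕ) : Prop where
  machine : Machine D X.W
  n_pos : 1 ≤ X.n
  N_eq : X.N = 2 * X.n
  S_pos : 0 < X.S
  A_ge : 1000 ≤ A
  N_le : (X.N : ℝ) ≤ A
  N_le_pow : X.N ≤ 2 ^ X.len
  terms_le : (X.terms : ℝ) + 1 ≤ X.S
  trunc : 2 * 4 ^ X.terms / (X.terms.factorial : ℝ) ≤ 1 / X.S
  eight_le_terms : 8 ≤ X.terms
  pi_err : |(X.pi : ℝ) / X.S - Real.pi| ≤ 20 * (X.terms + 1) / X.S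
  err : A ^ 30 * (100 * (X.terms + 1) / X.S) ≤ 1
  big : A ^ 12 * (X.S : ℝ) ^ 2 ≤ 2 ^ (D * X.W)

/-- The precision of the computed roots of unity. -/
noncomputable def Ctx.tau (X : Ctx) : ℝ := 100 * (X.terms + 1) / X.S

section
variable {X : Ctx} {A : ℝ} {D : ℕ} (hX : GoodCtx X A D)
include hX

theorem GoodCtx.S_pos' : (0 : ℝ) < X.S := by exact_mod_cast hX.S_pos
theorem GoodCtx.one_le_S : (1 : ℝ) ≤ X.S := by exact_mod_cast hX.S_pos
theorem GoodCtx.one_le_A : 1 ≤ A := by linarith [hX.A_ge]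
theorem GoodCtx.A_pos : 0 < A := by linarith [hX.A_ge]

theorem GoodCtx.tau_pos : 0 < X.tau := by
  have := hX.S_pos'
  unfold Ctx.tau
  positivity

theorem GoodCtx.inv_S_le : 100 / (X.S : ℝ) ≤ X.tau := by
  have := hX.S_pos'
  unfold Ctx.tau
  gcongr
  have : (0 : ℝ) ≤ X.terms := by positivity
  linarith

theorem GoodCtx.mul_tau_le {k : ℕ} (hk : k ≤ 30) : A ^ k * X.tau ≤ 1 :=
  le_trans (mul_le_mul_of_nonneg_right (pow_le_pow_right₀ hX.one_le_A hk) hX.tau_pos.le) hX.err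

theorem GoodCtx.tau_le : X.tau ≤ 1 / 1000 := by
  have h := hX.mul_tau_le (k := 1) (by norm_num)
  have := hX.A_ge
  have := hX.tau_pos
  nlinarith

/-- All size estimates go through this budget. Fixed-point numbers have j = 1; j = 2 is needed for
squared absolute values, which are not rescaled. -/
theorem GoodCtx.small_of_le {z : ℤ} {k j : ℕ} (hk : k ≤ 12) (hj : j ≤ 2)
    (h : |(z : ℝ)| ≤ A ^ k * (X.S : ℝ) ^ j) : Small D X.W z := by
  refine Small.of_real (h.trans (le_trans ?_ hX.big))
  have := hX.one_le_A
  have := hX.one_le_S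
  gcongr

theorem GoodCtx.smallC_of_norm_le {z : ℤ × ℤ} {k : ℕ} (hk : k ≤ 12)
    (h : ‖cv X.S z‖ ≤ A ^ k) : SmallC D X.W z :=
  ⟨hX.small_of_le hk (j := 1) (by norm_num) (by simpa using abs_fst_le hX.S_pos h),
    hX.small_of_le hk (j := 1) (by norm_num) (by simpa using abs_snd_le hX.S_pos h)⟩

theorem GoodCtx.small_S : Small D X.W X.S :=
  hX.small_of_le (k := 0) (j := 1) (by norm_num) (by norm_num)
    (by simp [abs_of_pos hX.S_pos'])

theorem GoodCtx.small_of_le_A {z : ℤ} (h : |(z : ℝ)| ≤ A) : Small D X.W z :=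
  hX.small_of_le (k := 1) (j := 0) (by norm_num) (by norm_num) (by simpa using h)

theorem GoodCtx.small_N : Small D X.W X.N :=
  hX.small_of_le_A (by
    rw [abs_of_nonneg]
    · exact hX.N_le
    · have := hX.n_pos
      have := hX.N_eq
      exact_mod_cast (by omega : 0 ≤ X.N))

/-- The error has three sources: the angle, off by 20 (K + 1) / S from π and by 1 / S from the
floor; the truncation of the exponential series, at most 1 / S; and the rounding of K Taylor terms,
at most 12 / S each. Together they stay below 34 (K + 1) / S, within τ = 100 (K + 1) / S. -/
theorem cisT_runs {a b : ℤ} (ha : 0 ≤ a) (hab : a ≤ b) (hb : 0 < b) (hbA : (b : ℝ) ≤ A) :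
    Runs (cisT X a b) ((X.terms + 1) * (5 * unitCost D))
      (fun z => ‖cv X.S z - Complex.exp (Real.pi * (a / b : ℝ) * Complex.I)‖ ≤ X.tau) := by
  have hM := hX.machine
  have hS := hX.S_pos'
  have hS1 := hX.one_le_S
  have hb' : (0 : ℝ) < b := by exact_mod_cast hb
  have hab' : (a : ℝ) / b ≤ 1 := (div_le_one hb').2 (by exact_mod_cast hab)
  have hab0 : 0 ≤ (a : ℝ) / b := div_nonneg (by exact_mod_cast ha) hb'.le
  have hA := hX.A_ge
  have hτ := hX.tau_le
  set K := X.terms with hK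
  have hτK : X.tau = 100 * (K + 1) / X.S := rfl
  have hKS : ((K : ℝ) + 1) / X.S ≤ 1 / 100000 := by
    have : X.tau = 100 * (((K : ℝ) + 1) / X.S) := by rw [hτK]; ring
    linarith
  have hinv : 1 / (X.S : ℝ) ≤ (K + 1) / X.S := by gcongr; linarith [(Nat.cast_nonneg K : (0 : ℝ) ≤ K)]
  have hsb : Small D X.W b := hX.small_of_le_A (by rwa [abs_of_pos hb'])
  have hsa : Small D X.W a := hsb.of_nonneg_le ha hab
  set θ : ℤ := X.pi * a / b with hθ
  set t : ℝ := θ / X.S with ht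
  have hpi : |(X.pi : ℝ) / X.S - Real.pi| ≤ 20 * ((K + 1) / X.S) := by
    have := hX.pi_err
    rwa [mul_div_assoc] at this
  have hterr : |t - Real.pi * (a / b)| ≤ 21 * ((K + 1) / X.S) := by
    have h1 := abs_ediv_sub_le (X.pi * a) hb
    have h2 : t - Real.pi * (a / b) = (((X.pi * a / b : ℤ) : ℝ) - ((X.pi * a : ℤ) : ℝ) / b) / X.S +
        ((X.pi : ℝ) / X.S - Real.pi) * (a / b) := by
      rw [ht, hθ]
      push_cast
      field_simp
      ring
    rw [h2]
    refine (abs_add_le _ _).trans ?_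
    rw [abs_div, abs_of_pos hS, abs_mul, abs_of_nonneg hab0]
    have h3 : |((X.pi * a / b : ℤ) : ℝ) - ((X.pi * a : ℤ) : ℝ) / b| / X.S ≤ 1 / X.S := by gcongr
    have h4 : |(X.pi : ℝ) / X.S - Real.pi| * (a / b) ≤ 20 * ((K + 1) / X.S) * 1 := by gcongr
    linarith
  have hpi2 : Real.pi * (a / b) ≤ 3.15 := by
    have := Real.pi_lt_d2
    nlinarith [Real.pi_pos]
  have hpi0 : 0 ≤ Real.pi * (a / b) := mul_nonneg Real.pi_pos.le hab0
  have ht4 : |t| ≤ 4 := by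
    have := abs_le.1 hterr
    rw [abs_le]
    constructor <;> linarith
  have hspi : Small D X.W X.pi := by
    refine hX.small_of_le (k := 1) (j := 1) (by norm_num) (by norm_num) ?_
    have h1 := abs_le.1 hpi
    have h2 : |(X.pi : ℝ) / X.S| ≤ 5 := by
      have := Real.pi_lt_d2
      have := Real.pi_gt_three
      rw [abs_le]
      constructor <;> linarith
    rw [abs_div, abs_of_pos hS, div_le_iff₀ hS] at h2
    rw [pow_one, pow_one]
    nlinarith
  have hsθ : Small D X.W θ := by
    refine hX.small_of_le (k := 1) (j := 1) (by norm_num) (by norm_num) ?_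
    rw [ht, abs_div, abs_of_pos hS, div_le_iff₀ hS] at ht4
    rw [pow_one, pow_one]
    nlinarith
  -- As |x| ≤ 4, the number e^4 bounds all Taylor terms and partial sums, so the intermediate
  -- results are small.
  have hexp4 : Real.exp 4 ≤ 64 := by
    have h1 : Real.exp 4 = Real.exp 1 ^ 4 := by rw [← Real.exp_nat_mul]; norm_num
    have h2 := Real.exp_one_lt_d9
    rw [h1]
    calc Real.exp 1 ^ 4 ≤ 2.7182818286 ^ 4 := by gcongr
      _ ≤ 64 := by norm_num
  set x : ℂ := (t : ℂ) * Complex.I with hx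
  have hxn : ‖x‖ ≤ 4 := by
    rw [hx, norm_mul, Complex.norm_I, mul_one, Complex.norm_real]
    exact ht4
  have hterm : ∀ k : ℕ, ‖x ^ k / (k.factorial : ℂ)‖ ≤ 64 := by
    intro k
    rw [norm_div, norm_pow, Complex.norm_natCast]
    calc ‖x‖ ^ k / (k.factorial : ℝ) ≤ 4 ^ k / (k.factorial : ℝ) := by gcongr
      _ ≤ Real.exp 4 := Real.pow_div_factorial_le_exp 4 (by norm_num) k
      _ ≤ 64 := hexp4
  have hsum : ∀ k : ℕ, ‖∑ m ∈ Finset.range k, x ^ m / (m.factorial : ℂ)‖ ≤ 64 := by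
    intro k
    refine (norm_sum_le _ _).trans ?_
    calc ∑ m ∈ Finset.range k, ‖x ^ m / (m.factorial : ℂ)‖
        ≤ ∑ m ∈ Finset.range k, 4 ^ m / (m.factorial : ℝ) := by
          gcongr with m
          rw [norm_div, norm_pow, Complex.norm_natCast]
          gcongr
      _ ≤ Real.exp 4 := Real.sum_le_exp_of_nonneg (by norm_num) k
      _ ≤ 64 := hexp4
  -- `E k / S` bounds the rounding error of the k-th Taylor term. It has to satisfy E (k+1) ≥ 4 /
  -- (k+1) * E k + 2, as do the values 0, 2, 6, 10, 12, 12, …: from k = 4 on the factor is at most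
  -- 4/5, and 12 is stable.
  let E : ℕ → ℝ := fun k => if k = 0 then 0 else if k = 1 then 2 else if k = 2 then 6 else
    if k = 3 then 10 else 12
  have hE12 : ∀ k, E k ≤ 12 := by
    intro k
    simp only [E]
    split_ifs <;> norm_num
  have hE0 : ∀ k, 0 ≤ E k := by
    intro k
    simp only [E]
    split_ifs <;> norm_num
  have hEs : ∀ k : ℕ, 4 / ((k : ℝ) + 1) * E k + 2 ≤ E (k + 1) := by
    intro k
    match k with
    | 0 => norm_num [E]
    | 1 => norm_num [E]
    | 2 => norm_num [E]
    | 3 => norm_num [E]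
    | k + 4 =>
      have h1 : E (k + 4 + 1) = 12 := by simp [E]
      have h2 : E (k + 4) = 12 := by simp [E]
      rw [h1, h2]
      have h3 : 4 / (((k + 4 : ℕ) : ℝ) + 1) ≤ 4 / 5 := by
        push_cast
        gcongr
        linarith [(Nat.cast_nonneg k : (0 : ℝ) ≤ k)]
      linarith
  refine Runs.mono (t := unitCost D + (K * (4 * unitCost D + 1) + 0)) ?_ (by
    have := one_le_unitCost D
    nlinarith)
  refine Runs.bind (ev_runs hM _ ⟨⟨hspi, hsa⟩, hsb⟩) fun θ' hθ' => ?_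
  simp only [Exp.eval_div, Exp.eval_mul, Exp.eval_lit] at hθ'
  rw [← hθ] at hθ'
  subst hθ'
  refine Runs.bind (forLoop_runs (fun k (st : (ℤ × ℤ) × (ℤ × ℤ)) =>
      ‖cv X.S st.1 - x ^ k / (k.factorial : ℂ)‖ ≤ E k / X.S ∧
      ‖cv X.S st.2 - ∑ m ∈ Finset.range k, x ^ m / (m.factorial : ℂ)‖ ≤ k * (12 / X.S))
      (4 * unitCost D) _ _ _ ?_ ?_) fun st hst => Runs.pure ?_
  · refine ⟨?_, ?_⟩
    · have : cv X.S (X.S, 0) = 1 := by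
        unfold cv
        have : (X.S : ℂ) ≠ 0 := by exact_mod_cast hX.S_pos.ne'
        simp [this]
      simp [this, E]
    · simp [cv]
  · rintro k hk ⟨st1, st2⟩ ⟨h1, h2⟩
    simp only at h1 h2
    have hk' : (k : ℝ) + 1 ≤ K := by exact_mod_cast hk
    have hk0 : (0 : ℝ) ≤ k := Nat.cast_nonneg k
    have hES : E k / X.S ≤ 1 := by
      rw [div_le_one hS]
      have h12 := hE12 k
      have : 1 / (X.S : ℝ) ≤ 1 / 100000 := hinv.trans hKS
      have := (div_le_div_iff₀ hS (by norm_num : (0:ℝ) < 100000)).1 this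
      linarith
    have hb1 : ‖cv X.S st1‖ ≤ A ^ 1 := by
      have := norm_le_norm_add_norm_sub' (cv X.S st1) (x ^ k / (k.factorial : ℂ))
      have := hterm k
      rw [pow_one]
      linarith
    have hb2 : ‖cv X.S st2‖ ≤ A ^ 1 := by
      have h3 := norm_le_norm_add_norm_sub' (cv X.S st2)
        (∑ m ∈ Finset.range k, x ^ m / (m.factorial : ℂ))
      have h4 := hsum k
      have h5 : (k : ℝ) * (12 / X.S) ≤ 1 := by
        calc (k : ℝ) * (12 / X.S) ≤ (K + 1) * (12 / X.S) := by gcongr; linarith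
          _ = 12 * ((K + 1) / X.S) := by ring
          _ ≤ 1 := by linarith
      rw [pow_one]
      linarith
    have hs1 := hX.smallC_of_norm_le (by norm_num) hb1
    have hs2 := hX.smallC_of_norm_le (by norm_num) hb2
    have hsk : Small D X.W (k : ℤ) := by
      refine hX.small_of_le (k := 0) (j := 1) (by norm_num) (by norm_num) ?_
      have := hX.terms_le
      rw [pow_zero, one_mul, pow_one, Int.cast_natCast, abs_of_nonneg hk0]
      linarith
    refine Runs.mono (t := 2 * unitCost D + (unitCost D + (unitCost D + 0))) ?_ (by omega)
    refine Runs.bind ⟨rfl, caddT_time hM hs2 hs1⟩ (P := fun s => s = (caddT X.W st2 st1).val)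
      fun s hs => ?_
    refine Runs.bind (ev_runs hM _
      ⟨hM.small_zero, ⟨hs1.2, hsθ⟩, hX.small_S, hsk, hM.small_one⟩) fun re hre => ?_
    refine Runs.bind (ev_runs hM _
      ⟨⟨hs1.1, hsθ⟩, hX.small_S, hsk, hM.small_one⟩) fun im him => ?_
    simp only [Exp.eval_sub, Exp.eval_zero, Exp.eval_div, Exp.eval_mul, Exp.eval_add, Exp.eval_lit,
      Exp.eval_one] at hre him
    refine Runs.pure ⟨?_, ?_⟩
    · simp only
      have hd : 0 < X.S * ((k : ℤ) + 1) := by have := hX.S_pos; positivity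
      have h3 : ‖cv X.S (re, im) - cv X.S st1 * (x / ((k : ℂ) + 1))‖ ≤ 2 / X.S := by
        have hre' : (cv X.S st1 * (x / ((k : ℂ) + 1))).re * X.S =
            -(((st1.2 * θ : ℤ) : ℝ) / ((X.S * ((k : ℤ) + 1) : ℤ) : ℝ)) := by
          have : x / ((k : ℂ) + 1) = (((t / (k + 1) : ℝ)) : ℂ) * Complex.I := by
            rw [hx]; push_cast; ring
          rw [this, Complex.mul_re, Complex.re_ofReal_mul, Complex.im_ofReal_mul, Complex.I_re,
            Complex.I_im, cv_im, ht]
          push_cast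
          field_simp
          ring
        have him' : (cv X.S st1 * (x / ((k : ℂ) + 1))).im * X.S =
            (((st1.1 * θ : ℤ) : ℝ) / ((X.S * ((k : ℤ) + 1) : ℤ) : ℝ)) := by
          have : x / ((k : ℂ) + 1) = (((t / (k + 1) : ℝ)) : ℂ) * Complex.I := by
            rw [hx]; push_cast; ring
          rw [this, Complex.mul_im, Complex.re_ofReal_mul, Complex.im_ofReal_mul, Complex.I_re,
            Complex.I_im, cv_re, ht]
          push_cast
          field_simp
          ring
        apply norm_cv_sub_le hX.S_pos
        · rw [hre', hre]
          have := abs_ediv_sub_le (st1.2 * θ) hd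
          rw [← abs_neg] at this
          convert this using 2
          push_cast
          ring
        · rw [him', him]
          exact abs_ediv_sub_le (st1.1 * θ) hd
      have h4 : x ^ (k + 1) / ((k + 1).factorial : ℂ) =
          x ^ k / (k.factorial : ℂ) * (x / ((k : ℂ) + 1)) := by
        rw [Nat.factorial_succ, pow_succ]
        push_cast
        have : (k.factorial : ℂ) ≠ 0 := by exact_mod_cast k.factorial_ne_zero
        have : (k : ℂ) + 1 ≠ 0 := by exact_mod_cast k.succ_ne_zero
        field_simp
      have h5 : ‖x / ((k : ℂ) + 1)‖ ≤ 4 / (k + 1) := by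
        rw [norm_div]
        have : ‖(k : ℂ) + 1‖ = k + 1 := by
          rw [← Nat.cast_succ, Complex.norm_natCast]
          push_cast
          rfl
        rw [this]
        gcongr
      have h6 : cv X.S (re, im) - x ^ (k + 1) / ((k + 1).factorial : ℂ) =
          (cv X.S (re, im) - cv X.S st1 * (x / ((k : ℂ) + 1))) +
          (cv X.S st1 - x ^ k / (k.factorial : ℂ)) * (x / ((k : ℂ) + 1)) := by
        rw [h4]
        ring
      rw [h6]
      refine (norm_add_le _ _).trans ?_
      rw [norm_mul]
      calc _ ≤ 2 / (X.S : ℝ) + E k / X.S * (4 / (k + 1)) := by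
            have := hE0 k
            gcongr
        _ = (4 / ((k : ℝ) + 1) * E k + 2) / X.S := by ring
        _ ≤ _ := by
          have := hEs k
          gcongr
    · subst hs
      simp only
      rw [caddT_val, cv_add, Finset.sum_range_succ, add_sub_add_comm]
      refine (norm_add_le _ _).trans ?_
      have : E k / X.S ≤ 12 / X.S := by
        have := hE12 k
        gcongr
      push_cast
      linarith
  · have h1 := hst.2
    have h2 : ‖Complex.exp x - ∑ m ∈ Finset.range K, x ^ m / (m.factorial : ℂ)‖ ≤ 1 / X.S := by
      refine (Complex.exp_bound' ?_).trans ?_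
      · have : (8 : ℝ) ≤ K := by exact_mod_cast hX.eight_le_terms
        rw [div_le_div_iff₀ (by positivity) (by norm_num)]
        push_cast
        linarith
      · calc ‖x‖ ^ K / (K.factorial : ℝ) * 2 ≤ 4 ^ K / (K.factorial : ℝ) * 2 := by gcongr
          _ = 2 * 4 ^ K / (K.factorial : ℝ) := by ring
          _ ≤ _ := hX.trunc
    -- An error in the angle passes to the point on the unit circle without growing.
    have h3 : ‖Complex.exp x - Complex.exp (Real.pi * (a / b : ℝ) * Complex.I)‖ ≤
        21 * ((K + 1) / X.S) := by
      have : x = ((t - Real.pi * (a / b) : ℝ) : ℂ) * Complex.I +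
          Real.pi * (a / b : ℝ) * Complex.I := by
        rw [hx]; push_cast; ring
      rw [this, Complex.exp_add, ← sub_one_mul, norm_mul]
      have h4 : ‖Complex.exp (Real.pi * (a / b : ℝ) * Complex.I)‖ = 1 := by
        rw [← Complex.ofReal_mul]
        exact Complex.norm_exp_ofReal_mul_I _
      rw [h4, mul_one, mul_comm]
      exact (Real.norm_exp_I_mul_ofReal_sub_one_le).trans hterr
    have h5 : cv X.S st.2 - Complex.exp (Real.pi * (a / b : ℝ) * Complex.I) =
        (cv X.S st.2 - ∑ m ∈ Finset.range K, x ^ m / (m.factorial : ℂ)) -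
        (Complex.exp x - ∑ m ∈ Finset.range K, x ^ m / (m.factorial : ℂ)) +
        (Complex.exp x - Complex.exp (Real.pi * (a / b : ℝ) * Complex.I)) := by ring
    rw [h5, hτK]
    refine (norm_add_le _ _).trans ?_
    have h6 := norm_sub_le (cv X.S st.2 - ∑ m ∈ Finset.range K, x ^ m / (m.factorial : ℂ))
      (Complex.exp x - ∑ m ∈ Finset.range K, x ^ m / (m.factorial : ℂ))
    have h7 : (K : ℝ) * (12 / X.S) ≤ 12 * ((K + 1) / X.S) := by
      rw [mul_div_assoc', mul_div_assoc', div_le_div_iff_of_pos_right hS]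
      linarith
    have h8 : 100 * ((K : ℝ) + 1) / X.S = 100 * ((K + 1) / X.S) := by ring
    have h9 : 0 ≤ ((K : ℝ) + 1) / X.S := by positivity
    rw [h8]
    linarith

end

/-! ### The fast Fourier transform -/

/-- The list `l` has length `k` and its entries approximate the values of `f` up to `e`. -/
def Approx (S : ℤ) (l : List (ℤ × ℤ)) (k : ℕ) (f : ℕ → ℂ) (e : ℝ) : Prop :=
  l.length = k ∧ ∀ i < k, ‖cv S (l.getD i (0, 0)) - f i‖ ≤ e

theorem Approx.norm_le {S : ℤ} {l : List (ℤ × ℤ)} {k : ℕ} {f : ℕ → ℂ} {e F : ℝ}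
    (h : Approx S l k f e) {i : ℕ} (hi : i < k) (hf : ‖f i‖ ≤ F) :
    ‖cv S (l.getD i (0, 0))‖ ≤ F + e := by
  have := norm_le_norm_add_norm_sub' (cv S (l.getD i (0, 0))) (f i)
  have := h.2 i hi
  linarith

theorem exists_getD_of_mem {l : List (ℤ × ℤ)} {a : ℤ × ℤ} (h : a ∈ l) :
    ∃ i < l.length, l.getD i (0, 0) = a := by
  obtain ⟨i, hi, rfl⟩ := List.mem_iff_getElem.1 h
  exact ⟨i, hi, by simp [hi]⟩

section
variable {X : Ctx} {A : ℝ} {D : ℕ} (hX : GoodCtx X A D)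
include hX

/-- Each multiplication adds at most 3 τ: τ for the rounding and 2 τ for the error of z, as long as
|cur| ≤ 2. The last hypothesis keeps the accumulated error at most 1 and thereby ensures this. -/
theorem powersT_runs {z : ℤ × ℤ} {ζ : ℂ} (hζ : ‖ζ‖ = 1) (hz : ‖cv X.S z - ζ‖ ≤ X.tau)
    (k j : ℕ) (cur : ℤ × ℤ) (hcur : ‖cv X.S cur - ζ ^ j‖ ≤ 3 * X.tau * j)
    (hjk : 3 * X.tau * (j + k : ℕ) ≤ 1) :
    Runs (powersT X z k cur) ((k + 1) * (3 * unitCost D)) (fun l => l.length = k ∧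
      ∀ i < k, ‖cv X.S (l.getD i (0, 0)) - ζ ^ (j + i)‖ ≤ 3 * X.tau * (j + i : ℕ)) := by
  have hU := one_le_unitCost D
  have hτ := hX.tau_pos
  induction k generalizing j cur with
  | zero => exact ⟨⟨rfl, fun i hi => by omega⟩, by simp [powersT]; omega⟩
  | succ k ih =>
    have hjle : 3 * X.tau * j ≤ 1 := by
      refine le_trans ?_ hjk
      gcongr
      exact_mod_cast Nat.le_add_right _ _
    have hcn : ‖cv X.S cur‖ ≤ 2 := by
      have := norm_le_norm_add_norm_sub' (cv X.S cur) (ζ ^ j)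
      rw [norm_pow, hζ, one_pow] at this
      linarith
    have hzn : ‖cv X.S z‖ ≤ 2 := by
      have := norm_le_norm_add_norm_sub' (cv X.S z) ζ
      have := hX.tau_le
      linarith
    have hA := hX.A_ge
    have hsc := hX.smallC_of_norm_le (k := 1) (by norm_num) (hcn.trans (by linarith))
    have hsz := hX.smallC_of_norm_le (k := 1) (by norm_num) (hzn.trans (by linarith))
    have hmt := cmulT_time hX.machine hsc hsz hX.small_S
    have hnext : ‖cv X.S (cmulT X.W X.S cur z).val - ζ ^ (j + 1)‖ ≤ 3 * X.tau * (j + 1 : ℕ) := by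
      have h1 := norm_cv_cmulT_sub_le X.W hX.S_pos cur z
      have h2 : cv X.S (cmulT X.W X.S cur z).val - ζ ^ (j + 1) =
          (cv X.S (cmulT X.W X.S cur z).val - cv X.S cur * cv X.S z) +
          (cv X.S cur * (cv X.S z - ζ) + (cv X.S cur - ζ ^ j) * ζ) := by ring
      rw [h2]
      refine (norm_add_le _ _).trans ?_
      have h3 := norm_add_le (cv X.S cur * (cv X.S z - ζ)) ((cv X.S cur - ζ ^ j) * ζ)
      rw [norm_mul, norm_mul, hζ, mul_one] at h3
      have h4 : ‖cv X.S cur‖ * ‖cv X.S z - ζ‖ ≤ 2 * X.tau := by gcongr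
      have h5 : 2 / (X.S : ℝ) ≤ X.tau := by
        have h6 := hX.inv_S_le
        have h7 : 2 / (X.S : ℝ) ≤ 100 / X.S := by
          have := hX.S_pos'
          gcongr
          norm_num
        linarith
      push_cast
      linarith
    have hr := ih (j + 1) (cmulT X.W X.S cur z).val hnext (by
      rw [show j + 1 + k = j + (k + 1) by ring]
      exact hjk)
    refine ⟨⟨?_, ?_⟩, ?_⟩
    · simp [powersT, hr.1.1]
    · rintro (_ | i) hi
      · simpa [powersT] using hcur
      · have := hr.1.2 i (by omega)
        rw [show j + (i + 1) = j + 1 + i by ring]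
        simpa [powersT] using this
    · have := hr.2
      simp only [powersT, bind_time, tick_time, pure_time]
      rw [add_mul]
      omega

theorem butterfly_runs (k : ℕ) (ts es os : List (ℤ × ℤ)) (ht : ts.length = k) (he : es.length = k)
    (ho : os.length = k)
    (hst : ∀ i < k, SmallC D X.W (ts.getD i (0, 0))) (hse : ∀ i < k, SmallC D X.W (es.getD i (0, 0)))
    (hso : ∀ i < k, SmallC D X.W (os.getD i (0, 0)))
    (hsm : ∀ i < k, SmallC D X.W (cmulT X.W X.S (ts.getD i (0, 0)) (os.getD i (0, 0))).val) :
    Runs (butterfly X ts es os) ((k + 1) * (7 * unitCost D)) (fun r =>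
      r.1.length = k ∧ r.2.length = k ∧ ∀ i < k,
        cv X.S (r.1.getD i (0, 0)) = cv X.S (es.getD i (0, 0)) +
          cv X.S (cmulT X.W X.S (ts.getD i (0, 0)) (os.getD i (0, 0))).val ∧
        cv X.S (r.2.getD i (0, 0)) = cv X.S (es.getD i (0, 0)) -
          cv X.S (cmulT X.W X.S (ts.getD i (0, 0)) (os.getD i (0, 0))).val) := by
  have hU := one_le_unitCost D
  induction k generalizing ts es os with
  | zero =>
    rw [List.length_eq_zero_iff] at ht he ho
    subst ht he ho
    exact ⟨⟨rfl, rfl, fun i hi => by omega⟩, by simp [butterfly]; omega⟩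
  | succ k ih =>
    obtain ⟨t, ts, rfl⟩ := List.exists_cons_of_length_eq_add_one ht
    obtain ⟨e, es, rfl⟩ := List.exists_cons_of_length_eq_add_one he
    obtain ⟨o, os, rfl⟩ := List.exists_cons_of_length_eq_add_one ho
    have hr := ih ts es os (by simpa using ht) (by simpa using he) (by simpa using ho)
      (fun i hi => by simpa using hst (i + 1) (by omega))
      (fun i hi => by simpa using hse (i + 1) (by omega))
      (fun i hi => by simpa using hso (i + 1) (by omega))
      (fun i hi => by simpa using hsm (i + 1) (by omega))
    have h0t : SmallC D X.W t := by simpa using hst 0 (by omega)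
    have h0e : SmallC D X.W e := by simpa using hse 0 (by omega)
    have h0o : SmallC D X.W o := by simpa using hso 0 (by omega)
    have h0m : SmallC D X.W (cmulT X.W X.S t o).val := by simpa using hsm 0 (by omega)
    have t1 := cmulT_time hX.machine h0t h0o hX.small_S
    have t2 := caddT_time hX.machine h0e h0m
    have t3 := csubT_time hX.machine h0e h0m
    refine ⟨⟨?_, ?_, ?_⟩, ?_⟩
    · simp [butterfly, hr.1.1]
    · simp [butterfly, hr.1.2.1]
    · rintro (_ | i) hi
      · simp only [butterfly, bind_val, pure_val, List.getD_cons_zero, caddT_val, csubT_val, cv_add,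
          cv_sub, and_self]
      · simpa [butterfly] using hr.1.2.2 i (by omega)
    · have := hr.2
      simp only [butterfly, bind_time, tick_time, pure_time]
      rw [add_mul]
      omega

omit hX in
-- Decimation in time: the even and the odd positions give two transforms of half the length at the
-- root ζ².
theorem dft_split (q : ℕ) (ζ : ℂ) (f : ℕ → ℂ) (k : ℕ) :
    ∑ j ∈ Finset.range (2 ^ (q + 1)), ζ ^ (j * k) * f j =
      ∑ j ∈ Finset.range (2 ^ q), (ζ ^ 2) ^ (j * k) * f (2 * j) +
        ζ ^ k * ∑ j ∈ Finset.range (2 ^ q), (ζ ^ 2) ^ (j * k) * f (2 * j + 1) := by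
  have key : ∀ m : ℕ, ∑ j ∈ Finset.range (2 * m), ζ ^ (j * k) * f j =
      ∑ j ∈ Finset.range m, (ζ ^ 2) ^ (j * k) * f (2 * j) +
        ζ ^ k * ∑ j ∈ Finset.range m, (ζ ^ 2) ^ (j * k) * f (2 * j + 1) := by
    intro m
    induction m with
    | zero => simp
    | succ m ih =>
      rw [mul_add, mul_one, Finset.sum_range_succ, Finset.sum_range_succ, ih,
        Finset.sum_range_succ, Finset.sum_range_succ]
      ring
  rw [pow_succ, mul_comm, key]

/-- A level of the recursion multiplies the error by at most 4: one share comes from the even half,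
three from the product of the odd half with the twiddle factor. With G = e + τ F + 2 / S, input
error, twiddle error and rounding are all absorbed in the growth 4^q G. The hypotheses on the root
speak of q = r + 1 and are void for length 1. -/
theorem fft_runs (q : ℕ) (tw a : List (ℤ × ℤ)) (ζ : ℂ) (f : ℕ → ℂ) (τ e F : ℝ) (hζ : ‖ζ‖ = 1)
    (hroot : ∀ r, q = r + 1 → ζ ^ 2 ^ r = -1)
    (htw : ∀ r, q = r + 1 → Approx X.S tw (2 ^ r) (fun k => ζ ^ k) τ)
    (hτ0 : 0 ≤ τ) (hτ : τ ≤ 1) (he : 0 ≤ e) (ha : Approx X.S a (2 ^ q) f e)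
    (hf : ∀ j < 2 ^ q, ‖f j‖ ≤ F)
    (hsize : 2 ^ q * F + 4 ^ q * (e + τ * F + 2 / X.S) ≤ A ^ 8) :
    Runs (fft X q tw a) ((q + 1) * 2 ^ q * (11 * unitCost D)) (fun r =>
      Approx X.S r (2 ^ q) (fun k => ∑ j ∈ Finset.range (2 ^ q), ζ ^ (j * k) * f j)
        (4 ^ q * (e + τ * F + 2 / X.S))) := by
  have hU := one_le_unitCost D
  have hS := hX.S_pos'
  have hF : 0 ≤ F := (norm_nonneg _).trans (hf 0 (by positivity))
  set G := e + τ * F + 2 / X.S with hG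
  have hG0 : 0 ≤ G := by positivity
  induction q generalizing tw a ζ f with
  | zero =>
    refine ⟨?_, by simp [fft]; omega⟩
    simp only [fft, bind_val, pure_val]
    refine ⟨ha.1, fun i hi => ?_⟩
    have := ha.2 i hi
    have h0 : i = 0 := by simpa using hi
    subst h0
    simp only [pow_zero, Finset.range_one, Finset.sum_singleton, zero_mul, one_mul]
    have h2 : 0 ≤ τ * F := by positivity
    have h3 : 0 ≤ 2 / (X.S : ℝ) := by positivity
    linarith
  | succ q ih =>
    have htw0 := htw q rfl
    have hrt := hroot q rfl
    have hp4 : (4 : ℝ) ^ (q + 1) = 4 * 4 ^ q := by rw [pow_succ]; ring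
    have hp2 : (2 : ℝ) ^ (q + 1) = 2 * 2 ^ q := by rw [pow_succ]; ring
    have h4 : (1 : ℝ) ≤ 4 ^ q := one_le_pow₀ (by norm_num)
    have h24 : (2 : ℝ) ^ q ≤ 4 ^ q := by gcongr; norm_num
    have hG4 : G ≤ 4 ^ q * G := le_mul_of_one_le_left hG0 h4
    have h2F : 0 ≤ 2 ^ q * F := by positivity
    have hsz : 2 ^ q * F + 4 ^ q * G ≤ A ^ 8 := by
      rw [hp4, hp2] at hsize
      nlinarith
    obtain ⟨hal, hav⟩ := ha
    have hlen := splitT_length a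
    rw [hal] at hlen
    have hl1 : (splitT a).val.1.length = 2 ^ q := by rw [hlen.1]; omega
    have hl2 : (splitT a).val.2.length = 2 ^ q := by rw [hlen.2]; omega
    have htwl := splitT_length tw
    rw [htw0.1] at htwl
    have hpow : ∀ r, q = r + 1 → (ζ ^ 2) ^ 2 ^ r = -1 := by
      rintro r rfl
      rw [← pow_mul, ← pow_succ']
      exact hrt
    have htw' : ∀ r, q = r + 1 → Approx X.S (splitT tw).val.1 (2 ^ r) (fun k => (ζ ^ 2) ^ k) τ := by
      rintro r rfl
      refine ⟨by rw [htwl.1, pow_succ]; omega, fun i hi => ?_⟩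
      dsimp only
      rw [(splitT_getD tw (0, 0) i).1, ← pow_mul]
      exact htw0.2 (2 * i) (by rw [pow_succ]; omega)
    have hζ2 : ‖ζ ^ 2‖ = 1 := by rw [norm_pow, hζ, one_pow]
    have hE := ih (splitT tw).val.1 (splitT a).val.1 (ζ ^ 2) (fun j => f (2 * j)) hζ2 hpow htw'
      ⟨hl1, fun i hi => by
        rw [(splitT_getD a (0, 0) i).1]
        exact hav (2 * i) (by rw [pow_succ]; omega)⟩
      (fun j hj => hf _ (by rw [pow_succ]; omega)) hsz
    have hO := ih (splitT tw).val.1 (splitT a).val.2 (ζ ^ 2) (fun j => f (2 * j + 1)) hζ2 hpow htw'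
      ⟨hl2, fun i hi => by
        rw [(splitT_getD a (0, 0) i).2]
        exact hav (2 * i + 1) (by rw [pow_succ]; omega)⟩
      (fun j hj => hf _ (by rw [pow_succ]; omega)) hsz
    have hdft : ∀ g : ℕ → ℂ, (∀ j < 2 ^ q, ‖g j‖ ≤ F) → ∀ k,
        ‖∑ j ∈ Finset.range (2 ^ q), (ζ ^ 2) ^ (j * k) * g j‖ ≤ 2 ^ q * F := by
      intro g hg k
      refine (norm_sum_le _ _).trans ?_
      calc _ ≤ ∑ j ∈ Finset.range (2 ^ q), F := by
            refine Finset.sum_le_sum fun j hj => ?_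
            rw [norm_mul, norm_pow, hζ2, one_pow, one_mul]
            exact hg j (Finset.mem_range.1 hj)
        _ = _ := by simp
    set ef := (fft X q (splitT tw).val.1 (splitT a).val.1).val
    set of := (fft X q (splitT tw).val.1 (splitT a).val.2).val
    have hfo : ∀ j < 2 ^ q, ‖f (2 * j + 1)‖ ≤ F := fun j hj => hf _ (by rw [pow_succ]; omega)
    have hfe : ∀ j < 2 ^ q, ‖f (2 * j)‖ ≤ F := fun j hj => hf _ (by rw [pow_succ]; omega)
    have hen : ∀ i < 2 ^ q, ‖cv X.S (ef.getD i (0, 0))‖ ≤ 2 ^ q * F + 4 ^ q * G :=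
      fun i hi => hE.1.norm_le hi (hdft _ hfe i)
    have hon : ∀ i < 2 ^ q, ‖cv X.S (of.getD i (0, 0))‖ ≤ 2 ^ q * F + 4 ^ q * G :=
      fun i hi => hO.1.norm_le hi (hdft _ hfo i)
    have htn : ∀ i < 2 ^ q, ‖cv X.S (tw.getD i (0, 0))‖ ≤ 1 + τ :=
      fun i hi => htw0.norm_le hi (by rw [norm_pow, hζ, one_pow])
    have hSG : 2 / (X.S : ℝ) ≤ G := by
      rw [hG]
      have : 0 ≤ τ * F := by positivity
      linarith
    have hτF : τ * F ≤ G := by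
      rw [hG]
      have : 0 ≤ 2 / (X.S : ℝ) := by positivity
      linarith
    -- Four contributions: the rounding, the twiddle error times the error of the odd half, the
    -- twiddle error times the exact odd half, and the error of the odd half. The second and the
    -- last cost 4^q G each; the other two together cost one more 4^q G, as 2^q ≤ 4^q.
    have hmn : ∀ i < 2 ^ q, ‖cv X.S (cmulT X.W X.S (tw.getD i (0, 0)) (of.getD i (0, 0))).val -
        ζ ^ i * ∑ j ∈ Finset.range (2 ^ q), (ζ ^ 2) ^ (j * i) * f (2 * j + 1)‖ ≤
          3 * (4 ^ q * G) := by
      intro i hi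
      have h1 := norm_cv_cmulT_sub_le X.W hX.S_pos (tw.getD i (0, 0)) (of.getD i (0, 0))
      have h2 := htw0.2 i hi
      have h3 := hO.1.2 i hi
      have h5 := hdft _ hfo i
      set Y := ∑ j ∈ Finset.range (2 ^ q), (ζ ^ 2) ^ (j * i) * f (2 * j + 1)
      set m := cv X.S (cmulT X.W X.S (tw.getD i (0, 0)) (of.getD i (0, 0))).val
      set t := cv X.S (tw.getD i (0, 0))
      set o := cv X.S (of.getD i (0, 0))
      have h6 : m - ζ ^ i * Y = (m - t * o) + ((t - ζ ^ i) * (o - Y) + ((t - ζ ^ i) * Y +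
        ζ ^ i * (o - Y))) := by ring
      rw [h6]
      refine (norm_add_le _ _).trans ?_
      have h7 := norm_add_le ((t - ζ ^ i) * (o - Y)) ((t - ζ ^ i) * Y + ζ ^ i * (o - Y))
      have h8 := norm_add_le ((t - ζ ^ i) * Y) (ζ ^ i * (o - Y))
      rw [norm_mul] at h7
      rw [norm_mul, norm_mul, norm_pow, hζ, one_pow, one_mul] at h8
      have h9 : ‖t - ζ ^ i‖ * ‖o - Y‖ ≤ τ * (4 ^ q * G) := by gcongr
      have h10 : ‖t - ζ ^ i‖ * ‖Y‖ ≤ τ * (2 ^ q * F) := by gcongr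
      have h11 : τ * (4 ^ q * G) ≤ 4 ^ q * G := mul_le_of_le_one_left (by positivity) hτ
      have h12 : 2 / (X.S : ℝ) + τ * (2 ^ q * F) ≤ 4 ^ q * G := by
        have : 2 / (X.S : ℝ) ≤ 4 ^ q * (2 / X.S) := le_mul_of_one_le_left (by positivity) h4
        have : τ * (2 ^ q * F) ≤ 4 ^ q * (τ * F) := by
          rw [mul_left_comm]
          gcongr
        have h13 : 4 ^ q * G = 4 ^ q * e + 4 ^ q * (τ * F) + 4 ^ q * (2 / X.S) := by
          rw [hG]; ring
        have : 0 ≤ 4 ^ q * e := by positivity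
        linarith
      linarith
    have hsm : ∀ i < 2 ^ q,
        SmallC D X.W (cmulT X.W X.S (tw.getD i (0, 0)) (of.getD i (0, 0))).val := by
      intro i hi
      refine hX.smallC_of_norm_le (k := 8) (by norm_num) ?_
      have h1 := hmn i hi
      have h2 := norm_le_norm_add_norm_sub'
        (cv X.S (cmulT X.W X.S (tw.getD i (0, 0)) (of.getD i (0, 0))).val)
        (ζ ^ i * ∑ j ∈ Finset.range (2 ^ q), (ζ ^ 2) ^ (j * i) * f (2 * j + 1))
      rw [norm_mul, norm_pow, hζ, one_pow, one_mul] at h2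
      have h3 := hdft _ hfo i
      rw [hp4, hp2] at hsize
      nlinarith
    have hA := hX.A_ge
    have hb := butterfly_runs hX (2 ^ q) tw ef of htw0.1 hE.1.1 hO.1.1
      (fun i hi => hX.smallC_of_norm_le (k := 1) (by norm_num) ((htn i hi).trans (by linarith)))
      (fun i hi => hX.smallC_of_norm_le (k := 8) (by norm_num) ((hen i hi).trans hsz))
      (fun i hi => hX.smallC_of_norm_le (k := 8) (by norm_num) ((hon i hi).trans hsz)) hsm
    set bf := (butterfly X tw ef of).val with hbf
    have hval : (fft X (q + 1) tw a).val = bf.1 ++ bf.2 := by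
      have := (appendT_runs bf.1 bf.2).1
      rw [← this]
      rfl
    refine ⟨?_, ?_⟩
    · rw [hval]
      refine ⟨by rw [List.length_append, hb.1.1, hb.1.2.1, pow_succ]; ring, fun k hk => ?_⟩
      dsimp only
      rw [dft_split]
      rcases lt_or_ge k (2 ^ q) with hkq | hkq
      · rw [List.getD_append _ _ _ _ (by rw [hb.1.1]; exact hkq), (hb.1.2.2 k hkq).1,
          add_sub_add_comm]
        refine (norm_add_le _ _).trans ?_
        have h1 := hE.1.2 k hkq
        have h2 := hmn k hkq
        rw [hp4]
        linarith
      · obtain ⟨i, rfl⟩ : ∃ i, k = 2 ^ q + i := ⟨k - 2 ^ q, by omega⟩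
        have hi : i < 2 ^ q := by rw [pow_succ] at hk; omega
        -- The half-length transforms have period 2^q in k, as (ζ²)^(2^q) = 1; so the second half of
        -- the output differs from the first only in the sign of the twiddle factor.
        have hper : ∀ g : ℕ → ℂ, ∑ j ∈ Finset.range (2 ^ q), (ζ ^ 2) ^ (j * (2 ^ q + i)) * g j =
            ∑ j ∈ Finset.range (2 ^ q), (ζ ^ 2) ^ (j * i) * g j := by
          intro g
          refine Finset.sum_congr rfl fun j _ => ?_
          congr 1
          rw [mul_add, pow_add, mul_comm j (2 ^ q), pow_mul, ← pow_mul ζ, mul_comm 2, pow_mul, hrt]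
          norm_num
        rw [List.getD_append_right _ _ _ _ (by rw [hb.1.1]; omega), hb.1.1, Nat.add_sub_cancel_left,
          (hb.1.2.2 i hi).2, hper (fun j => f (2 * j)), hper (fun j => f (2 * j + 1)), pow_add, hrt]
        have h1 := hE.1.2 i hi
        have h2 := hmn i hi
        rw [neg_one_mul, neg_mul, ← sub_eq_add_neg, sub_sub_sub_comm]
        refine (norm_sub_le _ _).trans ?_
        rw [hp4]
        linarith
    · have t1 := splitT_time a
      have t2 := splitT_time tw
      have t3 := hE.2
      have t4 := hO.2
      have t5 := hb.2
      have t6 := (appendT_runs bf.1 bf.2).2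
      have ht : (fft X (q + 1) tw a).time = (splitT a).time + ((splitT tw).time +
        ((fft X q (splitT tw).val.1 (splitT a).val.1).time +
        ((fft X q (splitT tw).val.1 (splitT a).val.2).time + ((butterfly X tw ef of).time +
          (appendT bf.1 bf.2).time)))) := rfl
      rw [ht, t1, t2, hal, htw0.1]
      rw [hb.1.1] at t6
      have hq1 : 1 ≤ 2 ^ q := Nat.one_le_two_pow
      rw [pow_succ]
      generalize unitCost D = U at *
      generalize 2 ^ q = Q at *
      have : (Q + 1) * (7 * U) ≤ 14 * (Q * U) := by nlinarith
      have : Q ≤ Q * U := Nat.le_mul_of_pos_right _ hU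
      have : (q + 1 + 1) * (Q * 2) * (11 * U) = 2 * ((q + 1) * Q * (11 * U)) + 22 * (Q * U) := by
        ring
      omega

end

/-! ### Convolution -/

/-- Orthogonality of characters: the powers of a nontrivial Q-th root of unity sum to 0. -/
theorem sum_pow_eq_ite {Q : ℕ} (hQ : 0 < Q) {ζ : ℂ} (hζ : IsPrimitiveRoot ζ Q) {a i : ℕ}
    (ha : a < Q) (hi : i < Q) :
    ∑ k ∈ Finset.range Q, (ζ ^ a * ζ⁻¹ ^ i) ^ k = if a = i then (Q : ℂ) else 0 := by
  have hζ0 : ζ ≠ 0 := hζ.ne_zero hQ.ne'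
  split_ifs with h
  · subst h
    rw [← mul_pow, mul_inv_cancel₀ hζ0]
    simp
  · have h1 : ζ ^ a * ζ⁻¹ ^ i ≠ 1 := by
      intro h2
      rw [inv_pow, ← div_eq_mul_inv, div_eq_one_iff_eq (pow_ne_zero _ hζ0)] at h2
      exact h (hζ.pow_inj ha hi h2)
    have h2 : (ζ ^ a * ζ⁻¹ ^ i) ^ Q = 1 := by
      rw [mul_pow, ← pow_mul, ← pow_mul, mul_comm a, mul_comm i, pow_mul, pow_mul, inv_pow,
        hζ.pow_eq_one]
      simp
    have h3 := mul_geom_sum (ζ ^ a * ζ⁻¹ ^ i) Q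
    rw [h2, sub_self] at h3
    exact (mul_eq_zero.1 h3).resolve_left (sub_ne_zero.2 h1)

theorem sum_range_ite_lt {p Q : ℕ} (h : p ≤ Q) (g f : ℕ → ℂ) :
    ∑ j ∈ Finset.range Q, g j * (if j < p then f j else 0) = ∑ j ∈ Finset.range p, g j * f j := by
  rw [← Finset.sum_subset (Finset.range_mono h)]
  · exact Finset.sum_congr rfl fun j hj => by rw [if_pos (Finset.mem_range.1 hj)]
  · intro j _ hj
    rw [if_neg (by simpa using hj), mul_zero]

/-- By orthogonality only the pairs with j + j' ≡ i modulo Q contribute. Since 2 p ≤ Q, both sides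
are below Q and the congruence is an equality: the padding yields the linear convolution. -/
theorem inverse_dft_mul {Q p : ℕ} (hQ : 0 < Q) (hp : 2 * p ≤ Q) {ζ : ℂ}
    (hζ : IsPrimitiveRoot ζ Q) (f h : ℕ → ℂ) {i : ℕ} (hi : i < Q) :
    ∑ k ∈ Finset.range Q, ζ⁻¹ ^ (k * i) *
        ((∑ j ∈ Finset.range Q, ζ ^ (j * k) * (if j < p then f j else 0)) *
          (∑ j ∈ Finset.range Q, ζ ^ (j * k) * (if j < p then h j else 0))) =
      Q * ∑ j ∈ Finset.range p, ∑ j' ∈ Finset.range p, if j + j' = i then f j * h j' else 0 := by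
  simp only [sum_range_ite_lt (by omega : p ≤ Q), Finset.sum_mul_sum]
  simp only [Finset.mul_sum]
  rw [Finset.sum_comm]
  refine Finset.sum_congr rfl fun j hj => ?_
  rw [Finset.sum_comm]
  refine Finset.sum_congr rfl fun j' hj' => ?_
  rw [Finset.mem_range] at hj hj'
  have h1 := sum_pow_eq_ite hQ hζ (show j + j' < Q by omega) hi
  have h2 : ∀ k, ζ⁻¹ ^ (k * i) * (ζ ^ (j * k) * f j * (ζ ^ (j' * k) * h j')) =
      (ζ ^ (j + j') * ζ⁻¹ ^ i) ^ k * (f j * h j') := by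
    intro k
    ring
  simp only [h2, ← Finset.sum_mul, h1]
  split_ifs <;> simp

/-- The cyclic convolution of length `p`. -/
noncomputable def cconv (p : ℕ) (f h : ℕ → ℂ) (i : ℕ) : ℂ :=
  ∑ j ∈ Finset.range p, ∑ j' ∈ Finset.range p, if (j + j') % p = i then f j * h j' else 0

/-- As j + j' < 2 p, the residue i arises only from j + j' = i and from j + j' = p + i. This is the
folding of the linear convolution. -/
theorem cconv_eq {p : ℕ} (f h : ℕ → ℂ) {i : ℕ} (hi : i < p) :
    cconv p f h i =
      (∑ j ∈ Finset.range p, ∑ j' ∈ Finset.range p, if j + j' = i then f j * h j' else 0) +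
      ∑ j ∈ Finset.range p, ∑ j' ∈ Finset.range p, if j + j' = p + i then f j * h j' else 0 := by
  unfold cconv
  simp only [← Finset.sum_add_distrib]
  refine Finset.sum_congr rfl fun j hj => Finset.sum_congr rfl fun j' hj' => ?_
  rw [Finset.mem_range] at hj hj'
  rcases lt_or_ge (j + j') p with h1 | h1
  · rw [Nat.mod_eq_of_lt h1, if_neg (show j + j' ≠ p + i by omega), add_zero]
  · rw [Nat.mod_eq_sub_mod h1, Nat.mod_eq_of_lt (by omega), if_neg (show j + j' ≠ i by omega),
      zero_add]
    congr 1
    exact propext ⟨fun h => by omega, fun h => by omega⟩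

theorem cv_zero (S : ℤ) : cv S (0, 0) = 0 := by simp [cv]

theorem cv_conj (S : ℤ) (t : ℤ × ℤ) : cv S (t.1, 0 - t.2) = (starRingEnd ℂ) (cv S t) := by
  apply Complex.ext <;> simp only [Complex.conj_re, Complex.conj_im, cv_re, cv_im]
  push_cast
  ring

theorem getD_map {l : List (ℤ × ℤ)} {g : ℤ × ℤ → ℤ × ℤ} {i : ℕ} (hi : i < l.length) :
    (l.map g).getD i (0, 0) = g (l.getD i (0, 0)) := by
  simp [hi]

theorem getD_zipWith {k l : List (ℤ × ℤ)} {g : ℤ × ℤ → ℤ × ℤ → ℤ × ℤ} {i : ℕ}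
    (hk : i < k.length) (hl : i < l.length) :
    (List.zipWith g k l).getD i (0, 0) = g (k.getD i (0, 0)) (l.getD i (0, 0)) := by
  simp [hk, hl]

theorem Approx.append_zeros {S : ℤ} {a : List (ℤ × ℤ)} {p : ℕ} {f : ℕ → ℂ} {e : ℝ}
    (h : Approx S a p f e) (he : 0 ≤ e) (g : ℕ) :
    Approx S (a ++ List.replicate g (0, 0)) (p + g) (fun j => if j < p then f j else 0) e := by
  refine ⟨by simp [h.1], fun i hi => ?_⟩
  dsimp only
  split_ifs with h1
  · rw [List.getD_append _ _ _ _ (by rw [h.1]; exact h1)]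
    exact h.2 i h1
  · rw [List.getD_append_right _ _ _ _ (by rw [h.1]; omega), h.1]
    have : (List.replicate g ((0 : ℤ), (0 : ℤ))).getD (i - p) (0, 0) = (0, 0) := by
      rw [List.getD_replicate]
      omega
    rw [this, cv_zero, sub_zero, norm_zero]
    exact he

theorem norm_mul_sub_mul_le {x y a b : ℂ} {M e : ℝ} (ha : ‖a‖ ≤ M) (hb : ‖b‖ ≤ M)
    (hx : ‖x - a‖ ≤ e) (hy : ‖y - b‖ ≤ e) : ‖x * y - a * b‖ ≤ e * (2 * M + e) := by
  have h : x * y - a * b = (x - a) * (y - b) + ((x - a) * b + a * (y - b)) := by ring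
  have he : 0 ≤ e := (norm_nonneg _).trans hx
  have hM : 0 ≤ M := (norm_nonneg _).trans ha
  rw [h]
  refine (norm_add_le _ _).trans ?_
  have h1 := norm_add_le ((x - a) * b) (a * (y - b))
  rw [norm_mul (x - a) b, norm_mul a] at h1
  rw [norm_mul (x - a)]
  have h2 : ‖x - a‖ * ‖y - b‖ ≤ e * e := by gcongr
  have h3 : ‖x - a‖ * ‖b‖ ≤ e * M := by gcongr
  have h4 : ‖a‖ * ‖y - b‖ ≤ M * e := by gcongr
  linarith

theorem convT_time_bound {q Q R U V p t : ℕ} (hq1 : 1 ≤ q) (hQR : Q = 2 * R) (hR : 1 ≤ R)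
    (hpQ : 2 * p ≤ Q) (hU : 1 ≤ U) (hUU : U ≤ V) :
    U + ((q + 1) * (3 * V) + (t + (U + ((R + 1) * (3 * U) +
    ((R * (U + 1) + 1) + (U + ((Q - p + 1) + ((p + 1) + ((p + 1) +
    ((q + 1) * Q * (11 * U) + ((q + 1) * Q * (11 * U) +
    ((Q * (2 * U + 1) + 1) + ((q + 1) * Q * (11 * U) +
    ((Q * (2 * U + 1) + 1) + ((Q + 1) + (p * (2 * U + 1) + 1)))))))))))))))) ≤
      t + (q + 1) * Q * (60 * V) := by
  have hpQ' : p ≤ Q := by omega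
  have z1 : (q + 1) * (3 * V) ≤ 3 * ((q + 1) * Q * V) := by
    calc (q + 1) * (3 * V) = 3 * ((q + 1) * V) * 1 := by ring
      _ ≤ 3 * ((q + 1) * V) * Q := Nat.mul_le_mul_left _ (by omega)
      _ = _ := by ring
  have z2 : Q * V * 2 ≤ (q + 1) * Q * V := by
    calc Q * V * 2 ≤ Q * V * (q + 1) := Nat.mul_le_mul_left _ (by omega)
      _ = _ := by ring
  have z3 : (q + 1) * Q * (11 * U) ≤ 11 * ((q + 1) * Q * V) := by
    calc (q + 1) * Q * (11 * U) ≤ (q + 1) * Q * (11 * V) := by gcongr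
      _ = _ := by ring
  have z4 : Q * (2 * U + 1) ≤ 3 * (Q * V) := by
    calc Q * (2 * U + 1) ≤ Q * (3 * V) := Nat.mul_le_mul_left _ (by omega)
      _ = _ := by ring
  have z5 : p * (2 * U + 1) ≤ 3 * (Q * V) := by
    calc p * (2 * U + 1) ≤ Q * (3 * V) := Nat.mul_le_mul hpQ' (by omega)
      _ = _ := by ring
  have z6 : (R + 1) * (3 * U) ≤ 3 * (Q * V) := by
    calc (R + 1) * (3 * U) ≤ Q * (3 * V) := Nat.mul_le_mul (by omega) (by omega)
      _ = _ := by ring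
  have z7 : R * (U + 1) ≤ 2 * (Q * V) := by
    calc R * (U + 1) ≤ Q * (2 * V) := Nat.mul_le_mul (by omega) (by omega)
      _ = _ := by ring
  have z8 : Q ≤ Q * V := Nat.le_mul_of_pos_right _ (by omega)
  have z9 : V ≤ Q * V := Nat.le_mul_of_pos_left _ (by omega)
  have z10 : (q + 1) * Q * (60 * V) = 60 * ((q + 1) * Q * V) := by ring
  rw [z10]
  have z11 : Q - p ≤ Q := Nat.sub_le _ _
  linarith

section
variable {X : Ctx} {A : ℝ} {D : ℕ} (hX : GoodCtx X A D)
include hX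

theorem GoodCtx.two_div_S_le : 2 / (X.S : ℝ) ≤ X.tau := by
  have h6 := hX.inv_S_le
  have h7 : 2 / (X.S : ℝ) ≤ 100 / X.S := by
    have := hX.S_pos'
    gcongr
    norm_num
  linarith

theorem GoodCtx.pow_mul_tau_le_one {k : ℕ} (hk : k ≤ 30) {r : ℝ} (hr : r ≤ A ^ k) :
    r * X.tau ≤ 1 :=
  (mul_le_mul_of_nonneg_right hr hX.tau_pos.le).trans (hX.mul_tau_le hk)

theorem GoodCtx.mul_pow_le {r : ℝ} (hr : r ≤ 1000) (k : ℕ) : r * A ^ k ≤ A ^ (k + 1) := by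
  rw [pow_succ, mul_comm]
  have := hX.A_pos
  exact mul_le_mul_of_nonneg_left (hr.trans hX.A_ge) (by positivity)

theorem GoodCtx.smallC_of_approx {l : List (ℤ × ℤ)} {k j : ℕ} {f : ℕ → ℂ} {e F : ℝ}
    (h : Approx X.S l k f e) (hf : ∀ i < k, ‖f i‖ ≤ F) (hj : j ≤ 12) (hF : F + e ≤ A ^ j)
    {a : ℤ × ℤ} (ha : a ∈ l) : SmallC D X.W a := by
  obtain ⟨i, hi, rfl⟩ := exists_getD_of_mem ha
  exact hX.smallC_of_norm_le hj ((h.norm_le (h.1 ▸ hi) (hf i (h.1 ▸ hi))).trans hF)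

omit hX in
theorem norm_dft_le {Q : ℕ} {ζ : ℂ} (hζ : ‖ζ‖ = 1) {f : ℕ → ℂ} {F : ℝ}
    (hf : ∀ j < Q, ‖f j‖ ≤ F) (k : ℕ) : ‖∑ j ∈ Finset.range Q, ζ ^ (j * k) * f j‖ ≤ Q * F := by
  refine (norm_sum_le _ _).trans ?_
  calc _ ≤ ∑ j ∈ Finset.range Q, F := by
        refine Finset.sum_le_sum fun j hj => ?_
        rw [norm_mul, norm_pow, hζ, one_pow, one_mul]
        exact hf j (Finset.mem_range.1 hj)
    _ = _ := by simp

set_option maxHeartbeats 1600000 in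
-- The error, in units of τ, through the stages: twiddle factors 3 A, forward transforms 4 A^4,
-- pointwise product 10 A^6, backward transform 7 A^9, division by the length 8 A^9, and twice this
-- after folding. Each transform of length Q = 2^q amplifies by 4^q = Q² ≤ A².
theorem convT_runs {p : ℕ} (hp : 1 ≤ p) (hpA : 4 * (p : ℝ) ≤ A) {a b : List (ℤ × ℤ)}
    {f h : ℕ → ℂ} {e : ℝ} (he0 : 0 ≤ e) (he : e ≤ A * X.tau) (ha : Approx X.S a p f e)
    (hb : Approx X.S b p h e) (hf : ∀ j < p, ‖f j‖ ≤ A) (hh : ∀ j < p, ‖h j‖ ≤ A) :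
    Runs (convT X p a b) ((X.terms + 1) * (5 * unitCost D) +
        (Nat.clog 2 (2 * p) + 1) * 2 ^ Nat.clog 2 (2 * p) * (60 * unitCost (D + 1)))
      (fun l => Approx X.S l p (cconv p f h) (16 * A ^ 9 * X.tau)) := by
  have hM := hX.machine
  have hS := hX.S_pos'
  have hA := hX.A_ge
  have hA1 := hX.one_le_A
  have hA0 := hX.A_pos
  have hτ0 := hX.tau_pos
  have h2S := hX.two_div_S_le
  have hSi : 0 ≤ 2 / (X.S : ℝ) := by positivity
  set q := Nat.clog 2 (2 * p) with hq
  set Q := 2 ^ q with hQ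
  obtain ⟨r, hr⟩ : ∃ r, q = r + 1 := by
    refine ⟨q - 1, ?_⟩
    have : 0 < q := Nat.clog_pos (by norm_num) (by omega)
    omega
  have hQr : Q = 2 * 2 ^ r := by rw [hQ, hr, pow_succ, mul_comm]
  have hpQ : 2 * p ≤ Q := Nat.le_pow_clog (by norm_num) _
  -- The power of two overshoots 2 p by at most a factor 2, so the length of the transform is still
  -- at most A.
  have hQp : Q ≤ 4 * p := by
    have : 2 ^ r < 2 * p := by
      rw [← not_le, ← Nat.clog_le_iff_le_pow (by norm_num)]
      omega
    omega
  have hQA : (Q : ℝ) ≤ A := le_trans (by exact_mod_cast hQp) hpA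
  have hQpos : 0 < Q := by positivity
  have hQ0 : (0 : ℝ) < Q := by exact_mod_cast hQpos
  have hQ1 : (1 : ℝ) ≤ Q := by exact_mod_cast hQpos
  have hQpow : (2 : ℝ) ^ q = Q := by rw [hQ]; push_cast; rfl
  have hQ4 : (4 : ℝ) ^ q = Q ^ 2 := by
    rw [← hQpow, ← pow_mul, mul_comm, pow_mul]
    norm_num
  set ζ := Complex.exp (2 * Real.pi * Complex.I / Q) with hζ
  have hprim : IsPrimitiveRoot ζ Q := Complex.isPrimitiveRoot_exp Q hQpos.ne'
  have hζn : ‖ζ‖ = 1 := hprim.norm'_eq_one hQpos.ne'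
  have hroot : ζ ^ 2 ^ r = -1 := by
    have h2 : IsPrimitiveRoot (ζ ^ 2 ^ r) 2 := hprim.pow hQpos (by rw [hQr, mul_comm])
    exact h2.eq_neg_one_of_two_right
  have hζe : Complex.exp (Real.pi * (((2 : ℤ) : ℝ) / ((2 ^ q : ℤ) : ℝ) : ℝ) * Complex.I) = ζ := by
    rw [hζ]
    congr 1
    rw [hQ]
    push_cast
    ring
  have hsp : Small D X.W (p : ℤ) := hX.small_of_le_A (by
    rw [Int.cast_natCast, abs_of_nonneg (by positivity)]
    linarith [(Nat.cast_nonneg p : (0 : ℝ) ≤ p)])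
  have hsQ : Small D X.W (2 ^ q : ℤ) := hX.small_of_le_A (by
    push_cast
    rw [hQpow, abs_of_nonneg hQ0.le]
    exact hQA)
  have hs2p : Small D X.W (2 * p : ℤ) := hsQ.of_nonneg_le (by positivity) (by exact_mod_cast hpQ)
  -- the twiddle factors
  set τ₁ := 3 * X.tau * A with hτ₁
  have hτ₁0 : 0 ≤ τ₁ := by positivity
  have hτ₁1 : τ₁ ≤ 1 := by
    have := hX.pow_mul_tau_le_one (k := 2) (by norm_num) (r := 3 * A)
      (by simpa using hX.mul_pow_le (r := 3) (by norm_num) 1)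
    linarith
  -- the error and size estimates
  have hE1 : (4 : ℝ) ^ q * (e + τ₁ * A + 2 / X.S) ≤ 4 * A ^ 4 * X.tau := by
    rw [hQ4]
    have h1 : e + τ₁ * A + 2 / X.S ≤ 4 * A ^ 2 * X.tau := by
      rw [hτ₁]
      have h3 : A ≤ A ^ 2 := by simpa using pow_le_pow_right₀ hA1 (by norm_num : 1 ≤ 2)
      have h4 : (2 : ℝ) * A ^ 1 ≤ A ^ 2 := hX.mul_pow_le (by norm_num) 1
      have : 0 ≤ (A ^ 2 - A - 1) * X.tau := mul_nonneg (by linarith) hτ0.le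
      linarith
    calc (Q : ℝ) ^ 2 * (e + τ₁ * A + 2 / X.S) ≤ A ^ 2 * (4 * A ^ 2 * X.tau) := by gcongr
      _ = _ := by ring
  have hE1' : 4 * A ^ 4 * X.tau ≤ 1 := hX.pow_mul_tau_le_one (k := 5) (by norm_num)
    (hX.mul_pow_le (by norm_num) 4)
  have hsize1 : (2 : ℝ) ^ q * A + 4 ^ q * (e + τ₁ * A + 2 / X.S) ≤ A ^ 3 := by
    rw [hQpow]
    have : (Q : ℝ) * A ≤ A * A := by gcongr
    have h3 : (2 : ℝ) * A ^ 2 ≤ A ^ 3 := hX.mul_pow_le (by norm_num) 2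
    have h4 : 1 ≤ A ^ 2 := one_le_pow₀ hA1
    linarith
  have hA38 : A ^ 3 ≤ A ^ 8 := pow_le_pow_right₀ hA1 (by norm_num)
  have hf0 : ∀ g : ℕ → ℂ, (∀ j < p, ‖g j‖ ≤ A) → ∀ j < 2 ^ q, ‖(if j < p then g j else 0)‖ ≤ A := by
    intro g hg j _
    split_ifs with h1
    · exact hg j h1
    · rw [norm_zero]
      exact hA0.le
  set E2 := 10 * A ^ 6 * X.tau with hE2
  have hE20 : 0 ≤ E2 := by positivity
  have hE3 : (4 : ℝ) ^ q * (E2 + τ₁ * A ^ 4 + 2 / X.S) ≤ 7 * A ^ 9 * X.tau := by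
    rw [hQ4]
    have h1 : E2 + τ₁ * A ^ 4 + 2 / X.S ≤ 15 * A ^ 6 * X.tau := by
      rw [hτ₁, hE2]
      have h2 : A ^ 5 ≤ A ^ 6 := pow_le_pow_right₀ hA1 (by norm_num)
      have h3 : 1 ≤ A ^ 6 := one_le_pow₀ hA1
      have : 0 ≤ (A ^ 6 - A ^ 5) * X.tau := mul_nonneg (by linarith) hτ0.le
      have : 0 ≤ (A ^ 6 - 1) * X.tau := mul_nonneg (by linarith) hτ0.le
      linarith
    calc (Q : ℝ) ^ 2 * (E2 + τ₁ * A ^ 4 + 2 / X.S) ≤ A ^ 2 * (15 * A ^ 6 * X.tau) := by gcongr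
      _ = 15 * (A ^ 8 * X.tau) := by ring
      _ ≤ 7 * A * (A ^ 8 * X.tau) := by
        have : 0 ≤ A ^ 8 * X.tau := by positivity
        exact mul_le_mul_of_nonneg_right (by linarith) this
      _ = _ := by ring
  have hsize3 : (2 : ℝ) ^ q * A ^ 4 + 4 ^ q * (E2 + τ₁ * A ^ 4 + 2 / X.S) ≤ A ^ 6 := by
    rw [hQpow]
    have h1 : (Q : ℝ) * A ^ 4 ≤ A * A ^ 4 := by gcongr
    have h2 : 7 * A ^ 9 * X.tau ≤ 1 := hX.pow_mul_tau_le_one (k := 10) (by norm_num)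
      (hX.mul_pow_le (by norm_num) 9)
    have h3 : 1 ≤ A ^ 5 := one_le_pow₀ hA1
    have h4 : (2 : ℝ) * A ^ 5 ≤ A ^ 6 := hX.mul_pow_le (by norm_num) 5
    linarith
  have hA68 : A ^ 6 ≤ A ^ 8 := pow_le_pow_right₀ hA1 (by norm_num)
  refine Runs.mono (t := unitCost D + ((q + 1) * (3 * unitCost (D + 1)) +
    ((X.terms + 1) * (5 * unitCost D) + (unitCost D + ((2 ^ r + 1) * (3 * unitCost D) +
    ((2 ^ r * (unitCost D + 1) + 1) + (unitCost D + ((Q - p + 1) + ((p + 1) + ((p + 1) +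
    ((q + 1) * Q * (11 * unitCost D) + ((q + 1) * Q * (11 * unitCost D) +
    ((Q * (2 * unitCost D + 1) + 1) + ((q + 1) * Q * (11 * unitCost D) +
    ((Q * (2 * unitCost D + 1) + 1) + ((Q + 1) + (p * (2 * unitCost D + 1) + 1))))))))))))))))) ?_
    ?_
  · refine Runs.bind (ev_runs hM _ ⟨hM.small_two, hsp⟩) fun p2 hp2 => ?_
    simp only [Exp.eval_mul, Exp.eval_two, Exp.eval_lit] at hp2
    subst hp2
    have hlog := log2up_runs hM (2 * p : ℤ) hs2p (by omega)
    rw [show (2 * (p : ℤ)).toNat = 2 * p by omega, ← hq] at hlog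
    refine Runs.bind hlog fun qq hqq => ?_
    subst hqq
    dsimp only
    have hcis := cisT_runs hX (a := 2) (b := 2 ^ q) (by norm_num)
      (by exact_mod_cast (by omega : 2 ≤ 2 ^ q)) (by positivity) (by push_cast; rw [hQpow]; exact hQA)
    rw [hζe] at hcis
    refine Runs.bind hcis fun z hz => ?_
    refine Runs.bind (ev_runs hM _ ⟨hsQ, hM.small_two⟩) fun half hhalf => ?_
    have hhalf' : half.toNat = 2 ^ r := by
      simp only [Exp.eval_div, Exp.eval_two, Exp.eval_lit] at hhalf
      rw [hhalf, hr, pow_succ, Int.mul_ediv_cancel _ (by norm_num)]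
      exact_mod_cast Int.toNat_natCast (2 ^ r)
    rw [hhalf']
    have hrA : 3 * X.tau * ((0 + 2 ^ r : ℕ) : ℝ) ≤ τ₁ := by
      rw [hτ₁]
      gcongr
      refine le_trans ?_ hQA
      exact_mod_cast (by omega : 0 + 2 ^ r ≤ Q)
    refine Runs.bind (powersT_runs hX hζn hz (2 ^ r) 0 (X.S, 0) (by
      have : (X.S : ℂ) ≠ 0 := by exact_mod_cast hX.S_pos.ne'
      simp [cv, this]) (hrA.trans hτ₁1)) fun tw htw => ?_
    have htwA : Approx X.S tw (2 ^ r) (fun k => ζ ^ k) τ₁ := by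
      refine ⟨htw.1, fun i hi => ?_⟩
      have := htw.2 i hi
      rw [zero_add] at this
      refine this.trans (le_trans ?_ hrA)
      gcongr
      omega
    have htws : ∀ t ∈ tw, SmallC D X.W t := fun t ht =>
      hX.smallC_of_approx htwA (F := 1) (fun i _ => by rw [norm_pow, hζn, one_pow]) (j := 1)
        (by norm_num) (by linarith) ht
    refine Runs.bind (P := fun l => l = tw.map fun t : ℤ × ℤ => (t.1, 0 - t.2)) ⟨?_, ?_⟩
      fun twc htwc => ?_
    · rw [mapT_val]
      rfl
    · rw [← htw.1]
      exact mapT_time _ _ _ fun t ht =>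
        (ev_runs hM (0 - (t.2 : Exp)) ⟨hM.small_zero, (htws t ht).2⟩).2
    -- The backward transform runs on ζ⁻¹, which is the conjugate of ζ as |ζ| = 1; conjugating the
    -- twiddle factors keeps their error.
    have htwcA : Approx X.S twc (2 ^ r) (fun k => ζ⁻¹ ^ k) τ₁ := by
      subst htwc
      refine ⟨by rw [List.length_map]; exact htw.1, fun i hi => ?_⟩
      rw [getD_map (by rw [htw.1]; exact hi), cv_conj]
      have h1 : ζ⁻¹ = (starRingEnd ℂ) ζ := Complex.inv_eq_conj hζn
      dsimp only
      rw [h1, ← map_pow, ← map_sub, Complex.norm_conj]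
      exact htwA.2 i hi
    refine Runs.bind (ev_runs hM _ ⟨hsQ, hsp⟩) fun gap hgap => ?_
    have hgap' : gap.toNat = Q - p := by
      simp only [Exp.eval_sub, Exp.eval_lit] at hgap
      rw [hgap, hQ]
      have : ((2 ^ q : ℕ) : ℤ) = 2 ^ q := by push_cast; rfl
      omega
    rw [hgap']
    refine Runs.bind (replicateT_runs _ _) fun zs hzs => ?_
    subst hzs
    refine Runs.bind ((appendT_runs a _).mono (by rw [ha.1])) fun a' ha' => ?_
    refine Runs.bind ((appendT_runs b _).mono (by rw [hb.1])) fun b' hb' => ?_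
    have hpg : p + (Q - p) = Q := by omega
    have haA := ha.append_zeros he0 (Q - p)
    have hbA := hb.append_zeros he0 (Q - p)
    rw [hpg, ← ha'] at haA
    rw [hpg, ← hb'] at hbA
    have hrt : ∀ r', q = r' + 1 → ζ ^ 2 ^ r' = -1 := by
      intro r' h'
      obtain rfl : r' = r := by omega
      exact hroot
    have hrtc : ∀ r', q = r' + 1 → ζ⁻¹ ^ 2 ^ r' = -1 := by
      intro r' h'
      rw [inv_pow, hrt r' h']
      norm_num
    have htwA' : ∀ r', q = r' + 1 → Approx X.S tw (2 ^ r') (fun k => ζ ^ k) τ₁ := by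
      intro r' h'
      obtain rfl : r' = r := by omega
      exact htwA
    have htwcA' : ∀ r', q = r' + 1 → Approx X.S twc (2 ^ r') (fun k => ζ⁻¹ ^ k) τ₁ := by
      intro r' h'
      obtain rfl : r' = r := by omega
      exact htwcA
    refine Runs.bind (fft_runs hX q tw a' ζ _ τ₁ e A hζn hrt htwA' hτ₁0 hτ₁1 he0 haA (hf0 f hf)
      (hsize1.trans hA38)) fun fa hfa => ?_
    refine Runs.bind (fft_runs hX q tw b' ζ _ τ₁ e A hζn hrt htwA' hτ₁0 hτ₁1 he0 hbA (hf0 h hh)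
      (hsize1.trans hA38)) fun fb hfb => ?_
    rw [← hQ] at hfa hfb
    have hFn : ∀ g : ℕ → ℂ, (∀ j < p, ‖g j‖ ≤ A) → ∀ k,
        ‖∑ j ∈ Finset.range Q, ζ ^ (j * k) * (if j < p then g j else 0)‖ ≤ A ^ 2 := by
      intro g hg k
      refine (norm_dft_le hζn (hf0 g hg) k).trans ?_
      calc ((2 ^ q : ℕ) : ℝ) * A ≤ A * A := by gcongr
        _ = A ^ 2 := by ring
    have hsum1 : A ^ 2 + 4 ^ q * (e + τ₁ * A + 2 / X.S) ≤ A ^ 3 := by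
      have h3 : (2 : ℝ) * A ^ 2 ≤ A ^ 3 := hX.mul_pow_le (by norm_num) 2
      have h4 : 1 ≤ A ^ 2 := one_le_pow₀ hA1
      linarith
    have hsfa : ∀ t ∈ fa, SmallC D X.W t := fun t ht =>
      hX.smallC_of_approx hfa (fun i _ => hFn f hf i) (by norm_num) hsum1 ht
    have hsfb : ∀ t ∈ fb, SmallC D X.W t := fun t ht =>
      hX.smallC_of_approx hfb (fun i _ => hFn h hh i) (by norm_num) hsum1 ht
    refine Runs.bind (P := fun l => l = (zipT (cmulT X.W X.S) fa fb).val) ⟨rfl, ?_⟩ fun fc hfc => ?_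
    · have := zipT_time (cmulT X.W X.S) fa fb (2 * unitCost D) fun t ht t' ht' =>
        cmulT_time hM (hsfa t ht) (hsfb t' ht') hX.small_S
      rwa [hfa.1] at this
    have hfcA : Approx X.S fc Q (fun k =>
        (∑ j ∈ Finset.range Q, ζ ^ (j * k) * (if j < p then f j else 0)) *
        (∑ j ∈ Finset.range Q, ζ ^ (j * k) * (if j < p then h j else 0))) E2 := by
      rw [hfc, zipT_val]
      refine ⟨by simp [hfa.1, hfb.1], fun i hi => ?_⟩
      rw [getD_zipWith (by rw [hfa.1]; exact hi) (by rw [hfb.1]; exact hi)]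
      have h1 := norm_cv_cmulT_sub_le X.W hX.S_pos (fa.getD i (0, 0)) (fb.getD i (0, 0))
      have h2 := norm_mul_sub_mul_le (hFn f hf i) (hFn h hh i)
        ((hfa.2 i hi).trans hE1) ((hfb.2 i hi).trans hE1)
      have h3 := norm_add_le _ _ |>.trans (add_le_add h1 h2)
      rw [sub_add_sub_cancel] at h3
      refine h3.trans ?_
      have h4 : 4 * A ^ 4 * X.tau * (2 * A ^ 2 + 4 * A ^ 4 * X.tau) ≤
          4 * A ^ 4 * X.tau * (2 * A ^ 2 + 1) := by gcongr
      have h7 : (3 : ℝ) * A ^ 1 ≤ A ^ 2 := hX.mul_pow_le (by norm_num) 1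
      have h5 : 0 ≤ (A ^ 2 - 3) * (A ^ 4 * X.tau) := mul_nonneg (by linarith) (by positivity)
      have h6 : X.tau ≤ A ^ 4 * X.tau := le_mul_of_one_le_left hτ0.le (one_le_pow₀ hA1)
      rw [hE2]
      linarith
    refine Runs.bind (fft_runs hX q twc fc ζ⁻¹ _ τ₁ E2 (A ^ 4) (by rw [norm_inv, hζn, inv_one]) hrtc
      htwcA' hτ₁0 hτ₁1 hE20 hfcA (fun j _ => by
        rw [norm_mul]
        calc _ ≤ A ^ 2 * A ^ 2 := by
              gcongr
              · exact hFn f hf j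
              · exact hFn h hh j
          _ = A ^ 4 := by ring)
      (hsize3.trans hA68)) fun c hc => ?_
    rw [← hQ] at hc
    set lin : ℕ → ℂ := fun i => ∑ j ∈ Finset.range p, ∑ j' ∈ Finset.range p,
      if j + j' = i then f j * h j' else 0 with hlin
    -- The backward transform is not normalised, hence the factor Q, removed by the division that
    -- follows.
    have hcA : Approx X.S c Q (fun i => Q * lin i) (7 * A ^ 9 * X.tau) := by
      refine ⟨hc.1, fun i hi => ?_⟩
      have h1 := hc.2 i hi
      dsimp only at h1
      rw [inverse_dft_mul hQpos hpQ hprim f h hi] at h1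
      exact h1.trans hE3
    have hlinn : ∀ i < Q, ‖(Q : ℂ) * lin i‖ ≤ A ^ 5 := by
      intro i hi
      rw [hlin]
      dsimp only
      rw [← inverse_dft_mul hQpos hpQ hprim f h hi]
      refine (norm_dft_le (by rw [norm_inv, hζn, inv_one]) (F := A ^ 4) (fun j _ => ?_) i).trans ?_
      · rw [norm_mul]
        calc _ ≤ A ^ 2 * A ^ 2 := by
              gcongr
              · exact hFn f hf j
              · exact hFn h hh j
          _ = A ^ 4 := by ring
      · calc (Q : ℝ) * A ^ 4 ≤ A * A ^ 4 := by gcongr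
          _ = A ^ 5 := by ring
    have h79 : 7 * A ^ 9 * X.tau ≤ 1 := hX.pow_mul_tau_le_one (k := 10) (by norm_num)
      (hX.mul_pow_le (by norm_num) 9)
    have h15 : 1 ≤ A ^ 5 := one_le_pow₀ hA1
    have h56 : (2 : ℝ) * A ^ 5 ≤ A ^ 6 := hX.mul_pow_le (by norm_num) 5
    have hsc : ∀ t ∈ c, SmallC D X.W t := fun t ht =>
      hX.smallC_of_approx hcA hlinn (j := 6) (by norm_num) (by linarith) ht
    refine Runs.bind (P := fun l => l = c.map fun t : ℤ × ℤ => (t.1 / 2 ^ q, t.2 / 2 ^ q)) ⟨?_, ?_⟩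
      fun c' hc' => ?_
    · rw [mapT_val]
      rfl
    · have := mapT_time (fun t : ℤ × ℤ => do
          let re ← ev X.W ((t.1 : Exp) / ((2 ^ q : ℤ) : Exp))
          let im ← ev X.W ((t.2 : Exp) / ((2 ^ q : ℤ) : Exp))
          pure (re, im)) c (2 * unitCost D) fun t ht => by
        have h1 := (ev_runs hM ((t.1 : Exp) / ((2 ^ q : ℤ) : Exp)) ⟨(hsc t ht).1, hsQ⟩).2
        have h2 := (ev_runs hM ((t.2 : Exp) / ((2 ^ q : ℤ) : Exp)) ⟨(hsc t ht).2, hsQ⟩).2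
        simp only [bind_time, pure_time]
        omega
      rw [hc.1] at this
      exact this
    have hc'A : Approx X.S c' Q lin (8 * A ^ 9 * X.tau) := by
      rw [hc']
      refine ⟨by rw [List.length_map]; exact hc.1, fun i hi => ?_⟩
      rw [getD_map (by rw [hc.1]; exact hi)]
      set t := c.getD i (0, 0) with ht
      have hQz : (0 : ℤ) < 2 ^ q := by positivity
      have hQc : (Q : ℂ) ≠ 0 := by exact_mod_cast hQpos.ne'
      have hQcast : ((2 ^ q : ℤ) : ℝ) = Q := by push_cast; exact hQpow
      have h1 : ‖cv X.S (t.1 / 2 ^ q, t.2 / 2 ^ q) - cv X.S t / Q‖ ≤ 2 / X.S := by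
        apply norm_cv_sub_le hX.S_pos
        · have := abs_ediv_sub_le t.1 hQz
          rw [hQcast] at this
          rw [← Complex.ofReal_natCast, Complex.div_ofReal_re, cv_re]
          convert this using 3
          field_simp
        · have := abs_ediv_sub_le t.2 hQz
          rw [hQcast] at this
          rw [← Complex.ofReal_natCast, Complex.div_ofReal_im, cv_im]
          convert this using 3
          field_simp
      have h2 : ‖cv X.S t / Q - lin i‖ ≤ 7 * A ^ 9 * X.tau := by
        have h3 : cv X.S t / Q - lin i = (cv X.S t - Q * lin i) / Q := by field_simp
        rw [h3, norm_div, Complex.norm_natCast]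
        exact (div_le_self (norm_nonneg _) hQ1).trans (hcA.2 i hi)
      have h3 := norm_add_le _ _ |>.trans (add_le_add h1 h2)
      rw [sub_add_sub_cancel] at h3
      have h6 : X.tau ≤ A ^ 9 * X.tau := le_mul_of_one_le_left hτ0.le (one_le_pow₀ hA1)
      linarith
    have hlinn' : ∀ i < Q, ‖lin i‖ ≤ A ^ 5 := by
      intro i hi
      have h1 := hlinn i hi
      rw [norm_mul, Complex.norm_natCast] at h1
      exact (le_mul_of_one_le_left (norm_nonneg _) hQ1).trans h1
    have h89 : 8 * A ^ 9 * X.tau ≤ 1 := hX.pow_mul_tau_le_one (k := 10) (by norm_num)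
      (hX.mul_pow_le (by norm_num) 9)
    have hsc' : ∀ t ∈ c', SmallC D X.W t := fun t ht =>
      hX.smallC_of_approx hc'A hlinn' (j := 6) (by norm_num) (by linarith) ht
    refine Runs.bind (P := fun s => s = (c'.take p, c'.drop p)) ⟨?_, ?_⟩ fun s hs => ?_
    · rw [cutT_val]
      simp
    · have := cutT_time (p : ℤ).toNat c'
      rwa [hc'A.1] at this
    subst hs
    have hl1 : (c'.take p).length = p := by rw [List.length_take, hc'A.1]; omega
    have hl2 : (c'.drop p).length = Q - p := by rw [List.length_drop, hc'A.1]
    refine ⟨?_, ?_⟩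
    · rw [zipT_val]
      refine ⟨by rw [List.length_zipWith, hl1, hl2]; omega, fun i hi => ?_⟩
      rw [getD_zipWith (by rw [hl1]; exact hi) (by rw [hl2]; omega), caddT_val, cv_add,
        cconv_eq f h hi]
      have e1 : (c'.take p).getD i (0, 0) = c'.getD i (0, 0) := by
        simp [List.getD_eq_getElem?_getD, hi]
      have e2 : (c'.drop p).getD i (0, 0) = c'.getD (p + i) (0, 0) := by
        simp [List.getD_eq_getElem?_getD]
      rw [e1, e2, add_sub_add_comm]
      refine (norm_add_le _ _).trans ?_
      have h1 := hc'A.2 i (by omega)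
      have h2 := hc'A.2 (p + i) (by omega)
      rw [hlin] at h1 h2
      dsimp only at h1 h2
      linarith
    · have := zipT_time (caddT X.W) (c'.take p) (c'.drop p) (2 * unitCost D) fun t ht t' ht' =>
        caddT_time hM (hsc' t (List.mem_of_mem_take ht)) (hsc' t' (List.mem_of_mem_drop ht'))
      rwa [hl1] at this
  · have hU := one_le_unitCost D
    have hUU : unitCost D ≤ unitCost (D + 1) := unitCost_mono (by omega)
    exact convT_time_bound (by omega) hQr Nat.one_le_two_pow hpQ hU hUU

end

/-! ### Hashing -/

/-- The power `ω ^ j` of `ω = exp (i π / N)`. -/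
noncomputable def rootPow (N j : ℤ) : ℂ := Complex.exp (Real.pi * (j / N : ℝ) * Complex.I)

theorem norm_rootPow (N j : ℤ) : ‖rootPow N j‖ = 1 := by
  unfold rootPow
  rw [← Complex.ofReal_mul]
  exact Complex.norm_exp_ofReal_mul_I _

theorem rootPow_add (N j k : ℤ) : rootPow N (j + k) = rootPow N j * rootPow N k := by
  unfold rootPow
  rw [← Complex.exp_add]
  congr 1
  push_cast
  ring

/-- The entry `i` of the hashed vector, `∑_{j mod p = i} v_j ω ^ j`. -/
noncomputable def hashHom (N p i : ℤ) : (ℤ →₀ ℤ) →+ ℂ :=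
  Finsupp.liftAddHom fun j =>
    (AddMonoidHom.mulLeft (if j % p = i then rootPow N j else 0)).comp (Int.castAddHom ℂ)

theorem hashHom_single (N p i j c : ℤ) :
    hashHom N p i (Finsupp.single j c) = (if j % p = i then rootPow N j else 0) * c := by
  simp [hashHom]

theorem hashHom_apply (N p i : ℤ) (v : ℤ →₀ ℤ) :
    hashHom N p i v = ∑ j ∈ v.support, (if j % p = i then rootPow N j else 0) * (v j : ℂ) := rfl

/-- The vector given by a list of pairs (index, value). -/
noncomputable def listVec (L : List (ℤ × ℤ)) : ℤ →₀ ℤ :=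
  (L.map fun a => Finsupp.single a.1 a.2).sum

@[simp] theorem listVec_nil : listVec [] = 0 := rfl

@[simp] theorem listVec_cons (a : ℤ × ℤ) (L : List (ℤ × ℤ)) :
    listVec (a :: L) = Finsupp.single a.1 a.2 + listVec L := by simp [listVec]

/-- The sum of the absolute values in a list of pairs. -/
def listNorm (L : List (ℤ × ℤ)) : ℤ := (L.map fun a => |a.2|).sum

@[simp] theorem listNorm_nil : listNorm [] = 0 := rfl

@[simp] theorem listNorm_cons (a : ℤ × ℤ) (L : List (ℤ × ℤ)) :
    listNorm (a :: L) = |a.2| + listNorm L := by simp [listNorm]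

theorem listNorm_nonneg (L : List (ℤ × ℤ)) : 0 ≤ listNorm L := by
  induction L with
  | nil => simp
  | cons a L ih => rw [listNorm_cons]; positivity

/-- All indices of a list of pairs lie in `[0, N)`. -/
def InRange (N : ℤ) (L : List (ℤ × ℤ)) : Prop := ∀ a ∈ L, 0 ≤ a.1 ∧ a.1 < N

theorem norm_hashHom_single_le (N p i j c : ℤ) : ‖hashHom N p i (Finsupp.single j c)‖ ≤ |(c : ℝ)| := by
  rw [hashHom_single, norm_mul, Complex.norm_intCast]
  split_ifs
  · rw [norm_rootPow, one_mul]
  · rw [norm_zero, zero_mul]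
    positivity

theorem norm_hashHom_listVec_le (N p i : ℤ) (L : List (ℤ × ℤ)) :
    ‖hashHom N p i (listVec L)‖ ≤ listNorm L := by
  induction L with
  | nil => simp
  | cons a L ih =>
    rw [listVec_cons, map_add, listNorm_cons]
    push_cast
    exact (norm_add_le _ _).trans (add_le_add (norm_hashHom_single_le _ _ _ _ _) ih)

theorem getD_setIfInBounds (A : Array ℤ) (i j : ℕ) (a : ℤ) :
    (A.setIfInBounds i a).getD j 0 = if i = j ∧ j < A.size then a else A.getD j 0 := by
  rw [Array.getD_eq_getD_getElem?, Array.getD_eq_getD_getElem?, Array.getElem?_setIfInBounds]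
  split_ifs <;> simp_all

section
variable {X : Ctx} {A : ℝ} {D : ℕ} (hX : GoodCtx X A D)
include hX

theorem GoodCtx.N_pos : 0 < X.N := by
  have := hX.n_pos
  have := hX.N_eq
  omega

/-- For the induction the arrays may start as approximations to any g with error e. The bound on ‖g
i‖ + listNorm L is preserved when an entry v moves from the list into g, and so is the one on the
error, since the entry adds at most |v| τ. -/
theorem foldLoop_runs {p : ℕ} (hp : 1 ≤ p) (hpA : (p : ℝ) ≤ A) (L : List (ℤ × ℤ))
    (hL : InRange X.N L) (st : Array ℤ × Array ℤ) (h1 : st.1.size = p) (h2 : st.2.size = p)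
    (g : ℕ → ℂ) (e : ℝ) (hst : ∀ i < p, ‖cv X.S (st.1.getD i 0, st.2.getD i 0) - g i‖ ≤ e)
    (hg : ∀ i < p, ‖g i‖ + listNorm L ≤ A) (he : e + listNorm L * X.tau ≤ 1) :
    Runs (foldLoop X p L st) ((L.length + 1) * ((X.terms + 1) * (13 * unitCost D))) (fun st' =>
      st'.1.size = p ∧ st'.2.size = p ∧ ∀ i < p,
        ‖cv X.S (st'.1.getD i 0, st'.2.getD i 0) - (g i + hashHom X.N p i (listVec L))‖ ≤
          e + listNorm L * X.tau) := by
  have hU := one_le_unitCost D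
  have hM := hX.machine
  have hA := hX.A_ge
  have hτ := hX.tau_pos
  have hN := hX.N_pos
  induction L generalizing st g e with
  | nil =>
    refine ⟨⟨h1, h2, fun i hi => by simpa [foldLoop] using hst i hi⟩, ?_⟩
    simp only [foldLoop, bind_time, tick_time, pure_time, List.length_nil]
    nlinarith
  | cons a L ih =>
    obtain ⟨j, v⟩ := a
    have hj := hL (j, v) (by simp)
    have hLn : (0 : ℝ) ≤ listNorm L := by exact_mod_cast listNorm_nonneg L
    rw [listNorm_cons] at hg he ⊢
    push_cast at hg he ⊢
    simp only at hj hg he ⊢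
    have he1 : e ≤ 1 := by
      have : 0 ≤ (|(v : ℝ)| + listNorm L) * X.tau := by positivity
      linarith
    have hpz : (0 : ℤ) < p := by exact_mod_cast hp
    set k := (j % (p : ℤ)).toNat with hk
    have hj0 := Int.emod_nonneg j hpz.ne'
    have hjp := Int.emod_lt_of_pos j hpz
    have hkj : (k : ℤ) = j % p := by omega
    have hkp : k < p := by omega
    have hvA : |(v : ℝ)| ≤ A := by
      have := hg 0 hp
      have := norm_nonneg (g 0)
      linarith
    have hsp : Small D X.W (p : ℤ) := hX.small_of_le_A (by
      rw [Int.cast_natCast, abs_of_nonneg (by positivity)]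
      exact hpA)
    have hsj : Small D X.W j := hX.small_N.of_nonneg_le hj.1 hj.2.le
    have hsv : Small D X.W v := hX.small_of_le_A hvA
    have hsi : Small D X.W (j % p) := hsp.of_nonneg_le hj0 hjp.le
    have hsab : SmallC D X.W (st.1.getD k 0, st.2.getD k 0) := by
      refine hX.smallC_of_norm_le (k := 2) (by norm_num) ?_
      have h3 := norm_le_norm_add_norm_sub' (cv X.S (st.1.getD k 0, st.2.getD k 0)) (g k)
      have h4 := hst k hkp
      have h5 := hg k hkp
      have h6 := abs_nonneg (v : ℝ)
      nlinarith
    refine Runs.mono (t := 1 + ((X.terms + 1) * (5 * unitCost D) + (unitCost D + (unitCost D +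
      (unitCost D + (unitCost D + (unitCost D + (unitCost D + (unitCost D +
      (L.length + 1) * ((X.terms + 1) * (13 * unitCost D)))))))))) ) ?_ ?_
    · refine Runs.tick_bind ?_
      refine Runs.bind (cisT_runs hX hj.1 hj.2.le hN hX.N_le) fun z hz => ?_
      change ‖cv X.S z - rootPow X.N j‖ ≤ _ at hz
      have hzn : ‖cv X.S z‖ ≤ 2 := by
        have h3 := norm_le_norm_add_norm_sub' (cv X.S z) (rootPow X.N j)
        rw [norm_rootPow] at h3
        have := hX.tau_le
        linarith
      have hsz := hX.smallC_of_norm_le (k := 1) (by norm_num) (hzn.trans (by linarith))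
      refine Runs.bind (ev_runs hM _ ⟨hsj, hsp⟩) fun i hi => ?_
      simp only [Exp.eval_mod, Exp.eval_lit] at hi
      subst hi
      refine Runs.bind (readA_runs hM _ _ hsi hsab.1) fun x hx => ?_
      refine Runs.bind (readA_runs hM _ _ hsi hsab.2) fun y hy => ?_
      rw [← hk] at hx hy
      subst hx hy
      refine Runs.bind (ev_runs hM _ ⟨hsab.1, hsv, hsz.1⟩) fun x' hx' => ?_
      refine Runs.bind (ev_runs hM _ ⟨hsab.2, hsv, hsz.2⟩) fun y' hy' => ?_
      simp only [Exp.eval_add, Exp.eval_mul, Exp.eval_lit] at hx' hy'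
      have hnew : cv X.S (x', y') = cv X.S (st.1.getD k 0, st.2.getD k 0) + v * cv X.S z := by
        rw [hx', hy']
        unfold cv
        push_cast
        ring
      have hgk := hg k hkp
      have hstk := hst k hkp
      have hbound : ‖cv X.S (x', y') - (g k + rootPow X.N j * v)‖ ≤ e + |(v : ℝ)| * X.tau := by
        rw [hnew]
        have h3 : cv X.S (st.1.getD k 0, st.2.getD k 0) + v * cv X.S z - (g k + rootPow X.N j * v) =
          (cv X.S (st.1.getD k 0, st.2.getD k 0) - g k) + v * (cv X.S z - rootPow X.N j) := by ring
        rw [h3]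
        refine (norm_add_le _ _).trans (add_le_add hstk ?_)
        rw [norm_mul, Complex.norm_intCast]
        gcongr
      have hsn : SmallC D X.W (x', y') := by
        refine hX.smallC_of_norm_le (k := 2) (by norm_num) ?_
        have h3 := norm_le_norm_add_norm_sub' (cv X.S (x', y')) (g k + rootPow X.N j * v)
        have h4 := norm_add_le (g k) (rootPow X.N j * v)
        rw [norm_mul, norm_rootPow, one_mul, Complex.norm_intCast] at h4
        have h5 : 0 ≤ listNorm L * X.tau := by positivity
        nlinarith
      refine Runs.bind (writeA_runs hM _ _ _ hsi hsn.1) fun A' hA' => ?_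
      refine Runs.bind (writeA_runs hM _ _ _ hsi hsn.2) fun B' hB' => ?_
      rw [← hk] at hA' hB'
      have hih := ih (fun a ha => hL a (by simp [ha])) (A', B') (by simp [hA', h1])
        (by simp [hB', h2]) (fun i => g i + hashHom X.N p i (Finsupp.single j v))
        (e + |(v : ℝ)| * X.tau) (fun i hi => ?_) (fun i hi => ?_) (by
          rw [add_mul] at he
          linarith)
      · refine Runs.imp hih fun st' h3 => ⟨h3.1, h3.2.1, fun i hi => ?_⟩
        have := h3.2.2 i hi
        rw [listVec_cons, map_add, ← add_assoc, add_mul, ← add_assoc]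
        exact this
      · rw [hA', hB', getD_setIfInBounds, getD_setIfInBounds, h1, h2, hashHom_single]
        by_cases hki : k = i
        · subst hki
          rw [if_pos ⟨rfl, hi⟩, if_pos ⟨rfl, hi⟩, if_pos hkj.symm]
          exact hbound
        · rw [if_neg (fun h => hki h.1), if_neg (fun h => hki h.1), if_neg (by omega), zero_mul,
            add_zero]
          have : 0 ≤ |(v : ℝ)| * X.tau := by positivity
          linarith [hst i hi]
      · have h3 := norm_add_le (g i) (hashHom X.N p i (Finsupp.single j v))
        have h4 := norm_hashHom_single_le X.N p i j v
        have h5 := hg i hi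
        linarith
    · simp only [List.length_cons]
      generalize unitCost D = U at *
      have : U ≤ (X.terms + 1) * U := Nat.le_mul_of_pos_left _ (by omega)
      have e1 : (L.length + 1 + 1) * ((X.terms + 1) * (13 * U)) =
        (L.length + 1) * ((X.terms + 1) * (13 * U)) + 13 * ((X.terms + 1) * U) := by ring
      have e2 : (X.terms + 1) * (5 * U) = 5 * ((X.terms + 1) * U) := by ring
      rw [e1, e2]
      linarith

theorem foldT_runs {p : ℕ} (hp : 1 ≤ p) (hpA : (p : ℝ) ≤ A) (L : List (ℤ × ℤ))
    (hL : InRange X.N L) (hLA : (listNorm L : ℝ) ≤ A) :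
    Runs (foldT X p L) ((L.length + 1) * ((X.terms + 1) * (13 * unitCost D)) + 6 * p) (fun l =>
      Approx X.S l p (fun i => hashHom X.N p i (listVec L)) (A * X.tau)) := by
  refine Runs.mono (t := (p + 1) + ((p + 1) +
    ((L.length + 1) * ((X.terms + 1) * (13 * unitCost D)) + (p + 1)))) ?_ (by omega)
  have hτ := hX.tau_pos
  have hAτ : A * X.tau ≤ 1 := by simpa using hX.mul_tau_le (k := 1) (by norm_num)
  have hLτ : listNorm L * X.tau ≤ A * X.tau := by gcongr
  refine Runs.bind (P := fun B => B = Array.replicate p 0) ⟨by simp [newArray], by simp [newArray]⟩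
    fun B1 hB1 => ?_
  refine Runs.bind (P := fun B => B = Array.replicate p 0) ⟨by simp [newArray], by simp [newArray]⟩
    fun B2 hB2 => ?_
  refine Runs.bind (foldLoop_runs hX hp hpA L hL (B1, B2) (by simp [hB1]) (by simp [hB2])
    (fun _ => 0) 0 (fun i hi => ?_) (fun i hi => by simpa using hLA) (by linarith))
    fun st hst => ⟨?_, ?_⟩
  · simp [hB1, hB2, Array.getD_eq_getD_getElem?, hi, cv]
  · rw [zipT_val]
    refine ⟨by simp [hst.1, hst.2.1], fun i hi => ?_⟩
    have h1 : (List.zipWith (fun a b : ℤ => (pure (a, b) : Timed (ℤ × ℤ)).val) st.1.toList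
        st.2.toList).getD i (0, 0) = (st.1.getD i 0, st.2.getD i 0) := by
      simp [List.getD_eq_getElem?_getD, Array.getD_eq_getD_getElem?, hst.1, hst.2.1, hi]
    rw [h1]
    have := hst.2.2 i hi
    rw [zero_add, zero_add] at this
    exact this.trans hLτ
  · have := zipT_time (fun a b : ℤ => (pure (a, b) : Timed (ℤ × ℤ))) st.1.toList st.2.toList 0
      fun _ _ _ _ => le_rfl
    simpa [hst.1] using this

end

/-- The (non-cyclic) convolution of two vectors given by lists. -/
noncomputable def prodVec (xs ys : List (ℤ × ℤ)) : ℤ →₀ ℤ :=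
  (xs.map fun a => (ys.map fun b => Finsupp.single (a.1 + b.1) (a.2 * b.2)).sum).sum

theorem cconv_zero_left (p : ℕ) (h : ℕ → ℂ) (i : ℕ) : cconv p (fun _ => 0) h i = 0 := by
  simp [cconv]

theorem cconv_zero_right (p : ℕ) (f : ℕ → ℂ) (i : ℕ) : cconv p f (fun _ => 0) i = 0 := by
  simp [cconv]

theorem cconv_add_left (p : ℕ) (f g h : ℕ → ℂ) (i : ℕ) :
    cconv p (fun j => f j + g j) h i = cconv p f h i + cconv p g h i := by
  simp only [cconv, ← Finset.sum_add_distrib]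
  refine Finset.sum_congr rfl fun j _ => Finset.sum_congr rfl fun j' _ => ?_
  split_ifs <;> ring

theorem cconv_add_right (p : ℕ) (f g h : ℕ → ℂ) (i : ℕ) :
    cconv p h (fun j => f j + g j) i = cconv p h f i + cconv p h g i := by
  simp only [cconv, ← Finset.sum_add_distrib]
  refine Finset.sum_congr rfl fun j _ => Finset.sum_congr rfl fun j' _ => ?_
  split_ifs <;> ring

/-- This is the reason for the twist by powers of ω: residues add modulo p and ω^(i+j) = ω^i ω^j.
The index `a.1 + b.1` is not reduced modulo N; a reduction would cost a sign, as ω^N = -1. -/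
theorem cconv_hashHom_single (N : ℤ) {p : ℕ} (hp : 1 ≤ p) (a b : ℤ × ℤ) {i : ℕ} :
    cconv p (fun j => hashHom N p j (Finsupp.single a.1 a.2))
      (fun j => hashHom N p j (Finsupp.single b.1 b.2)) i =
      hashHom N p i (Finsupp.single (a.1 + b.1) (a.2 * b.2)) := by
  have hpz : (0 : ℤ) < p := by exact_mod_cast hp
  have ha0 := Int.emod_nonneg a.1 hpz.ne'
  have hap := Int.emod_lt_of_pos a.1 hpz
  have hb0 := Int.emod_nonneg b.1 hpz.ne'
  have hbp := Int.emod_lt_of_pos b.1 hpz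
  set k := (a.1 % (p : ℤ)).toNat with hk
  set l := (b.1 % (p : ℤ)).toNat with hl
  have hk' : (k : ℤ) = a.1 % p := by omega
  have hl' : (l : ℤ) = b.1 % p := by omega
  unfold cconv
  rw [Finset.sum_eq_single k, Finset.sum_eq_single l]
  · simp only [hashHom_single, hk', hl', if_true]
    have hiff : (k + l) % p = i ↔ (a.1 + b.1) % (p : ℤ) = i := by
      rw [Int.add_emod, ← hk', ← hl']
      norm_cast
    simp only [hiff]
    split_ifs
    · rw [rootPow_add]
      push_cast
      ring
    · simp
  · intro j _ hj
    have : ¬ b.1 % (p : ℤ) = j := by omega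
    simp [hashHom_single, this]
  · intro h
    exact absurd (Finset.mem_range.2 (by omega)) h
  · intro j _ hj
    have : ¬ a.1 % (p : ℤ) = j := by omega
    simp [hashHom_single, this]
  · intro h
    exact absurd (Finset.mem_range.2 (by omega)) h

/-- Both sides are additive in each argument, which leaves the case of single entries. -/
theorem cconv_hashHom (N : ℤ) {p : ℕ} (hp : 1 ≤ p) (xs ys : List (ℤ × ℤ)) {i : ℕ} :
    cconv p (fun j => hashHom N p j (listVec xs)) (fun j => hashHom N p j (listVec ys)) i =
      hashHom N p i (prodVec xs ys) := by
  induction xs with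
  | nil => simp [prodVec, cconv_zero_left]
  | cons a xs ih =>
    simp only [listVec_cons, map_add]
    rw [cconv_add_left, ih]
    have : prodVec (a :: xs) ys = (ys.map fun b => Finsupp.single (a.1 + b.1) (a.2 * b.2)).sum +
      prodVec xs ys := by simp [prodVec]
    rw [this, map_add]
    congr 1
    clear this ih
    induction ys with
    | nil => simp [cconv_zero_right]
    | cons b ys ih =>
      simp only [listVec_cons, map_add, List.map_cons, List.sum_cons]
      rw [cconv_add_right, ih, cconv_hashHom_single N hp]

/-- The convolution has error 16 A^9 τ, and the hash that is subtracted adds at most A τ. -/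
theorem hashT_runs {X : Ctx} {A : ℝ} {D : ℕ} (hX : GoodCtx X A D) {p : ℕ} (hp : 1 ≤ p)
    (hpA : 4 * (p : ℝ) ≤ A) (xs ys ws : List (ℤ × ℤ)) (hx : InRange X.N xs) (hy : InRange X.N ys)
    (hw : InRange X.N ws) (hxA : (listNorm xs : ℝ) ≤ A) (hyA : (listNorm ys : ℝ) ≤ A)
    (hwA : (listNorm ws : ℝ) ≤ A) :
    Runs (hashT X p xs ys ws)
      ((xs.length + ys.length + ws.length + 4) * ((X.terms + 1) * (13 * unitCost D)) +
        (Nat.clog 2 (2 * p) + 1) * 2 ^ Nat.clog 2 (2 * p) * (90 * unitCost (D + 1)))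
      (fun l => Approx X.S l p (fun i => hashHom X.N p i (prodVec xs ys - listVec ws))
        (17 * A ^ 9 * X.tau)) := by
  have hτ := hX.tau_pos
  have hA0 := hX.A_pos
  have hA1 := hX.one_le_A
  have hp0 : (0 : ℝ) ≤ p := by positivity
  have hpA' : (p : ℝ) ≤ A := by linarith
  have hAτ : A * X.tau ≤ 1 := by simpa using hX.mul_tau_le (k := 1) (by norm_num)
  refine Runs.mono (t := ((xs.length + 1) * ((X.terms + 1) * (13 * unitCost D)) + 6 * p) +
    (((ys.length + 1) * ((X.terms + 1) * (13 * unitCost D)) + 6 * p) +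
    (((ws.length + 1) * ((X.terms + 1) * (13 * unitCost D)) + 6 * p) +
    (((X.terms + 1) * (5 * unitCost D) +
        (Nat.clog 2 (2 * p) + 1) * 2 ^ Nat.clog 2 (2 * p) * (60 * unitCost (D + 1))) +
    (p * (2 * unitCost D + 1) + 1))))) ?_ ?_
  · refine Runs.bind (foldT_runs hX hp hpA' xs hx hxA) fun a ha => ?_
    refine Runs.bind (foldT_runs hX hp hpA' ys hy hyA) fun b hb => ?_
    refine Runs.bind (foldT_runs hX hp hpA' ws hw hwA) fun w hw' => ?_
    have hfx : ∀ j < p, ‖hashHom X.N p j (listVec xs)‖ ≤ A := fun j _ =>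
      (norm_hashHom_listVec_le _ _ _ _).trans hxA
    have hfy : ∀ j < p, ‖hashHom X.N p j (listVec ys)‖ ≤ A := fun j _ =>
      (norm_hashHom_listVec_le _ _ _ _).trans hyA
    refine Runs.bind (convT_runs hX hp hpA (by positivity) le_rfl ha hb hfx hfy) fun c hc => ?_
    have h16 : 16 * A ^ 9 * X.tau ≤ 1 := hX.pow_mul_tau_le_one (k := 10) (by norm_num)
      (hX.mul_pow_le (by norm_num) 9)
    have hcn : ∀ i < p, ‖cconv p (fun i => hashHom X.N p i (listVec xs))
        (fun i => hashHom X.N p i (listVec ys)) i‖ ≤ A ^ 4 := by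
      intro i _
      refine (norm_sum_le _ _).trans ?_
      calc _ ≤ ∑ j ∈ Finset.range p, ∑ j' ∈ Finset.range p, A * A := by
            refine Finset.sum_le_sum fun j hj => (norm_sum_le _ _).trans
              (Finset.sum_le_sum fun j' hj' => ?_)
            rw [Finset.mem_range] at hj hj'
            split_ifs
            · rw [norm_mul]
              gcongr
              · exact hfx j hj
              · exact hfy j' hj'
            · rw [norm_zero]
              positivity
        _ = p * (p * (A * A)) := by simp
        _ ≤ A * (A * (A * A)) := by gcongr
        _ = A ^ 4 := by ring
    have h45 : (2 : ℝ) * A ^ 4 ≤ A ^ 5 := hX.mul_pow_le (by norm_num) 4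
    have h14 : 1 ≤ A ^ 4 := one_le_pow₀ hA1
    have hsc : ∀ t ∈ c, SmallC D X.W t := fun t ht =>
      hX.smallC_of_approx hc hcn (j := 5) (by norm_num) (by linarith) ht
    have h12 : (2 : ℝ) * A ^ 1 ≤ A ^ 2 := hX.mul_pow_le (by norm_num) 1
    have hsw : ∀ t ∈ w, SmallC D X.W t := fun t ht =>
      hX.smallC_of_approx hw' (F := A) (fun i _ => (norm_hashHom_listVec_le _ _ _ _).trans hwA)
        (j := 2) (by norm_num) (by linarith) ht
    refine ⟨?_, ?_⟩
    · rw [zipT_val]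
      refine ⟨by simp [hc.1, hw'.1], fun i hi => ?_⟩
      rw [getD_zipWith (by rw [hc.1]; exact hi) (by rw [hw'.1]; exact hi), csubT_val, cv_sub]
      dsimp only
      rw [map_sub, ← cconv_hashHom X.N hp, sub_sub_sub_comm]
      refine (norm_sub_le _ _).trans ?_
      have h3 := hc.2 i hi
      have h4 := hw'.2 i hi
      have h5 : A * X.tau ≤ A ^ 9 * X.tau := by
        gcongr
        simpa using pow_le_pow_right₀ hA1 (by norm_num : 1 ≤ 9)
      linarith
    · have := zipT_time (csubT X.W) c w (2 * unitCost D) fun t ht t' ht' =>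
        csubT_time hX.machine (hsc t ht) (hsw t' ht')
      rwa [hc.1] at this
  · have hU := one_le_unitCost D
    have hUU : unitCost D ≤ unitCost (D + 1) := unitCost_mono (by omega)
    have hpQ : 2 * p ≤ 2 ^ Nat.clog 2 (2 * p) := Nat.le_pow_clog (by norm_num) _
    generalize unitCost (D + 1) = V at *
    generalize unitCost D = U at *
    generalize 2 ^ Nat.clog 2 (2 * p) = Q at *
    generalize Nat.clog 2 (2 * p) = q at *
    have z1 : Q * V ≤ (q + 1) * Q * V := by
      calc Q * V = 1 * (Q * V) := by ring
        _ ≤ (q + 1) * (Q * V) := Nat.mul_le_mul_right _ (by omega)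
        _ = _ := by ring
    have z2 : p * (2 * U + 1) * 2 ≤ 3 * (Q * V) := by
      calc p * (2 * U + 1) * 2 = (2 * p) * (2 * U + 1) := by ring
        _ ≤ Q * (3 * V) := Nat.mul_le_mul hpQ (by omega)
        _ = _ := by ring
    have z3 : Q ≤ Q * V := Nat.le_mul_of_pos_right _ (by omega)
    have e1 : (xs.length + ys.length + ws.length + 4) * ((X.terms + 1) * (13 * U)) =
      (xs.length + 1) * ((X.terms + 1) * (13 * U)) + (ys.length + 1) * ((X.terms + 1) * (13 * U)) +
      (ws.length + 1) * ((X.terms + 1) * (13 * U)) + 13 * ((X.terms + 1) * U) := by ring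
    have e2 : (X.terms + 1) * (5 * U) = 5 * ((X.terms + 1) * U) := by ring
    have e3 : (q + 1) * Q * (60 * V) = 60 * ((q + 1) * Q * V) := by ring
    have e4 : (q + 1) * Q * (90 * V) = 90 * ((q + 1) * Q * V) := by ring
    rw [e1, e2, e3, e4]
    have z4 : 1 ≤ (X.terms + 1) * U := Nat.mul_pos (by omega) hU
    linarith

/-! ### Reading a bucket -/

theorem rootPow_re (N j : ℤ) : (rootPow N j).re = Real.cos (Real.pi * (j / N)) := by
  unfold rootPow
  rw [← Complex.ofReal_mul, Complex.exp_ofReal_mul_I_re]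

theorem rootPow_im (N j : ℤ) : (rootPow N j).im = Real.sin (Real.pi * (j / N)) := by
  unfold rootPow
  rw [← Complex.ofReal_mul, Complex.exp_ofReal_mul_I_im]

theorem rootPow_zero (N : ℤ) : rootPow N 0 = 1 := by simp [rootPow]

theorem rootPow_self {N : ℤ} (hN : 0 < N) : rootPow N N = -1 := by
  have : (N : ℝ) ≠ 0 := by exact_mod_cast hN.ne'
  unfold rootPow
  rw [div_self this, Complex.ofReal_one, mul_one, Complex.exp_pi_mul_I]

theorem rootPow_add_self {N : ℤ} (hN : 0 < N) (j : ℤ) : rootPow N (j + N) = -rootPow N j := by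
  rw [rootPow_add, rootPow_self hN, mul_neg_one]

theorem rootPow_half {N n : ℤ} (hn : 0 < n) (hN : N = 2 * n) : rootPow N n = Complex.I := by
  have : (n : ℝ) ≠ 0 := by exact_mod_cast hn.ne'
  have h : (n : ℝ) / N = 1 / 2 := by
    rw [hN]
    push_cast
    field_simp
  unfold rootPow
  rw [h]
  push_cast
  rw [mul_one_div, Complex.exp_pi_div_two_mul_I]

theorem rootPow_mul_two {N : ℤ} (hN : 0 < N) (k : ℤ) : rootPow N (2 * N * k) = 1 := by
  have : (N : ℝ) ≠ 0 := by exact_mod_cast hN.ne'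
  unfold rootPow
  have h : ((2 * N * k : ℤ) : ℝ) / N = 2 * k := by
    push_cast
    field_simp
  rw [h, Complex.exp_eq_one_iff]
  exact ⟨k, by push_cast; ring⟩

theorem rootPow_emod {N : ℤ} (hN : 0 < N) (j : ℤ) : rootPow N (j % (2 * N)) = rootPow N j := by
  conv_rhs => rw [← Int.emod_add_mul_ediv j (2 * N), rootPow_add, rootPow_mul_two hN, mul_one]

/-- Jordan's inequality sin x ≥ 2 x / π on [0, π/2], reflected for k beyond N / 2. It is the
quantitative separation of the powers of ω on which the orientation and quadrant tests rest. -/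
theorem le_sin_of_mem {N k : ℤ} (hN : 0 < N) (hk : 1 ≤ k) (hkN : k < N) :
    2 / (N : ℝ) ≤ Real.sin (Real.pi * (k / N)) := by
  have hN' : (0 : ℝ) < N := by exact_mod_cast hN
  have key : ∀ k : ℤ, 1 ≤ k → 2 * k ≤ N → 2 / (N : ℝ) ≤ Real.sin (Real.pi * (k / N)) := by
    intro k hk hkN
    have hk1 : (1 : ℝ) ≤ k := by exact_mod_cast hk
    have hk2 : 2 * (k : ℝ) ≤ N := by exact_mod_cast hkN
    have h1 : (k : ℝ) / N ≤ 1 / 2 := by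
      rw [div_le_div_iff₀ hN' (by norm_num)]
      linarith
    have h2 := Real.mul_le_sin (x := Real.pi * (k / N)) (by positivity)
      (by nlinarith [Real.pi_pos])
    refine le_trans ?_ h2
    have : 2 / Real.pi * (Real.pi * ((k : ℝ) / N)) = 2 * k / N := by
      field_simp
    rw [this]
    gcongr
    linarith
  rcases le_or_gt (2 * k) N with h | h
  · exact key k hk h
  · have h1 := key (N - k) (by omega) (by omega)
    rw [← Real.sin_pi_sub]
    convert h1 using 2
    push_cast
    field_simp

/-- Distinct powers of `ω` are apart. -/
theorem two_div_le_norm_rootPow_sub {N : ℤ} (hN : 0 < N) (j : ℤ) :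
    2 / (N : ℝ) ≤ ‖rootPow N (j + 1) - rootPow N j‖ := by
  have hN' : (0 : ℝ) < N := by exact_mod_cast hN
  have hN1 : (1 : ℝ) ≤ N := by exact_mod_cast hN
  rw [rootPow_add, ← mul_sub_one, norm_mul, norm_rootPow, one_mul]
  unfold rootPow
  rw [← Complex.ofReal_mul, mul_comm, Complex.norm_exp_I_mul_ofReal_sub_one]
  have h1 : (1 : ℝ) / N ≤ 1 := (div_le_one hN').2 hN1
  have h2 := Real.mul_le_sin (x := Real.pi * ((1 : ℤ) / N) / 2) (by positivity) (by
    push_cast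
    nlinarith [Real.pi_pos])
  have h3 : 2 / Real.pi * (Real.pi * (((1 : ℤ) : ℝ) / N) / 2) = 1 / N := by
    push_cast
    field_simp
  rw [h3] at h2
  refine le_trans ?_ (le_abs_self _)
  have : 2 / (N : ℝ) = 2 * (1 / N) := by ring
  rw [this]
  linarith

/-- A quarter turn backwards, unless the number lies in the first quadrant. -/
def rotStep (n : ℤ) (st : (ℤ × ℤ) × ℤ) : (ℤ × ℤ) × ℤ :=
  if 1 ≤ st.1.1 ∧ 0 ≤ st.1.2 then st else ((st.1.2, 0 - st.1.1), st.2 + n)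

/-- Each turn divides the point by i. The target is the quadrant without its imaginary axis; its
four rotated copies partition the nonzero points, so three turns are enough. -/
theorem rotStep_three (n : ℤ) (z : ℤ × ℤ) :
    ∃ r : ℕ, r ≤ 3 ∧ (rotStep n (rotStep n (rotStep n (z, 0)))).2 = r * n ∧
      (∀ S : ℤ, cv S z = Complex.I ^ r * cv S (rotStep n (rotStep n (rotStep n (z, 0)))).1) ∧
      (z ≠ 0 → 1 ≤ (rotStep n (rotStep n (rotStep n (z, 0)))).1.1 ∧
        0 ≤ (rotStep n (rotStep n (rotStep n (z, 0)))).1.2) := by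
  obtain ⟨a, b⟩ := z
  have hI : ∀ (S : ℤ) (a b : ℤ), cv S (a, b) = Complex.I * cv S (b, 0 - a) := by
    intro S a b
    unfold cv
    push_cast
    linear_combination ((a : ℂ) / S) * Complex.I_sq
  have hz : (a, b) ≠ (0 : ℤ × ℤ) ↔ a ≠ 0 ∨ b ≠ 0 := by
    rw [Ne, Prod.mk_eq_zero]
    tauto
  rw [hz]
  by_cases h0 : 1 ≤ a ∧ 0 ≤ b
  · refine ⟨0, by norm_num, ?_⟩
    simp [rotStep, h0]
  by_cases h1 : 1 ≤ b ∧ 0 ≤ 0 - a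
  · refine ⟨1, by norm_num, ?_⟩
    simp only [rotStep, h0, h1, if_true, if_false, and_self]
    exact ⟨by push_cast; ring, fun S => by rw [pow_one]; exact hI S a b, fun _ => trivial⟩
  by_cases h2 : 1 ≤ 0 - a ∧ 0 ≤ 0 - b
  · refine ⟨2, by norm_num, ?_⟩
    simp only [rotStep, h0, h1, h2, if_true, if_false, and_self]
    exact ⟨by push_cast; ring, fun S => by rw [hI S a b, hI S b]; ring, fun _ => trivial⟩
  · refine ⟨3, by norm_num, ?_⟩
    simp only [rotStep, h0, h1, h2, if_false]
    exact ⟨by push_cast; ring, fun S => by rw [hI S a b, hI S b, hI S (0 - a)]; ring,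
      fun h => by omega⟩

/-- If a point of the first quadrant is close to a power of `ω`, then this is one of the first
`n + 1` powers. -/
theorem le_half_of_quadrant {N n j : ℤ} (hn : 0 < n) (hN : N = 2 * n) {w : ℂ} {ε : ℝ}
    (hε : ε < 2 / N) (hre : 0 ≤ w.re) (him : 0 ≤ w.im) (hj0 : 0 ≤ j) (hj : j < 2 * N)
    (h : ‖w - rootPow N j‖ ≤ ε) : j ≤ n := by
  have hNpos : 0 < N := by omega
  have hN' : (0 : ℝ) < N := by exact_mod_cast hNpos
  by_contra hlt
  -- For n < j ≤ N the real part of ω^j is at most -2 / N, and for N < j < 2 N the imaginary part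
  -- is; neither is within ε of a point of the first quadrant.
  rcases le_or_gt j N with h1 | h1
  · have h2 := le_sin_of_mem (N := N) (k := j - n) hNpos (by omega) (by omega)
    have h3 := (Complex.abs_re_le_norm _).trans h
    rw [Complex.sub_re, rootPow_re] at h3
    have h4 : Real.cos (Real.pi * (j / N)) = -Real.sin (Real.pi * ((j - n : ℤ) / N)) := by
      rw [← Real.cos_add_pi_div_two]
      congr 1
      have : (n : ℝ) = N / 2 := by rw [hN]; push_cast; ring
      push_cast
      rw [this]
      field_simp
      ring
    rw [h4] at h3
    have := (abs_le.1 h3).2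
    linarith
  · have h2 := le_sin_of_mem (N := N) (k := j - N) hNpos (by omega) (by omega)
    have h3 := (Complex.abs_im_le_norm _).trans h
    rw [Complex.sub_im, rootPow_im] at h3
    have h4 : Real.sin (Real.pi * (j / N)) = -Real.sin (Real.pi * ((j - N : ℤ) / N)) := by
      rw [← Real.sin_add_pi]
      congr 1
      push_cast
      field_simp
      ring
    rw [h4] at h3
    have := (abs_le.1 h3).2
    linarith

/-- The orientation test of the binary search. -/
theorem cross_test {N n j k : ℤ} (hn : 0 < n) (hN : N = 2 * n) {w c : ℂ} {ε : ℝ} (hε1 : ε ≤ 1)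
    (hε : 3 * ε < 2 / N) (hj0 : 0 ≤ j) (hj : j ≤ n) (hk0 : 0 ≤ k) (hk : k ≤ n)
    (hw : ‖w - rootPow N j‖ ≤ ε) (hc : ‖c - rootPow N k‖ ≤ ε) :
    (0 ≤ c.re * w.im - c.im * w.re → k ≤ j) ∧ (c.re * w.im - c.im * w.re < 0 → j ≤ k) := by
  have hNpos : 0 < N := by omega
  have hN' : (N : ℝ) ≠ 0 := by exact_mod_cast hNpos.ne'
  have h1 : ((starRingEnd ℂ) c * w).im = c.re * w.im - c.im * w.re := by
    simp [Complex.mul_im]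
    ring
  -- For exact points the test value is sin (π (j - k) / N), of absolute value at least 2 / N unless
  -- j = k. The perturbation below changes it by at most 3 ε, so the sign is right.
  have h2 : ((starRingEnd ℂ) (rootPow N k) * rootPow N j).im = Real.sin (Real.pi * ((j - k : ℤ) / N)) := by
    have : Real.pi * ((j - k : ℤ) / N) = Real.pi * (j / N) - Real.pi * (k / N) := by
      push_cast
      ring
    rw [this, Real.sin_sub]
    simp only [Complex.mul_im, Complex.conj_re, Complex.conj_im, rootPow_re, rootPow_im]
    ring
  have h3 := norm_mul_sub_mul_le (x := (starRingEnd ℂ) c) (a := (starRingEnd ℂ) (rootPow N k))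
    (M := 1) (e := ε) (by rw [Complex.norm_conj, norm_rootPow]) (norm_rootPow N j).le
    (by rw [← map_sub, Complex.norm_conj]; exact hc) hw
  have h4 := (Complex.abs_im_le_norm _).trans h3
  rw [Complex.sub_im, h1, h2] at h4
  have hε0 : 0 ≤ ε := (norm_nonneg _).trans hw
  have h5 : ε * (2 * 1 + ε) ≤ 3 * ε := by nlinarith
  obtain ⟨h6, h7⟩ := abs_le.1 (h4.trans h5)
  constructor
  · intro h
    by_contra hlt
    have h8 := le_sin_of_mem (N := N) (k := k - j) hNpos (by omega) (by omega)
    have h9 : Real.sin (Real.pi * ((j - k : ℤ) / N)) = -Real.sin (Real.pi * ((k - j : ℤ) / N)) := by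
      rw [← Real.sin_neg]
      congr 1
      push_cast
      ring
    rw [h9] at h7
    linarith
  · intro h
    by_contra hlt
    have h8 := le_sin_of_mem (N := N) (k := j - k) hNpos (by omega) (by omega)
    linarith

theorem distSq_val (X : Ctx) (hS : 0 < X.S) (z w : ℤ × ℤ) :
    (((distSq X z w).val : ℤ) : ℝ) = (X.S : ℝ) ^ 2 * ‖cv X.S z - cv X.S w‖ ^ 2 := by
  have hS' : (X.S : ℝ) ≠ 0 := by exact_mod_cast hS.ne'
  have h : (distSq X z w).val = (z.1 - w.1) * (z.1 - w.1) + (z.2 - w.2) * (z.2 - w.2) := rfl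
  rw [h, Complex.sq_norm, Complex.normSq_apply, Complex.sub_re, Complex.sub_im, cv_re, cv_re, cv_im,
    cv_im]
  push_cast
  field_simp

section
variable {X : Ctx} {A : ℝ} {D : ℕ} (hX : GoodCtx X A D)
include hX

theorem GoodCtx.tau_le_inv : X.tau ≤ 1 / A ^ 2 := by
  have h := hX.mul_tau_le (k := 2) (by norm_num)
  have := hX.A_pos
  rw [le_div_iff₀ (by positivity)]
  linarith

theorem GoodCtx.inv_sq_lt : 10 * (1 / A ^ 2) < 2 / (X.N : ℝ) := by
  have hA := hX.A_ge
  have hN := hX.N_le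
  have hN' : (0 : ℝ) < X.N := by exact_mod_cast hX.N_pos
  have hA0 := hX.A_pos
  rw [mul_one_div, div_lt_div_iff₀ (by positivity) hN']
  nlinarith

theorem distSq_time {z w : ℤ × ℤ} (hz : SmallC D X.W z) (hw : SmallC D X.W w) :
    (distSq X z w).time ≤ unitCost D :=
  (ev_runs hX.machine ((z.1 - w.1) * (z.1 - w.1) + (z.2 - w.2) * (z.2 - w.2) : Exp)
    ⟨⟨⟨hz.1, hw.1⟩, ⟨hz.1, hw.1⟩⟩, ⟨⟨hz.2, hw.2⟩, ⟨hz.2, hw.2⟩⟩⟩).2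

theorem small_distSq {z w : ℤ × ℤ} (hz : ‖cv X.S z‖ ≤ 10) (hw : ‖cv X.S w‖ ≤ 10) :
    Small D X.W (distSq X z w).val := by
  refine hX.small_of_le (k := 1) (j := 2) (by norm_num) (by norm_num) ?_
  rw [distSq_val X hX.S_pos, abs_of_nonneg (by positivity), pow_one, mul_comm]
  have h := (norm_sub_le (cv X.S z) (cv X.S w)).trans (add_le_add hz hw)
  have h0 := norm_nonneg (cv X.S z - cv X.S w)
  have hA := hX.A_ge
  gcongr
  nlinarith

/-- A bucket with colliding entries may hold any complex number, so range and time are claimed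
without assumption on the phase, and the exponent only if z is within 1 / A² of a power of ω. This
distance is far below the spacing 2 / N, so that orientation test and final comparison are reliable.
-/
theorem phaseT_runs {z : ℤ × ℤ} (hz : ‖cv X.S z‖ ≤ 5) :
    Runs (phaseT X z) ((X.len + 4) * ((X.terms + 1) * (20 * unitCost D))) (fun r =>
      0 ≤ r ∧ r < 2 * X.N ∧ ∀ j, 0 ≤ j → j < 2 * X.N →
        ‖cv X.S z - rootPow X.N j‖ ≤ 1 / A ^ 2 → r = j) := by
  have hM := hX.machine
  have hA := hX.A_ge
  have hA0 := hX.A_pos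
  have hn := hX.n_pos
  have hNn := hX.N_eq
  have hN := hX.N_pos
  have hU := one_le_unitCost D
  have hS := hX.S_pos'
  have hτ := hX.tau_le_inv
  have hinv := hX.inv_sq_lt
  have hinv0 : 0 ≤ 1 / A ^ 2 := by positivity
  have hinv1 : 1 / A ^ 2 ≤ 1 := by
    rw [div_le_one (by positivity)]
    exact one_le_pow₀ hX.one_le_A
  have hNA := hX.N_le
  have hn' : (X.n : ℝ) = X.N / 2 := by rw [hNn]; push_cast; ring
  have hsn : Small D X.W X.n := hX.small_N.of_nonneg_le (by omega) (by omega)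
  have hA12 : (6 : ℝ) * A ^ 1 ≤ A ^ 2 := hX.mul_pow_le (by norm_num) 1
  have hs6 : ∀ y : ℤ, 0 ≤ y → y ≤ 6 * X.N → Small D X.W y := by
    intro y h0 h1
    refine hX.small_of_le (k := 2) (j := 0) (by norm_num) (by norm_num) ?_
    have h1' : (y : ℝ) ≤ 6 * X.N := by exact_mod_cast h1
    rw [abs_of_nonneg (by exact_mod_cast h0), pow_zero, mul_one]
    linarith
  refine Runs.mono (t := 3 * (4 * unitCost D + 1) + (unitCost D +
    ((X.len + 1) * (((X.terms + 1) * (5 * unitCost D) + 2 * unitCost D) + 1) + (unitCost D +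
    ((X.terms + 1) * (5 * unitCost D) + ((X.terms + 1) * (5 * unitCost D) +
    (unitCost D + (unitCost D + (unitCost D + unitCost D))))))))) ?_ ?_
  · refine Runs.bind (P := fun st => st = rotStep X.n (rotStep X.n (rotStep X.n (z, 0))) ∧
      ‖cv X.S st.1‖ ≤ 5 ∧ 0 ≤ st.2 ∧ st.2 ≤ 3 * X.n) ?_ fun st hst => ?_
    · refine (forLoop_runs (fun k st => st = (rotStep X.n)^[k] (z, 0) ∧
        ‖cv X.S st.1‖ ≤ 5 ∧ 0 ≤ st.2 ∧ st.2 ≤ k * X.n) (4 * unitCost D) _ _ 3 ?_ ?_).imp ?_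
      · exact ⟨rfl, hz, le_rfl, by simp⟩
      · rintro k hk ⟨w, base⟩ ⟨h1, h2, h3, h4⟩
        simp only at h2 h3 h4
        have hsw := hX.smallC_of_norm_le (k := 1) (by norm_num) (h2.trans (by linarith))
        have hk3 : (k : ℤ) ≤ 2 := by omega
        have hsb : Small D X.W base := hs6 _ h3 (by nlinarith)
        have hstep : (rotStep X.n)^[k + 1] (z, 0) = rotStep X.n (w, base) := by
          rw [Function.iterate_succ_apply', h1]
        refine Runs.mono (t := unitCost D + (unitCost D + 2 * unitCost D)) ?_ (by omega)
        refine Runs.bind (leT_runs hM _ _ hM.small_one hsw.1) fun b1 hb1 => ?_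
        refine Runs.bind (leT_runs hM _ _ hM.small_zero hsw.2) fun b2 hb2 => ?_
        simp only [Exp.eval_one, Exp.eval_zero, Exp.eval_lit] at hb1 hb2
        subst hb1 hb2
        refine Runs.ite (fun hb => ?_) (fun hb => ?_)
        · rw [Bool.and_eq_true] at hb
          have hb' : 1 ≤ w.1 ∧ 0 ≤ w.2 := ⟨of_decide_eq_true hb.1, of_decide_eq_true hb.2⟩
          refine Runs.mono (t := 0) (Runs.pure ⟨?_, h2, h3, ?_⟩) (by omega)
          · rw [hstep]
            simp [rotStep, hb']
          · push_cast
            linarith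
        · have hb' : ¬ (1 ≤ w.1 ∧ 0 ≤ w.2) := by
            rintro ⟨h5, h6⟩
            simp [h5, h6] at hb
          refine Runs.mono (t := unitCost D + (unitCost D + 0)) ?_ (by omega)
          refine Runs.bind (ev_runs hM _ ⟨hM.small_zero, hsw.1⟩) fun im him => ?_
          refine Runs.bind (ev_runs hM _ ⟨hsb, hsn⟩) fun bs hbs => ?_
          simp only [Exp.eval_sub, Exp.eval_add, Exp.eval_zero, Exp.eval_lit] at him hbs
          refine Runs.pure ⟨?_, ?_, ?_, ?_⟩
          · rw [hstep, him, hbs]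
            simp [rotStep, hb']
          · have : cv X.S (w.2, im) = -Complex.I * cv X.S w := by
              rw [him]
              unfold cv
              push_cast
              linear_combination ((w.2 : ℂ) / X.S) * Complex.I_sq
            simp only [this, norm_mul, norm_neg, Complex.norm_I, one_mul]
            exact h2
          · simp only [hbs]
            omega
          · simp only [hbs]
            push_cast
            linarith
      · rintro st ⟨h1, h2, h3, h4⟩
        exact ⟨h1, h2, h3, by simpa using h4⟩
    obtain ⟨hst1, hstn, hst0, hst3⟩ := hst
    obtain ⟨r, hr3, hr, hrcv, hrq⟩ := rotStep_three X.n z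
    rw [← hst1] at hr hrcv hrq
    have hsst := hX.smallC_of_norm_le (k := 1) (by norm_num) (hstn.trans (by linarith))
    -- the exponent that remains after the turns
    have hmain : ∀ j, 0 ≤ j → j < 2 * X.N → ‖cv X.S z - rootPow X.N j‖ ≤ 1 / A ^ 2 →
        ∃ k, 0 ≤ k ∧ k ≤ X.n ∧ ‖cv X.S st.1 - rootPow X.N k‖ ≤ 1 / A ^ 2 ∧
          (st.2 + k) % (2 * X.N) = j := by
      intro j hj0 hj hd
      have hz0 : z ≠ 0 := by
        rintro rfl
        have : cv X.S (0 : ℤ × ℤ) = 0 := cv_zero X.S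
        rw [this, zero_sub, norm_neg, norm_rootPow, le_div_iff₀ (by positivity)] at hd
        nlinarith
      obtain ⟨hq1, hq2⟩ := hrq hz0
      have hIr : rootPow X.N st.2 = Complex.I ^ r := by
        rw [hr]
        clear hr3 hr hrcv hrq
        induction r with
        | zero => simp [rootPow_zero]
        | succ r ih =>
          push_cast
          rw [add_mul, one_mul, rootPow_add, ih, rootPow_half (by omega) hNn, pow_succ]
      have hclose : ‖cv X.S st.1 - rootPow X.N ((j - st.2) % (2 * X.N))‖ ≤ 1 / A ^ 2 := by
        rw [rootPow_emod hN]
        have h1 : rootPow X.N j = Complex.I ^ r * rootPow X.N (j - st.2) := by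
          rw [← hIr, ← rootPow_add]
          congr 1
          ring
        rw [hrcv X.S, h1, ← mul_sub, norm_mul, norm_pow, Complex.norm_I, one_pow, one_mul] at hd
        exact hd
      have h0 := Int.emod_nonneg (j - st.2) (show 2 * X.N ≠ 0 by omega)
      have h1 := Int.emod_lt_of_pos (j - st.2) (show 0 < 2 * X.N by omega)
      refine ⟨_, h0, le_half_of_quadrant (by omega) hNn (by linarith) ?_ ?_ h0 h1 hclose,
        hclose, ?_⟩
      · rw [cv_re]
        have : (0 : ℝ) ≤ st.1.1 := by exact_mod_cast (by omega : 0 ≤ st.1.1)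
        positivity
      · rw [cv_im]
        have : (0 : ℝ) ≤ st.1.2 := by exact_mod_cast hq2
        positivity
      · rw [Int.add_emod_emod]
        rw [add_sub_cancel]
        exact Int.emod_eq_of_lt hj0 hj
    refine Runs.bind (ev_runs hM _ ⟨hsn, hM.small_one⟩) fun hi hhi => ?_
    simp only [Exp.eval_add, Exp.eval_one, Exp.eval_lit] at hhi
    subst hhi
    -- Every exponent that is close enough stays within the closed interval. Its length minus 1 is
    -- at least halved in each step, and the upper end starts just outside the range 0, …, n.
    refine Runs.bind (forLoop_runs (fun i (lh : ℤ × ℤ) => 0 ≤ lh.1 ∧ lh.1 ≤ X.n ∧ lh.1 ≤ lh.2 ∧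
        lh.2 ≤ X.n + 1 ∧ (lh.2 - lh.1 - 1) * 2 ^ i ≤ X.n ∧
        ∀ k, 0 ≤ k → k ≤ X.n → ‖cv X.S st.1 - rootPow X.N k‖ ≤ 1 / A ^ 2 → lh.1 ≤ k ∧ k ≤ lh.2)
      ((X.terms + 1) * (5 * unitCost D) + 2 * unitCost D) _ _ _ ?_ ?_) fun lh hlh => ?_
    · refine ⟨le_rfl, by omega, by simp only; omega, le_rfl, by simp, fun k h0 h1 _ => ⟨h0, ?_⟩⟩
      simp only
      omega
    · rintro i - ⟨lo, hi⟩ ⟨h1, h2, h3, h4, h5, h6⟩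
      simp only at h1 h2 h3 h4 h5 h6
      refine Runs.mono (t := unitCost D + ((X.terms + 1) * (5 * unitCost D) + (unitCost D + 0))) ?_
        (by omega)
      refine Runs.bind (ev_runs hM _ ⟨⟨hs6 lo h1 (by omega), hs6 hi (by omega) (by omega)⟩,
        hM.small_two⟩) fun mid hmid => ?_
      simp only [Exp.eval_add, Exp.eval_div, Exp.eval_two, Exp.eval_lit] at hmid
      have hmid0 : 0 ≤ mid := by omega
      have hmidn : mid ≤ X.n := by omega
      refine Runs.bind (cisT_runs hX hmid0 (by omega) hN hX.N_le) fun c hc => ?_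
      change ‖cv X.S c - rootPow X.N mid‖ ≤ _ at hc
      have hcn : ‖cv X.S c‖ ≤ 2 := by
        have h7 := norm_le_norm_add_norm_sub' (cv X.S c) (rootPow X.N mid)
        rw [norm_rootPow] at h7
        have := hX.tau_le
        linarith
      have hsc := hX.smallC_of_norm_le (k := 1) (by norm_num) (hcn.trans (by linarith))
      refine Runs.bind (leT_runs hM _ _ hM.small_zero ⟨⟨hsc.1, hsst.2⟩, ⟨hsc.2, hsst.1⟩⟩)
        fun b hb => ?_
      simp only [Exp.eval_zero, Exp.eval_sub, Exp.eval_mul, Exp.eval_lit] at hb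
      have hcross : (cv X.S c).re * (cv X.S st.1).im - (cv X.S c).im * (cv X.S st.1).re =
          ((c.1 * st.1.2 - c.2 * st.1.1 : ℤ) : ℝ) / (X.S : ℝ) ^ 2 := by
        rw [cv_re, cv_im, cv_re, cv_im]
        push_cast
        field_simp
      have hpow : (2 : ℤ) ^ (i + 1) = 2 * 2 ^ i := by rw [pow_succ]; ring
      have hpos : (0 : ℤ) < 2 ^ i := by positivity
      refine Runs.pure ?_
      by_cases hcr : 0 ≤ c.1 * st.1.2 - c.2 * st.1.1
      · have hbt : b = true := by rw [hb]; exact decide_eq_true hcr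
        simp only [hbt, if_true]
        refine ⟨hmid0, hmidn, by omega, h4, ?_, fun k hk0 hkn hkd => ⟨?_, (h6 k hk0 hkn hkd).2⟩⟩
        · rw [hpow]
          have : 2 * (hi - mid - 1) ≤ hi - lo - 1 := by omega
          nlinarith
        · refine (cross_test (by omega) hNn hinv1 (by linarith) hk0 hkn hmid0 hmidn hkd
            (hc.trans hτ)).1 ?_
          rw [hcross]
          have : (0 : ℝ) ≤ ((c.1 * st.1.2 - c.2 * st.1.1 : ℤ) : ℝ) := by exact_mod_cast hcr
          positivity
      · have hbf : b = false := by rw [hb]; exact decide_eq_false hcr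
        simp only [hbf, Bool.false_eq_true, if_false]
        refine ⟨h1, h2, by omega, by omega, ?_, fun k hk0 hkn hkd => ⟨(h6 k hk0 hkn hkd).1, ?_⟩⟩
        · rw [hpow]
          have : 2 * (mid - lo - 1) ≤ hi - lo - 1 := by omega
          nlinarith
        · refine (cross_test (by omega) hNn hinv1 (by linarith) hk0 hkn hmid0 hmidn hkd
            (hc.trans hτ)).2 ?_
          rw [hcross]
          have : ((c.1 * st.1.2 - c.2 * st.1.1 : ℤ) : ℝ) < 0 := by exact_mod_cast not_le.1 hcr
          exact div_neg_of_neg_of_pos this (by positivity)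
    obtain ⟨lo, hi⟩ := lh
    obtain ⟨h1, h2, h3, h4, h5, h6⟩ := hlh
    simp only at h1 h2 h3 h4 h5 h6
    -- After len + 1 steps the length minus 1 is below 1, because n < 2^(len + 1).
    have hwidth : hi - lo ≤ 1 := by
      by_contra hlt
      have h7 : (1 : ℤ) * 2 ^ (X.len + 1) ≤ (hi - lo - 1) * 2 ^ (X.len + 1) := by
        gcongr
        omega
      have h8 := hX.N_le_pow
      have h9 : (2 : ℤ) ^ (X.len + 1) = 2 * 2 ^ X.len := by rw [pow_succ]; ring
      omega
    refine Runs.bind (ev_runs hM _ ⟨hs6 lo h1 (by omega), hM.small_one⟩) fun nxt hnxt => ?_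
    simp only [Exp.eval_add, Exp.eval_one, Exp.eval_lit] at hnxt
    refine Runs.bind (cisT_runs hX (a := lo) h1 (by omega) hN hX.N_le) fun c0 hc0 => ?_
    refine Runs.bind (cisT_runs hX (a := nxt) (by omega) (by omega) hN hX.N_le) fun c1 hc1 => ?_
    change ‖cv X.S c0 - rootPow X.N lo‖ ≤ _ at hc0
    change ‖cv X.S c1 - rootPow X.N nxt‖ ≤ _ at hc1
    have hcn : ∀ c k, ‖cv X.S c - rootPow X.N k‖ ≤ X.tau → ‖cv X.S c‖ ≤ 2 := by
      intro c k hc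
      have h7 := norm_le_norm_add_norm_sub' (cv X.S c) (rootPow X.N k)
      rw [norm_rootPow] at h7
      have := hX.tau_le
      linarith
    have hsc0 := hX.smallC_of_norm_le (k := 1) (by norm_num) ((hcn c0 lo hc0).trans (by linarith))
    have hsc1 := hX.smallC_of_norm_le (k := 1) (by norm_num) ((hcn c1 nxt hc1).trans (by linarith))
    refine Runs.bind (P := fun d => d = (distSq X c0 st.1).val) ⟨rfl, distSq_time hX hsc0 hsst⟩
      fun d0 hd0 => ?_
    refine Runs.bind (P := fun d => d = (distSq X c1 st.1).val) ⟨rfl, distSq_time hX hsc1 hsst⟩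
      fun d1 hd1 => ?_
    have hsd0 := small_distSq hX (z := c0) (w := st.1) ((hcn c0 lo hc0).trans (by norm_num))
      (hstn.trans (by norm_num))
    have hsd1 := small_distSq hX (z := c1) (w := st.1) ((hcn c1 nxt hc1).trans (by norm_num))
      (hstn.trans (by norm_num))
    rw [← hd0] at hsd0
    rw [← hd1] at hsd1
    refine Runs.bind (leT_runs hM _ _ hsd0 hsd1) fun b hb => ?_
    simp only [Exp.eval_lit] at hb
    have hsel : 0 ≤ (if b then lo else nxt) ∧ (if b then lo else nxt) ≤ X.n + 1 := by
      split_ifs <;> omega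
    refine Runs.imp (ev_runs hM _ ⟨⟨hs6 _ hst0 (by omega), hs6 _ hsel.1 (by omega)⟩, hM.small_two,
      hX.small_N⟩) fun res hres => ?_
    simp only [Exp.eval_add, Exp.eval_mod, Exp.eval_mul, Exp.eval_two, Exp.eval_lit] at hres
    refine ⟨?_, ?_, fun j hj0 hj hd => ?_⟩
    · rw [hres]
      exact Int.emod_nonneg _ (by omega)
    · rw [hres]
      exact Int.emod_lt_of_pos _ (by omega)
    · obtain ⟨k, hk0, hkn, hkd, hkj⟩ := hmain j hj0 hj hd
      have h7 := h6 k hk0 hkn hkd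
      -- The neighbour of the right exponent is at distance at least 2 / N - 2 / A² > 2 / A², the
      -- right one at distance at most 2 / A²; comparing distances therefore decides correctly.
      have hgap : ∀ c : ℤ × ℤ, ∀ i : ℤ, ‖cv X.S c - rootPow X.N i‖ ≤ X.tau → (i = k + 1 ∨ k = i + 1) →
          2 * (1 / A ^ 2) < ‖cv X.S c - cv X.S st.1‖ := by
        intro c i hc hik
        have h8 : 2 / (X.N : ℝ) ≤ ‖rootPow X.N i - rootPow X.N k‖ := by
          rcases hik with rfl | rfl
          · exact two_div_le_norm_rootPow_sub hN k
          · rw [norm_sub_rev]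
            exact two_div_le_norm_rootPow_sub hN i
        have h9 : rootPow X.N i - rootPow X.N k = (cv X.S c - cv X.S st.1) -
          (cv X.S c - rootPow X.N i) + (cv X.S st.1 - rootPow X.N k) := by ring
        rw [h9] at h8
        have h10 := norm_add_le (cv X.S c - cv X.S st.1 - (cv X.S c - rootPow X.N i))
          (cv X.S st.1 - rootPow X.N k)
        have h11 := norm_sub_le (cv X.S c - cv X.S st.1) (cv X.S c - rootPow X.N i)
        linarith
      have hnear : ∀ c : ℤ × ℤ, ‖cv X.S c - rootPow X.N k‖ ≤ X.tau →
          ‖cv X.S c - cv X.S st.1‖ ≤ 2 * (1 / A ^ 2) := by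
        intro c hc
        have h9 : cv X.S c - cv X.S st.1 = (cv X.S c - rootPow X.N k) -
          (cv X.S st.1 - rootPow X.N k) := by ring
        rw [h9]
        refine (norm_sub_le _ _).trans ?_
        linarith
      have hcmp : ∀ c c' : ℤ × ℤ, ‖cv X.S c - cv X.S st.1‖ < ‖cv X.S c' - cv X.S st.1‖ →
          (distSq X c st.1).val < (distSq X c' st.1).val := by
        intro c c' hcc
        have : (((distSq X c st.1).val : ℤ) : ℝ) < ((distSq X c' st.1).val : ℤ) := by
          rw [distSq_val X hX.S_pos, distSq_val X hX.S_pos]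
          gcongr
        exact_mod_cast this
      have hselk : (if b then lo else nxt) = k := by
        rcases eq_or_ne lo k with h8 | h8
        · subst h8
          have := hcmp c0 c1 ((hnear c0 hc0).trans_lt (hgap c1 nxt hc1 (Or.inl hnxt)))
          have hbt : b = true := by
            rw [hb, hd0, hd1]
            exact decide_eq_true this.le
          simp [hbt]
        · have hk1 : k = nxt := by omega
          subst hk1
          have := hcmp c1 c0 ((hnear c1 hc1).trans_lt (hgap c0 lo hc0 (Or.inr hnxt)))
          have hbf : b = false := by
            rw [hb, hd0, hd1]
            exact decide_eq_false (not_le.2 this)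
          simp [hbf]
      rw [hres, hselk]
      exact hkj
  · generalize unitCost D = U at *
    have e1 : (X.len + 4) * ((X.terms + 1) * (20 * U)) =
      20 * (X.len * ((X.terms + 1) * U)) + 80 * ((X.terms + 1) * U) := by ring
    have e2 : (X.terms + 1) * (5 * U) = 5 * ((X.terms + 1) * U) := by ring
    have e3 : (X.len + 1) * (5 * ((X.terms + 1) * U) + 2 * U + 1) =
      5 * (X.len * ((X.terms + 1) * U)) + 5 * ((X.terms + 1) * U) + 2 * (X.len * U) + X.len +
        2 * U + 1 := by ring
    have z1 : U ≤ (X.terms + 1) * U := Nat.le_mul_of_pos_left _ (by omega)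
    have z2 : X.len * U ≤ X.len * ((X.terms + 1) * U) := Nat.mul_le_mul_left _ z1
    have z3 : X.len ≤ X.len * U := Nat.le_mul_of_pos_right _ hU
    rw [e1, e2, e3]
    linarith

end

/-! ### Index, absolute value and sign of a bucket entry -/

section
variable {X : Ctx} {A : ℝ} {D : ℕ} (hX : GoodCtx X A D)
include hX

theorem GoodCtx.inv_S_le_inv_pow : 1 / (X.S : ℝ) ≤ 1 / A ^ 4 := by
  have h := hX.mul_tau_le (k := 4) (by norm_num)
  have hA := hX.A_pos
  have hS := hX.S_pos'
  have h1 : 1 / (X.S : ℝ) ≤ X.tau := by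
    refine le_trans ?_ hX.inv_S_le
    gcongr
    norm_num
  refine h1.trans ?_
  rw [le_div_iff₀ (by positivity)]
  linarith

/-- Near c ω^i the integer square root g gives |c| up to 2 / A^4 after division by S, so rounding is
exact, and z S / g is close to ω^i or -ω^i. The sign of c is seen in the phase, since -ω^i =
ω^(i+N). The bound on the decoded value holds for every heavy bucket and controls the size of wrong
records. -/
theorem decodeT_runs {z : ℤ × ℤ} (hz : ‖cv X.S z‖ ≤ A ^ 5)
    (hheavy : X.S * X.S ≤ X.N * X.N * (z.1 * z.1 + z.2 * z.2)) :
    Runs (decodeT X z) ((D * X.W + 1) * (7 * unitCost (D + 3)) +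
        (X.len + 5) * ((X.terms + 1) * (20 * unitCost D))) (fun r =>
      0 ≤ r.1 ∧ r.1 < X.N ∧ |(r.2 : ℝ)| ≤ 2 * ‖cv X.S z‖ ∧
        ∀ i c : ℤ, 0 ≤ i → i < X.N → c ≠ 0 → ‖cv X.S z - c * rootPow X.N i‖ ≤ 1 / A ^ 4 →
          r = (i, c)) := by
  have hM := hX.machine
  have hA := hX.A_ge
  have hA0 := hX.A_pos
  have hA1 := hX.one_le_A
  have hN := hX.N_pos
  have hU := one_le_unitCost D
  have hS := hX.S_pos'
  have hSz := hX.S_pos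
  have hz1 := abs_fst_le hX.S_pos hz
  have hz2 := abs_snd_le hX.S_pos hz
  have hsz := hX.smallC_of_norm_le (k := 5) (by norm_num) hz
  set q : ℤ := z.1 * z.1 + z.2 * z.2 with hq
  have hqn : (q : ℝ) = (X.S : ℝ) ^ 2 * ‖cv X.S z‖ ^ 2 := by
    rw [Complex.sq_norm, Complex.normSq_apply, cv_re, cv_im, hq]
    push_cast
    field_simp
  have hq1 : 1 ≤ q := by
    by_contra h
    have h1 : q ≤ 0 := by omega
    nlinarith [mul_pos hN hN, mul_pos hSz hSz]
  have hsq : Small D X.W q := by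
    refine hX.small_of_le (k := 10) (j := 2) (by norm_num) (by norm_num) ?_
    rw [hqn, abs_of_nonneg (by positivity), mul_comm]
    gcongr
    calc ‖cv X.S z‖ ^ 2 ≤ (A ^ 5) ^ 2 := by gcongr
      _ = A ^ 10 := by ring
  -- The square root costs one step per bit, and q has at most about D * W bits.
  have hclog : Nat.clog 2 q.toNat ≤ D * X.W := by
    apply (Nat.clog_le_iff_le_pow (by norm_num)).2
    have := hsq
    unfold Small at this
    omega
  refine Runs.mono (t := unitCost D + ((D * X.W + 1) * (7 * unitCost (D + 3)) + (unitCost D +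
    (unitCost D + (unitCost D + ((X.len + 4) * ((X.terms + 1) * (20 * unitCost D)) +
    (unitCost D + 2 * unitCost D))))))) ?_ ?_
  · refine Runs.bind (ev_runs hM _ ⟨⟨hsz.1, hsz.1⟩, hsz.2, hsz.2⟩) fun q' hq' => ?_
    simp only [Exp.eval_add, Exp.eval_mul, Exp.eval_lit] at hq'
    rw [← hq] at hq'
    rw [hq']
    refine Runs.bind ((isqrt_runs hM q hsq hq1).mono
      (Nat.mul_le_mul_right _ (by omega))) fun g hg => ?_
    obtain ⟨hg0, hg1, hg2⟩ := hg
    have hgpos : 1 ≤ g := by nlinarith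
    have hgq : g ≤ q := by nlinarith
    have hsg : Small D X.W g := hsq.of_nonneg_le hg0 hgq
    have hgr : (1 : ℝ) ≤ g := by exact_mod_cast hgpos
    set ρ := ‖cv X.S z‖ with hρ
    have hρ0 : 0 ≤ ρ := norm_nonneg _
    have hgρ : (g : ℝ) ≤ X.S * ρ := by
      have h1 : (g : ℝ) * g ≤ q := by exact_mod_cast hg1
      rw [hqn, ← mul_pow] at h1
      have h2 : (g : ℝ) ^ 2 ≤ (X.S * ρ) ^ 2 := by nlinarith
      exact (pow_le_pow_iff_left₀ (by linarith) (by positivity) (by norm_num)).1 h2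
    have hgρ' : X.S * ρ ≤ g + 1 := by
      have h1 : (q : ℝ) ≤ (g + 1) * (g + 1) := by exact_mod_cast hg2.le
      rw [hqn, ← mul_pow] at h1
      have h2 : (X.S * ρ) ^ 2 ≤ ((g : ℝ) + 1) ^ 2 := by nlinarith
      exact (pow_le_pow_iff_left₀ (by positivity) (by linarith) (by norm_num)).1 h2
    have hsS := hX.small_S
    refine Runs.bind (ev_runs hM _ ⟨⟨⟨hM.small_two, hsg⟩, hsS⟩, hM.small_two, hsS⟩) fun v hv => ?_
    refine Runs.bind (ev_runs hM _ ⟨⟨hsz.1, hsS⟩, hsg⟩) fun re hre => ?_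
    refine Runs.bind (ev_runs hM _ ⟨⟨hsz.2, hsS⟩, hsg⟩) fun im him => ?_
    simp only [Exp.eval_add, Exp.eval_mul, Exp.eval_div, Exp.eval_two, Exp.eval_lit] at hv hre him
    have hv0 : 0 ≤ v := by rw [hv]; positivity
    have hvub : 2 * (X.S : ℝ) * v ≤ 2 * g + X.S := by
      have : 2 * X.S * v ≤ 2 * g + X.S := by
        rw [hv]
        exact Int.mul_ediv_self_le (by positivity)
      exact_mod_cast this
    have hvlb : 2 * (g : ℝ) + X.S < 2 * X.S * v + 2 * X.S := by
      have h1 : 2 * g + X.S < 2 * X.S * v + 2 * X.S := by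
        rw [hv]
        have := Int.lt_mul_ediv_self_add (x := 2 * g + X.S) (k := 2 * X.S) (by positivity)
        linarith
      exact_mod_cast h1
    -- Rounding gives 0 if ρ < 1/2, and at most ρ + 1/2 ≤ 2 ρ otherwise.
    have hvρ : (v : ℝ) ≤ 2 * ρ := by
      rcases lt_or_ge ρ (1 / 2) with h | h
      · have h1 : v < 1 := by
          by_contra h2
          have h3 : (1 : ℝ) ≤ v := by exact_mod_cast not_lt.1 h2
          nlinarith
        have h2 : v = 0 := by omega
        rw [h2]
        push_cast
        positivity
      · have h1 : (v : ℝ) ≤ ρ + 1 / 2 := by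
          have : 2 * (X.S : ℝ) * v ≤ 2 * X.S * (ρ + 1 / 2) := by linarith
          exact le_of_mul_le_mul_left this (by positivity)
        linarith
    have hsv : Small D X.W v := by
      refine hX.small_of_le (k := 6) (j := 0) (by norm_num) (by norm_num) ?_
      rw [abs_of_nonneg (by exact_mod_cast hv0), pow_zero, mul_one]
      have : (2 : ℝ) * A ^ 5 ≤ A ^ 6 := hX.mul_pow_le (by norm_num) 5
      linarith
    -- the phase
    have hphase : ‖cv X.S (re, im) - cv X.S z * (X.S / g : ℝ)‖ ≤ 2 / X.S := by
      have hgz : 0 < g := by omega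
      apply norm_cv_sub_le hX.S_pos
      · have := abs_ediv_sub_le (z.1 * X.S) hgz
        rw [← hre] at this
        rw [Complex.re_mul_ofReal, cv_re]
        convert this using 3
        push_cast
        field_simp
      · have := abs_ediv_sub_le (z.2 * X.S) hgz
        rw [← him] at this
        rw [Complex.im_mul_ofReal, cv_im]
        convert this using 3
        push_cast
        field_simp
    have hSinv := hX.inv_S_le_inv_pow
    have hS2 : 2 / (X.S : ℝ) ≤ 2 * (1 / A ^ 4) := by
      calc 2 / (X.S : ℝ) = 2 * (1 / X.S) := by ring
        _ ≤ _ := by gcongr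
    have h44 : 1 / A ^ 4 ≤ 1 / 1000 := by
      gcongr
      calc (1000 : ℝ) ≤ A ^ 1 := by simpa using hA
        _ ≤ A ^ 4 := pow_le_pow_right₀ hA1 (by norm_num)
    have hphn : ‖cv X.S (re, im)‖ ≤ 5 := by
      have h1 := norm_le_norm_add_norm_sub' (cv X.S (re, im)) (cv X.S z * (X.S / g : ℝ))
      rw [norm_mul, Complex.norm_real, Real.norm_of_nonneg (by positivity), ← hρ] at h1
      have h2 : ρ * (X.S / g) ≤ 2 := by
        rw [mul_div_assoc', div_le_iff₀ (by linarith)]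
        linarith
      linarith
    refine Runs.bind (phaseT_runs hX hphn) fun j hj => ?_
    obtain ⟨hj0, hjN, hjs⟩ := hj
    have hsj : Small D X.W j := by
      refine hX.small_of_le (k := 2) (j := 0) (by norm_num) (by norm_num) ?_
      rw [abs_of_nonneg (by exact_mod_cast hj0), pow_zero, mul_one]
      have h1 : (j : ℝ) ≤ 2 * X.N := by exact_mod_cast hjN.le
      have h2 := hX.N_le
      have : (2 : ℝ) * A ^ 1 ≤ A ^ 2 := hX.mul_pow_le (by norm_num) 1
      linarith
    -- what a bucket with a single entry gives
    have hsingle : ∀ i c : ℤ, 0 ≤ i → i < X.N → c ≠ 0 →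
        ‖cv X.S z - c * rootPow X.N i‖ ≤ 1 / A ^ 4 →
        v = |c| ∧ j = if 0 < c then i else i + X.N := by
      intro i c hi0 hiN hc hd
      have hc1 : (1 : ℝ) ≤ |(c : ℝ)| := by exact_mod_cast Int.one_le_abs hc
      have hcρ : abs (ρ - |(c : ℝ)|) ≤ 1 / A ^ 4 := by
        have h1 := abs_norm_sub_norm_le (cv X.S z) (c * rootPow X.N i)
        rw [norm_mul, norm_rootPow, mul_one, Complex.norm_intCast] at h1
        exact h1.trans hd
      obtain ⟨hcρ1, hcρ2⟩ := abs_le.1 hcρ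
      have hgS : abs ((g : ℝ) / X.S - |(c : ℝ)|) ≤ 2 * (1 / A ^ 4) := by
        have h1 : (g : ℝ) / X.S ≤ ρ := by
          rw [div_le_iff₀ hS]
          linarith
        have h2 : ρ - 1 / X.S ≤ (g : ℝ) / X.S := by
          rw [le_div_iff₀ hS, sub_mul, one_div, inv_mul_cancel₀ hS.ne']
          linarith
        rw [abs_le]
        constructor <;> linarith
      obtain ⟨hgS1, hgS2⟩ := abs_le.1 hgS
      refine ⟨?_, ?_⟩
      · have h1 : (v : ℝ) ≤ g / X.S + 1 / 2 := by
          have h2 : 2 * (X.S : ℝ) * v ≤ 2 * X.S * (g / X.S + 1 / 2) := by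
            have : 2 * (X.S : ℝ) * (g / X.S + 1 / 2) = 2 * g + X.S := by field_simp
            rw [this]
            exact hvub
          exact le_of_mul_le_mul_left h2 (by positivity)
        have h2 : (g : ℝ) / X.S < v + 1 / 2 := by
          have h3 : 2 * (X.S : ℝ) * (g / X.S) < 2 * X.S * (v + 1 / 2) := by
            have : 2 * (X.S : ℝ) * (g / X.S) = 2 * g := by field_simp
            rw [this]
            linarith
          exact lt_of_mul_lt_mul_left h3 (by positivity)
        have h3 : (v : ℝ) < ((|c| + 1 : ℤ) : ℝ) := by
          push_cast
          linarith
        have h4 : ((|c| : ℤ) : ℝ) < ((v + 1 : ℤ) : ℝ) := by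
          push_cast
          linarith
        have h5 : v < |c| + 1 := by exact_mod_cast h3
        have h6 : |c| < v + 1 := by exact_mod_cast h4
        omega
      -- A negative entry is |c| times the opposite power of ω, so one statement about |c| covers
      -- both signs.
      · have key : ∀ k : ℤ, 0 ≤ k → k < 2 * X.N →
            (c : ℂ) * rootPow X.N i = (|(c : ℝ)| : ℝ) * rootPow X.N k → j = k := by
          intro k hk0 hkN hck
          refine hjs k hk0 hkN ?_
          rw [hck] at hd
          have hgS0 : 1 / 2 ≤ (g : ℝ) / X.S := by linarith
          have hSg : (X.S : ℝ) / g ≤ 2 := by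
            rw [div_le_iff₀ (by linarith)]
            rw [le_div_iff₀ hS] at hgS0
            linarith
          have hSg0 : 0 ≤ (X.S : ℝ) / g := by positivity
          have h1 : ‖cv X.S z - (g / X.S : ℝ) * rootPow X.N k‖ ≤ 3 * (1 / A ^ 4) := by
            have h2 : cv X.S z - (g / X.S : ℝ) * rootPow X.N k =
              (cv X.S z - (|(c : ℝ)| : ℝ) * rootPow X.N k) +
              ((|(c : ℝ)| - g / X.S : ℝ) : ℂ) * rootPow X.N k := by
              push_cast
              ring
            rw [h2]
            refine (norm_add_le _ _).trans ?_
            rw [norm_mul, norm_rootPow, mul_one, Complex.norm_real, Real.norm_eq_abs, abs_sub_comm]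
            linarith
          have h2 : cv X.S (re, im) - rootPow X.N k =
              (cv X.S (re, im) - cv X.S z * (X.S / g : ℝ)) +
              (cv X.S z - (g / X.S : ℝ) * rootPow X.N k) * (X.S / g : ℝ) := by
            have h3 : ((g / X.S : ℝ) : ℂ) * ((X.S / g : ℝ) : ℂ) = 1 := by
              have h4 : (g / X.S : ℝ) * (X.S / g : ℝ) = 1 := by field_simp
              rw [← Complex.ofReal_mul, h4, Complex.ofReal_one]
            linear_combination rootPow X.N k * h3
          rw [h2]
          refine (norm_add_le _ _).trans ?_
          rw [norm_mul, Complex.norm_real, Real.norm_of_nonneg hSg0]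
          have h3 : ‖cv X.S z - (g / X.S : ℝ) * rootPow X.N k‖ * (X.S / g) ≤
              3 * (1 / A ^ 4) * 2 := by gcongr
          have h4 : 8 * (1 / A ^ 4) ≤ 1 / A ^ 2 := by
            rw [mul_one_div, div_le_div_iff₀ (by positivity) (by positivity)]
            have : (8 : ℝ) * A ^ 3 ≤ A ^ 4 := hX.mul_pow_le (by norm_num) 3
            have : A ^ 2 ≤ A ^ 3 := pow_le_pow_right₀ hA1 (by norm_num)
            linarith
          linarith
        split_ifs with hc0
        · refine key i hi0 (by omega) ?_
          rw [abs_of_pos (by exact_mod_cast hc0)]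
          push_cast
          rfl
        · refine key (i + X.N) (by omega) (by omega) ?_
          rw [rootPow_add_self hN, abs_of_nonpos (by exact_mod_cast not_lt.1 hc0)]
          push_cast
          ring
    refine Runs.bind (leT_runs hM _ _ hX.small_N hsj) fun b hb => ?_
    simp only [Exp.eval_lit] at hb
    refine Runs.ite (fun hbt => ?_) (fun hbf => ?_)
    · have hNj : X.N ≤ j := by
        rw [hb] at hbt
        exact of_decide_eq_true hbt
      refine Runs.mono (t := unitCost D + (unitCost D + 0)) ?_ (by omega)
      refine Runs.bind (ev_runs hM _ ⟨hsj, hX.small_N⟩) fun i' hi' => ?_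
      refine Runs.bind (ev_runs hM _ ⟨hM.small_zero, hsv⟩) fun v' hv' => Runs.pure ?_
      simp only [Exp.eval_sub, Exp.eval_zero, Exp.eval_lit] at hi' hv'
      refine ⟨by simp only; omega, by simp only; omega, ?_, fun i c hi0 hiN hc hd => ?_⟩
      · simp only [hv', zero_sub]
        push_cast
        rw [abs_neg, abs_of_nonneg (by exact_mod_cast hv0)]
        exact hvρ
      · obtain ⟨h1, h2⟩ := hsingle i c hi0 hiN hc hd
        split_ifs at h2 with h3
        · omega
        · have h4 : |c| = -c := abs_of_nonpos (not_lt.1 h3)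
          rw [Prod.mk.injEq]
          omega
    · have hNj : j < X.N := by
        rw [hb] at hbf
        exact not_le.1 (of_decide_eq_false hbf)
      refine Runs.mono (t := 0) (Runs.pure ⟨hj0, hNj, ?_, fun i c hi0 hiN hc hd => ?_⟩) (by omega)
      · rw [abs_of_nonneg (by exact_mod_cast hv0)]
        exact hvρ
      · obtain ⟨h1, h2⟩ := hsingle i c hi0 hiN hc hd
        split_ifs at h2 with h3
        · have h4 : |c| = c := abs_of_pos h3
          rw [Prod.mk.injEq]
          omega
        · omega
  · generalize unitCost D = U at *
    have e1 : (X.len + 5) * ((X.terms + 1) * (20 * U)) =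
      (X.len + 4) * ((X.terms + 1) * (20 * U)) + 20 * ((X.terms + 1) * U) := by ring
    have z1 : U ≤ (X.terms + 1) * U := Nat.le_mul_of_pos_left _ (by omega)
    rw [e1]
    linarith

end

/-! ### Buckets -/

/-- The sum of the absolute values of the coordinates. -/
def vecNorm (g : ℤ →₀ ℤ) : ℤ := ∑ i ∈ g.support, |g i|

theorem vecNorm_nonneg (g : ℤ →₀ ℤ) : 0 ≤ vecNorm g := Finset.sum_nonneg fun _ _ => abs_nonneg _

theorem vecNorm_eq_sum {g : ℤ →₀ ℤ} {s : Finset ℤ} (h : g.support ⊆ s) :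
    vecNorm g = ∑ i ∈ s, |g i| := by
  refine Finset.sum_subset h fun i _ hi => ?_
  rw [Finsupp.notMem_support_iff.1 hi, abs_zero]

theorem vecNorm_add_le (g h : ℤ →₀ ℤ) : vecNorm (g + h) ≤ vecNorm g + vecNorm h := by
  rw [vecNorm_eq_sum (s := g.support ∪ h.support) Finsupp.support_add,
    vecNorm_eq_sum (g := g) Finset.subset_union_left,
    vecNorm_eq_sum (g := h) Finset.subset_union_right, ← Finset.sum_add_distrib]
  exact Finset.sum_le_sum fun i _ => abs_add_le _ _

theorem vecNorm_neg (g : ℤ →₀ ℤ) : vecNorm (-g) = vecNorm g := by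
  simp [vecNorm, Finsupp.support_neg]

theorem vecNorm_sub_le (g h : ℤ →₀ ℤ) : vecNorm (g - h) ≤ vecNorm g + vecNorm h := by
  rw [sub_eq_add_neg, ← vecNorm_neg h]
  exact vecNorm_add_le _ _

theorem vecNorm_single (i c : ℤ) : vecNorm (Finsupp.single i c) = |c| := by
  rw [vecNorm_eq_sum (s := {i}) Finsupp.support_single_subset]
  simp

@[simp] theorem vecNorm_zero : vecNorm 0 = 0 := by simp [vecNorm]

theorem vecNorm_listVec_le (L : List (ℤ × ℤ)) : vecNorm (listVec L) ≤ listNorm L := by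
  induction L with
  | nil => simp
  | cons a L ih =>
    rw [listVec_cons, listNorm_cons, ← vecNorm_single a.1]
    exact (vecNorm_add_le _ _).trans (by linarith)

/-- The elements of the support that share their residue modulo `p` with another one. -/
def nonIsolated (g : ℤ →₀ ℤ) (p : ℕ) : Finset ℤ :=
  g.support.filter fun i => ∃ j ∈ g.support, j ≠ i ∧ j % (p : ℤ) = i % (p : ℤ)

/-- The part of the support that is hashed into the bucket `b`. -/
def bucket (g : ℤ →₀ ℤ) (p b : ℕ) : Finset ℤ := g.support.filter fun i => i % (p : ℤ) = b

theorem hashHom_eq_sum_bucket (N : ℤ) (p b : ℕ) (g : ℤ →₀ ℤ) :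
    hashHom N p b g = ∑ j ∈ bucket g p b, rootPow N j * (g j : ℂ) := by
  rw [hashHom_apply, bucket, Finset.sum_filter]
  refine Finset.sum_congr rfl fun j _ => ?_
  split_ifs <;> simp

theorem norm_hashHom_le (N : ℤ) (p b : ℕ) (g : ℤ →₀ ℤ) :
    ‖hashHom N p b g‖ ≤ ∑ j ∈ bucket g p b, |(g j : ℝ)| := by
  rw [hashHom_eq_sum_bucket]
  refine (norm_sum_le _ _).trans (Finset.sum_le_sum fun j _ => ?_)
  rw [norm_mul, norm_rootPow, one_mul, Complex.norm_intCast]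

theorem bucket_eq_singleton {g : ℤ →₀ ℤ} {p b : ℕ} {i : ℤ} (hi : i ∈ bucket g p b)
    (h : i ∉ nonIsolated g p) : bucket g p b = {i} := by
  rw [bucket, Finset.mem_filter] at hi
  ext j
  rw [Finset.mem_singleton, bucket, Finset.mem_filter]
  constructor
  · rintro ⟨hj, hjb⟩
    by_contra hne
    exact h (Finset.mem_filter.2 ⟨hi.1, j, hj, hne, hjb.trans hi.2.symm⟩)
  · rintro rfl
    exact hi

theorem sum_bucket (g : ℤ →₀ ℤ) {p : ℕ} (hp : 1 ≤ p) (f : ℤ → ℝ) :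
    ∑ b ∈ Finset.range p, ∑ j ∈ bucket g p b, f j = ∑ j ∈ g.support, f j := by
  have h : ∀ b : ℕ, bucket g p b = g.support.filter fun j => (j % (p : ℤ)).toNat = b := by
    intro b
    refine Finset.filter_congr fun j _ => ?_
    have := Int.emod_nonneg j (b := (p : ℤ)) (by omega)
    omega
  simp_rw [h]
  refine Finset.sum_fiberwise_of_maps_to (fun j _ => ?_) f
  have := Int.emod_lt_of_pos j (b := (p : ℤ)) (by omega)
  have := Int.emod_nonneg j (b := (p : ℤ)) (by omega)
  rw [Finset.mem_range]
  omega

theorem vecNorm_cast (g : ℤ →₀ ℤ) : ((vecNorm g : ℤ) : ℝ) = ∑ j ∈ g.support, |(g j : ℝ)| := by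
  simp [vecNorm]

theorem norm_hashHom_le_vecNorm (N : ℤ) (p b : ℕ) (g : ℤ →₀ ℤ) :
    ‖hashHom N p b g‖ ≤ vecNorm g := by
  refine (norm_hashHom_le N p b g).trans ?_
  rw [vecNorm_cast]
  exact Finset.sum_le_sum_of_subset_of_nonneg (Finset.filter_subset _ _) fun _ _ _ => abs_nonneg _

/-- Distinct buckets of a set that all meet a set `T` of indices are at most as many as `T`. -/
theorem card_le_of_buckets {g : ℤ →₀ ℤ} {p : ℕ} {s : Finset ℕ} {T : Finset ℤ}
    (h : ∀ b ∈ s, ∃ i ∈ T, i ∈ bucket g p b) : s.card ≤ T.card := by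
  choose! f hf using h
  refine Finset.card_le_card_of_injOn f (fun b hb => (hf b hb).1) fun b hb b' hb' he => ?_
  have h1 := (Finset.mem_filter.1 (hf b hb).2).2
  have h2 := (Finset.mem_filter.1 (hf b' hb').2).2
  rw [he, h2] at h1
  exact_mod_cast h1.symm

/-! ### One repetition -/

/-- Whether a pair (index, value) is a nonzero coordinate of `g`. -/
def IsEntry (g : ℤ →₀ ℤ) (a : ℤ × ℤ) : Prop := g a.1 = a.2 ∧ a.2 ≠ 0

instance (g : ℤ →₀ ℤ) : DecidablePred (IsEntry g) := fun _ => inferInstanceAs (Decidable (_ ∧ _))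

/-- What the records of one repetition with the modulus `p` say about `g`. -/
structure Records (N B : ℤ) (g : ℤ →₀ ℤ) (p : ℕ) (new : List (ℤ × ℤ)) : Prop where
  inRange : InRange N new
  norm_le : listNorm new ≤ 3 * vecNorm g
  length_le : (new.length : ℤ) ≤ B
  mem : ∀ i ∈ g.support, i ∉ nonIsolated g p → (i, g i) ∈ new
  wrong_le : new.countP (fun a => ¬ IsEntry g a) ≤ (nonIsolated g p).card

/-- The test for a heavy bucket. -/
def Heavy (X : Ctx) (z : ℤ × ℤ) : Prop := X.S * X.S ≤ X.N * X.N * (z.1 * z.1 + z.2 * z.2)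

instance (X : Ctx) : DecidablePred (Heavy X) := fun _ => inferInstanceAs (Decidable (_ ≤ _))

section
variable {X : Ctx} {A : ℝ} {D : ℕ} (hX : GoodCtx X A D)
include hX

theorem GoodCtx.heavy_iff (z : ℤ × ℤ) : Heavy X z ↔ 1 ≤ X.N * ‖cv X.S z‖ := by
  have hS := hX.S_pos'
  have hN : (0 : ℝ) < X.N := by exact_mod_cast hX.N_pos
  have h1 : ((z.1 * z.1 + z.2 * z.2 : ℤ) : ℝ) = (X.S : ℝ) ^ 2 * ‖cv X.S z‖ ^ 2 := by
    rw [Complex.sq_norm, Complex.normSq_apply, cv_re, cv_im]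
    push_cast
    field_simp
  have h2 : Heavy X z ↔ (X.S : ℝ) ^ 2 * 1 ^ 2 ≤ (X.S : ℝ) ^ 2 * (X.N * ‖cv X.S z‖) ^ 2 := by
    unfold Heavy
    rw [← Int.cast_le (R := ℝ), Int.cast_mul, Int.cast_mul, h1, Int.cast_mul]
    constructor <;> intro h <;> linarith
  rw [h2, mul_le_mul_iff_right₀ (by positivity),
    pow_le_pow_iff_left₀ (by norm_num) (by positivity) (by norm_num)]

/-- A heavy bucket is not empty, as the error is below 1 / N; so the heavy buckets are at most as
many as the coordinates. The bucket of an isolated coordinate is heavy and is decoded exactly. Hence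
a wrong pair comes from a bucket all of whose elements are non-isolated, and choosing one element
per bucket injects the wrong pairs into the non-isolated coordinates. -/
theorem records_of_approx {p : ℕ} (hp : 1 ≤ p) {g : ℤ →₀ ℤ} {l : List (ℤ × ℤ)} {η : ℝ} {B : ℤ}
    (hl : Approx X.S l p (fun b => hashHom X.N p b g) η) (hη : η ≤ 1 / A ^ 4)
    (hg : ∀ i ∈ g.support, 0 ≤ i ∧ i < X.N) (hgA : (vecNorm g : ℝ) ≤ A ^ 4) :
    ((l.filter (Heavy X)).length ≤ g.support.card) ∧
    (((l.filter (Heavy X)).length : ℤ) ≤ B →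
      Records X.N B g p ((l.filter (Heavy X)).map fun z => (decodeT X z).val)) := by
  have hA := hX.A_ge
  have hA0 := hX.A_pos
  have hA1 := hX.one_le_A
  have hN : (0 : ℝ) < X.N := by exact_mod_cast hX.N_pos
  have hN1 : (1 : ℝ) ≤ X.N := by exact_mod_cast hX.N_pos
  -- As N ≤ A and η ≤ 1 / A^4, the error stays below the threshold 1 / N with a factor 3 to spare.
  have hη1 : X.N * (3 * η) < 1 := by
    have h1 : (3 : ℝ) * A ^ 1 ≤ A ^ 2 := hX.mul_pow_le (by norm_num) 1
    have h3 : A ^ 2 < A ^ 4 := pow_lt_pow_right₀ (by linarith) (by norm_num)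
    calc X.N * (3 * η) ≤ A * (3 * (1 / A ^ 4)) := by
          have := hX.N_le
          rcases le_or_gt 0 η with h | h
          · gcongr
          · have : X.N * (3 * η) ≤ 0 := by nlinarith
            refine this.trans (by positivity)
      _ = (3 * A ^ 1) / A ^ 4 := by ring
      _ < 1 := by rw [div_lt_one (by positivity)]; linarith
  set f : ℕ → ℤ × ℤ := fun b => l.getD b (0, 0) with hf
  have hlf : l = (List.range p).map f := by
    apply List.ext_getElem
    · simp [hl.1]
    · intro i h1 h2
      simp [hf, List.getElem?_eq_getElem h1]
  set dec : ℕ → ℤ × ℤ := fun b => (decodeT X (f b)).val with hdec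
  set s : List ℕ := (List.range p).filter fun b => Heavy X (f b) with hs
  have hsl : l.filter (Heavy X) = s.map f := by
    conv_lhs => rw [hlf]
    rw [List.filter_map, hs]
    rfl
  have hsn : s.Nodup := List.nodup_range.filter _
  have hmem : ∀ b, b ∈ s ↔ b < p ∧ Heavy X (f b) := by simp [hs]
  have happ : ∀ b < p, ‖cv X.S (f b) - hashHom X.N p b g‖ ≤ η := hl.2
  -- A heavy bucket has absolute value above 3 η, so its exact value is at least 2 η. The decoded
  -- value, at most twice the computed one, is then at most 3 times the exact one; this is the
  -- factor 3 in `norm_le`.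
  have hheavy : ∀ b ∈ s, 2 * η ≤ ‖hashHom X.N p b g‖ := by
    intro b hb
    obtain ⟨hbp, hb⟩ := (hmem b).1 hb
    rw [hX.heavy_iff] at hb
    have h1 := norm_le_norm_add_norm_sub' (cv X.S (f b)) (hashHom X.N p b g)
    have h2 := happ b hbp
    by_contra h3
    have h4 : ‖cv X.S (f b)‖ ≤ 3 * η := by linarith
    have : X.N * ‖cv X.S (f b)‖ ≤ X.N * (3 * η) := by gcongr
    linarith
  have hne : ∀ b ∈ s, (bucket g p b).Nonempty := by
    intro b hb
    rw [Finset.nonempty_iff_ne_empty]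
    intro he
    have h1 := happ b ((hmem b).1 hb).1
    have h2 := (hX.heavy_iff _).1 ((hmem b).1 hb).2
    rw [hashHom_eq_sum_bucket, he, Finset.sum_empty, sub_zero] at h1
    have : X.N * ‖cv X.S (f b)‖ ≤ X.N * η := by gcongr
    have h3 := norm_nonneg (cv X.S (f b))
    nlinarith
  have hdecs : ∀ b ∈ s, 0 ≤ (dec b).1 ∧ (dec b).1 < X.N ∧ |((dec b).2 : ℝ)| ≤ 2 * ‖cv X.S (f b)‖ ∧
        ∀ i c : ℤ, 0 ≤ i → i < X.N → c ≠ 0 → ‖cv X.S (f b) - c * rootPow X.N i‖ ≤ 1 / A ^ 4 →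
          dec b = (i, c) := by
    intro b hb
    obtain ⟨hbp, hb⟩ := (hmem b).1 hb
    refine (decodeT_runs hX ?_ hb).1
    have h1 := norm_le_norm_add_norm_sub' (cv X.S (f b)) (hashHom X.N p b g)
    have h2 := happ b hbp
    have h3 := norm_hashHom_le_vecNorm X.N p b g
    have h4 : (2 : ℝ) * A ^ 4 ≤ A ^ 5 := hX.mul_pow_le (by norm_num) 4
    have h5 : 1 / A ^ 4 ≤ 1 := by
      rw [div_le_one (by positivity)]
      exact one_le_pow₀ hA1
    have h6 : 1 ≤ A ^ 4 := one_le_pow₀ hA1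
    linarith
  have hiso : ∀ b < p, ∀ i ∈ bucket g p b, i ∉ nonIsolated g p → b ∈ s ∧ dec b = (i, g i) := by
    intro b hbp i hi hni
    have his : i ∈ g.support := (Finset.mem_filter.1 hi).1
    have hgi : g i ≠ 0 := Finsupp.mem_support_iff.1 his
    have h1 := happ b hbp
    rw [hashHom_eq_sum_bucket, bucket_eq_singleton hi hni, Finset.sum_singleton, mul_comm] at h1
    have hbs : b ∈ s := by
      rw [hmem]
      refine ⟨hbp, (hX.heavy_iff _).2 ?_⟩
      have h2 := norm_le_norm_add_norm_sub (cv X.S (f b)) ((g i : ℂ) * rootPow X.N i)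
      rw [norm_mul, norm_rootPow, mul_one, Complex.norm_intCast] at h2
      have h3 : (1 : ℝ) ≤ |(g i : ℝ)| := by exact_mod_cast Int.one_le_abs hgi
      have h4 : 1 - η ≤ ‖cv X.S (f b)‖ := by linarith
      have h5 : X.N * (1 - η) ≤ X.N * ‖cv X.S (f b)‖ := by gcongr
      have h6 : (2 : ℝ) ≤ X.N := by
        have := hX.N_eq
        have := hX.n_pos
        have : 2 ≤ X.N := by omega
        exact_mod_cast this
      nlinarith
    exact ⟨hbs, (hdecs b hbs).2.2.2 i (g i) (hg i his).1 (hg i his).2 hgi (h1.trans hη)⟩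
  have hlen : (l.filter (Heavy X)).length = s.toFinset.card := by
    rw [hsl, List.length_map, List.toFinset_card_of_nodup hsn]
  refine ⟨?_, fun hB => ?_⟩
  · rw [hlen]
    refine card_le_of_buckets (g := g) (p := p) fun b hb => ?_
    obtain ⟨i, hi⟩ := hne b (List.mem_toFinset.1 hb)
    exact ⟨i, (Finset.mem_filter.1 hi).1, hi⟩
  have hnew : (l.filter (Heavy X)).map (fun z => (decodeT X z).val) = s.map dec := by
    rw [hsl, List.map_map]
    rfl
  rw [hnew]
  refine ⟨?_, ?_, ?_, ?_, ?_⟩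
  · intro a ha
    obtain ⟨b, hb, rfl⟩ := List.mem_map.1 ha
    exact ⟨(hdecs b hb).1, (hdecs b hb).2.1⟩
  · have h1 : listNorm (s.map dec) = ∑ b ∈ s.toFinset, |(dec b).2| := by
      rw [listNorm, List.map_map, List.sum_toFinset _ hsn]
      rfl
    have h2 : ((listNorm (s.map dec) : ℤ) : ℝ) ≤ 3 * (vecNorm g : ℝ) := by
      rw [h1, vecNorm_cast, ← sum_bucket g hp, Finset.mul_sum]
      push_cast
      calc ∑ b ∈ s.toFinset, |((dec b).2 : ℝ)|
          ≤ ∑ b ∈ s.toFinset, 3 * ∑ j ∈ bucket g p b, |(g j : ℝ)| := by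
            refine Finset.sum_le_sum fun b hb => ?_
            rw [List.mem_toFinset] at hb
            have h3 := (hdecs b hb).2.2.1
            have h4 := hheavy b hb
            have h5 := happ b ((hmem b).1 hb).1
            have h6 := norm_le_norm_add_norm_sub' (cv X.S (f b)) (hashHom X.N p b g)
            have h7 := norm_hashHom_le X.N p b g
            linarith
        _ ≤ _ := by
            refine Finset.sum_le_sum_of_subset_of_nonneg (fun b hb => ?_) fun b _ _ => by positivity
            exact Finset.mem_range.2 ((hmem b).1 (List.mem_toFinset.1 hb)).1
    exact_mod_cast h2
  · rw [List.length_map, ← List.toFinset_card_of_nodup hsn, ← hlen]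
    exact hB
  · intro i hi hni
    have h1 := Int.emod_lt_of_pos i (b := (p : ℤ)) (by omega)
    have h2 := Int.emod_nonneg i (b := (p : ℤ)) (by omega)
    obtain ⟨h3, h4⟩ := hiso (i % (p : ℤ)).toNat (by omega) i
      (Finset.mem_filter.2 ⟨hi, by omega⟩) hni
    exact List.mem_map.2 ⟨_, h3, h4⟩
  · rw [List.countP_map, List.countP_eq_length_filter, ← List.toFinset_card_of_nodup (hsn.filter _)]
    refine card_le_of_buckets (g := g) (p := p) fun b hb => ?_
    rw [List.mem_toFinset, List.mem_filter] at hb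
    obtain ⟨i, hi⟩ := hne b hb.1
    refine ⟨i, ?_, hi⟩
    by_contra hni
    have h1 := (hiso b ((hmem b).1 hb.1).1 i hi hni).2
    have h2 := hb.2
    simp only [Function.comp, h1, IsEntry, decide_eq_true_eq] at h2
    exact h2 ⟨trivial, Finsupp.mem_support_iff.1 (Finset.mem_filter.1 hi).1⟩

theorem heavies_runs (l : List (ℤ × ℤ)) (hl : ∀ z ∈ l, SmallC D X.W z) :
    Runs (heavies X l) (l.length * (unitCost D + 1) + 1) (fun r => r = l.filter (Heavy X)) := by
  have hM := hX.machine
  induction l with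
  | nil => exact ⟨rfl, by simp [heavies]⟩
  | cons z l ih =>
    have hz := hl z (by simp)
    have hS := hX.small_S
    have hN := hX.small_N
    refine Runs.mono (Runs.tick_bind (Runs.bind (leT_runs hM _ _ ⟨hS, hS⟩
      ⟨⟨hN, hN⟩, ⟨hz.1, hz.1⟩, hz.2, hz.2⟩) fun b hb => Runs.bind (t' := 0)
        (ih fun z hz => hl z (by simp [hz])) fun r hr => Runs.pure ?_)) ?_
    · rw [hb, hr, List.filter_cons]
      rfl
    · simp only [List.length_cons, add_mul]
      omega

/-- If the support has at most B elements, the test on the number of heavy buckets succeeds. The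
same test keeps the time under control on all outcomes, since at most B buckets are ever decoded. -/
theorem repetition_runs {p : ℕ} (hp : 1 ≤ p)
    (hpA : 4 * (p : ℝ) ≤ A) (xs ys ws : List (ℤ × ℤ)) (hx : InRange X.N xs) (hy : InRange X.N ys)
    (hw : InRange X.N ws) (hxA : (listNorm xs : ℝ) ≤ A) (hyA : (listNorm ys : ℝ) ≤ A)
    (hwA : (listNorm ws : ℝ) ≤ A)
    (hg : ∀ i ∈ (prodVec xs ys - listVec ws).support, 0 ≤ i ∧ i < X.N)
    (hgA : (vecNorm (prodVec xs ys - listVec ws) : ℝ) ≤ A ^ 4) (B : ℕ) (hB : (B : ℝ) ≤ A) :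
    Runs (repetition X xs ys ws B p)
      ((xs.length + ys.length + ws.length + 4) * ((X.terms + 1) * (13 * unitCost D)) +
        (Nat.clog 2 (2 * p) + 1) * 2 ^ Nat.clog 2 (2 * p) * (94 * unitCost (D + 1)) +
        B * ((D * X.W + 1) * (7 * unitCost (D + 3)) +
          (X.len + 6) * ((X.terms + 1) * (20 * unitCost D))))
      (fun r => ((prodVec xs ys - listVec ws).support.card ≤ B → r ≠ none) ∧
        ∀ new, r = some new → Records X.N B (prodVec xs ys - listVec ws) p new) := by
  have hM := hX.machine
  have hA1 := hX.one_le_A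
  have hA0 := hX.A_pos
  set g := prodVec xs ys - listVec ws with hgdef
  have hη : 17 * A ^ 9 * X.tau ≤ 1 / A ^ 4 := by
    rw [le_div_iff₀ (by positivity)]
    have h1 := hX.mul_tau_le (k := 14) (by norm_num)
    have h2 : (17 : ℝ) * A ^ 13 ≤ A ^ 14 := hX.mul_pow_le (by norm_num) 13
    have h3 := hX.tau_pos
    calc 17 * A ^ 9 * X.tau * A ^ 4 = (17 * A ^ 13) * X.tau := by ring
      _ ≤ A ^ 14 * X.tau := by gcongr
      _ ≤ 1 := by linarith
  set T1 := (xs.length + ys.length + ws.length + 4) * ((X.terms + 1) * (13 * unitCost D)) with hT1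
  set P2 := 2 ^ Nat.clog 2 (2 * p) with hP2
  have hP : 2 * p ≤ P2 := Nat.le_pow_clog (by norm_num) _
  set Td := (D * X.W + 1) * (7 * unitCost (D + 3)) +
        (X.len + 5) * ((X.terms + 1) * (20 * unitCost D)) with hTd
  refine Runs.mono (t := (T1 + (Nat.clog 2 (2 * p) + 1) * P2 * (90 * unitCost (D + 1))) +
    ((p * (unitCost D + 1) + 1) + ((p + 1) + (unitCost D + (B * (Td + 1) + 1))))) ?_ ?_
  · refine Runs.bind (hashT_runs hX hp hpA xs ys ws hx hy hw hxA hyA hwA) fun l hl => ?_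
    have hrec := records_of_approx hX hp (B := B) hl hη hg hgA
    refine Runs.bind ((heavies_runs hX l fun z hz => hX.smallC_of_approx hl
      (F := A ^ 4) (j := 5) (fun b _ => (norm_hashHom_le_vecNorm _ _ _ _).trans hgA) (by norm_num)
      ?_ hz).mono (by rw [hl.1])) fun hs hhs => ?_
    · have h4 : (2 : ℝ) * A ^ 4 ≤ A ^ 5 := hX.mul_pow_le (by norm_num) 4
      have h5 : 1 / A ^ 4 ≤ 1 := by
        rw [div_le_one (by positivity)]
        exact one_le_pow₀ hA1
      have h6 : 1 ≤ A ^ 4 := one_le_pow₀ hA1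
      linarith
    have hlen : hs.length ≤ p := by
      rw [hhs, ← hl.1]
      exact List.length_filter_le _ _
    refine Runs.bind ((lengthT_runs hs).mono (by omega)) fun k hk => ?_
    have hsk : Small D X.W k := by
      refine hX.small_of_le_A ?_
      rw [hk]
      have : ((hs.length : ℤ) : ℝ) ≤ p := by exact_mod_cast hlen
      rw [abs_of_nonneg (by positivity)]
      have : (0 : ℝ) ≤ p := by positivity
      linarith
    have hsB : Small D X.W B := by
      refine hX.small_of_le_A ?_
      rw [Int.cast_natCast, abs_of_nonneg (by positivity)]
      exact hB
    refine Runs.bind (leT_runs hM _ _ hsk hsB) fun b hb => ?_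
    simp only [Exp.eval_lit, hk] at hb
    refine Runs.ite (fun hbt => ?_) (fun hbf => ?_)
    · have hkB : (hs.length : ℤ) ≤ B := by
        rw [hb] at hbt
        exact of_decide_eq_true hbt
      refine Runs.mono (t := (B * (Td + 1) + 1) + 0) ?_ (by omega)
      refine Runs.bind (P := fun r => r = hs.map fun z => (decodeT X z).val)
        ⟨mapT_val _ _, ?_⟩ fun r hr => Runs.pure ⟨fun _ => by simp, ?_⟩
      · refine (mapT_time _ _ Td fun z hz => ?_).trans ?_
        · rw [hhs, List.mem_filter] at hz
          refine (decodeT_runs hX ?_ (of_decide_eq_true hz.2)).2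
          obtain ⟨i, hi, rfl⟩ := exists_getD_of_mem hz.1
          refine (hl.norm_le (hl.1 ▸ hi) ((norm_hashHom_le_vecNorm _ _ _ _).trans hgA)).trans ?_
          have h4 : (2 : ℝ) * A ^ 4 ≤ A ^ 5 := hX.mul_pow_le (by norm_num) 4
          have h5 : 1 / A ^ 4 ≤ 1 := by
            rw [div_le_one (by positivity)]
            exact one_le_pow₀ hA1
          have h6 : 1 ≤ A ^ 4 := one_le_pow₀ hA1
          linarith
        · have : hs.length ≤ B := by exact_mod_cast hkB
          gcongr
      · rintro new ⟨⟩
        rw [hr, hhs]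
        exact hrec.2 (by rw [← hhs]; exact hkB)
    · refine Runs.mono (t := 0) (Runs.pure ⟨fun h => ?_, by simp⟩) (by omega)
      rw [hb] at hbf
      have := of_decide_eq_false hbf
      have h1 := hrec.1
      rw [← hhs] at h1
      have h2 : hs.length ≤ B := h1.trans h
      omega
  · have h1 := one_le_unitCost D
    have h2 : unitCost D ≤ unitCost (D + 1) := unitCost_mono (by omega)
    clear_value Td T1
    generalize unitCost D = U at *
    generalize unitCost (D + 1) = U' at *
    generalize unitCost (D + 3) = U'' at *
    have e1 : (X.len + 6) * ((X.terms + 1) * (20 * U)) =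
      (X.len + 5) * ((X.terms + 1) * (20 * U)) + (X.terms + 1) * (20 * U) := by ring
    have e2 : 1 ≤ (X.terms + 1) * (20 * U) := Nat.mul_pos (by omega) (by omega)
    rw [e1]
    have e3 : B * (Td + 1) ≤ B * ((D * X.W + 1) * (7 * U'') +
          ((X.len + 5) * ((X.terms + 1) * (20 * U)) + (X.terms + 1) * (20 * U))) := by
      refine Nat.mul_le_mul_left B ?_
      linarith
    have e4 : p * (U + 1) ≤ P2 * U' := by
      calc p * (U + 1) ≤ p * (2 * U) := by gcongr; omega
        _ = (2 * p) * U := by ring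
        _ ≤ _ := by gcongr
    have e5 : P2 * U' ≤ (Nat.clog 2 (2 * p) + 1) * P2 * U' := by
      rw [mul_assoc]
      exact Nat.le_mul_of_pos_left _ (by omega)
    have e6 : 2 * p * U' ≤ P2 * U' := by gcongr
    have e7 : p * U' ≥ p := Nat.le_mul_of_pos_right _ (by omega)
    have e8 : p * U' ≥ U' := Nat.le_mul_of_pos_left _ (by omega)
    have e9 : (Nat.clog 2 (2 * p) + 1) * P2 * (94 * U') =
      (Nat.clog 2 (2 * p) + 1) * P2 * (90 * U') + 4 * ((Nat.clog 2 (2 * p) + 1) * P2 * U') := by ring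
    rw [e9]
    generalize (Nat.clog 2 (2 * p) + 1) * P2 * U' = Q at *
    linarith

end

/-! ### Sorting -/

@[simp] theorem leT_val_iff (W : ℕ) (a b : Exp) : (leT W a b).val = true ↔ a.eval ≤ b.eval :=
  decide_eq_true_iff

@[simp] theorem eqT_val_iff (W : ℕ) (a b : Exp) : (eqT W a b).val = true ↔ a.eval = b.eval :=
  decide_eq_true_iff

@[simp] theorem ev_val (W : ℕ) (e : Exp) : (ev W e).val = e.eval := rfl

/-- The lexicographic order on pairs. -/
def PairLE (a b : ℤ × ℤ) : Prop := a.1 < b.1 ∨ a.1 = b.1 ∧ a.2 ≤ b.2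

theorem PairLE.trans {a b c : ℤ × ℤ} (h : PairLE a b) (h' : PairLE b c) : PairLE a c := by
  unfold PairLE at *
  omega

theorem PairLE.total (a b : ℤ × ℤ) : PairLE a b ∨ PairLE b a := by
  unfold PairLE
  omega

theorem PairLE.antisymm {a b : ℤ × ℤ} (h : PairLE a b) (h' : PairLE b a) : a = b := by
  unfold PairLE at *
  ext <;> omega

theorem lePair_val (W : ℕ) (a b : ℤ × ℤ) : (lePair W a b).val = true ↔ PairLE a b := by
  unfold lePair PairLE
  rw [bind_val]
  by_cases h : a.1 = b.1
  · rw [if_pos ((eqT_val_iff W (.lit a.1) (.lit b.1)).2 h)]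
    simp [h]
  · rw [if_neg (fun h' => h ((eqT_val_iff W (.lit a.1) (.lit b.1)).1 h'))]
    simp only [leT_val_iff, Exp.eval_lit]
    omega

section
variable {D W : ℕ} (hM : Machine D W)
include hM

theorem lePair_time {a b : ℤ × ℤ} (ha : SmallC D W a) (hb : SmallC D W b) :
    (lePair W a b).time ≤ 2 * unitCost D := by
  have h : Runs (lePair W a b) (unitCost D + unitCost D) (fun _ => True) :=
    Runs.bind (eqT_runs hM _ _ ha.1 hb.1) fun e _ => Runs.ite
      (fun _ => (leT_runs hM (.lit _) (.lit _) ha.2 hb.2).imp fun _ _ => trivial)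
      (fun _ => (leT_runs hM (.lit _) (.lit _) ha.1 hb.1).imp fun _ _ => trivial)
  have := h.2
  omega

theorem mergeT_time (k l : List (ℤ × ℤ)) (hk : ∀ a ∈ k, SmallC D W a)
    (hl : ∀ a ∈ l, SmallC D W a) :
    (mergeT W k l).time ≤ (k.length + l.length + 1) * (2 * unitCost D + 1) := by
  induction k, l using mergeT.induct with
  | case1 l =>
    rw [mergeT]
    simp only [bind_time, tick_time, pure_time]
    exact Nat.mul_pos (by omega) (by omega)
  | case2 k h =>
    rw [mergeT]
    · simp only [bind_time, tick_time, pure_time]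
      exact Nat.mul_pos (by omega) (by omega)
    · exact h
  | case3 a k b l ih1 ih2 =>
    rw [mergeT]
    have h1 := lePair_time hM (hk a (by simp)) (hl b (by simp))
    simp only [bind_time, tick_time]
    split_ifs with h
    · have := ih1 (fun x hx => hk x (by simp [hx])) hl
      simp only [bind_time, pure_time, List.length_cons, add_mul] at this ⊢
      omega
    · have := ih2 hk (fun x hx => hl x (by simp [hx]))
      simp only [bind_time, pure_time, List.length_cons, add_mul] at this ⊢
      omega

end

theorem mergeT_perm (W : ℕ) (k l : List (ℤ × ℤ)) : (mergeT W k l).val.Perm (k ++ l) := by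
  induction k, l using mergeT.induct with
  | case1 l =>
    rw [mergeT]
    exact List.Perm.refl _
  | case2 k h =>
    rw [mergeT]
    · simp
    · exact h
  | case3 a k b l ih1 ih2 =>
    rw [mergeT]
    simp only [bind_val]
    split_ifs with h
    · exact ih1.cons a
    · exact (ih2.cons b).trans List.perm_middle.symm

theorem mergeT_sorted (W : ℕ) (k l : List (ℤ × ℤ)) (hk : k.Pairwise PairLE)
    (hl : l.Pairwise PairLE) : (mergeT W k l).val.Pairwise PairLE := by
  induction k, l using mergeT.induct with
  | case1 l =>
    rw [mergeT]
    exact hl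
  | case2 k h =>
    rw [mergeT]
    · exact hk
    · exact h
  | case3 a k b l ih1 ih2 =>
    rw [mergeT]
    simp only [bind_val]
    split_ifs with h
    · rw [lePair_val] at h
      refine List.Pairwise.cons (fun x hx => ?_) (ih1 hk.of_cons hl)
      rw [(mergeT_perm W _ _).mem_iff, List.mem_append, List.mem_cons] at hx
      rcases hx with hx | rfl | hx
      · exact List.rel_of_pairwise_cons hk hx
      · exact h
      · exact h.trans (List.rel_of_pairwise_cons hl hx)
    · rw [lePair_val] at h
      replace h := (PairLE.total a b).resolve_left h
      refine List.Pairwise.cons (fun x hx => ?_) (ih2 hk hl.of_cons)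
      rw [(mergeT_perm W _ _).mem_iff, List.mem_append, List.mem_cons] at hx
      rcases hx with (rfl | hx) | hx
      · exact h
      · exact h.trans (List.rel_of_pairwise_cons hk hx)
      · exact List.rel_of_pairwise_cons hl hx

theorem msort_perm (W d : ℕ) (l : List (ℤ × ℤ)) : (msort W d l).val.Perm l := by
  induction d generalizing l with
  | zero => exact List.Perm.refl _
  | succ d ih =>
    rw [msort]
    simp only [bind_val]
    exact (mergeT_perm _ _ _).trans (((ih _).append (ih _)).trans (splitT_perm l))

theorem msort_sorted (W d : ℕ) (l : List (ℤ × ℤ)) (hl : l.length ≤ 2 ^ d) :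
    (msort W d l).val.Pairwise PairLE := by
  induction d generalizing l with
  | zero =>
    match l, hl with
    | [], _ => exact List.Pairwise.nil
    | [a], _ => exact List.pairwise_singleton _ _
  | succ d ih =>
    rw [msort]
    simp only [bind_val]
    have h := splitT_length l
    rw [pow_succ] at hl
    exact mergeT_sorted _ _ _ (ih _ (by omega)) (ih _ (by omega))

/-- The summand on the left closes the recursion: of the two units gained from the two halves, one
pays for the constant overhead of splitting and merging, and one is passed on. -/
theorem msort_time {D W : ℕ} (hM : Machine D W) (d : ℕ) (l : List (ℤ × ℤ))
    (hl : ∀ a ∈ l, SmallC D W a) :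
    (msort W d l).time + (2 * unitCost D + 2) ≤
      (d * l.length + 2 ^ (d + 1)) * (2 * unitCost D + 2) := by
  induction d generalizing l with
  | zero =>
    simp only [msort, bind_time, tick_time, pure_time]
    omega
  | succ d ih =>
    rw [msort]
    simp only [bind_time, splitT_time]
    have hp := splitT_perm l
    have h0 : (splitT l).val.1.length + (splitT l).val.2.length = l.length := by
      rw [← List.length_append, hp.length_eq]
    have hs1 : ∀ a ∈ (splitT l).val.1, SmallC D W a := fun a ha =>
      hl a (hp.mem_iff.1 (List.mem_append_left _ ha))
    have hs2 : ∀ a ∈ (splitT l).val.2, SmallC D W a := fun a ha =>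
      hl a (hp.mem_iff.1 (List.mem_append_right _ ha))
    have h1 := ih _ hs1
    have h2 := ih _ hs2
    have p1 := msort_perm W d (splitT l).val.1
    have p2 := msort_perm W d (splitT l).val.2
    have h3 := mergeT_time hM _ _ (fun a ha => hs1 a (p1.mem_iff.1 ha))
      (fun a ha => hs2 a (p2.mem_iff.1 ha))
    rw [p1.length_eq, p2.length_eq, h0] at h3
    have e : ((d + 1) * l.length + 2 ^ (d + 1 + 1)) * (2 * unitCost D + 2) =
        (d * (splitT l).val.1.length + 2 ^ (d + 1)) * (2 * unitCost D + 2) +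
        (d * (splitT l).val.2.length + 2 ^ (d + 1)) * (2 * unitCost D + 2) +
        l.length * (2 * unitCost D + 2) := by
      rw [← h0, pow_succ 2 (d + 1)]
      ring
    have e2 : (l.length + 1) * (2 * unitCost D + 1) + (l.length + 1) =
      l.length * (2 * unitCost D + 2) + (2 * unitCost D + 2) := by ring
    omega

/-! ### Pruning -/

/-- In a sorted list the copies of a pair are consecutive: a different successor shows that no copy
follows. -/
theorem PairLE.cons_notMem {a b : ℤ × ℤ} {l : List (ℤ × ℤ)} (h : (a :: b :: l).Pairwise PairLE)
    (hne : a ≠ b) : a ∉ b :: l := by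
  intro hm
  have h1 : PairLE a b := List.rel_of_pairwise_cons h (by simp)
  rcases List.mem_cons.1 hm with h2 | h2
  · exact hne h2
  · exact hne (h1.antisymm (List.rel_of_pairwise_cons h.of_cons h2))

/-- Because equal pairs are consecutive, the run counted in `cnt` ends only when all copies of `cur`
have been seen; so the threshold is applied to the total number of occurrences. -/
theorem prune_spec (W : ℕ) (m : ℤ) (cur : ℤ × ℤ) (cnt : ℕ) (l : List (ℤ × ℤ))
    (hs : (cur :: l).Pairwise PairLE) :
    (prune W m cur cnt l).val.Pairwise (fun a b => PairLE a b ∧ a ≠ b) ∧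
    ∀ x, x ∈ (prune W m cur cnt l).val ↔ (x = cur ∨ x ∈ l) ∧
      3 * (5 * m) ≤ 4 * ((l.count x + if x = cur then cnt else 0 : ℕ) : ℤ) := by
  induction l generalizing cur cnt with
  | nil =>
    rw [prune]
    simp only [bind_val, pure_val, leT_val_iff, Exp.eval_mul, Exp.eval_three, Exp.eval_five,
      Exp.eval_four, Exp.eval_lit]
    constructor
    · split_ifs <;> simp
    · intro x
      by_cases hx : x = cur <;> split_ifs with h1 <;> simp [hx, h1]
  | cons a l ih =>
    by_cases hca : cur = a
    · subst hca
      have hv : (prune W m cur cnt (cur :: l)).val = (prune W m cur ((cnt + 1 : ℕ) : ℤ) l).val := by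
        rw [prune]
        simp
      rw [hv]
      obtain ⟨h1, h2⟩ := ih cur (cnt + 1) (hs.of_cons)
      refine ⟨h1, fun x => ?_⟩
      rw [h2 x, List.count_cons, List.mem_cons]
      by_cases hx : x = cur
      · subst hx
        simp only [true_or, beq_self_eq_true, if_true, true_and]
        rw [add_assoc, add_comm 1 cnt]
      · have : ¬ cur = x := fun h => hx h.symm
        simp [hx, this]
    · have hv : (prune W m cur cnt (a :: l)).val = if 3 * (5 * m) ≤ 4 * (cnt : ℤ) then
          cur :: (prune W m a ((1 : ℕ) : ℤ) l).val else (prune W m a ((1 : ℕ) : ℤ) l).val := by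
        have hne : ¬ (cur.1 = a.1 ∧ cur.2 = a.2) := fun h => hca (Prod.ext h.1 h.2)
        rw [prune]
        simp [hne]
      obtain ⟨h1, h2⟩ := ih a 1 hs.of_cons
      have hnm := PairLE.cons_notMem hs hca
      have hcount : (a :: l).count cur = 0 := List.count_eq_zero.2 hnm
      have hx2 : ∀ x, x ∈ (prune W m a ((1 : ℕ) : ℤ) l).val ↔ x ∈ a :: l ∧
          3 * (5 * m) ≤ 4 * (((a :: l).count x : ℕ) : ℤ) := by
        intro x
        rw [h2, List.mem_cons, List.count_cons]
        simp only [beq_iff_eq, eq_comm (a := x) (b := a)]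
      rw [hv]
      have hmem : ∀ x ≠ cur, (x ∈ (prune W m a ((1 : ℕ) : ℤ) l).val ↔ (x = cur ∨ x ∈ a :: l) ∧
          3 * (5 * m) ≤ 4 * (((a :: l).count x + if x = cur then cnt else 0 : ℕ) : ℤ)) := by
        intro x hx
        rw [hx2]
        simp [hx]
      split_ifs with hc
      · refine ⟨List.Pairwise.cons (fun x hx => ?_) h1, fun x => ?_⟩
        · have := ((hx2 x).1 hx).1
          refine ⟨List.rel_of_pairwise_cons hs this, ?_⟩
          rintro rfl
          exact hnm this
        · by_cases hx : x = cur
          · subst hx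
            simp [hcount, hc]
          · rw [List.mem_cons, ← hmem x hx]
            simp [hx]
      · refine ⟨h1, fun x => ?_⟩
        by_cases hx : x = cur
        · subst hx
          rw [hx2]
          simp [hcount, hc, hnm]
        · exact hmem x hx

theorem prune_time {D W : ℕ} (hM : Machine D W) {m : ℤ} (hm : Small D W m) (cur : ℤ × ℤ)
    (cnt : ℕ) (l : List (ℤ × ℤ)) (hcur : SmallC D W cur) (hl : ∀ a ∈ l, SmallC D W a)
    (hcnt : Small D W ((cnt + l.length : ℕ) : ℤ)) (h1 : Small D W ((1 + l.length : ℕ) : ℤ)) :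
    (prune W m cur cnt l).time ≤ (l.length + 1) * (3 * unitCost D + 1) := by
  have hc0 : Small D W (cnt : ℤ) := hcnt.of_nonneg_le (by positivity) (by push_cast; omega)
  have hle : (leT W (3 * (5 * m)) (4 * (cnt : ℤ))).time ≤ unitCost D :=
    (leT_runs hM (3 * (5 * Exp.lit m)) (4 * Exp.lit (cnt : ℤ)) ⟨hM.small_three, hM.small_five, hm⟩
      ⟨hM.small_four, hc0⟩).2
  induction l generalizing cur cnt with
  | nil =>
    rw [prune]
    simp only [bind_time, tick_time, pure_time, List.length_nil]
    omega
  | cons a l ih =>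
    have ha := hl a (by simp)
    have e1 : (eqT W cur.1 a.1).time ≤ unitCost D := (eqT_runs hM (.lit _) (.lit _) hcur.1 ha.1).2
    have e2 : (eqT W cur.2 a.2).time ≤ unitCost D := (eqT_runs hM (.lit _) (.lit _) hcur.2 ha.2).2
    have hl' : ∀ a ∈ l, SmallC D W a := fun x hx => hl x (by simp [hx])
    have h1' : Small D W ((1 + l.length : ℕ) : ℤ) :=
      h1.of_nonneg_le (by positivity) (by simp)
    have key : ∀ cur' (cnt' : ℕ), SmallC D W cur' → Small D W ((cnt' + l.length : ℕ) : ℤ) →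
        (prune W m cur' cnt' l).time ≤ (l.length + 1) * (3 * unitCost D + 1) := by
      intro cur' cnt' hcur' hcnt'
      have hc0' : Small D W (cnt' : ℤ) := hcnt'.of_nonneg_le (by positivity) (by push_cast; omega)
      exact ih cur' cnt' hcur' hl' hcnt' h1' hc0'
        (leT_runs hM (3 * (5 * Exp.lit m)) (4 * Exp.lit (cnt' : ℤ)) ⟨hM.small_three, hM.small_five, hm⟩
          ⟨hM.small_four, hc0'⟩).2
    have k2 := key a 1 ha h1'
    have k1 := key cur (cnt + 1) hcur (hcnt.of_nonneg_le (by positivity) (by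
      push_cast [List.length_cons]; omega))
    have e3 : (ev W (Exp.lit (cnt : ℤ) + 1)).time ≤ unitCost D :=
      (ev_runs hM (Exp.lit (cnt : ℤ) + 1) ⟨hc0, hM.small_one⟩).2
    rw [prune]
    simp only [bind_time, tick_time, List.length_cons, add_mul]
    split_ifs with hb
    · have h5 : (ev W (Exp.lit (cnt : ℤ) + 1)).val = ((cnt + 1 : ℕ) : ℤ) := by simp [ev]
      simp only [bind_time]
      rw [h5]
      simp only [add_mul] at k1
      omega
    · simp only [bind_time, pure_time]
      have h6 : prune W m a 1 l = prune W m a ((1 : ℕ) : ℤ) l := rfl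
      rw [h6]
      simp only [add_mul] at k2
      omega

/-- The indices of a list of pairs are strictly increasing. -/
def IndexSorted (L : List (ℤ × ℤ)) : Prop := L.Pairwise fun a b => a.1 < b.1

/-- Several values may survive pruning at one index. What is used later is that every surviving
index keeps exactly one of its pairs, whichever it is. -/
theorem assign_spec (W : ℕ) (l : List (ℤ × ℤ)) (hs : l.Pairwise fun a b => PairLE a b ∧ a ≠ b) :
    IndexSorted (assign W l).val ∧ (assign W l).val.Sublist l ∧
    ∀ a ∈ l, ∃ b ∈ (assign W l).val, b.1 = a.1 := by
  induction l using assign.induct with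
  | case1 => simp [assign, IndexSorted]
  | case2 a => simp [assign, IndexSorted]
  | case3 a b l ih =>
    obtain ⟨h1, h2, h3⟩ := ih hs.of_cons
    rw [assign]
    simp only [bind_val, pure_val, eqT_val_iff, Exp.eval_lit]
    split_ifs with hab
    · refine ⟨h1, h2.cons a, fun x hx => ?_⟩
      rcases List.mem_cons.1 hx with rfl | hx
      · obtain ⟨c, hc, hc'⟩ := h3 b (by simp)
        exact ⟨c, hc, hc'.trans hab.symm⟩
      · exact h3 x hx
    · refine ⟨List.Pairwise.cons (fun x hx => ?_) h1, h2.cons_cons a, fun x hx => ?_⟩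
      · have hab' : a.1 < b.1 := by
          have := (List.rel_of_pairwise_cons hs (show b ∈ b :: l by simp)).1
          unfold PairLE at this
          omega
        rcases List.mem_cons.1 (h2.subset hx) with rfl | hx'
        · exact hab'
        · have := (List.rel_of_pairwise_cons hs.of_cons hx').1
          unfold PairLE at this
          omega
      · rcases List.mem_cons.1 hx with rfl | hx
        · exact ⟨x, by simp, rfl⟩
        · obtain ⟨c, hc, hc'⟩ := h3 x hx
          exact ⟨c, by simp [hc], hc'⟩

theorem assign_time {D W : ℕ} (hM : Machine D W) (l : List (ℤ × ℤ))
    (hl : ∀ a ∈ l, SmallC D W a) : (assign W l).time ≤ (l.length + 1) * (unitCost D + 1) := by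
  induction l using assign.induct with
  | case1 => simp [assign]
  | case2 a =>
    simp only [assign, bind_time, tick_time, pure_time, List.length_singleton]
    omega
  | case3 a b l ih =>
    have h1 := ih fun x hx => hl x (by simp_all)
    have e1 : (eqT W a.1 b.1).time ≤ unitCost D :=
      (eqT_runs hM (.lit _) (.lit _) (hl a (by simp)).1 (hl b (by simp)).1).2
    rw [assign]
    simp only [bind_time, tick_time, pure_time, List.length_cons, add_mul] at h1 ⊢
    omega

/-! ### Adding sparse vectors -/

theorem IndexSorted.notMem_of_lt {a : ℤ × ℤ} {l : List (ℤ × ℤ)} (h : IndexSorted (a :: l))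
    {x : ℤ × ℤ} (hx : x ∈ l) : a.1 < x.1 := List.rel_of_pairwise_cons h hx

theorem listVec_append (k l : List (ℤ × ℤ)) : listVec (k ++ l) = listVec k + listVec l := by
  simp [listVec]

theorem addSparse_spec (W : ℕ) (k l : List (ℤ × ℤ)) (hk : IndexSorted k) (hl : IndexSorted l) :
    IndexSorted (addSparse W k l).val ∧ (∀ a ∈ (addSparse W k l).val, a.2 ≠ 0) ∧
    (∀ a ∈ (addSparse W k l).val, ∃ b ∈ k ++ l, b.1 = a.1) ∧
    (addSparse W k l).val.length ≤ k.length + l.length ∧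
    listVec (addSparse W k l).val = listVec k + listVec l := by
  -- All cases of the merge end alike: an entry with the smallest index is put in front, or dropped
  -- if it is zero.
  have step : ∀ (a : ℤ × ℤ) (r s : List (ℤ × ℤ)), (∀ x ∈ s, a.1 < x.1) →
      (IndexSorted r ∧ (∀ x ∈ r, x.2 ≠ 0) ∧ (∀ x ∈ r, ∃ b ∈ s, b.1 = x.1) ∧
        r.length ≤ s.length ∧ listVec r = listVec s) →
      (IndexSorted (if a.2 = 0 then r else a :: r) ∧
        (∀ x ∈ (if a.2 = 0 then r else a :: r), x.2 ≠ 0) ∧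
        (∀ x ∈ (if a.2 = 0 then r else a :: r), x.1 = a.1 ∨ ∃ b ∈ s, b.1 = x.1) ∧
        (if a.2 = 0 then r else a :: r).length ≤ s.length + 1 ∧
        listVec (if a.2 = 0 then r else a :: r) = Finsupp.single a.1 a.2 + listVec s) := by
    rintro a r s has ⟨h1, h2, h3, h4, h5⟩
    split_ifs with ha
    · exact ⟨h1, h2, fun x hx => Or.inr (h3 x hx), by omega, by simp [ha, h5]⟩
    · refine ⟨List.Pairwise.cons (fun x hx => ?_) h1, fun x hx => ?_, fun x hx => ?_, ?_, ?_⟩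
      · obtain ⟨b, hb, hb'⟩ := h3 x hx
        rw [← hb']
        exact has b hb
      · rcases List.mem_cons.1 hx with rfl | hx
        · exact ha
        · exact h2 x hx
      · rcases List.mem_cons.1 hx with rfl | hx
        · exact Or.inl rfl
        · exact Or.inr (h3 x hx)
      · simpa using h4
      · rw [listVec_cons, h5]
  induction k, l using addSparse.induct with
  | case1 => simp [addSparse, IndexSorted]
  | case2 a k ih =>
    have := step a _ (k ++ []) (fun x hx => hk.notMem_of_lt (by simpa using hx))
      (by simpa using ih hk.of_cons hl)
    rw [addSparse]
    simp only [bind_val, pure_val, eqT_val_iff, Exp.eval_lit, Exp.eval_zero]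
    refine ⟨this.1, this.2.1, fun x hx => ?_, ?_, ?_⟩
    · rcases this.2.2.1 x hx with h | ⟨b, hb, h⟩
      · exact ⟨a, by simp, h.symm⟩
      · exact ⟨b, by simp_all, h⟩
    · simpa using this.2.2.2.1
    · simpa using this.2.2.2.2
  | case3 b l ih =>
    have := step b _ l (fun x hx => hl.notMem_of_lt hx) (by simpa using ih hk hl.of_cons)
    rw [addSparse]
    simp only [bind_val, pure_val, eqT_val_iff, Exp.eval_lit, Exp.eval_zero]
    refine ⟨this.1, this.2.1, fun x hx => ?_, ?_, ?_⟩
    · rcases this.2.2.1 x hx with h | ⟨c, hc, h⟩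
      · exact ⟨b, by simp, h.symm⟩
      · exact ⟨c, by simp [hc], h⟩
    · simpa using this.2.2.2.1
    · simpa using this.2.2.2.2
  | case4 a k b l ih1 ih2 ih3 =>
    rw [addSparse]
    simp only [bind_val, eqT_val_iff, Exp.eval_lit]
    split_ifs with hab
    · have h := ih1 hk.of_cons hl.of_cons
      rw [← listVec_append, ← List.length_append] at h
      have := step (a.1, a.2 + b.2) _ (k ++ l) (fun x hx => ?_) h
      · simp only [bind_val, pure_val, eqT_val_iff, ev_val, Exp.eval_lit, Exp.eval_add,
          Exp.eval_zero] at this ⊢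
        refine ⟨this.1, this.2.1, fun x hx => ?_, ?_, ?_⟩
        · rcases this.2.2.1 x hx with h | ⟨c, hc, h⟩
          · exact ⟨a, by simp, h.symm⟩
          · refine ⟨c, ?_, h⟩
            rcases List.mem_append.1 hc with h | h <;> simp [h]
        · have := this.2.2.2.1
          simp only [List.length_append, List.length_cons] at this ⊢
          omega
        · rw [this.2.2.2.2, Finsupp.single_add, listVec_append, listVec_cons, listVec_cons, ← hab]
          abel
      · rcases List.mem_append.1 hx with h | h
        · exact hk.notMem_of_lt h
        · rw [hab]
          exact hl.notMem_of_lt h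
    rw [bind_val]
    simp only [leT_val_iff, Exp.eval_lit]
    split_ifs with hab'
    · have h := ih2 hk.of_cons hl
      rw [← listVec_append, ← List.length_append] at h
      have := step a _ (k ++ b :: l) (fun x hx => ?_) h
      · simp only [bind_val, pure_val, eqT_val_iff, Exp.eval_lit, Exp.eval_zero] at this ⊢
        refine ⟨this.1, this.2.1, fun x hx => ?_, ?_, ?_⟩
        · rcases this.2.2.1 x hx with h | ⟨c, hc, h⟩
          · exact ⟨a, by simp, h.symm⟩
          · exact ⟨c, by simp only [List.cons_append, List.mem_cons, hc, or_true], h⟩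
        · have := this.2.2.2.1
          simp only [List.length_append, List.length_cons] at this ⊢
          omega
        · rw [this.2.2.2.2, listVec_append, listVec_cons a]
          abel
      · rcases List.mem_append.1 hx with h | h
        · exact hk.notMem_of_lt h
        · rcases List.mem_cons.1 h with rfl | h
          · omega
          · have := hl.notMem_of_lt h
            omega
    · have h := ih3 hk hl.of_cons
      rw [← listVec_append, ← List.length_append] at h
      have := step b _ (a :: k ++ l) (fun x hx => ?_) h
      · simp only [bind_val, pure_val, eqT_val_iff, Exp.eval_lit, Exp.eval_zero] at this ⊢
        refine ⟨this.1, this.2.1, fun x hx => ?_, ?_, ?_⟩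
        · rcases this.2.2.1 x hx with h | ⟨c, hc, h⟩
          · exact ⟨b, by simp, h.symm⟩
          · refine ⟨c, ?_, h⟩
            rcases List.mem_append.1 hc with h | h
            · exact List.mem_append_left _ h
            · exact List.mem_append_right _ (List.mem_cons_of_mem _ h)
        · have := this.2.2.2.1
          simp only [List.length_append, List.length_cons] at this ⊢
          omega
        · rw [this.2.2.2.2, listVec_append, listVec_cons b]
          abel
      · rcases List.mem_append.1 hx with h | h
        · rcases List.mem_cons.1 h with rfl | h
          · omega
          · have := hk.notMem_of_lt h
            omega
        · exact hl.notMem_of_lt h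

theorem addSparse_time {D W : ℕ} (hM : Machine D W) (k l : List (ℤ × ℤ))
    (hk : ∀ a ∈ k, SmallC D W a) (hl : ∀ a ∈ l, SmallC D W a) :
    (addSparse W k l).time ≤ (k.length + l.length + 1) * (4 * unitCost (D + 1) + 1) := by
  have hM' : Machine (D + 1) W := hM.mono (by omega)
  have hk' : ∀ a ∈ k, SmallC (D + 1) W a := fun a ha =>
    ⟨(hk a ha).1.mono (by omega), (hk a ha).2.mono (by omega)⟩
  have hl' : ∀ a ∈ l, SmallC (D + 1) W a := fun a ha =>
    ⟨(hl a ha).1.mono (by omega), (hl a ha).2.mono (by omega)⟩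
  have hz : ∀ a, Small (D + 1) W a → (eqT W a 0).time ≤ unitCost (D + 1) := fun a ha =>
    (eqT_runs hM' (.lit _) 0 ha hM'.small_zero).2
  induction k, l using addSparse.induct with
  | case1 => simp [addSparse]
  | case2 a k ih =>
    have h1 := ih (fun x hx => hk x (by simp [hx])) hl (fun x hx => hk' x (by simp [hx])) hl'
    have h2 := hz a.2 (hk' a (by simp)).2
    rw [addSparse]
    simp only [bind_time, tick_time, pure_time, List.length_cons, List.length_nil, add_mul] at h1 ⊢
    omega
  | case3 b l ih =>
    have h1 := ih hk (fun x hx => hl x (by simp [hx])) hk' (fun x hx => hl' x (by simp [hx]))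
    have h2 := hz b.2 (hl' b (by simp)).2
    rw [addSparse]
    simp only [bind_time, tick_time, pure_time, List.length_cons, List.length_nil, add_mul] at h1 ⊢
    omega
  | case4 a k b l ih1 ih2 ih3 =>
    have ha := hk' a (by simp)
    have hb := hl' b (by simp)
    have e1 : (eqT W a.1 b.1).time ≤ unitCost (D + 1) := (eqT_runs hM' (.lit _) (.lit _) ha.1 hb.1).2
    have e2 : (leT W a.1 b.1).time ≤ unitCost (D + 1) := (leT_runs hM' (.lit _) (.lit _) ha.1 hb.1).2
    have e3 : (ev W (Exp.lit a.2 + Exp.lit b.2)).time ≤ unitCost (D + 1) :=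
      (ev_runs hM' (Exp.lit a.2 + Exp.lit b.2) ⟨ha.2, hb.2⟩).2
    have ha2 := hz a.2 ha.2
    have hb2 := hz b.2 hb.2
    have hsum : Small (D + 1) W (a.2 + b.2) := by
      have h1 := (hk a (by simp)).2
      have h2 := (hl b (by simp)).2
      unfold Small at h1 h2 ⊢
      have h3 : 2 * 2 ^ (D * W) ≤ 2 ^ ((D + 1) * W) := by
        rw [← pow_succ']
        refine Nat.pow_le_pow_right (by norm_num) ?_
        rw [add_mul]
        have := hM.1
        omega
      omega
    have hs2 := hz _ hsum
    have h1 := ih1 (fun x hx => hk x (by simp [hx])) (fun x hx => hl x (by simp [hx]))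
      (fun x hx => hk' x (by simp [hx])) (fun x hx => hl' x (by simp [hx]))
    have h2 := ih2 (fun x hx => hk x (by simp [hx])) hl (fun x hx => hk' x (by simp [hx])) hl'
    have h3 := ih3 hk (fun x hx => hl x (by simp [hx])) hk' (fun x hx => hl' x (by simp [hx]))
    rw [addSparse]
    have hval : (ev W (Exp.lit a.2 + Exp.lit b.2)).val = a.2 + b.2 := rfl
    simp only [bind_time, tick_time]
    split_ifs with hab
    · simp only [bind_time, pure_time, hval, List.length_cons, add_mul] at h1 ⊢
      omega
    rw [bind_time]
    split_ifs with hab'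
    · simp only [bind_time, pure_time, List.length_cons, add_mul] at h2 ⊢
      omega
    · simp only [bind_time, pure_time, List.length_cons, add_mul] at h3 ⊢
      omega

/-! ### Lists sorted by index -/

theorem IndexSorted.nodup {L : List (ℤ × ℤ)} (h : IndexSorted L) : L.Nodup :=
  h.imp fun {a b} hab he => by rw [he] at hab; exact lt_irrefl _ hab

theorem IndexSorted.nodup_map_fst {L : List (ℤ × ℤ)} (h : IndexSorted L) :
    (L.map Prod.fst).Nodup :=
  List.pairwise_map.2 (h.imp fun {_ _} hab => hab.ne)

theorem listVec_apply_eq_zero {L : List (ℤ × ℤ)} {i : ℤ} (h : ∀ a ∈ L, a.1 ≠ i) :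
    listVec L i = 0 := by
  induction L with
  | nil => simp
  | cons a L ih =>
    rw [listVec_cons, Finsupp.add_apply, ih fun b hb => h b (by simp [hb]),
      Finsupp.single_apply, if_neg (h a (by simp)), add_zero]

theorem listVec_apply_of_mem {L : List (ℤ × ℤ)} (h : (L.map Prod.fst).Nodup) {i c : ℤ}
    (hm : (i, c) ∈ L) : listVec L i = c := by
  induction L with
  | nil => simp at hm
  | cons a L ih =>
    rw [List.map_cons, List.nodup_cons] at h
    rw [listVec_cons, Finsupp.add_apply, Finsupp.single_apply]
    rcases List.mem_cons.1 hm with rfl | hm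
    · rw [if_pos rfl, listVec_apply_eq_zero, add_zero]
      rintro b hb rfl
      exact h.1 (List.mem_map.2 ⟨_, hb, rfl⟩)
    · rw [if_neg, ih h.2 hm, zero_add]
      rintro rfl
      exact h.1 (List.mem_map.2 ⟨_, hm, rfl⟩)

theorem listVec_apply_ne_zero {L : List (ℤ × ℤ)} {i : ℤ} (h : listVec L i ≠ 0) :
    ∃ a ∈ L, a.1 = i := by
  by_contra h'
  push Not at h'
  exact h (listVec_apply_eq_zero h')

theorem vecNorm_listVec {L : List (ℤ × ℤ)} (h : (L.map Prod.fst).Nodup) :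
    vecNorm (listVec L) = listNorm L := by
  have h1 : (listVec L).support ⊆ (L.map Prod.fst).toFinset := by
    intro i hi
    obtain ⟨a, ha, rfl⟩ := listVec_apply_ne_zero (Finsupp.mem_support_iff.1 hi)
    rw [List.mem_toFinset]
    exact List.mem_map_of_mem ha
  rw [vecNorm_eq_sum h1, List.sum_toFinset _ h, List.map_map, listNorm]
  congr 1
  refine List.map_congr_left fun a ha => ?_
  simp only [Function.comp]
  rw [listVec_apply_of_mem h (c := a.2) ha]

/-- Each element of `z` uses up its occurrences in `L`. -/
theorem sum_count_mul_le {z : List (ℤ × ℤ)} (hz : z.Nodup) (L : List (ℤ × ℤ)) (f : ℤ × ℤ → ℤ)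
    (hf : ∀ a, 0 ≤ f a) : (z.map fun a => (L.count a : ℤ) * f a).sum ≤ (L.map f).sum := by
  rw [← List.sum_toFinset _ hz, Finset.sum_list_map_count]
  simp only [nsmul_eq_mul]
  rw [← Finset.sum_subset (Finset.inter_subset_left (s₂ := L.toFinset)) fun a ha h => ?_]
  · refine (Finset.sum_le_sum_of_subset_of_nonneg Finset.inter_subset_right
      fun a _ _ => mul_nonneg (Int.natCast_nonneg _) (hf a)).trans (le_of_eq ?_)
    refine Finset.sum_congr rfl fun a _ => ?_
    congr! 2
    congr 1
    exact lawful_beq_subsingleton _ _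
  · have hn : a ∉ L := fun hn => h (Finset.mem_inter.2 ⟨ha, List.mem_toFinset.2 hn⟩)
    rw [List.count_eq_zero.2 hn]
    simp

/-! ### From the records to the vector -/

theorem le_two_pow_log2up (W v : ℕ) : v ≤ 2 ^ (log2up W (v : ℤ)).val.1 := by
  rcases Nat.eq_zero_or_pos v with rfl | hv
  · positivity
  · rw [log2up_val W v (by exact_mod_cast hv)]
    exact Nat.le_pow_clog (by norm_num) _

/-- The threshold of three quarters of 5 m, in integers. The last clause speaks of the index only,
because another frequent value at the same index may win in `assign`. -/
theorem collect_spec (W : ℕ) (m : ℤ) (L : List (ℤ × ℤ)) :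
    IndexSorted (collect W m L).val ∧
    (∀ a ∈ (collect W m L).val, 15 * m ≤ 4 * (L.count a : ℤ)) ∧
    ∀ a ∈ L, 15 * m ≤ 4 * (L.count a : ℤ) → ∃ b ∈ (collect W m L).val, b.1 = a.1 := by
  have hv : (lengthT L).val = L.length := (lengthT_runs L).1
  have hd := le_two_pow_log2up W L.length
  have hp := msort_perm W (log2up W (L.length : ℤ)).val.1 L
  have hs := msort_sorted W _ L hd
  rw [collect]
  simp only [bind_val, hv]
  generalize (msort W (log2up W (L.length : ℤ)).val.1 L).val = s at hp hs
  cases s with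
  | nil =>
    have hL : L = [] := hp.symm.eq_nil
    subst hL
    simp [IndexSorted]
  | cons a l =>
    obtain ⟨h1, h2⟩ := prune_spec W m a 1 l hs
    simp only [Nat.cast_one] at h1 h2
    obtain ⟨h3, h4, h5⟩ := assign_spec W _ h1
    have h6 : ∀ x, x ∈ (prune W m a 1 l).val ↔ x ∈ L ∧ 15 * m ≤ 4 * (L.count x : ℤ) := by
      intro x
      rw [h2 x, ← hp.mem_iff, ← hp.count_eq, List.mem_cons, List.count_cons]
      simp only [beq_iff_eq, eq_comm (a := x) (b := a)]
      refine and_congr_right fun _ => ?_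
      constructor <;> intro h <;> linarith
    simp only [bind_val]
    refine ⟨h3, fun x hx => ((h6 x).1 (h4.subset hx)).2, fun x hx hc => ?_⟩
    obtain ⟨b, hb, hb'⟩ := h5 x ((h6 x).2 ⟨hx, hc⟩)
    exact ⟨b, hb, hb'⟩

theorem collect_time {D W : ℕ} (hM : Machine D W) {m : ℕ} (hm : Small D W (m : ℤ))
    (L : List (ℤ × ℤ)) (hL : ∀ a ∈ L, SmallC D W a) (hlen : Small D W (L.length : ℤ)) :
    (collect W (m : ℤ) L).time ≤
      (L.length + 1) * ((Nat.clog 2 L.length + 1) * (30 * unitCost (D + 1))) := by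
  have hU := one_le_unitCost D
  have hUU : unitCost D ≤ unitCost (D + 1) := unitCost_mono (by omega)
  have hv : (lengthT L).val = L.length := (lengthT_runs L).1
  have hvt := (lengthT_runs L).2
  rw [collect]
  simp only [bind_time, hv]
  rcases Nat.eq_zero_or_pos L.length with h0 | hpos
  · have hL0 := List.length_eq_zero_iff.1 h0
    subst hL0
    have h1 : log2up W ((0 : ℕ) : ℤ) = (pure (0, 1) : Timed (ℕ × ℤ)) := rfl
    rw [List.length_nil, h1]
    simp only [pure_time, pure_val, msort, bind_time, bind_val, tick_time]
    have : (lengthT ([] : List (ℤ × ℤ))).time ≤ 1 := hvt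
    have h2 : 1 ≤ (Nat.clog 2 0 + 1) := by omega
    nlinarith
  · have hlog := log2up_runs hM _ hlen (by exact_mod_cast hpos)
    rw [Int.toNat_natCast] at hlog
    rw [hlog.1]
    have ht := hlog.2
    set d := Nat.clog 2 L.length with hd
    have hms := msort_time hM d L hL
    have hp := msort_perm W d L
    have hs := msort_sorted W d L (Nat.le_pow_clog (by norm_num) _)
    dsimp only
    generalize (msort W d L).val = s at hp hs
    have h2d : 2 ^ d ≤ 2 * L.length := by
      rcases Nat.lt_or_ge 1 L.length with h1 | h1
      · have h2 := Nat.pow_pred_clog_lt_self (b := 2) (by norm_num) h1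
        have h3 : 0 < d := Nat.clog_pos (by norm_num) (by omega)
        rw [← hd] at h2
        obtain ⟨e, he⟩ : ∃ e, d = e + 1 := ⟨d - 1, by omega⟩
        rw [he] at h2 ⊢
        rw [pow_succ]
        simp only [Nat.pred_succ] at h2
        omega
      · have : L.length = 1 := by omega
        rw [hd, this]
        norm_num
    refine (Nat.add_le_add hvt (Nat.add_le_add ht (Nat.add_le_add_left (m :=
      (L.length + 1) * (6 * unitCost D)) ?_ _))).trans ?_
    · cases s with
      | nil => simp
      | cons a l =>
        have hl : l.length + 1 = L.length := by
          have := hp.length_eq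
          simpa using this
        have hsm : ∀ x ∈ a :: l, SmallC D W x := fun x hx => hL x (hp.mem_iff.1 hx)
        have hpr : ((1 + l.length : ℕ) : ℤ) = (L.length : ℤ) := by
          rw [← hl]
          push_cast
          ring
        have h1 := prune_time hM hm a 1 l (hsm a (by simp)) (fun x hx => hsm x (by simp [hx]))
          (by rw [hpr]; exact hlen) (by rw [hpr]; exact hlen)
        obtain ⟨h2, h3⟩ := prune_spec W m a 1 l hs
        rw [Nat.cast_one] at h1 h2 h3
        have hsub : (prune W m a 1 l).val ⊆ a :: l := fun x hx => by
          rw [h3 x] at hx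
          exact List.mem_cons.2 hx.1
        have hlen2 : (prune W m a 1 l).val.length ≤ L.length := by
          have h5 : (prune W m a 1 l).val.Nodup := h2.imp fun {_ _} h => h.2
          have := (h5.subperm hsub).length_le
          simpa [hl] using this
        have h4 := assign_time hM (prune W m a 1 l).val fun x hx => hsm x (hsub hx)
        simp only [bind_time]
        rw [hl] at h1
        have h5 : ((prune W m a 1 l).val.length + 1) * (unitCost D + 1) ≤
          (L.length + 1) * (unitCost D + 1) := by gcongr
        nlinarith
    have e0 : (d * L.length + 2 ^ (d + 1)) * (2 * unitCost D + 2) ≤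
        ((d + 1) * (L.length + 1)) * (16 * unitCost (D + 1)) := by
      have h1 : d * L.length + 2 ^ (d + 1) ≤ 4 * ((d + 1) * (L.length + 1)) := by
        rw [pow_succ]
        nlinarith
      calc _ ≤ 4 * ((d + 1) * (L.length + 1)) * (4 * unitCost (D + 1)) :=
            Nat.mul_le_mul h1 (by omega)
        _ = _ := by ring
    have e1 : (d + 1) * (3 * unitCost (D + 1)) ≤
        ((d + 1) * (L.length + 1)) * (3 * unitCost (D + 1)) := by
      refine Nat.mul_le_mul_right _ (Nat.le_mul_of_pos_right _ (by omega))
    have e2 : (L.length + 1) * (6 * unitCost D) ≤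
        ((d + 1) * (L.length + 1)) * (6 * unitCost (D + 1)) :=
      Nat.mul_le_mul (Nat.le_mul_of_pos_left _ (by omega)) (by omega)
    have e3 : L.length + 1 ≤ ((d + 1) * (L.length + 1)) * unitCost (D + 1) :=
      (Nat.le_mul_of_pos_left _ (by omega)).trans (Nat.le_mul_of_pos_right _ (by omega))
    have e4 : (L.length + 1) * ((d + 1) * (30 * unitCost (D + 1))) =
        ((d + 1) * (L.length + 1)) * (16 * unitCost (D + 1)) +
        ((d + 1) * (L.length + 1)) * (3 * unitCost (D + 1)) +
        ((d + 1) * (L.length + 1)) * (6 * unitCost (D + 1)) +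
        5 * (((d + 1) * (L.length + 1)) * unitCost (D + 1)) := by ring
    rw [e4]
    omega

/-- The kept pairs are distinct, and each uses up at least 15 m / 4 of the records. Counting with
weights gives the analogous bound for the norm. -/
theorem collect_length_mul_le (W : ℕ) (m : ℤ) (L : List (ℤ × ℤ)) :
    15 * m * (collect W m L).val.length ≤ 4 * (L.length : ℤ) := by
  obtain ⟨h1, h2, -⟩ := collect_spec W m L
  generalize (collect W m L).val = z at *
  have h3 := sum_count_mul_le h1.nodup L (fun _ => 1) fun _ => by norm_num
  have h4 : (z.map fun a => 15 * m).sum ≤ (z.map fun a => 4 * ((L.count a : ℤ) * 1)).sum :=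
    List.sum_le_sum fun a ha => by linarith [h2 a ha]
  rw [List.sum_map_mul_left (f := fun a => (L.count a : ℤ) * 1)] at h4
  simp only [List.map_const', List.sum_replicate, nsmul_eq_mul] at h3 h4
  linarith

theorem collect_norm_mul_le (W : ℕ) (m : ℤ) (L : List (ℤ × ℤ)) :
    15 * m * listNorm (collect W m L).val ≤ 4 * listNorm L := by
  obtain ⟨h1, h2, -⟩ := collect_spec W m L
  generalize (collect W m L).val = z at *
  have h3 := sum_count_mul_le h1.nodup L (fun a => |a.2|) fun _ => abs_nonneg _
  have h4 : (z.map fun a => 15 * m * |a.2|).sum ≤ (z.map fun a => 4 * ((L.count a : ℤ) * |a.2|)).sum :=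
    List.sum_le_sum fun a ha => by nlinarith [h2 a ha, abs_nonneg a.2]
  rw [List.sum_map_mul_left, List.sum_map_mul_left] at h4
  rw [listNorm, listNorm]
  linarith

/-- The coordinates that remain wrong are few: each of them was missed in more than a quarter of
the `5 m` repetitions, or wrongly recorded in at least three quarters of them. -/
theorem card_support_sub_collect_le (W : ℕ) {m : ℕ} (hm : 1 ≤ m) (L : List (ℤ × ℤ)) (g : ℤ →₀ ℤ)
    {s : ℕ} (hmiss : ∑ i ∈ g.support, (5 * m - L.count (i, g i)) ≤ s)
    (hwrong : L.countP (fun a => ¬ IsEntry g a) ≤ s) :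
    15 * m * (g - listVec (collect W m L).val).support.card ≤ 16 * s := by
  obtain ⟨h1, h2, h3⟩ := collect_spec W m L
  generalize (collect W m L).val = z at *
  -- A wrong coordinate has one of two causes. Either no pair is kept at its index, so the right
  -- pair fell below the threshold and was missed more than 5 m / 4 times; or a wrong pair is kept
  -- there, perhaps in place of the right one. The first kind numbers at most 4 s / (5 m), the
  -- second at most 4 s / (15 m), which add up to 16 s / (15 m).
  set T1 := g.support.filter fun i => 5 * m ≤ 4 * (5 * m - L.count (i, g i)) with hT1
  set T2 := (z.filter fun a => ¬ IsEntry g a) with hT2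
  have hsub : (g - listVec z).support ⊆ T1 ∪ (T2.map Prod.fst).toFinset := by
    intro i hi
    rw [Finsupp.mem_support_iff, Finsupp.sub_apply, sub_ne_zero] at hi
    rw [Finset.mem_union, List.mem_toFinset, List.mem_map]
    by_cases hz : ∃ b ∈ z, b.1 = i
    · obtain ⟨b, hb, rfl⟩ := hz
      right
      refine ⟨b, ?_, rfl⟩
      rw [hT2, List.mem_filter]
      refine ⟨hb, ?_⟩
      rw [listVec_apply_of_mem h1.nodup_map_fst (c := b.2) hb] at hi
      exact decide_eq_true fun h => hi h.1
    · left
      rw [listVec_apply_eq_zero fun a ha h => hz ⟨a, ha, h⟩] at hi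
      rw [hT1, Finset.mem_filter, Finsupp.mem_support_iff]
      refine ⟨hi, ?_⟩
      by_contra hc
      have hc' : 15 * (m : ℤ) ≤ 4 * (L.count (i, g i) : ℤ) := by omega
      have hmem : (i, g i) ∈ L := by
        rw [← List.count_pos_iff]
        omega
      exact hz (h3 _ hmem hc')
  have hc1 : 5 * m * T1.card ≤ 4 * s := by
    have h4 : ∑ i ∈ T1, (5 * m) ≤ ∑ i ∈ T1, 4 * (5 * m - L.count (i, g i)) :=
      Finset.sum_le_sum fun i hi => (Finset.mem_filter.1 hi).2
    have h5 : ∑ i ∈ T1, (5 * m - L.count (i, g i)) ≤ ∑ i ∈ g.support, (5 * m - L.count (i, g i)) :=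
      Finset.sum_le_sum_of_subset (Finset.filter_subset _ _)
    rw [Finset.sum_const, smul_eq_mul, ← Finset.mul_sum] at h4
    linarith
  have hc2 : 15 * m * T2.length ≤ 4 * s := by
    have h4 := sum_count_mul_le (h1.nodup.filter fun a => ¬ IsEntry g a) L
      (fun a => if ¬ IsEntry g a then 1 else 0) fun a => by split_ifs <;> norm_num
    have h5 : (T2.map fun a => 15 * (m : ℤ)).sum ≤
        (T2.map fun a => 4 * ((L.count a : ℤ) * if ¬ IsEntry g a then 1 else 0)).sum := by
      refine List.sum_le_sum fun a ha => ?_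
      rw [hT2, List.mem_filter] at ha
      rw [if_pos (of_decide_eq_true ha.2)]
      linarith [h2 a ha.1]
    rw [List.sum_map_mul_left (f := fun a => (L.count a : ℤ) * if ¬ IsEntry g a then 1 else 0)] at h5
    have h6 : (L.map fun a => if ¬ IsEntry g a then (1 : ℤ) else 0).sum =
        L.countP (fun a => ¬ IsEntry g a) := by
      clear * -
      induction L with
      | nil => simp
      | cons a L ih =>
        rw [List.map_cons, List.sum_cons, ih, List.countP_cons]
        by_cases h : IsEntry g a <;> simp [h, add_comm]
    rw [h6] at h4
    simp only [List.map_const', List.sum_replicate, nsmul_eq_mul] at h5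
    zify at hwrong ⊢
    linarith
  have hcard : (g - listVec z).support.card ≤ T1.card + T2.length := by
    have h4 := (Finset.card_le_card hsub).trans (Finset.card_union_le _ _)
    have h5 := List.toFinset_card_le (T2.map Prod.fst)
    rw [List.length_map] at h5
    exact h4.trans (by omega)
  nlinarith

/-! ### The sieve -/

/-- The array `a` of length `M` holds a one at the indices with the property `P` and a zero at all
others. -/
def Marked (a : Array ℤ) (M : ℕ) (P : ℕ → Prop) : Prop :=
  a.size = M ∧ ∀ j < M, (a.getD j 0 = 0 ∧ ¬ P j) ∨ (a.getD j 0 = 1 ∧ P j)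

theorem Marked.set {a : Array ℤ} {M : ℕ} {P : ℕ → Prop} (h : Marked a M P) (i : ℕ) :
    Marked (a.setIfInBounds i 1) M (fun j => P j ∨ j = i) := by
  refine ⟨by simp [h.1], fun j hj => ?_⟩
  rw [getD_setIfInBounds, h.1]
  by_cases hij : i = j
  · subst hij
    simp [hj]
  · have hji : ¬ j = i := fun h => hij h.symm
    simpa [hij, hji] using h.2 j hj

theorem Marked.congr {a : Array ℤ} {M : ℕ} {P Q : ℕ → Prop} (h : Marked a M P)
    (hPQ : ∀ j < M, P j ↔ Q j) : Marked a M Q :=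
  ⟨h.1, fun j hj => by rw [← hPQ j hj]; exact h.2 j hj⟩

/-- The sieve crosses out multiples of a prime from its double on, and a composite number is at
least twice its least prime factor. -/
theorem not_prime_iff_marked {i : ℕ} (hi : 2 ≤ i) :
    ¬ i.Prime ↔ ∃ q, q.Prime ∧ q < i ∧ q ∣ i ∧ 2 * q ≤ i := by
  constructor
  · intro h
    have h1 := Nat.minFac_prime (n := i) (by omega)
    have h2 := Nat.minFac_dvd i
    have h3 : i.minFac < i := (Nat.not_prime_iff_minFac_lt hi).1 h
    refine ⟨i.minFac, h1, h3, h2, ?_⟩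
    obtain ⟨t, ht⟩ := h2
    rcases t with _ | _ | t
    · omega
    · omega
    · nlinarith [h1.pos]
  · rintro ⟨q, hq, hqi, hqd, -⟩ h
    rcases (Nat.dvd_prime h).1 hqd with h1 | h1
    · exact hq.one_lt.ne' h1
    · omega

/-- A harmonic sum. Only primes cause crossing out, but summing over all k is good enough for the
claimed time. -/
theorem sum_div_le (M : ℕ) (hM : 1 ≤ M) :
    ∑ k ∈ Finset.range (M - 2), (M - 1) / (k + 2) ≤ M * (Nat.clog 2 M + 1) := by
  have hMr : (1 : ℝ) ≤ M := by exact_mod_cast hM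
  have h1 : ((∑ k ∈ Finset.range (M - 2), (M - 1) / (k + 2) : ℕ) : ℝ) ≤ M * (harmonic M : ℝ) := by
    rw [harmonic]
    push_cast
    rw [Finset.mul_sum]
    calc ∑ k ∈ Finset.range (M - 2), (((M - 1) / (k + 2) : ℕ) : ℝ)
        ≤ ∑ k ∈ Finset.range (M - 2), (M : ℝ) * ((k : ℝ) + 1)⁻¹ := by
          refine Finset.sum_le_sum fun k _ => ?_
          refine Nat.cast_div_le.trans ?_
          rw [div_eq_mul_inv]
          gcongr
          · exact_mod_cast Nat.sub_le M 1
          · push_cast; linarith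
      _ ≤ _ := by
          refine Finset.sum_le_sum_of_subset_of_nonneg (fun k hk => ?_) fun k _ _ => by positivity
          rw [Finset.mem_range] at hk ⊢
          omega
  have h2 : Real.log M ≤ Nat.clog 2 M := by
    calc Real.log M ≤ Real.log (2 ^ Nat.clog 2 M) := by
          refine Real.log_le_log (by linarith) ?_
          exact_mod_cast Nat.le_pow_clog (by norm_num) M
      _ = Nat.clog 2 M * Real.log 2 := Real.log_pow _ _
      _ ≤ Nat.clog 2 M * 1 := by
          gcongr
          linarith [Real.log_two_lt_d9]
      _ = _ := mul_one _
  have h3 := harmonic_le_one_add_log M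
  have h4 : ((∑ k ∈ Finset.range (M - 2), (M - 1) / (k + 2) : ℕ) : ℝ) ≤
      ((M * (Nat.clog 2 M + 1) : ℕ) : ℝ) := by
    push_cast at h1 ⊢
    refine h1.trans ?_
    gcongr
    linarith
  exact_mod_cast h4

/-- After k steps the marked indices are the proper multiples of primes below k + 2. For the index k
+ 2 itself, being marked thus means being composite. -/
theorem sieve_runs {D W : ℕ} (hM : Machine D W) {M : ℕ} (h3 : 3 ≤ M) (hsM : Small D W (M : ℤ)) :
    Runs (sieve W M) (M * ((Nat.clog 2 M + 1) * (14 * unitCost D))) (fun a =>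
      a.toList.Nodup ∧ ∀ x : ℤ, x ∈ a.toList ↔ ∃ p : ℕ, p.Prime ∧ p < M ∧ x = p) := by
  have hU := one_le_unitCost D
  have hsm : ∀ {x : ℕ}, x ≤ M → Small D W (x : ℤ) := fun hx =>
    hsM.of_nonneg_le (by positivity) (by exact_mod_cast hx)
  set t : ℕ → ℕ := fun k => 3 * unitCost D + (unitCost D + (M - 1) / (k + 2) * (2 * unitCost D + 1))
    with ht
  have hsum : ∑ k ∈ Finset.range (M - 2), (t k + 1) ≤
      M * (5 * unitCost D) + M * (Nat.clog 2 M + 1) * (3 * unitCost D) := by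
    have h1 : ∑ k ∈ Finset.range (M - 2), (t k + 1) =
        (M - 2) * (4 * unitCost D + 1) +
        (∑ k ∈ Finset.range (M - 2), (M - 1) / (k + 2)) * (2 * unitCost D + 1) := by
      have h2 : (M - 2) * (4 * unitCost D + 1) =
          ∑ k ∈ Finset.range (M - 2), (4 * unitCost D + 1) := by simp
      rw [Finset.sum_mul, h2, ← Finset.sum_add_distrib]
      refine Finset.sum_congr rfl fun k _ => ?_
      rw [ht]
      ring
    rw [h1]
    exact Nat.add_le_add (Nat.mul_le_mul (by omega) (by omega))
      (Nat.mul_le_mul (sum_div_le M (by omega)) (by omega))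
  refine Runs.mono (t := (M + 1) + (unitCost D + ((∑ k ∈ Finset.range (M - 2), (t k + 1)) +
    ((M + 1) + (M + 0))))) ?_ ?_
  · refine Runs.bind (P := fun a => Marked a M fun _ => False) (t := M + 1) ⟨?_, ?_⟩ fun a ha => ?_
    · refine ⟨by simp [newArray], fun j hj => Or.inl ⟨?_, not_false⟩⟩
      simp [newArray, hj]
    · simp [newArray]
    refine Runs.bind (ev_runs hM _ ⟨hsM, hM.small_two⟩) fun cnt hcnt => ?_
    simp only [Exp.eval_sub, Exp.eval_lit, Exp.eval_two] at hcnt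
    have hcnt' : cnt.toNat = M - 2 := by omega
    rw [hcnt']
    refine Runs.bind (forLoop_runs_sum (fun k (st : Array ℤ × List ℤ) =>
      Marked st.1 M (fun j => ∃ q, q.Prime ∧ q < k + 2 ∧ q ∣ j ∧ 2 * q ≤ j) ∧ st.2.Nodup ∧
        ∀ x : ℤ, x ∈ st.2 ↔ ∃ p : ℕ, p.Prime ∧ p < k + 2 ∧ x = p) t _ _ _ ?_ ?_) ?_
    · refine ⟨ha.congr fun j _ => ?_, List.nodup_nil, fun x => ?_⟩
      · simp only [false_iff]
        rintro ⟨q, hq, h, -⟩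
        have := hq.two_le
        omega
      · simp only [List.not_mem_nil, false_iff]
        rintro ⟨q, hq, h, -⟩
        have := hq.two_le
        omega
    · rintro k hk ⟨a, ps⟩ ⟨hmark, hnd, hps⟩
      have hi : k + 2 < M := by omega
      have h3 : unitCost D + (unitCost D + (unitCost D +
          (unitCost D + (M - 1) / (k + 2) * (2 * unitCost D + 1)))) = t k := by
        rw [ht]
        ring
      rw [← h3]
      refine Runs.bind (ev_runs hM (Exp.lit (k : ℤ) + 2) ⟨hsm (by omega), hM.small_two⟩)
        fun i hieq => ?_
      simp only [Exp.eval_add, Exp.eval_lit, Exp.eval_two] at hieq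
      replace hieq : i = ((k + 2 : ℕ) : ℤ) := by rw [hieq]; push_cast; ring
      subst hieq
      have hmi := hmark.2 (k + 2) hi
      refine Runs.bind (readA_runs hM _ _ (hsm hi.le) ?_) fun c hc => ?_
      · rw [Int.toNat_natCast]
        rcases hmi with h | h <;> rw [h.1]
        · exact hM.small_zero
        · exact hM.small_one
      rw [Int.toNat_natCast] at hc
      have hsc : Small D W c := by
        rw [hc]
        rcases hmi with h | h <;> rw [h.1]
        · exact hM.small_zero
        · exact hM.small_one
      refine Runs.bind (eqT_runs hM _ _ hsc hM.small_zero) fun b hb => ?_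
      simp only [Exp.eval_lit, Exp.eval_zero] at hb
      refine Runs.ite (fun hbt => ?_) (fun hbf => ?_)
      · have hc0 : c = 0 := by
          rw [hb] at hbt
          exact of_decide_eq_true hbt
        have hprime : (k + 2).Prime := by
          by_contra hnp
          rw [not_prime_iff_marked (by omega)] at hnp
          rcases hmi with h | h
          · exact h.2 hnp
          · rw [hc, h.1] at hc0
            exact one_ne_zero hc0
        refine Runs.bind (ev_runs hM _ ⟨⟨⟨hsM, hM.small_one⟩, hsm hi.le⟩, hM.small_one⟩)
          fun m hm => ?_
        simp only [Exp.eval_sub, Exp.eval_div, Exp.eval_lit, Exp.eval_one] at hm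
        have hm' : m.toNat = (M - 1) / (k + 2) - 1 := by
          have h1 : (M : ℤ) - 1 = ((M - 1 : ℕ) : ℤ) := by push_cast [show 1 ≤ M by omega]; ring
          rw [hm, h1, ← Int.natCast_ediv]
          omega
        rw [hm']
        refine Runs.mono (t := ((M - 1) / (k + 2) - 1) * (2 * unitCost D + 1) + 0) ?_ ?_
        · refine Runs.bind (forLoop_runs (fun l A => Marked A M fun j =>
            (∃ q, q.Prime ∧ q < k + 2 ∧ q ∣ j ∧ 2 * q ≤ j) ∨
              ∃ s, s < l ∧ j = (s + 2) * (k + 2)) (2 * unitCost D) _ _ _ ?_ ?_) ?_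
          · exact hmark.congr fun j _ => by simp
          · intro l hl A hA
            have hlM : (l + 2) * (k + 2) < M := by
              have h1 : (M - 1) / (k + 2) * (k + 2) ≤ M - 1 := Nat.div_mul_le_self _ _
              have h2 : (l + 2) * (k + 2) ≤ (M - 1) / (k + 2) * (k + 2) := by
                gcongr
                omega
              omega
            have hlM' : l ≤ M := by nlinarith
            rw [two_mul]
            refine Runs.bind (ev_runs hM _ ⟨⟨hsm hlM', hM.small_two⟩, hsm hi.le⟩) fun idx hidx => ?_
            simp only [Exp.eval_mul, Exp.eval_add, Exp.eval_lit, Exp.eval_two] at hidx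
            replace hidx : idx = (((l + 2) * (k + 2) : ℕ) : ℤ) := by rw [hidx]; push_cast; ring
            subst hidx
            refine (writeA_runs hM _ _ _ (hsm hlM.le) hM.small_one).imp fun A' hA' => ?_
            rw [hA', Int.toNat_natCast]
            refine (hA.set _).congr fun j _ => ?_
            constructor
            · rintro ((h | ⟨s, hs, h⟩) | h)
              · exact Or.inl h
              · exact Or.inr ⟨s, by omega, h⟩
              · exact Or.inr ⟨l, by omega, h⟩
            · rintro (h | ⟨s, hs, h⟩)
              · exact Or.inl (Or.inl h)
              · rcases Nat.lt_succ_iff_lt_or_eq.1 hs with hs | rfl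
                · exact Or.inl (Or.inr ⟨s, hs, h⟩)
                · exact Or.inr h
          · intro A hA
            refine Runs.pure ⟨hA.congr fun j hj => ?_, ?_, fun x => ?_⟩
            · constructor
              · rintro (⟨q, hq, hq1, hq2, hq3⟩ | ⟨s, hs, rfl⟩)
                · exact ⟨q, hq, by omega, hq2, hq3⟩
                · exact ⟨k + 2, hprime, by omega, Dvd.intro_left _ rfl, by gcongr; omega⟩
              · rintro ⟨q, hq, hq1, hq2, hq3⟩
                rcases Nat.lt_or_ge q (k + 2) with h | h
                · exact Or.inl ⟨q, hq, h, hq2, hq3⟩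
                · obtain rfl : q = k + 2 := by omega
                  obtain ⟨s, rfl⟩ := hq2
                  right
                  have hs2 : 2 ≤ s := by
                    by_contra h2
                    have : s ≤ 1 := by omega
                    nlinarith
                  refine ⟨s - 2, ?_, ?_⟩
                  · have : s ≤ (M - 1) / (k + 2) := by
                      rw [Nat.le_div_iff_mul_le (by omega)]
                      rw [mul_comm]
                      omega
                    omega
                  · rw [Nat.sub_add_cancel hs2, mul_comm]
            · refine List.nodup_cons.2 ⟨fun hx => ?_, hnd⟩
              obtain ⟨p, -, hp1, hp2⟩ := (hps _).1 hx
              have : k + 2 = p := by exact_mod_cast hp2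
              omega
            · rw [List.mem_cons, hps]
              constructor
              · rintro (rfl | ⟨p, hp, h1, h2⟩)
                · exact ⟨k + 2, hprime, by omega, rfl⟩
                · exact ⟨p, hp, by omega, h2⟩
              · rintro ⟨p, hp, h1, h2⟩
                rcases Nat.lt_or_ge p (k + 2) with h | h
                · exact Or.inr ⟨p, hp, h, h2⟩
                · obtain rfl : p = k + 2 := by omega
                  exact Or.inl h2
        · rw [add_zero]
          exact Nat.mul_le_mul_right _ (Nat.sub_le _ _)
      · have hnp : ¬ (k + 2).Prime := by
          rw [not_prime_iff_marked (by omega)]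
          rw [hb] at hbf
          have := of_decide_eq_false hbf
          rcases hmi with h | h
          · exact absurd (hc.trans h.1) this
          · exact h.2
        refine Runs.mono (t := 0) (Runs.pure ⟨hmark.congr fun j hj => ?_, hnd, fun x => ?_⟩)
          (by omega)
        · refine exists_congr fun q => and_congr_right fun hq => and_congr_left fun _ => ?_
          constructor
          · intro h
            omega
          · intro h
            have : q ≠ k + 2 := by rintro rfl; exact hnp hq
            omega
        · rw [hps]
          refine exists_congr fun q => and_congr_right fun hq => and_congr_left fun _ => ?_
          constructor
          · intro h
            omega
          · intro h
            have : q ≠ k + 2 := by rintro rfl; exact hnp hq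
            omega
    · rintro ⟨a, ps⟩ ⟨-, hnd, hps⟩
      rw [show M - 2 + 2 = M by omega] at hps
      have hlen : ps.length ≤ M := by
        have h1 : ps ⊆ (List.range M).map (fun k : ℕ => (k : ℤ)) := fun x hx => by
          obtain ⟨p, -, h2, h3⟩ := (hps x).1 hx
          exact List.mem_map.2 ⟨p, List.mem_range.2 h2, h3.symm⟩
        simpa using (hnd.subperm h1).length_le
      refine Runs.bind ((lengthT_runs ps).mono (by omega)) fun k hk => ?_
      refine Runs.mono (Runs.tick_bind (Runs.pure ?_)) (by omega)
      simpa using ⟨hnd, hps⟩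
  · have e1 : M * ((Nat.clog 2 M + 1) * (14 * unitCost D)) =
      14 * (M * (Nat.clog 2 M + 1) * unitCost D) := by ring
    have e2 : M * unitCost D ≤ M * (Nat.clog 2 M + 1) * unitCost D :=
      Nat.mul_le_mul_right _ (Nat.le_mul_of_pos_right _ (by omega))
    have e3 : M ≤ M * unitCost D := Nat.le_mul_of_pos_right _ (by omega)
    have e4 : unitCost D ≤ M * unitCost D := Nat.le_mul_of_pos_left _ (by omega)
    have e5 : M * (5 * unitCost D) = 5 * (M * unitCost D) := by ring
    have e6 : M * (Nat.clog 2 M + 1) * (3 * unitCost D) =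
      3 * (M * (Nat.clog 2 M + 1) * unitCost D) := by ring
    omega

/-! ### The number of primes, and collisions -/

/-- Chebyshev's lower bound in terms of q = ⌈log M⌉: it gives M - 1 - q ≤ q π, where π counts the
primes below M, and 2 q ≤ M - 2 for M ≥ 32. -/
theorem le_primeCounting {M : ℕ} (hM : 32 ≤ M) :
    M ≤ 2 * (Nat.clog 2 M * Nat.primeCounting' M) := by
  obtain ⟨n, rfl⟩ : ∃ n, M = n + 1 := ⟨M - 1, by omega⟩
  have h := Chebyshev.pi_ge n
  rw [Nat.primeCounting_eq_primeCounting'_succ] at h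
  have hn : (31 : ℝ) ≤ n := by exact_mod_cast (by omega : 31 ≤ n)
  have hlog : 0 < Real.log n := Real.log_pos (by linarith)
  rw [div_le_iff₀ hlog] at h
  have hl2 : 0 < Real.log 2 := Real.log_pos (by norm_num)
  set q := Nat.clog 2 (n + 1) with hq
  have hlogM : Real.log (n + 1) ≤ q * Real.log 2 := by
    rw [← Real.log_pow]
    refine Real.log_le_log (by linarith) ?_
    have : n + 1 ≤ 2 ^ q := Nat.le_pow_clog (by norm_num) _
    exact_mod_cast this
  have hqn : 2 * q ≤ n - 1 := by
    have h1 : Nat.clog 2 (n + 1) ≤ (n - 1) / 2 := by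
      rw [Nat.clog_le_iff_le_pow (by norm_num)]
      have key : ∀ j : ℕ, 15 ≤ j → 2 * j + 3 ≤ 2 ^ j := by
        intro j hj
        induction j, hj using Nat.le_induction with
        | base => norm_num
        | succ j hj ih => rw [pow_succ]; omega
      have := key ((n - 1) / 2) (by omega)
      omega
    omega
  have hlogn : Real.log n ≤ Real.log (n + 1) := Real.log_le_log (by linarith) (by linarith)
  have hπ : (0 : ℝ) ≤ Nat.primeCounting' (n + 1) := by positivity
  have hqn' : 2 * (q : ℝ) ≤ n - 1 := by
    have : 2 * q + 1 ≤ n := by omega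
    have : 2 * (q : ℝ) + 1 ≤ n := by exact_mod_cast this
    linarith
  have h1 : (n : ℝ) * Real.log 2 - q * Real.log 2 ≤
      Nat.primeCounting' (n + 1) * (q * Real.log 2) := by
    have : (Nat.primeCounting' (n + 1) : ℝ) * Real.log n ≤
      Nat.primeCounting' (n + 1) * (q * Real.log 2) := by
      gcongr
      linarith
    linarith
  have h2 : (n : ℝ) - q ≤ Nat.primeCounting' (n + 1) * q := by
    have : ((n : ℝ) - q) * Real.log 2 ≤ (Nat.primeCounting' (n + 1) * q) * Real.log 2 := by
      linarith
    exact le_of_mul_le_mul_right this hl2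
  have h3 : ((n + 1 : ℕ) : ℝ) ≤ ((2 * (q * Nat.primeCounting' (n + 1)) : ℕ) : ℝ) := by
    push_cast
    linarith
  exact_mod_cast h3

/-- A crude bound on the logarithm, for the case in which M is so large that log M is not comparable
with log N. -/
theorem sq_clog_le {M : ℕ} (hM : 1 ≤ M) : Nat.clog 2 M ^ 2 ≤ 4 * M := by
  have key : ∀ j : ℕ, (j + 1) ^ 2 ≤ 4 * 2 ^ j := by
    intro j
    induction j with
    | zero => norm_num
    | succ j ih =>
      rcases j with _ | _ | j
      · norm_num
      · norm_num
      · have h1 : (j + 1 + 1 + 1 + 1) ^ 2 ≤ 2 * (j + 1 + 1 + 1) ^ 2 := by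
          nlinarith [Nat.zero_le (j * j)]
        rw [pow_succ 2 (j + 1 + 1)]
        omega
  rcases Nat.eq_zero_or_pos (Nat.clog 2 M) with h | h
  · rw [h]
    omega
  · obtain ⟨j, hj⟩ : ∃ j, Nat.clog 2 M = j + 1 := ⟨Nat.clog 2 M - 1, by omega⟩
    have h1 : 2 ^ j < M := (Nat.lt_clog_iff_pow_lt (by norm_num)).1 (by omega)
    rw [hj]
    have := key j
    omega

/-- The primes below `C b L ^ 2` are many compared to `k L`, if `C k < b` and `k ≤ 2 ^ L`. -/
theorem mul_le_primeCounting {C b L k : ℕ} (hC : 360000 ≤ C) (hL : 1 ≤ L) (hb : 1 ≤ b)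
    (hk : k ≤ 2 ^ L) (hCk : C * k ≤ b) :
    150 * (k * L) ≤ Nat.primeCounting' (C * b * L * L) := by
  set M := C * b * L * L with hMdef
  have hCM : C ≤ M := by
    rw [hMdef, mul_assoc, mul_assoc]
    exact Nat.le_mul_of_pos_right _ (Nat.mul_pos hb (Nat.mul_pos hL hL))
  have h1 := le_primeCounting (M := M) (by omega)
  set q := Nat.clog 2 M with hq
  have hq0 : 0 < q := Nat.clog_pos (by norm_num) (by omega)
  -- By Chebyshev's bound M ≤ 2 q π, this inequality suffices.
  suffices h : 300 * (k * L * q) ≤ M by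
    have h2 : (150 * (k * L)) * (2 * q) ≤ Nat.primeCounting' M * (2 * q) := by
      calc (150 * (k * L)) * (2 * q) = 300 * (k * L * q) := by ring
        _ ≤ M := h
        _ ≤ _ := h1
        _ = _ := by ring
    exact Nat.le_of_mul_le_mul_right h2 (by omega)
  -- If b ≤ 4^L, then log M ≤ (C + 4) L, while C k ≤ b gives M ≥ C² k L²; so C² ≥ 300 (C + 4) is
  -- enough. Otherwise k² ≤ 4^L ≤ b, and with log² M ≤ 4 M the squared claim reduces to 360000 b L²
  -- ≤ C b L². This is the origin of the constant 360000.
  rcases Nat.le_total b (4 ^ L) with hbL | hbL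
  · have hqL : q ≤ (C + 4) * L := by
      rw [hq, Nat.clog_le_iff_le_pow (by norm_num)]
      have e1 : C ≤ 2 ^ (C * L) :=
        Nat.lt_two_pow_self.le.trans (Nat.pow_le_pow_right (by norm_num)
          (Nat.le_mul_of_pos_right _ hL))
      have e2 : L ≤ 2 ^ L := Nat.lt_two_pow_self.le
      have e3 : (4 : ℕ) ^ L = 2 ^ L * 2 ^ L := by rw [← mul_pow]; norm_num
      calc M ≤ 2 ^ (C * L) * (2 ^ L * 2 ^ L) * 2 ^ L * 2 ^ L := by
            rw [hMdef]
            gcongr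
            rw [← e3]
            exact hbL
        _ = 2 ^ ((C + 4) * L) := by rw [← pow_add, ← pow_add, ← pow_add, ← pow_add]; ring_nf
    calc 300 * (k * L * q) ≤ 300 * (k * L * ((C + 4) * L)) := by gcongr
      _ = (300 * (C + 4)) * (k * L * L) := by ring
      _ ≤ (C * C) * (k * L * L) := Nat.mul_le_mul_right _ (by nlinarith)
      _ = C * (C * k) * L * L := by ring
      _ ≤ C * b * L * L := by gcongr
  · have hkb : k ^ 2 ≤ b := by
      calc k ^ 2 ≤ (2 ^ L) ^ 2 := by gcongr
        _ = 4 ^ L := by rw [← pow_mul, mul_comm, pow_mul]; norm_num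
        _ ≤ b := hbL
    have hq2 : q ^ 2 ≤ 4 * M := sq_clog_le (by omega)
    refine (Nat.pow_le_pow_iff_left (n := 2) (by norm_num)).1 ?_
    calc (300 * (k * L * q)) ^ 2 = 90000 * (k ^ 2 * L ^ 2 * q ^ 2) := by ring
      _ ≤ 90000 * (b * L ^ 2 * (4 * M)) := by gcongr
      _ = 360000 * (b * L * L) * M := by ring
      _ ≤ C * (b * L * L) * M := by gcongr
      _ = M ^ 2 := by rw [hMdef]; ring

/-- A product of distinct primes is at least 2 to the power of their number. -/
theorem card_primeFactors_le {d L : ℕ} (hd : d ≠ 0) (hdL : d < 2 ^ L) : d.primeFactors.card ≤ L := by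
  have h1 : 2 ^ d.primeFactors.card ≤ ∏ p ∈ d.primeFactors, p := by
    rw [← Finset.prod_const]
    exact Finset.prod_le_prod' fun p hp => (Nat.prime_of_mem_primeFactors hp).two_le
  have h2 : ∏ p ∈ d.primeFactors, p ≤ d :=
    Nat.le_of_dvd (Nat.pos_of_ne_zero hd) (Nat.prod_primeFactors_dvd d)
  exact ((Nat.pow_lt_pow_iff_right (by norm_num)).1 ((h1.trans h2).trans_lt hdL)).le

/-- A non-isolated i has a partner j with p ∣ j - i. For each ordered pair of distinct indices, j -
i is nonzero and below 2^L in absolute value, so at most L primes divide it. -/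
theorem sum_card_nonIsolated_le {g : ℤ →₀ ℤ} {L : ℕ}
    (hg : ∀ i ∈ g.support, 0 ≤ i ∧ i < 2 ^ L) {s : Finset ℕ} (hs : ∀ p ∈ s, p.Prime) :
    ∑ p ∈ s, (nonIsolated g p).card ≤ g.support.card * (g.support.card * L) := by
  have h1 : ∀ p ∈ s, (nonIsolated g p).card ≤ ∑ i ∈ g.support, ∑ j ∈ g.support,
      if j ≠ i ∧ j % (p : ℤ) = i % (p : ℤ) then 1 else 0 := by
    intro p _
    rw [nonIsolated, Finset.card_filter]
    refine Finset.sum_le_sum fun i _ => ?_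
    split_ifs with h
    · obtain ⟨j, hj, hji⟩ := h
      refine le_trans ?_ (Finset.single_le_sum (f := fun j : ℤ =>
        if j ≠ i ∧ j % (p : ℤ) = i % (p : ℤ) then 1 else 0) (fun _ _ => Nat.zero_le _) hj)
      simp only [if_pos hji, le_refl]
    · exact Nat.zero_le _
  refine (Finset.sum_le_sum h1).trans ?_
  rw [Finset.sum_comm]
  refine (Finset.sum_le_card_nsmul _ _ (g.support.card * L) fun i hi => ?_).trans_eq
    (by rw [smul_eq_mul])
  rw [Finset.sum_comm]
  refine (Finset.sum_le_card_nsmul _ _ L fun j hj => ?_).trans_eq (by rw [smul_eq_mul])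
  by_cases hji : j = i
  · simp [hji]
  · have hd : (j - i).natAbs ≠ 0 := by omega
    have hlt : (j - i).natAbs < 2 ^ L := by
      have h2 := hg i hi
      have h3 := hg j hj
      zify
      rw [abs_lt]
      constructor <;> linarith
    refine le_trans ?_ (card_primeFactors_le hd hlt)
    rw [← Finset.card_filter]
    refine Finset.card_le_card fun p hp => ?_
    rw [Finset.mem_filter] at hp
    refine Nat.mem_primeFactors.2 ⟨hs p hp.1, ?_, hd⟩
    have h4 : (p : ℤ) ∣ j - i := Int.ModEq.dvd (hp.2.2).symm
    exact Int.natCast_dvd.1 h4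

/-! ### Randomized computations -/

section Pmf
variable {α β : Type}

/-- The expectation of `φ` under the law `p`. -/
noncomputable def mean (p : PMF α) (φ : α → ℝ≥0∞) : ℝ≥0∞ := ∑' a, p a * φ a

theorem mean_pure (a : α) (φ : α → ℝ≥0∞) : mean (PMF.pure a) φ = φ a := by
  rw [mean, tsum_eq_single a fun b hb => by rw [PMF.pure_apply_of_ne _ _ hb, zero_mul],
    PMF.pure_apply_self, one_mul]

theorem mean_bind (p : PMF α) (f : α → PMF β) (φ : β → ℝ≥0∞) :
    mean (p.bind f) φ = mean p fun a => mean (f a) φ := by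
  simp only [mean, PMF.bind_apply, ← ENNReal.tsum_mul_right, ← ENNReal.tsum_mul_left]
  rw [ENNReal.tsum_comm]
  simp only [mul_assoc]

theorem mean_map (p : PMF α) (f : α → β) (φ : β → ℝ≥0∞) :
    mean (p.map f) φ = mean p fun a => φ (f a) := by
  rw [PMF.map, mean_bind]
  simp only [Function.comp, mean_pure]

theorem mean_mono (p : PMF α) {φ ψ : α → ℝ≥0∞} (h : ∀ a, φ a ≤ ψ a) : mean p φ ≤ mean p ψ :=
  ENNReal.tsum_le_tsum fun a => mul_le_mul_right (h a) _

theorem mean_const (p : PMF α) (c : ℝ≥0∞) : mean p (fun _ => c) = c := by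
  rw [mean, ENNReal.tsum_mul_right, PMF.tsum_coe, one_mul]

theorem mean_add (p : PMF α) (φ ψ : α → ℝ≥0∞) :
    mean p (fun a => φ a + ψ a) = mean p φ + mean p ψ := by
  simp only [mean, mul_add, ENNReal.tsum_add]

theorem mean_uniformOfFinset (s : Finset α) (hs : s.Nonempty) (φ : α → ℝ≥0∞) :
    mean (PMF.uniformOfFinset s hs) φ = (∑ a ∈ s, φ a) / s.card := by
  rw [mean, tsum_eq_sum (s := s) fun a ha => by
    rw [PMF.uniformOfFinset_apply_of_notMem hs ha, zero_mul], ENNReal.div_eq_inv_mul,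
    Finset.mul_sum]
  exact Finset.sum_congr rfl fun a ha => by rw [PMF.uniformOfFinset_apply_of_mem hs ha]

end Pmf

section Rnd
variable {α β : Type}

/-- The expectation of a function of the result. -/
noncomputable def Rnd.ex (m : Rnd α) (φ : α → ℝ≥0∞) : ℝ≥0∞ := mean m.law fun o => φ o.val

theorem Rnd.ex_pure (a : α) (φ : α → ℝ≥0∞) : Rnd.ex (pure a) φ = φ a := mean_pure _ _

theorem Rnd.ex_lift (t : Timed α) (φ : α → ℝ≥0∞) : Rnd.ex (liftM t : Rnd α) φ = φ t.val :=
  mean_pure _ _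

theorem Rnd.ex_bind (m : Rnd α) (f : α → Rnd β) (φ : β → ℝ≥0∞) :
    Rnd.ex (m >>= f) φ = Rnd.ex m fun a => Rnd.ex (f a) φ := by
  refine (mean_bind _ _ _).trans ?_
  refine congrArg (mean m.law) (funext fun t => ?_)
  exact mean_map _ _ _

theorem Rnd.ex_lift_bind (t : Timed α) (f : α → Rnd β) (φ : β → ℝ≥0∞) :
    Rnd.ex ((liftM t : Rnd α) >>= f) φ = Rnd.ex (f t.val) φ := by
  rw [Rnd.ex_bind, Rnd.ex_lift]

theorem Rnd.ex_mono (m : Rnd α) {φ ψ : α → ℝ≥0∞} (h : ∀ a, φ a ≤ ψ a) : m.ex φ ≤ m.ex ψ :=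
  mean_mono _ fun _ => h _

theorem Rnd.ex_le_one (m : Rnd α) {φ : α → ℝ≥0∞} (h : ∀ a, φ a ≤ 1) : m.ex φ ≤ 1 :=
  (m.ex_mono h).trans (mean_const _ _).le

theorem Rnd.ex_add_const (m : Rnd α) (φ : α → ℝ≥0∞) (c : ℝ≥0∞) :
    (m.ex fun a => φ a + c) = m.ex φ + c := by
  rw [Rnd.ex, mean_add, mean_const]
  rfl

open Classical in
-- All estimates concern the expectation of the indicator of failure; this converts them into a
-- probability of success.
theorem Rnd.le_toOuterMeasure (m : Rnd α) (P : α → Prop) {δ : ℝ} (hδ : 0 ≤ δ)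
    (h : (m.ex fun a => if P a then 0 else 1) ≤ ENNReal.ofReal δ) :
    ENNReal.ofReal (1 - δ) ≤ m.law.toOuterMeasure {o | P o.val} := by
  have h1 : m.law.toOuterMeasure {o | P o.val} = m.ex fun a => if P a then 1 else 0 := by
    rw [PMF.toOuterMeasure_apply, Rnd.ex, mean]
    refine tsum_congr fun o => ?_
    by_cases ho : P o.val <;> simp [ho]
  have h2 : (m.ex fun a => if P a then 1 else 0) + (m.ex fun a => if P a then 0 else 1) = 1 := by
    rw [Rnd.ex, Rnd.ex, ← mean_add]
    refine Eq.trans (congrArg (mean m.law) (funext fun o => ?_)) (mean_const m.law 1)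
    split_ifs <;> simp
  rw [h1, ENNReal.ofReal_sub _ hδ, ENNReal.ofReal_one]
  refine tsub_le_iff_right.2 (h2.symm.le.trans ?_)
  gcongr

/-- On every outcome the result satisfies `P` and the number of steps is at most `t`. -/
def Always (m : Rnd α) (t : ℕ) (P : α → Prop) : Prop :=
  ∀ o ∈ m.law.support, P o.val ∧ o.time ≤ t

variable {m : Rnd α} {t t' : ℕ} {P : α → Prop} {f : α → Rnd β} {Q : β → Prop}

theorem Always.bind (h : Always m t P) (h' : ∀ a, P a → Always (f a) t' Q) :
    Always (m >>= f) (t + t') Q := by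
  intro o ho
  obtain ⟨s, hs, ho⟩ := (PMF.mem_support_bind_iff _ _ _).1 ho
  obtain ⟨r, hr, rfl⟩ := (PMF.mem_support_map_iff _ _ _).1 ho
  obtain ⟨h1, h2⟩ := h s hs
  obtain ⟨h3, h4⟩ := h' _ h1 r hr
  exact ⟨h3, Nat.add_le_add h2 h4⟩

theorem Always.lift {m : Timed α} (h : Runs m t P) : Always (liftM m : Rnd α) t P := by
  intro o ho
  obtain rfl := (PMF.mem_support_pure_iff _ _).1 ho
  exact h

theorem Always.pure {a : α} (h : P a) : Always (pure a : Rnd α) 0 P := by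
  intro o ho
  obtain rfl := (PMF.mem_support_pure_iff _ _).1 ho
  exact ⟨h, le_rfl⟩

theorem Always.mono (h : Always m t P) (ht : t ≤ t') : Always m t' P :=
  fun o ho => ⟨(h o ho).1, (h o ho).2.trans ht⟩

theorem Always.imp {P' : α → Prop} (h : Always m t P) (hP : ∀ a, P a → P' a) : Always m t P' :=
  fun o ho => ⟨hP _ (h o ho).1, (h o ho).2⟩

end Rnd

/-! ### Picking a prime -/

/-- The array lists the primes below `M`. -/
def IsPrimeArray (a : Array ℤ) (M : ℕ) : Prop :=
  a.toList.Nodup ∧ ∀ x : ℤ, x ∈ a.toList ↔ ∃ p : ℕ, p.Prime ∧ p < M ∧ x = p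

theorem sum_range_getD {M : Type} [AddCommMonoid M] (l : List ℤ) (φ : ℤ → M) :
    ∑ i ∈ Finset.range l.length, φ (l.getD i 0) = (l.map φ).sum := by
  induction l with
  | nil => simp
  | cons a l ih =>
    rw [List.length_cons, Finset.sum_range_succ', List.map_cons, List.sum_cons, ← ih, add_comm]
    simp

theorem IsPrimeArray.sum_eq {a : Array ℤ} {M : ℕ} (h : IsPrimeArray a M) {R : Type}
    [AddCommMonoid R] (φ : ℤ → R) :
    (a.toList.map φ).sum = ∑ p ∈ M.primesBelow, φ (p : ℤ) := by
  rw [← List.sum_toFinset _ h.1]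
  have h1 : a.toList.toFinset = M.primesBelow.image fun p : ℕ => (p : ℤ) := by
    ext x
    rw [List.mem_toFinset, h.2, Finset.mem_image]
    constructor
    · rintro ⟨p, h1, h2, h3⟩
      exact ⟨p, Nat.mem_primesBelow.2 ⟨h2, h1⟩, h3.symm⟩
    · rintro ⟨p, h1, h2⟩
      exact ⟨p, (Nat.mem_primesBelow.1 h1).2, (Nat.mem_primesBelow.1 h1).1, h2.symm⟩
  rw [h1, Finset.sum_image fun p _ q _ h => by exact_mod_cast h]

theorem IsPrimeArray.size_eq {a : Array ℤ} {M : ℕ} (h : IsPrimeArray a M) :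
    a.size = Nat.primeCounting' M := by
  have := h.sum_eq fun _ => 1
  simpa [Nat.primesBelow_card_eq_primeCounting'] using this

/-- The primes are listed without repetition, so a uniform position is a uniform prime. M ≥ 3 makes
the list nonempty, which leaves the guard `max _ 1` in `draw` without effect. -/
theorem ex_pick (W : ℕ) {a : Array ℤ} {M : ℕ} (h : IsPrimeArray a M) (hM : 3 ≤ M)
    (φ : ℤ → ℝ≥0∞) :
    (pick W a).ex φ = (∑ p ∈ M.primesBelow, φ (p : ℤ)) / Nat.primeCounting' M := by
  have h1 : (pick W a).ex φ = (draw W (a.size : ℤ)).ex fun i => φ (a.getD i.toNat 0) := by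
    rw [pick, Rnd.ex_bind]
    congr 1
    ext i
    exact Rnd.ex_lift _ _
  have hpos : 1 ≤ a.size := by
    rw [h.size_eq, Nat.one_le_iff_ne_zero, Ne, Nat.primeCounting'_eq_zero_iff]
    omega
  have h2 : (draw W (a.size : ℤ)).ex (fun i => φ (a.getD i.toNat 0)) =
      (∑ i ∈ Finset.range (max (a.size : ℤ).toNat 1), φ (a.getD i 0)) /
        (Finset.range (max (a.size : ℤ).toNat 1)).card :=
    (mean_map _ _ _).trans (mean_uniformOfFinset _ _ _)
  rw [h1, h2, Finset.card_range, Int.toNat_natCast, max_eq_left hpos, ← h.size_eq, ← h.sum_eq φ,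
    ← sum_range_getD]
  simp

theorem pick_always {D W : ℕ} (hW : Machine D W) {a : Array ℤ} {M : ℕ} (h : IsPrimeArray a M)
    (hM : 3 ≤ M) (hsM : Small D W (M : ℤ)) :
    Always (pick W a) (2 * unitCost D) (fun x => ∃ p : ℕ, p.Prime ∧ p < M ∧ x = p) := by
  have hpos : 1 ≤ a.size := by
    rw [h.size_eq, Nat.one_le_iff_ne_zero, Ne, Nat.primeCounting'_eq_zero_iff]
    omega
  have hle : a.size ≤ M := by
    rw [h.size_eq, ← Nat.primesBelow_card_eq_primeCounting']
    exact (Finset.card_filter_le _ _).trans (by simp)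
  have hsa : ∀ x : ℕ, x ≤ M → Small D W (x : ℤ) := fun x hx =>
    hsM.of_nonneg_le (by positivity) (by exact_mod_cast hx)
  have hdraw : Always (draw W (a.size : ℤ)) (unitCost D) (fun i => ∃ j : ℕ, j < a.size ∧ i = j) := by
    intro o ho
    obtain ⟨j, hj, rfl⟩ := (PMF.mem_support_map_iff _ _ _).1 ho
    replace hj := (PMF.mem_support_uniformOfFinset_iff _ _).1 hj
    rw [Finset.mem_range, Int.toNat_natCast, max_eq_left hpos] at hj
    exact ⟨⟨j, hj, rfl⟩, (Nat.le_add_right _ _).trans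
      (words_add_le_unitCost hW (hsa _ hle) hW.small_zero)⟩
  rw [two_mul]
  refine Always.bind hdraw fun i hi => ?_
  obtain ⟨j, hj, rfl⟩ := hi
  have hmem : ∃ p : ℕ, p.Prime ∧ p < M ∧ a.getD j 0 = p := by
    rw [← h.2]
    simp [hj]
  refine Always.lift ((readA_runs hW _ _ (hsa j (by omega)) ?_).imp fun x hx => ?_)
  · obtain ⟨p, -, h2, h3⟩ := hmem
    rw [Int.toNat_natCast, h3]
    exact hsa p h2.le
  · rw [hx, Int.toNat_natCast]
    exact hmem

/-! ### The repetitions -/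

/-- The state after `t` repetitions: `L` is the list of all records, and `s` bounds the number of
missed coordinates and that of wrong records. -/
structure RecordState (N : ℤ) (B : ℕ) (g : ℤ →₀ ℤ) (t s : ℕ) (L : List (ℤ × ℤ)) : Prop where
  inRange : InRange N L
  norm_le : listNorm L ≤ 3 * t * vecNorm g
  abs_le : ∀ a ∈ L, |a.2| ≤ 3 * vecNorm g
  length_le : L.length ≤ t * B
  missed_le : ∑ i ∈ g.support, (t - L.count (i, g i)) ≤ s
  wrong_le : L.countP (fun a => ¬ IsEntry g a) ≤ s
  eq_zero : g.support.card = 0 → s = 0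

theorem RecordState.nil (N : ℤ) (B : ℕ) (g : ℤ →₀ ℤ) : RecordState N B g 0 0 [] :=
  ⟨by simp [InRange], by simp, by simp, by simp, by simp, by simp, fun _ => rfl⟩

theorem listNorm_append (k l : List (ℤ × ℤ)) : listNorm (k ++ l) = listNorm k + listNorm l := by
  simp [listNorm]

theorem abs_le_listNorm {L : List (ℤ × ℤ)} {a : ℤ × ℤ} (h : a ∈ L) : |a.2| ≤ listNorm L :=
  List.single_le_sum (fun x hx => by
    obtain ⟨b, -, rfl⟩ := List.mem_map.1 hx
    exact abs_nonneg _) _ (List.mem_map_of_mem (f := fun a : ℤ × ℤ => |a.2|) h)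

/-- A single quantity, the number of non-isolated coordinates, pays for both kinds of error of a
repetition, missed coordinates and wrong records. -/
theorem RecordState.append {N : ℤ} {B : ℕ} {g : ℤ →₀ ℤ} {t s p : ℕ} {L new : List (ℤ × ℤ)}
    (h : RecordState N B g t s L) (h' : Records N B g p new) :
    RecordState N B g (t + 1) (s + (nonIsolated g p).card) (new ++ L) := by
  refine ⟨fun a ha => ?_, ?_, fun a ha => ?_, ?_, ?_, ?_, fun h0 => ?_⟩
  · rcases List.mem_append.1 ha with ha | ha
    · exact h'.inRange a ha
    · exact h.inRange a ha
  · rw [listNorm_append]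
    have := h.norm_le
    have := h'.norm_le
    push_cast
    linarith
  · rcases List.mem_append.1 ha with ha | ha
    · exact (abs_le_listNorm ha).trans h'.norm_le
    · exact h.abs_le a ha
  · rw [List.length_append, add_mul]
    have := h.length_le
    have := h'.length_le
    omega
  · calc ∑ i ∈ g.support, (t + 1 - (new ++ L).count (i, g i))
        ≤ ∑ i ∈ g.support, ((t - L.count (i, g i)) + if i ∈ nonIsolated g p then 1 else 0) := by
          refine Finset.sum_le_sum fun i hi => ?_
          rw [List.count_append]
          split_ifs with hn
          · omega
          · have := List.count_pos_iff.2 (h'.mem i hi hn)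
            omega
      _ ≤ s + (nonIsolated g p).card := by
          rw [Finset.sum_add_distrib, ← Finset.card_filter]
          refine Nat.add_le_add h.missed_le (Finset.card_le_card fun i hi => ?_)
          exact (Finset.mem_filter.1 hi).2
  · rw [List.countP_append]
    have := h.wrong_le
    have := h'.wrong_le
    omega
  · have h1 : (nonIsolated g p).card ≤ g.support.card := Finset.card_filter_le _ _
    have := h.eq_zero h0
    omega

/-- What is known about the arguments of one call of `locate`. -/
structure RoundInput (X : Ctx) (A : ℝ) (xs ys ws : List (ℤ × ℤ)) : Prop where
  inRange_xs : InRange X.N xs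
  inRange_ys : InRange X.N ys
  inRange_ws : InRange X.N ws
  norm_xs : (listNorm xs : ℝ) ≤ A
  norm_ys : (listNorm ys : ℝ) ≤ A
  norm_ws : (listNorm ws : ℝ) ≤ A
  support : ∀ i ∈ (prodVec xs ys - listVec ws).support, 0 ≤ i ∧ i < X.N
  vecNorm_le : (vecNorm (prodVec xs ys - listVec ws) : ℝ) ≤ A ^ 3

/-- A bound for the number of steps of one repetition with a prime below `M`. -/
def repetitionTime (X : Ctx) (D B M k : ℕ) : ℕ :=
  (k + 4) * ((X.terms + 1) * (13 * unitCost D)) +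
    (Nat.clog 2 (2 * M) + 1) * 2 ^ Nat.clog 2 (2 * M) * (94 * unitCost (D + 1)) +
    B * ((D * X.W + 1) * (7 * unitCost (D + 3)) + (X.len + 6) * ((X.terms + 1) * (20 * unitCost D)))

section
variable {X : Ctx} {A : ℝ} {D : ℕ} (hX : GoodCtx X A D) {xs ys ws : List (ℤ × ℤ)}
  (hI : RoundInput X A xs ys ws) {B M : ℕ} (hB : (B : ℝ) ≤ A) (hM : 3 ≤ M) (hMA : 4 * (M : ℝ) ≤ A)
include hX hI hB hMA

theorem repetition_runs_of_prime {p : ℕ} (hp : p.Prime) (hpM : p < M) :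
    Runs (repetition X xs ys ws B p)
      (repetitionTime X D B M (xs.length + ys.length + ws.length))
      (fun r => ((prodVec xs ys - listVec ws).support.card ≤ B → r ≠ none) ∧
        ∀ new, r = some new → Records X.N B (prodVec xs ys - listVec ws) p new) := by
  have hpM' : (p : ℝ) ≤ M := by exact_mod_cast hpM.le
  have hA3 : A ^ 3 ≤ A ^ 4 := pow_le_pow_right₀ hX.one_le_A (by norm_num)
  refine (repetition_runs hX hp.one_le (by linarith) xs ys ws hI.inRange_xs hI.inRange_ys
    hI.inRange_ws hI.norm_xs hI.norm_ys hI.norm_ws hI.support (hI.vecNorm_le.trans hA3) B hB).mono ?_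
  have h1 : Nat.clog 2 (2 * p) ≤ Nat.clog 2 (2 * M) := Nat.clog_mono_right 2 (by omega)
  have h2 : 2 ^ Nat.clog 2 (2 * p) ≤ 2 ^ Nat.clog 2 (2 * M) := Nat.pow_le_pow_right (by norm_num) h1
  unfold repetitionTime
  gcongr

include hM in
-- Nothing is assumed about the size of the support: either the invariants of the records persist,
-- or the loop has ended with `none`.
theorem repeatLoop_always {primes : Array ℤ} (hpr : IsPrimeArray primes M) (j : ℕ) {t s : ℕ}
    {L : List (ℤ × ℤ)} (hL : RecordState X.N B (prodVec xs ys - listVec ws) t s L) :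
    Always (repeatLoop X xs ys ws B primes j L)
      (j * (repetitionTime X D B M (xs.length + ys.length + ws.length) + (2 * unitCost D + B + 2)))
      (fun r => ∀ L', r = some L' →
        ∃ s, RecordState X.N B (prodVec xs ys - listVec ws) (t + j) s L') := by
  induction j generalizing t s L with
  | zero =>
    rw [repeatLoop, zero_mul]
    refine Always.pure fun L' h => ⟨s, ?_⟩
    obtain rfl := Option.some.inj h
    exact hL
  | succ j ih =>
    have hsM : Small D X.W (M : ℤ) := hX.small_of_le_A (by
      rw [Int.cast_natCast, abs_of_nonneg (by positivity)]
      have : (0 : ℝ) ≤ M := by positivity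
      linarith)
    rw [repeatLoop]
    refine Always.mono (t := 2 * unitCost D + (repetitionTime X D B M (xs.length + ys.length +
      ws.length) + ((B + 1) + (1 + j * (repetitionTime X D B M (xs.length + ys.length + ws.length) +
        (2 * unitCost D + B + 2)))))) ?_ (by rw [add_mul]; omega)
    refine Always.bind (pick_always hX.machine hpr hM hsM) fun x hx => ?_
    obtain ⟨p, hp, hpM, rfl⟩ := hx
    refine Always.bind (Always.lift (repetition_runs_of_prime hX hI hB hMA hp hpM)) fun r hr => ?_
    cases r with
    | none => exact Always.mono (t := 0) (Always.pure (by simp)) (Nat.zero_le _)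
    | some new =>
      have hrec := hr.2 new rfl
      refine Always.bind (Always.lift ((appendT_runs new L).mono ?_)) fun L' hL' => ?_
      · have := hrec.length_le
        omega
      · subst hL'
        refine Always.bind (Always.lift (P := fun _ => True) ⟨trivial, le_rfl⟩) fun _ _ => ?_
        refine (ih (hL.append hrec)).imp fun r hr rest h => ?_
        rw [← add_assoc, add_right_comm]
        exact hr rest h

/-- The result of all repetitions leads to a vector that is right at all but few coordinates. -/
def GoodRecords (X : Ctx) (B : ℕ) (g : ℤ →₀ ℤ) (m : ℕ) (r : Option (List (ℤ × ℤ))) : Prop :=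
  ∃ L, r = some L ∧ (∃ s, RecordState X.N B g (5 * m) s L) ∧
    2 * (g - listVec (collect X.W m L).val).support.card ≤ g.support.card

/-- The bound for the probability of failure with `j` repetitions to go. -/
noncomputable def failureBound (k m j s : ℕ) : ℝ :=
  (11 / 10) ^ j * (16 : ℝ) ^ ((s : ℝ) / k) / (2 : ℝ) ^ (15 * (m : ℝ) / 8)

omit hX hI hB hMA in
-- Bernoulli's inequality for exponents in [0, 1]: the convex function 16^x lies below its chord.
theorem sixteen_rpow_le {c k : ℕ} (h : c ≤ k) : (16 : ℝ) ^ ((c : ℝ) / k) ≤ 1 + 15 * ((c : ℝ) / k) := by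
  have h1 : (c : ℝ) / k ≤ 1 := div_le_one_of_le₀ (by exact_mod_cast h) (by positivity)
  have := rpow_one_add_le_one_add_mul_self (s := 15) (by norm_num)
    (by positivity : (0 : ℝ) ≤ (c : ℝ) / k) h1
  norm_num at this
  linarith

omit hX hI hB hMA in
/-- One repetition with a random prime multiplies the bound by at most `11 / 10` on average. -/
theorem sum_failureBound_le {g : ℤ →₀ ℤ} {ℓ : ℕ} (hg : ∀ i ∈ g.support, 0 ≤ i ∧ i < 2 ^ ℓ)
    (hπ : 150 * (g.support.card * ℓ) ≤ Nat.primeCounting' M) (m j s : ℕ) :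
    ∑ p ∈ M.primesBelow, failureBound g.support.card m j (s + (nonIsolated g p).card) ≤
      failureBound g.support.card m (j + 1) s * Nat.primeCounting' M := by
  set k := g.support.card with hk
  set Q := (11 / 10 : ℝ) ^ j * (16 : ℝ) ^ ((s : ℝ) / k) / (2 : ℝ) ^ (15 * (m : ℝ) / 8) with hQ
  have hQ0 : 0 ≤ Q := by positivity
  have h1 : ∀ p ∈ M.primesBelow, failureBound k m j (s + (nonIsolated g p).card) ≤
      Q * (1 + 15 * (((nonIsolated g p).card : ℝ) / k)) := by
    intro p _
    have h2 : failureBound k m j (s + (nonIsolated g p).card) =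
        Q * (16 : ℝ) ^ (((nonIsolated g p).card : ℝ) / k) := by
      rw [failureBound, hQ]
      push_cast
      rw [add_div, Real.rpow_add (by norm_num)]
      ring
    rw [h2]
    exact mul_le_mul_of_nonneg_left (sixteen_rpow_le (Finset.card_filter_le _ _)) hQ0
  refine (Finset.sum_le_sum h1).trans ?_
  rw [← Finset.mul_sum, Finset.sum_add_distrib, ← Finset.mul_sum, ← Finset.sum_div, Finset.sum_const,
    Nat.primesBelow_card_eq_primeCounting', nsmul_eq_mul, mul_one]
  -- The mean of c / k, with c the number of non-isolated coordinates, is at most k ℓ / π ≤ 1 / 150,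
  -- and 1 + 15 / 150 = 11 / 10.
  have h3 := sum_card_nonIsolated_le hg (s := M.primesBelow)
    fun p hp => (Nat.mem_primesBelow.1 hp).2
  have h4 : (∑ p ∈ M.primesBelow, ((nonIsolated g p).card : ℝ)) / k ≤ k * ℓ := by
    refine div_le_of_le_mul₀ (by positivity) (by positivity) ?_
    rw [mul_comm]
    exact_mod_cast h3
  have h5 : 150 * ((k : ℝ) * ℓ) ≤ Nat.primeCounting' M := by exact_mod_cast hπ
  have h6 : failureBound k m (j + 1) s = Q * (11 / 10) := by
    rw [failureBound, hQ, pow_succ]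
    ring
  rw [h6, mul_assoc]
  refine mul_le_mul_of_nonneg_left ?_ hQ0
  linarith

omit hX hI hB hMA in
-- 16^(s/k) = 2^(4 s/k) reaches the denominator 2^(15 m / 8) exactly from s = (15/32) m k on, and no
-- smaller total of errors can leave more than half of the coordinates wrong.
theorem one_le_failureBound {k m s : ℕ} (hk : k ≠ 0) (h : 15 * m * k ≤ 32 * s) :
    1 ≤ failureBound k m 0 s := by
  rw [failureBound, pow_zero, one_mul, le_div_iff₀ (by positivity), one_mul]
  have h1 : (16 : ℝ) ^ ((s : ℝ) / k) = 2 ^ (4 * ((s : ℝ) / k)) := by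
    rw [Real.rpow_mul (by norm_num)]
    norm_num
  rw [h1]
  refine Real.rpow_le_rpow_of_exponent_le (by norm_num) ?_
  have hk0 : (0 : ℝ) < k := by positivity
  have h2 : 15 * (m : ℝ) * k ≤ 32 * s := by exact_mod_cast h
  rw [mul_div_assoc', div_le_div_iff₀ (by norm_num) hk0]
  linarith

omit hX hI hB hMA in
-- (11/10)^5 = 1.61… is less than half of 2^(15/8) = 3.66…, which is bounded below by 40/11.
theorem failureBound_le (k m : ℕ) : failureBound k m (5 * m) 0 ≤ (1 / 2) ^ m := by
  rw [failureBound, Nat.cast_zero, zero_div, Real.rpow_zero, mul_one,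
    div_le_iff₀ (by positivity)]
  have h1 : (2 : ℝ) ^ (15 * (m : ℝ) / 8) = ((2 : ℝ) ^ (15 / 8 : ℝ)) ^ m := by
    rw [← Real.rpow_natCast, ← Real.rpow_mul (by norm_num)]
    congr 1
    ring
  rw [h1, ← mul_pow, pow_mul]
  refine pow_le_pow_left₀ (by norm_num) ?_ m
  have h2 : (4 : ℝ) ≤ ((2 : ℝ) ^ (15 / 8 : ℝ)) * (11 / 10) := by
    refine (pow_le_pow_iff_left₀ (by norm_num) (by positivity) (by norm_num : (8 : ℕ) ≠ 0)).1 ?_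
    rw [mul_pow, ← Real.rpow_natCast ((2 : ℝ) ^ (15 / 8 : ℝ)), ← Real.rpow_mul (by norm_num)]
    norm_num
  have h3 : (2 : ℝ) ^ (15 / 8 : ℝ) ≥ 40 / 11 := by linarith
  norm_num
  linarith

open Classical in
include hM in
-- A supermartingale argument: at the end the bound is at least 1 on every failure, and a repetition
-- does not increase it on average. Empty support needs separate treatment, as s / k is meaningless
-- then; but in that case s = 0, and nothing can be wrong.
theorem repeatLoop_ex {primes : Array ℤ} (hpr : IsPrimeArray primes M) {m ℓ : ℕ} (hm : 1 ≤ m)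
    (hN : X.N ≤ 2 ^ ℓ) (hk : (prodVec xs ys - listVec ws).support.card ≤ B)
    (hπ : 150 * ((prodVec xs ys - listVec ws).support.card * ℓ) ≤ Nat.primeCounting' M) (j : ℕ)
    {t s : ℕ} (htj : t + j = 5 * m) {L : List (ℤ × ℤ)}
    (hL : RecordState X.N B (prodVec xs ys - listVec ws) t s L) :
    (repeatLoop X xs ys ws B primes j L).ex
      (fun r => if GoodRecords X B (prodVec xs ys - listVec ws) m r then 0 else 1) ≤
      ENNReal.ofReal (failureBound (prodVec xs ys - listVec ws).support.card m j s) := by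
  set g := prodVec xs ys - listVec ws with hg
  induction j generalizing t s L with
  | zero =>
    rw [repeatLoop, Rnd.ex_pure]
    split_ifs with hgood
    · exact zero_le
    · obtain rfl : t = 5 * m := by omega
      have h1 : ¬ 2 * (g - listVec (collect X.W m L).val).support.card ≤ g.support.card :=
        fun h => hgood ⟨L, rfl, ⟨s, hL⟩, h⟩
      have h2 := card_support_sub_collect_le X.W hm L g hL.missed_le hL.wrong_le
      have hk0 : g.support.card ≠ 0 := by
        intro h0
        have h3 := hL.eq_zero h0
        rw [h3, mul_zero, Nat.le_zero, mul_eq_zero] at h2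
        omega
      rw [← ENNReal.ofReal_one]
      refine ENNReal.ofReal_le_ofReal (one_le_failureBound hk0 ?_)
      push Not at h1
      have h4 : 15 * m * g.support.card ≤
          15 * m * (2 * (g - listVec (collect X.W m L).val).support.card) :=
        Nat.mul_le_mul_left _ h1.le
      linarith
  | succ j ih =>
    rw [repeatLoop, Rnd.ex_bind, ex_pick X.W hpr hM]
    refine ENNReal.div_le_of_le_mul ?_
    have hstep : ∀ p ∈ M.primesBelow,
        Rnd.ex (do
          let r ← (repetition X xs ys ws B (p : ℤ) : Timed _)
          match r with
          | none => pure none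
          | some new => do
            let L' ← (appendT new L : Timed _)
            let _ ← (tick 1 : Timed _)
            repeatLoop X xs ys ws B primes j L')
          (fun r => if GoodRecords X B g m r then 0 else 1) ≤
        ENNReal.ofReal (failureBound g.support.card m j (s + (nonIsolated g p).card)) := by
      intro p hp
      obtain ⟨hpM, hpp⟩ := Nat.mem_primesBelow.1 hp
      have hr := (repetition_runs_of_prime hX hI hB hMA hpp hpM).1
      rw [Rnd.ex_lift_bind]
      generalize (repetition X xs ys ws B (p : ℤ)).val = r at hr
      cases r with
      | none => exact absurd rfl (hr.1 hk)
      | some new =>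
        dsimp only
        rw [Rnd.ex_lift_bind, Rnd.ex_lift_bind, (appendT_runs new L).1]
        exact ih (by omega) (hL.append (hr.2 new rfl))
    refine (Finset.sum_le_sum hstep).trans ?_
    rw [← ENNReal.ofReal_natCast, ← ENNReal.ofReal_mul (by unfold failureBound; positivity),
      ← ENNReal.ofReal_sum_of_nonneg fun p _ => by unfold failureBound; positivity]
    refine ENNReal.ofReal_le_ofReal (sum_failureBound_le (ℓ := ℓ) (fun i hi => ?_) hπ m j s)
    exact ⟨(hI.support i hi).1, (hI.support i hi).2.trans_le hN⟩

end

/-! ### Locating coordinates -/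

/-- What holds of the result of `locate` in any case. -/
structure Located (N : ℤ) (B : ℕ) (g : ℤ →₀ ℤ) (z : List (ℤ × ℤ)) : Prop where
  sorted : IndexSorted z
  inRange : InRange N z
  norm_le : listNorm z ≤ 4 * vecNorm g
  length_le : 3 * z.length ≤ 4 * B

theorem Located.nil (N : ℤ) (B : ℕ) (g : ℤ →₀ ℤ) : Located N B g [] :=
  ⟨List.Pairwise.nil, by simp [InRange], by simpa using vecNorm_nonneg g, by simp⟩

/-- A kept pair accounts for at least 15 m / 4 records. As each of the 5 m repetitions contributes
norm at most 3 ‖g‖ and at most B pairs, norm at most 4 ‖g‖ and at most 4 B / 3 pairs remain, on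
every outcome. -/
theorem RecordState.located_collect {N : ℤ} {B : ℕ} {g : ℤ →₀ ℤ} {m s : ℕ} {L : List (ℤ × ℤ)}
    (W : ℕ) (hm : 1 ≤ m) (h : RecordState N B g (5 * m) s L) :
    Located N B g (collect W m L).val := by
  obtain ⟨h1, h2, -⟩ := collect_spec W m L
  have hm' : (1 : ℤ) ≤ m := by exact_mod_cast hm
  refine ⟨h1, fun a ha => ?_, ?_, ?_⟩
  · refine h.inRange a (List.count_pos_iff.1 ?_)
    have := h2 a ha
    omega
  · have h3 := collect_norm_mul_le W m L
    have h4 := h.norm_le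
    push_cast at h4
    have h5 : (15 * (m : ℤ)) * listNorm (collect W m L).val ≤ (15 * (m : ℤ)) * (4 * vecNorm g) := by
      linarith
    exact le_of_mul_le_mul_left h5 (by linarith)
  · have h3 := collect_length_mul_le W m L
    have h4 : (L.length : ℤ) ≤ 5 * m * B := by exact_mod_cast h.length_le
    have h5 : (5 * (m : ℤ)) * (3 * (collect W m L).val.length) ≤ (5 * (m : ℤ)) * (4 * B) := by
      linarith
    have h6 := le_of_mul_le_mul_left h5 (by linarith)
    exact_mod_cast h6

/-- A bound for the number of steps of `locate`. -/
def locateTime (X : Ctx) (D B M k m : ℕ) : ℕ :=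
  unitCost D + (M * ((Nat.clog 2 M + 1) * (14 * unitCost D)) +
    (5 * m * (repetitionTime X D B M k + (2 * unitCost D + B + 2)) +
      (5 * m * B + 1) * ((Nat.clog 2 (5 * m * B) + 1) * (30 * unitCost (D + 1)))))

section
variable {X : Ctx} {A : ℝ} {D : ℕ} (hX : GoodCtx X A D) {xs ys ws : List (ℤ × ℤ)}
  (hI : RoundInput X A xs ys ws) {C B : ℕ} (hB : 1 ≤ B) (hC : 360000 ≤ C) (hlen : 1 ≤ X.len)
  (hMA : 4 * ((C * B * X.len * X.len : ℕ) : ℝ) ≤ A)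
include hX hB hC hlen hMA

theorem locate_sieve :
    (ev X.W ((C : ℤ) * (B : ℤ) * (X.len : ℤ) * (X.len : ℤ))).val = ((C * B * X.len * X.len : ℕ) : ℤ) ∧
    (ev X.W ((C : ℤ) * (B : ℤ) * (X.len : ℤ) * (X.len : ℤ))).time ≤ unitCost D ∧
    C ≤ C * B * X.len * X.len ∧ (B : ℝ) ≤ A ∧
    Runs (sieve X.W ((C * B * X.len * X.len : ℕ) : ℤ))
      ((C * B * X.len * X.len) * ((Nat.clog 2 (C * B * X.len * X.len) + 1) * (14 * unitCost D)))
      (fun a => IsPrimeArray a (C * B * X.len * X.len)) := by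
  set M := C * B * X.len * X.len with hM
  have hM0 : (0 : ℝ) ≤ M := by positivity
  have hle : ∀ x : ℕ, x ≤ M → (x : ℝ) ≤ A := fun x hx => by
    have : (x : ℝ) ≤ M := by exact_mod_cast hx
    linarith
  have hsm : ∀ x : ℕ, x ≤ M → Small D X.W (x : ℤ) := fun x hx => hX.small_of_le_A (by
    rw [Int.cast_natCast, abs_of_nonneg (by positivity)]
    exact hle x hx)
  have hC1 : 1 ≤ C := by omega
  have h1 : C ≤ M := by
    rw [hM, mul_assoc, mul_assoc]
    exact Nat.le_mul_of_pos_right _ (Nat.mul_pos hB (Nat.mul_pos hlen hlen))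
  have h2 : B ≤ M := by
    rw [hM, mul_comm C, mul_assoc, mul_assoc]
    exact Nat.le_mul_of_pos_right _ (Nat.mul_pos hC1 (Nat.mul_pos hlen hlen))
  have h3 : X.len ≤ M := by
    rw [hM]
    exact Nat.le_mul_of_pos_left _ (Nat.mul_pos (Nat.mul_pos hC1 hB) hlen)
  refine ⟨by simp [hM], ?_, h1, hle B h2, sieve_runs hX.machine (by omega) (hsm M le_rfl)⟩
  exact (ev_runs hX.machine (Exp.lit (C : ℤ) * Exp.lit (B : ℤ) * Exp.lit (X.len : ℤ) *
    Exp.lit (X.len : ℤ)) ⟨⟨⟨hsm C h1, hsm B h2⟩, hsm _ h3⟩, hsm _ h3⟩).2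

include hI

theorem locate_always {m : ℕ} (hm : 1 ≤ m) (hmB : (5 * m * B : ℝ) ≤ A) :
    Always (locate C X xs ys ws B m)
      (locateTime X D B (C * B * X.len * X.len) (xs.length + ys.length + ws.length) m)
      (Located X.N B (prodVec xs ys - listVec ws)) := by
  obtain ⟨h1, h2, h3, h4, h5⟩ := locate_sieve hX hB hC hlen hMA
  set M := C * B * X.len * X.len with hM
  rw [locate, locateTime]
  refine Always.bind (Always.lift (P := fun x => x = (M : ℤ)) ⟨h1, h2⟩) fun x hx => ?_
  subst hx
  refine Always.bind (Always.lift h5) fun primes hpr => ?_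
  refine Always.bind (repeatLoop_always hX hI h4 (by omega) hMA hpr (5 * m)
    (RecordState.nil X.N B _)) fun r hr => ?_
  cases r with
  | none => exact Always.mono (t := 0) (Always.pure (Located.nil _ _ _)) (Nat.zero_le _)
  | some L =>
    obtain ⟨s, hL⟩ := hr L rfl
    rw [zero_add] at hL
    have hLA : ((L.length : ℕ) : ℝ) ≤ A := by
      have : ((L.length : ℕ) : ℝ) ≤ 5 * m * B := by exact_mod_cast hL.length_le
      linarith
    have hmA : ((m : ℕ) : ℝ) ≤ A := by
      have : m ≤ 5 * m * B := by nlinarith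
      have : (m : ℝ) ≤ 5 * m * B := by exact_mod_cast this
      linarith
    refine Always.lift ⟨hL.located_collect X.W hm, (collect_time hX.machine
      (hX.small_of_le_A ?_) L (fun a ha => ⟨?_, ?_⟩) (hX.small_of_le_A ?_)).trans ?_⟩
    · rw [Int.cast_natCast, abs_of_nonneg (by positivity)]
      exact hmA
    · refine hX.small_N.of_nonneg_le (hL.inRange a ha).1 (hL.inRange a ha).2.le
    · refine hX.small_of_le (k := 4) (j := 0) (by norm_num) (by norm_num) ?_
      have h6 : ((|a.2| : ℤ) : ℝ) ≤ ((3 * vecNorm (prodVec xs ys - listVec ws) : ℤ) : ℝ) :=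
        Int.cast_le.2 (hL.abs_le a ha)
      push_cast at h6
      rw [pow_zero, mul_one]
      have h7 := hI.vecNorm_le
      have h8 : (3 : ℝ) * A ^ 3 ≤ A ^ 4 := hX.mul_pow_le (by norm_num) 3
      linarith
    · rw [Int.cast_natCast, abs_of_nonneg (by positivity)]
      exact hLA
    · have h6 : L.length ≤ 5 * m * B := hL.length_le
      have h7 : Nat.clog 2 L.length ≤ Nat.clog 2 (5 * m * B) := Nat.clog_mono_right 2 h6
      gcongr

open Classical in
-- The hypothesis C k ≤ B acts twice: there are at least 150 k L primes to choose from, and there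
-- are never more than B heavy buckets.
theorem locate_ex {m : ℕ} (hm : 1 ≤ m) (hN : X.N ≤ 2 ^ X.len)
    (hk : C * (prodVec xs ys - listVec ws).support.card ≤ B) :
    (locate C X xs ys ws B m).ex (fun z =>
      if Located X.N B (prodVec xs ys - listVec ws) z ∧
        2 * (prodVec xs ys - listVec ws - listVec z).support.card ≤
          (prodVec xs ys - listVec ws).support.card then 0 else 1) ≤
      ENNReal.ofReal ((1 / 2) ^ m) := by
  obtain ⟨h1, h2, h3, h4, h5⟩ := locate_sieve hX hB hC hlen hMA
  set M := C * B * X.len * X.len with hM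
  set g := prodVec xs ys - listVec ws with hg
  have hcard : g.support.card ≤ 2 ^ X.len := by
    have h6 : g.support ⊆ Finset.Ico (0 : ℤ) ((2 ^ X.len : ℕ) : ℤ) := fun i hi => by
      rw [Finset.mem_Ico]
      push_cast
      exact ⟨(hI.support i hi).1, (hI.support i hi).2.trans_le hN⟩
    have h7 := Finset.card_le_card h6
    rwa [Int.card_Ico, sub_zero, Int.toNat_natCast] at h7
  have hkB : g.support.card ≤ B := (Nat.le_mul_of_pos_left _ (by omega)).trans hk
  have h7 := repeatLoop_ex hX hI h4 (by omega) hMA h5.1 hm hN hkB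
    (mul_le_primeCounting hC hlen hB hcard hk) (5 * m) (by omega) (RecordState.nil X.N B _)
  rw [locate, Rnd.ex_lift_bind, h1, Rnd.ex_lift_bind, Rnd.ex_bind]
  refine le_trans (Rnd.ex_mono _ fun r => ?_)
    (h7.trans (ENNReal.ofReal_le_ofReal (failureBound_le _ _)))
  split_ifs with hgood
  · obtain ⟨L, rfl, ⟨s, hL⟩, hc⟩ := hgood
    dsimp only
    rw [Rnd.ex_lift, if_pos ⟨hL.located_collect X.W hm, hc⟩]
  · exact Rnd.ex_le_one _ fun z => by split_ifs <;> simp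

end

/-! ### The rounds -/

/-- The state `w` after some rounds: `r` of them, with parameters that add up to `σ`. -/
structure PartialSum (N : ℤ) (h : ℤ →₀ ℤ) (r σ : ℕ) (w : List (ℤ × ℤ)) : Prop where
  sorted : IndexSorted w
  ne_zero : ∀ a ∈ w, a.2 ≠ 0
  inRange : InRange N w
  norm_le : vecNorm (h - listVec w) ≤ 5 ^ r * vecNorm h
  length_le : 3 * w.length ≤ 4 * σ

theorem PartialSum.nil (N : ℤ) (h : ℤ →₀ ℤ) : PartialSum N h 0 0 [] :=
  ⟨List.Pairwise.nil, by simp, by simp [InRange], by simp, by simp⟩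

/-- The norm of a located vector is at most 4 times that of the remaining vector, so even a failed
round enlarges the latter at most fivefold. Over ⌈log B⌉ rounds this is a polynomial factor. -/
theorem PartialSum.add {N : ℤ} {h : ℤ →₀ ℤ} {r σ b : ℕ} {w z : List (ℤ × ℤ)} (W : ℕ)
    (hw : PartialSum N h r σ w) (hz : Located N b (h - listVec w) z) :
    PartialSum N h (r + 1) (σ + b) (addSparse W w z).val ∧
      h - listVec (addSparse W w z).val = h - listVec w - listVec z := by
  obtain ⟨h1, h2, h3, h4, h5⟩ := addSparse_spec W w z hw.sorted hz.sorted
  have h6 : h - listVec (addSparse W w z).val = h - listVec w - listVec z := by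
    rw [h5]
    abel
  refine ⟨⟨h1, h2, fun a ha => ?_, ?_, ?_⟩, h6⟩
  · obtain ⟨b, hb, hba⟩ := h3 a ha
    rw [← hba]
    rcases List.mem_append.1 hb with hb | hb
    · exact hw.inRange b hb
    · exact hz.inRange b hb
  · rw [h6]
    have h7 := vecNorm_sub_le (h - listVec w) (listVec z)
    have h8 := vecNorm_listVec_le z
    have h9 := hz.norm_le
    have h10 := hw.norm_le
    rw [pow_succ]
    linarith
  · have := hw.length_le
    have := hz.length_le
    omega

/-- The hypotheses on the arguments of `rounds`, where `R` is the number of rounds. -/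
structure RoundsInput (X : Ctx) (A : ℝ) (D C : ℕ) (xs ys : List (ℤ × ℤ)) (B R : ℕ) : Prop where
  ctx : GoodCtx X A D
  one_le_len : 1 ≤ X.len
  C_ge : 360000 ≤ C
  inRange_xs : InRange X.N xs
  inRange_ys : InRange X.N ys
  norm_xs : (listNorm xs : ℝ) ≤ A
  norm_ys : (listNorm ys : ℝ) ≤ A
  support : ∀ i ∈ (prodVec xs ys).support, 0 ≤ i ∧ i < X.N
  norm_prod : 2 * (5 ^ R * (vecNorm (prodVec xs ys) : ℝ)) ≤ A
  one_le_B : 1 ≤ B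
  B_le : B ≤ 2 ^ R
  pow_le : (2 ^ R : ℝ) ≤ A
  modulus_le : 4 * ((C * B * X.len * X.len : ℕ) : ℝ) ≤ A

/-- The parameter of `locate` after `r` rounds. -/
def roundParam (B r : ℕ) : ℕ := (B + 2 ^ r - 1) / 2 ^ r

theorem one_le_roundParam {B : ℕ} (hB : 1 ≤ B) (r : ℕ) : 1 ≤ roundParam B r := by
  rw [roundParam, Nat.one_le_div_iff (by positivity)]
  omega

theorem le_roundParam_mul (B r : ℕ) : B ≤ roundParam B r * 2 ^ r := by
  have h1 := Nat.lt_div_mul_add (a := B + 2 ^ r - 1) (b := 2 ^ r) (by positivity)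
  have h2 : 0 < 2 ^ r := by positivity
  unfold roundParam
  omega

theorem roundParam_zero (B : ℕ) : roundParam B 0 = B := by simp [roundParam]

/-- Dividing by 2^r with rounding up and then by 2 with rounding up is dividing by 2^(r+1) with
rounding up; so the parameters form a geometric series up to rounding. -/
theorem two_mul_roundParam_succ_le (B r : ℕ) : 2 * roundParam B (r + 1) ≤ roundParam B r + 1 := by
  have h0 : 0 < 2 ^ r := by positivity
  have h1 : roundParam B (r + 1) = (roundParam B r + 1) / 2 := by
    rw [roundParam, roundParam, pow_succ, ← Nat.div_div_eq_div_mul, ← Nat.add_div_right _ h0]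
    congr 2
    omega
  omega

theorem roundParam_le {B : ℕ} (hB : 1 ≤ B) (r : ℕ) : roundParam B r ≤ B := by
  induction r with
  | zero => rw [roundParam_zero]
  | succ r ih =>
    have := two_mul_roundParam_succ_le B r
    omega

section
variable {X : Ctx} {A : ℝ} {D C : ℕ} {xs ys : List (ℤ × ℤ)} {B R : ℕ}
  (hI : RoundsInput X A D C xs ys B R) {r σ : ℕ} {w : List (ℤ × ℤ)}
  (hw : PartialSum X.N (prodVec xs ys) r σ w)
include hI

theorem RoundsInput.roundParam_val (hr : r ≤ R) :
    Runs (ev X.W ((Exp.lit (B : ℤ) + Exp.lit ((2 ^ r : ℕ) : ℤ) - 1) / Exp.lit ((2 ^ r : ℕ) : ℤ)))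
      (unitCost D)
      (fun b => b = (roundParam B r : ℤ)) := by
  have hX := hI.ctx
  have hB : (B : ℝ) ≤ 2 ^ R := by exact_mod_cast hI.B_le
  have hsB : Small D X.W (B : ℤ) := hX.small_of_le_A (by
    rw [Int.cast_natCast, abs_of_nonneg (by positivity)]
    exact hB.trans hI.pow_le)
  have hsP : Small D X.W ((2 ^ r : ℕ) : ℤ) := hX.small_of_le_A (by
    rw [Int.cast_natCast, abs_of_nonneg (by positivity)]
    push_cast
    exact (pow_le_pow_right₀ (by norm_num) hr).trans hI.pow_le)
  have h0 : 0 < 2 ^ r := by positivity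
  have h1 := ev_runs hX.machine ((Exp.lit (B : ℤ) + Exp.lit ((2 ^ r : ℕ) : ℤ) - 1) /
    Exp.lit ((2 ^ r : ℕ) : ℤ)) ⟨⟨⟨hsB, hsP⟩, hX.machine.small_one⟩, hsP⟩
  refine h1.imp fun b hb => ?_
  rw [hb]
  simp only [Exp.eval_sub, Exp.eval_add, Exp.eval_div, Exp.eval_lit, Exp.eval_one]
  rw [roundParam, Int.natCast_ediv, Nat.cast_sub (by have := hI.one_le_B; omega)]
  push_cast
  rfl

theorem RoundsInput.double_runs (hr : r < R) :
    Runs (ev X.W (2 * Exp.lit ((2 ^ r : ℕ) : ℤ))) (unitCost D)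
      (fun b => b = ((2 ^ (r + 1) : ℕ) : ℤ)) := by
  have hX := hI.ctx
  have hsP : Small D X.W ((2 ^ r : ℕ) : ℤ) := hX.small_of_le_A (by
    rw [Int.cast_natCast, abs_of_nonneg (by positivity)]
    push_cast
    exact (pow_le_pow_right₀ (by norm_num) hr.le).trans hI.pow_le)
  have h1 := ev_runs hX.machine (2 * Exp.lit ((2 ^ r : ℕ) : ℤ)) ⟨hX.machine.small_two, hsP⟩
  refine h1.imp fun b hb => ?_
  rw [hb]
  simp [pow_succ, mul_comm]

include hw

theorem RoundsInput.roundInput (hr : r ≤ R) : RoundInput X A xs ys w := by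
  have hA := hI.ctx.one_le_A
  have hv0 := vecNorm_nonneg (prodVec xs ys)
  have h5 : (5 : ℤ) ^ r ≤ 5 ^ R := pow_le_pow_right₀ (by norm_num) hr
  have h51 : (1 : ℤ) ≤ 5 ^ R := one_le_pow₀ (by norm_num)
  have h1 : vecNorm (prodVec xs ys - listVec w) ≤ 5 ^ R * vecNorm (prodVec xs ys) :=
    hw.norm_le.trans (mul_le_mul_of_nonneg_right h5 hv0)
  have h2 : listNorm w ≤ 2 * (5 ^ R * vecNorm (prodVec xs ys)) := by
    rw [← vecNorm_listVec hw.sorted.nodup_map_fst]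
    have h3 := vecNorm_sub_le (prodVec xs ys) (prodVec xs ys - listVec w)
    rw [sub_sub_cancel] at h3
    nlinarith
  have hn := hI.norm_prod
  refine ⟨hI.inRange_xs, hI.inRange_ys, hw.inRange, hI.norm_xs, hI.norm_ys, ?_, fun i hi => ?_, ?_⟩
  · refine le_trans ?_ hn
    exact_mod_cast h2
  · by_cases hi' : i ∈ (prodVec xs ys).support
    · exact hI.support i hi'
    · rw [Finsupp.mem_support_iff, Finsupp.sub_apply, Finsupp.notMem_support_iff.1 hi', zero_sub,
        neg_ne_zero] at hi
      obtain ⟨a, ha, rfl⟩ := listVec_apply_ne_zero hi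
      exact hw.inRange a ha
  · have h3 : (vecNorm (prodVec xs ys - listVec w) : ℝ) ≤ 5 ^ R * (vecNorm (prodVec xs ys) : ℝ) := by
      exact_mod_cast h1
    have h4 : (0 : ℝ) ≤ 5 ^ R * (vecNorm (prodVec xs ys) : ℝ) := by
      have : (0 : ℝ) ≤ vecNorm (prodVec xs ys) := by exact_mod_cast hv0
      positivity
    have h5 : A ^ 1 ≤ A ^ 3 := pow_le_pow_right₀ hA (by norm_num)
    rw [pow_one] at h5
    linarith

omit hw in
theorem RoundsInput.modulus_roundParam_le (r : ℕ) :
    4 * ((C * roundParam B r * X.len * X.len : ℕ) : ℝ) ≤ A := by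
  refine le_trans ?_ hI.modulus_le
  have := roundParam_le hI.one_le_B r
  gcongr

open Classical in
-- The invariant C k 2^r < B survives a successful round, which halves k; a failed round is charged
-- 2^(-m). After R rounds, 2^R ≥ B leaves no room for k ≥ 1.
theorem rounds_ex {m : ℕ} (hm : 1 ≤ m) (k : ℕ) (hrk : r + k = R)
    (hcard : C * (prodVec xs ys - listVec w).support.card * 2 ^ r < B) :
    (rounds C X xs ys B m k ((2 ^ r : ℕ) : ℤ) w).ex (fun w' =>
      if IndexSorted w' ∧ (∀ a ∈ w', a.2 ≠ 0) ∧ listVec w' = prodVec xs ys then 0 else 1) ≤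
      k * ENNReal.ofReal ((1 / 2) ^ m) := by
  have hX := hI.ctx
  induction k generalizing r σ w with
  | zero =>
    rw [rounds, Rnd.ex_pure, if_pos]
    · exact zero_le
    refine ⟨hw.sorted, hw.ne_zero, ?_⟩
    have hR : r = R := by omega
    have h1 : (prodVec xs ys - listVec w).support.card = 0 := by
      by_contra h0
      have h2 := hI.B_le
      have h3 := hI.C_ge
      rw [hR] at hcard
      have h4 : 1 * 2 ^ R ≤ C * (prodVec xs ys - listVec w).support.card * 2 ^ R :=
        Nat.mul_le_mul_right _ (Nat.mul_pos (by omega) (Nat.pos_of_ne_zero h0))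
      omega
    rw [Finset.card_eq_zero, Finsupp.support_eq_empty, sub_eq_zero] at h1
    exact h1.symm
  | succ k ih =>
    have hr : r < R := by omega
    have hin := hI.roundInput hw hr.le
    have hk : C * (prodVec xs ys - listVec w).support.card ≤ roundParam B r := by
      have h1 := le_roundParam_mul B r
      have h2 : C * (prodVec xs ys - listVec w).support.card * 2 ^ r < roundParam B r * 2 ^ r :=
        hcard.trans_le h1
      exact (Nat.lt_of_mul_lt_mul_right h2).le
    have hloc := locate_ex hX hin (one_le_roundParam hI.one_le_B r) hI.C_ge hI.one_le_len
      (hI.modulus_roundParam_le r) hm hX.N_le_pow hk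
    rw [rounds, Rnd.ex_lift_bind, (hI.roundParam_val hr.le).1, Rnd.ex_bind]
    -- The union bound: for each z the failure probability of the later rounds is at most the
    -- indicator that this round failed plus the bound for k good rounds.
    refine le_trans (Rnd.ex_mono _ fun z => ?_) ((Rnd.ex_add_const _ _ _).le.trans
      (add_le_add_left hloc ((k : ℝ≥0∞) * ENNReal.ofReal ((1 / 2) ^ m))) |>.trans ?_)
    · split_ifs with hz
      · obtain ⟨hw', he⟩ := hw.add X.W hz.1
        rw [zero_add, Rnd.ex_lift_bind, Rnd.ex_lift_bind, (hI.double_runs hr).1]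
        refine ih hw' (by omega) ?_
        rw [he, pow_succ]
        refine lt_of_le_of_lt ?_ hcard
        have h1 := Nat.mul_le_mul_left (C * 2 ^ r) hz.2
        linarith
      · exact le_trans (Rnd.ex_le_one _ fun z => by split_ifs <;> simp) le_self_add
    · rw [Nat.cast_add, Nat.cast_one, add_mul, one_mul, add_comm]

end

/-! ### The number of steps of the rounds -/

/-- The number of steps of a round that comes from the sizes of the vectors. -/
def roundCost (X : Ctx) (D H : ℕ) : ℕ := 100 * ((H + 4) * ((X.terms + 1) * unitCost (D + 3)))

/-- The number of steps of a round per unit of its parameter. -/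
def paramCost (X : Ctx) (D C B m : ℕ) : ℕ :=
  unitCost (D + 3) * (2000 * (C * X.len * X.len * (Nat.clog 2 (2 * (C * B * X.len * X.len)) + 1)) +
    35 * (D * X.W + 1) + 100 * ((X.len + 6) * (X.terms + 1)) + 180 * (Nat.clog 2 (5 * m * B) + 1))

/-- The cost is sorted into a share governed by the lengths of the lists and a share proportional to
b. Logarithms are replaced by their values for B, so the coefficient of b is the same in all rounds
and only the parameters have to be summed. -/
theorem locateTime_le (X : Ctx) (D C : ℕ) {b B k H m : ℕ} (hm : 1 ≤ m) (hb : 1 ≤ b) (hbB : b ≤ B)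
    (hkH : k ≤ H) (hC : 1 ≤ C) (hlen : 1 ≤ X.len) :
    locateTime X D b (C * b * X.len * X.len) k m + 2 * unitCost D ≤
      m * (90 * ((H + 4) * ((X.terms + 1) * unitCost (D + 3))) + paramCost X D C B m * b) := by
  have hU0 : unitCost D ≤ unitCost (D + 3) := unitCost_mono (by omega)
  have hU1 : unitCost (D + 1) ≤ unitCost (D + 3) := unitCost_mono (by omega)
  have hU := one_le_unitCost (D + 3)
  unfold locateTime repetitionTime paramCost
  set U := unitCost (D + 3) with hUdef
  set Q := C * X.len * X.len with hQ
  have hM : C * b * X.len * X.len = Q * b := by rw [hQ]; ring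
  have hMB : C * B * X.len * X.len = Q * B := by rw [hQ]; ring
  rw [hM, hMB]
  have hQ1 : 1 ≤ Q := Nat.mul_pos (Nat.mul_pos hC hlen) hlen
  have hQb : 1 ≤ Q * b := Nat.mul_pos hQ1 hb
  have hQbB : Q * b ≤ Q * B := Nat.mul_le_mul_left _ hbB
  set Λ := Nat.clog 2 (2 * (Q * B)) + 1 with hΛ
  have hΛ1 : Nat.clog 2 (2 * (Q * b)) + 1 ≤ Λ :=
    Nat.succ_le_succ (Nat.clog_mono_right 2 (by omega))
  have hΛ2 : Nat.clog 2 (Q * b) + 1 ≤ Λ := Nat.succ_le_succ (Nat.clog_mono_right 2 (by omega))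
  have hpow : 2 ^ Nat.clog 2 (2 * (Q * b)) ≤ 4 * (Q * b) := by
    have h2 := Nat.pow_pred_clog_lt_self (b := 2) (by norm_num) (x := 2 * (Q * b)) (by omega)
    have h3 : 0 < Nat.clog 2 (2 * (Q * b)) := Nat.clog_pos (by norm_num) (by omega)
    obtain ⟨e, he⟩ : ∃ e, Nat.clog 2 (2 * (Q * b)) = e + 1 := ⟨_, (Nat.succ_pred_eq_of_pos h3).symm⟩
    rw [he] at h2 ⊢
    rw [Nat.pred_succ] at h2
    rw [pow_succ]
    omega
  set G := Nat.clog 2 (5 * m * B) + 1 with hG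
  have hG1 : Nat.clog 2 (5 * m * b) + 1 ≤ G :=
    Nat.succ_le_succ (Nat.clog_mono_right 2 (Nat.mul_le_mul_left _ hbB))
  set V := X.terms + 1 with hV
  have hV1 : 1 ≤ V := by omega
  -- the five contributions
  have t1 : Q * b * ((Nat.clog 2 (Q * b) + 1) * (14 * unitCost D)) ≤ m * (14 * (U * (Q * Λ) * b)) := by
    calc Q * b * ((Nat.clog 2 (Q * b) + 1) * (14 * unitCost D)) ≤ Q * b * (Λ * (14 * U)) := by gcongr
      _ = 1 * (14 * (U * (Q * Λ) * b)) := by ring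
      _ ≤ _ := by gcongr
  have t2 : (k + 4) * (V * (13 * unitCost D)) ≤ 13 * ((H + 4) * (V * U)) := by
    calc (k + 4) * (V * (13 * unitCost D)) ≤ (H + 4) * (V * (13 * U)) := by gcongr
      _ = _ := by ring
  have t3 : (Nat.clog 2 (2 * (Q * b)) + 1) * 2 ^ Nat.clog 2 (2 * (Q * b)) * (94 * unitCost (D + 1)) ≤
      376 * (U * (Q * Λ) * b) := by
    calc _ ≤ Λ * (4 * (Q * b)) * (94 * U) := by gcongr
      _ = _ := by ring
  have t4 : b * ((D * X.W + 1) * (7 * U) + (X.len + 6) * (V * (20 * unitCost D))) ≤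
      7 * (U * (D * X.W + 1) * b) + 20 * (U * ((X.len + 6) * V) * b) := by
    calc _ ≤ b * ((D * X.W + 1) * (7 * U) + (X.len + 6) * (V * (20 * U))) := by gcongr
      _ = _ := by ring
  have t5 : (5 * m * b + 1) * ((Nat.clog 2 (5 * m * b) + 1) * (30 * unitCost (D + 1))) ≤
      m * (180 * (U * G * b)) := by
    have h1 : 1 ≤ m * b := Nat.mul_pos hm hb
    calc _ ≤ (6 * (m * b)) * (G * (30 * U)) := by
          refine Nat.mul_le_mul ?_ ?_
          · rw [mul_assoc]
            omega
          · gcongr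
      _ = _ := by ring
  have t6 : U ≤ (H + 4) * (V * U) :=
    (Nat.le_mul_of_pos_left _ hV1).trans (Nat.le_mul_of_pos_left _ (by omega))
  have t7 : b ≤ U * (Q * Λ) * b :=
    Nat.le_mul_of_pos_left _ (Nat.mul_pos hU (Nat.mul_pos hQ1 (by omega)))
  have t8 : U ≤ m * U := Nat.le_mul_of_pos_left _ hm
  have e : U * (2000 * (Q * Λ) + 35 * (D * X.W + 1) + 100 * ((X.len + 6) * V) + 180 * G) * b =
      2000 * (U * (Q * Λ) * b) + 35 * (U * (D * X.W + 1) * b) + 100 * (U * ((X.len + 6) * V) * b) +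
        180 * (U * G * b) := by ring
  rw [e]
  generalize U * (Q * Λ) * b = y1 at *
  generalize U * (D * X.W + 1) * b = y2 at *
  generalize U * ((X.len + 6) * V) * b = y3 at *
  generalize U * G * b = y4 at *
  generalize (H + 4) * (V * U) = y5 at *
  have t9 : 5 * m * ((k + 4) * (V * (13 * unitCost D)) +
      (Nat.clog 2 (2 * (Q * b)) + 1) * 2 ^ Nat.clog 2 (2 * (Q * b)) * (94 * unitCost (D + 1)) +
      b * ((D * X.W + 1) * (7 * U) + (X.len + 6) * (V * (20 * unitCost D))) +
      (2 * unitCost D + b + 2)) ≤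
      5 * m * (13 * y5 + 376 * y1 + (7 * y2 + 20 * y3) + (4 * y5 + y1)) := by
    refine Nat.mul_le_mul_left _ ?_
    linarith
  have t10 : U ≤ m * y5 := t6.trans (Nat.le_mul_of_pos_left _ hm)
  linarith [Nat.zero_le (m * y1), Nat.zero_le (m * y5)]

/-- The parameters still to come add up to at most 2 b + k, by `two_mul_roundParam_succ_le`.
Together with those already used they stay within 3 B, which bounds the length of w by 4 B; at the
start this says 2 B + R ≤ 3 B. -/
theorem rounds_always {X : Ctx} {A : ℝ} {D C : ℕ} {xs ys : List (ℤ × ℤ)} {B R : ℕ}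
    (hI : RoundsInput X A D C xs ys B R) {m : ℕ} (hm : 1 ≤ m) (hmB : (5 * m * B : ℝ) ≤ A) (k : ℕ)
    {r σ : ℕ} {w : List (ℤ × ℤ)} (hw : PartialSum X.N (prodVec xs ys) r σ w) (hrk : r + k = R)
    (hσ : σ + 2 * roundParam B r + k ≤ 3 * B) :
    Always (rounds C X xs ys B m k ((2 ^ r : ℕ) : ℤ) w)
      (k * (m * roundCost X D (xs.length + ys.length + 4 * B)) +
        m * (paramCost X D C B m * (2 * roundParam B r + k))) (fun _ => True) := by
  have hX := hI.ctx
  induction k generalizing r σ w with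
  | zero => exact Always.mono (t := 0) (Always.pure trivial) (Nat.zero_le _)
  | succ k ih =>
    have hr : r < R := by omega
    have hin := hI.roundInput hw hr.le
    have hb1 := one_le_roundParam hI.one_le_B r
    have hbB := roundParam_le hI.one_le_B r
    have hb2 := two_mul_roundParam_succ_le B r
    set b := roundParam B r with hb
    set H := xs.length + ys.length + 4 * B with hH
    have hwlen := hw.length_le
    have hmb : (5 * m * b : ℝ) ≤ A := by
      refine le_trans ?_ hmB
      have : (b : ℝ) ≤ B := by exact_mod_cast hbB
      gcongr
    have hloc := locate_always hX hin hb1 hI.C_ge hI.one_le_len (hI.modulus_roundParam_le r) hm hmb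
    have hT := locateTime_le X D C (k := xs.length + ys.length + w.length) (H := H) hm hb1 hbB
      (by omega) (by have := hI.C_ge; omega) hI.one_le_len
    set T := locateTime X D b (C * b * X.len * X.len) (xs.length + ys.length + w.length) m with hTdef
    set y := (H + 4) * ((X.terms + 1) * unitCost (D + 3)) with hy
    rw [rounds]
    refine Always.mono (t := unitCost D + (T + (5 * y + (unitCost D +
      (k * (m * roundCost X D H) + m * (paramCost X D C B m * (2 * roundParam B (r + 1) + k))))))) ?_ ?_
    · refine Always.bind (Always.lift (hI.roundParam_val hr.le)) fun x hx => ?_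
      subst hx
      refine Always.bind hloc fun z hz => ?_
      have hzlen := hz.length_le
      have hw' := (hw.add X.W hz).1
      refine Always.bind (Always.lift (P := fun l => l = (addSparse X.W w z).val)
        ⟨rfl, ?_⟩) fun w' hw'' => ?_
      · refine (addSparse_time hX.machine w z (fun a ha => ?_) (fun a ha => ?_)).trans ?_
        · refine ⟨hX.small_N.of_nonneg_le (hw.inRange a ha).1 (hw.inRange a ha).2.le,
            hX.small_of_le_A ?_⟩
          have h1 : ((|a.2| : ℤ) : ℝ) ≤ (listNorm w : ℝ) := by exact_mod_cast abs_le_listNorm ha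
          push_cast at h1
          exact h1.trans hin.norm_ws
        · refine ⟨hX.small_N.of_nonneg_le (hz.inRange a ha).1 (hz.inRange a ha).2.le,
            hX.small_of_le (k := 4) (j := 0) (by norm_num) (by norm_num) ?_⟩
          have h1 : ((|a.2| : ℤ) : ℝ) ≤ ((4 * vecNorm (prodVec xs ys - listVec w) : ℤ) : ℝ) :=
            Int.cast_le.2 ((abs_le_listNorm ha).trans hz.norm_le)
          push_cast at h1
          rw [pow_zero, mul_one]
          have h7 := hin.vecNorm_le
          have h8 : (4 : ℝ) * A ^ 3 ≤ A ^ 4 := hX.mul_pow_le (by norm_num) 3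
          linarith
        · have hU1 : unitCost (D + 1) ≤ unitCost (D + 3) := unitCost_mono (by omega)
          have hU := one_le_unitCost (D + 3)
          calc _ ≤ (H + 4) * (5 * unitCost (D + 3)) := Nat.mul_le_mul (by omega) (by omega)
            _ = 5 * ((H + 4) * (1 * unitCost (D + 3))) := by ring
            _ ≤ 5 * y := by
                rw [hy]
                gcongr
                omega
      · subst hw''
        exact Always.bind (Always.lift (hI.double_runs hr)) fun P' hP' => by
          subst hP'
          exact ih hw' (by omega) (by omega)
    · have e1 : roundCost X D H = 100 * y := rfl
      have e2 : paramCost X D C B m * (2 * roundParam B (r + 1) + k) ≤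
          paramCost X D C B m * (b + (k + 1)) := Nat.mul_le_mul_left _ (by omega)
      have e3 := Nat.mul_le_mul_left m e2
      have e4 : m * (paramCost X D C B m * (b + (k + 1))) + m * (paramCost X D C B m * b) =
          m * (paramCost X D C B m * (2 * b + (k + 1))) := by ring
      have e5 : y ≤ m * y := Nat.le_mul_of_pos_left _ hm
      rw [e1]
      have e6 : (k + 1) * (m * (100 * y)) = k * (m * (100 * y)) + 100 * (m * y) := by ring
      rw [mul_add] at hT
      have e7 : m * (90 * y) = 90 * (m * y) := by ring
      rw [e7] at hT
      rw [e6]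
      omega

/-! ### Sparse lists and dense vectors -/

section
variable {N : ℕ} {L : List (ℤ × ℤ)} {x : Fin N → ℤ}

theorem Represents.toFinset_eq (h : Represents L x) :
    L.toFinset = (Finset.univ.filter fun k => x k ≠ 0).image fun k : Fin N =>
      (((k : ℕ) : ℤ), x k) := by
  ext ⟨i, c⟩
  rw [List.mem_toFinset, h.2, Finset.mem_image]
  constructor
  · rintro ⟨k, rfl, rfl, h0⟩
    exact ⟨k, by simpa using h0, rfl⟩
  · rintro ⟨k, hk, he⟩
    obtain ⟨rfl, rfl⟩ := Prod.mk.inj he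
    exact ⟨k, rfl, rfl, by simpa using hk⟩

/-- Zero coordinates contribute nothing and the order of the list is irrelevant, so sums over the
list become sums over the dense vector. -/
theorem Represents.sum_map {M : Type} [AddCommMonoid M] (h : Represents L x) (F : ℤ × ℤ → M)
    (hF : ∀ i, F (i, 0) = 0) : (L.map F).sum = ∑ k : Fin N, F (((k : ℕ) : ℤ), x k) := by
  rw [← List.sum_toFinset _ (List.Nodup.of_map _ h.1), h.toFinset_eq, Finset.sum_image]
  · refine Finset.sum_subset (Finset.filter_subset _ _) fun k _ hk => ?_
    have : x k = 0 := by simpa using hk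
    rw [this, hF]
  · intro k _ l _ hkl
    have := (Prod.mk.inj hkl).1
    exact Fin.ext (by exact_mod_cast this)

theorem Represents.length_eq (h : Represents L x) : L.length = norm0 x := by
  rw [← List.toFinset_card_of_nodup (List.Nodup.of_map _ h.1), h.toFinset_eq,
    Finset.card_image_of_injective, norm0]
  intro k l hkl
  have := (Prod.mk.inj hkl).1
  exact Fin.ext (by exact_mod_cast this)

theorem Represents.inRange (h : Represents L x) : InRange N L := by
  intro a ha
  obtain ⟨k, hk, -⟩ := (h.2 a.1 a.2).1 ha
  have := k.2
  omega

theorem Represents.listNorm_le (h : Represents L x) {M : ℤ} (hM : ∀ k, |x k| ≤ M) :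
    listNorm L ≤ N * M := by
  rw [listNorm, h.sum_map _ fun i => by simp]
  refine (Finset.sum_le_sum fun k _ => hM k).trans ?_
  simp

theorem prodVec_apply {N' : ℕ} {L' : List (ℤ × ℤ)} {y : Fin N' → ℤ} (hx : Represents L x)
    (hy : Represents L' y) (i : ℤ) :
    prodVec L L' i =
      ∑ j : Fin N, ∑ j' : Fin N', if ((j : ℕ) : ℤ) + ((j' : ℕ) : ℤ) = i then x j * y j' else 0 := by
  rw [prodVec, hx.sum_map _ fun i => by simp, Finsupp.finsetSum_apply]
  refine Finset.sum_congr rfl fun j _ => ?_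
  rw [hy.sum_map _ fun i => by simp, Finsupp.finsetSum_apply]
  exact Finset.sum_congr rfl fun j' _ => by rw [Finsupp.single_apply]

end

theorem vecNorm_prodVec_le (xs ys : List (ℤ × ℤ)) :
    vecNorm (prodVec xs ys) ≤ listNorm xs * listNorm ys := by
  have key : ∀ a : ℤ × ℤ, vecNorm ((ys.map fun b => Finsupp.single (a.1 + b.1) (a.2 * b.2)).sum) ≤
      |a.2| * listNorm ys := by
    intro a
    induction ys with
    | nil => simp [vecNorm]
    | cons b ys ih =>
      rw [List.map_cons, List.sum_cons, listNorm_cons, mul_add]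
      refine (vecNorm_add_le _ _).trans (add_le_add ?_ ih)
      rw [vecNorm_single, abs_mul]
  induction xs with
  | nil => simp [vecNorm, prodVec]
  | cons a xs ih =>
    rw [prodVec, List.map_cons, List.sum_cons, listNorm_cons, add_mul]
    exact (vecNorm_add_le _ _).trans (add_le_add (key a) ih)

section
variable {n : ℕ} {u v : Fin n → ℤ} {xs ys : List (ℤ × ℤ)} (hx : Represents xs (zeroPad u))
  (hy : Represents ys (zeroPad v))
include hx hy

/-- Only indices below n carry nonzero values, so j + j' < 2 n and the reduction modulo 2 n has no
effect. -/
theorem prodVec_zeroPad_apply (k : Fin (2 * n)) :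
    prodVec xs ys ((k : ℕ) : ℤ) = cyclicConv (zeroPad u) (zeroPad v) k := by
  rw [prodVec_apply hx hy, cyclicConv]
  refine Finset.sum_congr rfl fun j _ => Finset.sum_congr rfl fun j' _ => ?_
  by_cases hj : (j : ℕ) < n
  · by_cases hj' : (j' : ℕ) < n
    · rw [Nat.mod_eq_of_lt (by omega)]
      norm_cast
    · simp [zeroPad, hj']
  · simp [zeroPad, hj]

theorem prodVec_zeroPad_ne_zero {i : ℤ} (h : prodVec xs ys i ≠ 0) :
    ∃ k : Fin (2 * n), ((k : ℕ) : ℤ) = i := by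
  rw [prodVec_apply hx hy] at h
  obtain ⟨j, -, hj⟩ := Finset.exists_ne_zero_of_sum_ne_zero h
  obtain ⟨j', -, hj'⟩ := Finset.exists_ne_zero_of_sum_ne_zero hj
  by_cases h1 : (j : ℕ) < n
  · by_cases h2 : (j' : ℕ) < n
    · split_ifs at hj' with h3
      · exact ⟨⟨j + j', by omega⟩, by simpa using h3⟩
      · exact absurd rfl hj'
    · simp [zeroPad, h2] at hj'
  · simp [zeroPad, h1] at hj'

theorem card_support_prodVec :
    (prodVec xs ys).support.card = norm0 (cyclicConv (zeroPad u) (zeroPad v)) := by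
  have h1 : (prodVec xs ys).support =
      (Finset.univ.filter fun k => cyclicConv (zeroPad u) (zeroPad v) k ≠ 0).image
        fun k : Fin (2 * n) => ((k : ℕ) : ℤ) := by
    ext i
    rw [Finsupp.mem_support_iff, Finset.mem_image]
    constructor
    · intro h
      obtain ⟨k, rfl⟩ := prodVec_zeroPad_ne_zero hx hy h
      rw [prodVec_zeroPad_apply hx hy] at h
      exact ⟨k, by simpa using h, rfl⟩
    · rintro ⟨k, hk, rfl⟩
      rw [prodVec_zeroPad_apply hx hy]
      simpa using hk
  rw [h1, Finset.card_image_of_injective, norm0]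
  intro k l hkl
  exact Fin.ext (by simpa using hkl)

theorem represents_of_listVec_eq {w : List (ℤ × ℤ)} (hs : IndexSorted w) (h0 : ∀ a ∈ w, a.2 ≠ 0)
    (he : listVec w = prodVec xs ys) : Represents w (cyclicConv (zeroPad u) (zeroPad v)) := by
  refine ⟨hs.nodup_map_fst, fun i c => ⟨fun h => ?_, ?_⟩⟩
  · have h1 := listVec_apply_of_mem hs.nodup_map_fst h
    have h2 : c ≠ 0 := h0 _ h
    rw [he] at h1
    obtain ⟨k, rfl⟩ := prodVec_zeroPad_ne_zero hx hy (h1.trans_ne h2)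
    exact ⟨k, rfl, by rw [← h1, prodVec_zeroPad_apply hx hy], h2⟩
  · rintro ⟨k, rfl, rfl, h2⟩
    rw [← prodVec_zeroPad_apply hx hy, ← he] at h2 ⊢
    obtain ⟨a, ha, hak⟩ := listVec_apply_ne_zero h2
    rw [← hak, listVec_apply_of_mem hs.nodup_map_fst (i := a.1) (c := a.2) ha]
    exact ha

end

theorem abs_zeroPad_le {n : ℕ} {u : Fin n → ℤ} {M : ℤ} (hM : 0 ≤ M) (h : ∀ i, |u i| ≤ M)
    (k : Fin (2 * n)) : |zeroPad u k| ≤ M := by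
  unfold zeroPad
  split_ifs with hk
  · exact h _
  · simpa using hM

/-! ### The number of repetitions -/

/-- The upper bound expresses minimality of the number of doublings. It may fail if no doubling is
needed, since then d itself can exceed 2 R; hence the proviso. -/
theorem doublings_spec (R : ℕ) (fuel : ℕ) (d : ℝ) (hd : 0 < d) (h : (R : ℝ) ≤ 2 ^ fuel * d) :
    (R : ℝ) ≤ 2 ^ (doublings R fuel d).val * d ∧
      ((doublings R fuel d).val ≠ 0 → 2 ^ (doublings R fuel d).val * d ≤ 2 * R) ∧
      (doublings R fuel d).time ≤ (doublings R fuel d).val + 1 := by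
  induction fuel generalizing d with
  | zero =>
    have h1 : doublings R 0 d = ⟨0, 0⟩ := rfl
    rw [h1]
    simpa using h
  | succ fuel ih =>
    by_cases hR : (R : ℝ) ≤ d
    · have h1 : doublings R (fuel + 1) d = ⟨0, 1⟩ := by
        rw [doublings, if_pos hR]
        rfl
      rw [h1]
      simpa using hR
    · have h1 : doublings R (fuel + 1) d =
          ⟨(doublings R fuel (2 * d)).val + 1, 1 + ((doublings R fuel (2 * d)).time + 0)⟩ := by
        rw [doublings, if_neg hR]
        rfl
      rw [h1]
      obtain ⟨h2, h3, h4⟩ := ih (2 * d) (by positivity) (by rw [pow_succ] at h; linarith)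
      refine ⟨?_, fun _ => ?_, by simp only; omega⟩
      · simp only [pow_succ]
        linarith
      · simp only [pow_succ]
        by_cases h5 : (doublings R fuel (2 * d)).val = 0
        · rw [h5]
          push Not at hR
          linarith
        · linarith [h3 h5]

theorem le_two_pow_ceil_mul {R δ : ℝ} (hδ : 0 < δ) : R ≤ 2 ^ ⌈R / δ⌉₊ * δ := by
  have h1 : R / δ ≤ (2 : ℝ) ^ ⌈R / δ⌉₊ :=
    (Nat.le_ceil _).trans (by exact_mod_cast Nat.lt_two_pow_self.le)
  rwa [div_le_iff₀ hδ] at h1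

/-! ### The shared data -/

/-- Applied with k = (c - 30 g) L, this gives the precision A^30 τ ≤ 1; that 2 k ≥ c L is the reason
for the condition c ≥ 60 g. -/
theorem mul_add_le_two_pow {k : ℕ} (hk : 20 ≤ k) : 100 * (2 * k + 42) ≤ 2 ^ k := by
  induction k, hk using Nat.le_induction with
  | base => norm_num
  | succ k hk ih => rw [pow_succ]; omega

/-- The factorial outgrows 8^K, as K! ≥ 8! 9^(K-8). With K = c L + 40 terms the truncation error 2 ·
4^K / K! of the exponential series is thus at most 2^(40-K) = 1 / S. -/
theorem two_mul_eight_pow_le {K : ℕ} (hK : 40 ≤ K) : 2 * 8 ^ K ≤ 2 ^ 40 * K.factorial := by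
  obtain ⟨m, rfl⟩ := Nat.exists_eq_add_of_le (show 8 ≤ K by omega)
  have h1 := Nat.factorial_mul_pow_le_factorial (m := 8) (n := m)
  have h2 : 8 ^ m ≤ (8 + 1) ^ m := Nat.pow_le_pow_left (by norm_num) m
  have h3 : (8 : ℕ).factorial = 40320 := rfl
  rw [h3] at h1
  rw [pow_add]
  omega

/-- A number of words that suffices for all numbers in the computation. -/
def wordBound (g c : ℕ) : ℕ := 12 * g + 2 * c + 8

/-- With A = 2^(gL) and S = 2^(cL), the largest number to be stored is A^12 S² = 2^((12 g + 2 c) L),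
which explains the number of words; the 8 further words cover numerals. -/
theorem setup_runs {g c n : ℕ} (hg : 10 ≤ g) (hc : 60 * g ≤ c) (hn : 0 < n) :
    Runs (setup c (Nat.clog 2 (2 * n)) (n : ℤ))
      (unitCost (wordBound g c + 1) * ((11 * c + 390) * Nat.clog 2 (2 * n)))
      (fun X => X.W = Nat.clog 2 (2 * n) ∧ X.N = ((2 * n : ℕ) : ℤ) ∧ X.len = Nat.clog 2 (2 * n) ∧
        X.terms = c * Nat.clog 2 (2 * n) + 40 ∧
        GoodCtx X (2 ^ (g * Nat.clog 2 (2 * n))) (wordBound g c)) := by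
  set L := Nat.clog 2 (2 * n) with hL
  set D := wordBound g c with hD
  have hL1 : 1 ≤ L := Nat.clog_pos (by norm_num) (by omega)
  have hNL : 2 * n ≤ 2 ^ L := Nat.le_pow_clog (by norm_num) _
  have hM : Machine D L := ⟨hL1, by rw [hD, wordBound]; omega⟩
  have hgL : 10 ≤ g * L := by nlinarith
  have hcL : 60 * (g * L) ≤ c * L := by nlinarith
  have hcc : c ≤ c * L := Nat.le_mul_of_pos_right _ hL1
  have hkey : 100 * (c * L + 41) ≤ 2 ^ (c * L - 30 * (g * L)) := by
    have h1 := mul_add_le_two_pow (k := c * L - 30 * (g * L)) (by omega)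
    omega
  have hDL : D * L = 12 * (g * L) + 2 * (c * L) + 8 * L := by rw [hD, wordBound]; ring
  have hpow : ∀ z : ℕ, z ≤ 2 ^ (2 * (c * L)) → Small D L (z : ℤ) := by
    intro z hz
    rw [Small, Int.natAbs_natCast]
    exact hz.trans (Nat.pow_le_pow_right (by norm_num) (by omega))
  have hself : ∀ z : ℕ, z ≤ 2 * (c * L) → Small D L (z : ℤ) := fun z hz =>
    hpow z (hz.trans Nat.lt_two_pow_self.le)
  have hn2 : Small D L (n : ℤ) := hpow n (by
    calc n ≤ 2 * n := by omega
      _ ≤ 2 ^ L := hNL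
      _ ≤ _ := Nat.pow_le_pow_right (by norm_num) (by nlinarith))
  have hN2 : Small D L (2 * n : ℤ) := by
    have := hpow (2 * n) (hNL.trans (Nat.pow_le_pow_right (by norm_num) (by nlinarith)))
    exact_mod_cast this
  have hK1 : c * L + 40 + 1 ≤ 2 ^ (c * L) := by
    have : 2 ^ (c * L - 30 * (g * L)) ≤ 2 ^ (c * L) :=
      Nat.pow_le_pow_right (by norm_num) (Nat.sub_le _ _)
    omega
  have hclog : Nat.clog 2 (2 * (n : ℤ)).toNat = L := by
    rw [hL]
    congr 1
  set U := unitCost (D + 1) with hU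
  have hDU : unitCost D ≤ U := unitCost_mono (by omega)
  have hU1 : 1 ≤ U := one_le_unitCost _
  refine Runs.mono (t := U + ((L + 1) * (3 * U) + (U + (c * L * (U + 1) + (U +
    (9 * U * (c * L + 40 + 1) + 0)))))) ?_ ?_
  swap
  · have h1 : U ≤ U * L := Nat.le_mul_of_pos_right _ hL1
    have h2 : c * L ≤ c * L * U := Nat.le_mul_of_pos_right _ hU1
    nlinarith
  refine Runs.bind ((ev_runs hM (2 * Exp.lit (n : ℤ)) ⟨hM.small_two, hn2⟩).mono hDU) fun N hN => ?_
  simp only [Exp.eval_mul, Exp.eval_two, Exp.eval_lit] at hN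
  subst hN
  refine Runs.bind (log2up_runs hM _ hN2 (by omega)) fun l hl => ?_
  rw [hclog] at hl
  subst hl
  refine Runs.bind ((ev_runs hM (Exp.lit (c : ℤ) * Exp.lit (L : ℤ))
    ⟨hself c (by omega), hself L (by nlinarith)⟩).mono hDU) fun s hs => ?_
  simp only [Exp.eval_mul, Exp.eval_lit] at hs
  have hs' : s = ((c * L : ℕ) : ℤ) := by rw [hs]; push_cast; rfl
  clear hs
  subst hs'
  rw [Int.toNat_natCast]
  have hloop := forLoop_runs (fun i (P : ℤ) => P = 2 ^ i) U
    (fun _ (P : ℤ) => ev L (2 * Exp.lit P)) 1 (c * L) (by simp) (by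
      rintro i hi P rfl
      have h1 : Small D L ((2 ^ i : ℕ) : ℤ) :=
        hpow _ (Nat.pow_le_pow_right (by norm_num) (by omega))
      push_cast at h1
      refine ((ev_runs hM (2 * Exp.lit (2 ^ i)) ⟨hM.small_two, h1⟩).mono hDU).imp fun a ha => ?_
      rw [ha]
      simp [pow_succ'])
  refine Runs.bind hloop fun S hS => ?_
  refine Runs.bind ((ev_runs hM (Exp.lit ((c * L : ℕ) : ℤ) + 40)
    ⟨hself _ (by omega), hM.small_forty⟩).mono hDU) fun K hK => ?_
  have hK' : K.toNat = c * L + 40 := by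
    rw [hK]
    simp only [Exp.eval_add, Exp.eval_lit, Exp.eval_forty]
    omega
  rw [hK']
  have hSpos : 0 < S := by rw [hS]; positivity
  have hSr : (S : ℝ) = 2 ^ (c * L) := by rw [hS]; push_cast; rfl
  have hSK : Small D L (S * (((c * L + 40 : ℕ) : ℤ) + 1)) := by
    have h1 := hpow (2 ^ (c * L) * (c * L + 40 + 1)) (by
      rw [two_mul, pow_add]
      exact Nat.mul_le_mul_left _ hK1)
    rw [hS]
    push_cast at h1 ⊢
    exact h1
  have hS4 : (S : ℝ) ≤ 4 ^ (c * L + 40) := by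
    rw [hSr, show (4 : ℝ) = 2 ^ 2 by norm_num, ← pow_mul]
    exact pow_le_pow_right₀ (by norm_num) (by omega)
  refine Runs.bind ((piT_runs hM hSpos hSK hS4).mono (by gcongr)) fun pi hpi => ?_
  refine Runs.pure ⟨rfl, by push_cast; rfl, rfl, rfl, ?_⟩
  constructor
  case machine => exact hM
  case n_pos => show (1 : ℤ) ≤ n; omega
  case N_eq => rfl
  case S_pos => exact hSpos
  case A_ge =>
    calc (1000 : ℝ) ≤ 2 ^ 10 := by norm_num
      _ ≤ _ := pow_le_pow_right₀ (by norm_num) hgL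
  case N_le =>
    have h1 : ((2 * n : ℕ) : ℝ) ≤ 2 ^ L := by exact_mod_cast hNL
    have h2 : L ≤ g * L := Nat.le_mul_of_pos_left _ (by omega)
    show ((2 * (n : ℤ) : ℤ) : ℝ) ≤ 2 ^ (g * L)
    refine le_trans ?_ (h1.trans (pow_le_pow_right₀ (by norm_num) h2))
    push_cast
    rfl
  case N_le_pow =>
    show 2 * (n : ℤ) ≤ 2 ^ L
    exact_mod_cast hNL
  case terms_le =>
    show ((c * L + 40 : ℕ) : ℝ) + 1 ≤ (S : ℝ)
    rw [hSr]
    exact_mod_cast hK1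
  case trunc =>
    show 2 * 4 ^ (c * L + 40) / ((c * L + 40).factorial : ℝ) ≤ 1 / (S : ℝ)
    rw [hSr, div_le_div_iff₀ (by positivity) (by positivity)]
    have h1 : (2 : ℝ) * 8 ^ (c * L + 40) ≤ 2 ^ 40 * ((c * L + 40).factorial : ℝ) := by
      exact_mod_cast two_mul_eight_pow_le (K := c * L + 40) (by omega)
    rw [show (8 : ℝ) = 4 * 2 by norm_num, mul_pow, pow_add 2 (c * L) 40] at h1
    have h2 : (0 : ℝ) < 2 ^ 40 := by positivity
    refine le_of_mul_le_mul_left ?_ h2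
    linarith
  case eight_le_terms => show 8 ≤ c * L + 40; omega
  case pi_err => exact_mod_cast hpi
  case err =>
    show ((2 : ℝ) ^ (g * L)) ^ 30 * (100 * (((c * L + 40 : ℕ) : ℝ) + 1) / S) ≤ 1
    rw [← mul_div_assoc, hSr, div_le_one (by positivity), ← pow_mul]
    have h1 : (100 : ℝ) * (((c * L + 40 : ℕ) : ℝ) + 1) ≤ 2 ^ (c * L - 30 * (g * L)) := by
      exact_mod_cast hkey
    calc _ ≤ (2 : ℝ) ^ (g * L * 30) * 2 ^ (c * L - 30 * (g * L)) := by gcongr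
      _ = _ := by rw [← pow_add]; congr 1; omega
  case big =>
    show ((2 : ℝ) ^ (g * L)) ^ 12 * (S : ℝ) ^ 2 ≤ 2 ^ (D * L)
    rw [hSr, ← pow_mul, ← pow_mul, ← pow_add]
    exact pow_le_pow_right₀ (by norm_num) (by omega)

/-! ### The bounds on the input -/

/-- The exponent for which `2 ^ (boundExp C κ * len)` bounds the input. -/
def boundExp (C κ : ℕ) : ℕ := 5 * κ + C + 10

section
variable {C κ n B : ℕ}

theorem clog_le_of_le_pow (hB : B ≤ (2 * n) ^ κ) : Nat.clog 2 B ≤ κ * Nat.clog 2 (2 * n) := by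
  rw [Nat.clog_le_iff_le_pow (by norm_num), mul_comm, pow_mul]
  exact hB.trans (Nat.pow_le_pow_left (Nat.le_pow_clog (by norm_num) _) _)

theorem clog_le_self (B : ℕ) : Nat.clog 2 B ≤ B := by
  rw [Nat.clog_le_iff_le_pow (by norm_num)]
  exact Nat.lt_two_pow_self.le

/-- All quantities are bounded by powers of 2 with exponents linear in L. With R ≤ κ L and 5^R ≤
2^(3R), the norm of the remaining vector needs the exponent 1 + 3 R + 2 L + 2 κ L and the modulus
needs 2 + C + R + 2 L; (5 κ + C + 10) L dominates both. -/
theorem roundsInput {D : ℕ} {X : Ctx} {u v : Fin n → ℤ} {xs ys : List (ℤ × ℤ)} (hn : 0 < n)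
    (hC : 360000 ≤ C) (hx : Represents xs (zeroPad u)) (hy : Represents ys (zeroPad v))
    (hu : ∀ i, |u i| ≤ (2 * (n : ℤ)) ^ κ) (hv : ∀ i, |v i| ≤ (2 * (n : ℤ)) ^ κ)
    (hB : B ≤ (2 * n) ^ κ) (hB1 : 1 ≤ B) (hN : X.N = ((2 * n : ℕ) : ℤ))
    (hlen : X.len = Nat.clog 2 (2 * n))
    (hX : GoodCtx X (2 ^ (boundExp C κ * Nat.clog 2 (2 * n))) D) :
    RoundsInput X (2 ^ (boundExp C κ * Nat.clog 2 (2 * n))) D C xs ys B (Nat.clog 2 B) := by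
  have hL1 : 1 ≤ Nat.clog 2 (2 * n) := Nat.clog_pos (by norm_num) (by omega)
  have hR := clog_le_of_le_pow hB
  have hNL : 2 * n ≤ 2 ^ Nat.clog 2 (2 * n) := Nat.le_pow_clog (by norm_num) _
  have hBR : B ≤ 2 ^ Nat.clog 2 B := Nat.le_pow_clog (by norm_num) _
  set L := Nat.clog 2 (2 * n) with hL
  set R := Nat.clog 2 B with hRdef
  have hκ : (2 * (n : ℤ)) ^ κ ≤ 2 ^ (κ * L) := by
    rw [mul_comm κ, pow_mul]
    exact pow_le_pow_left₀ (by positivity) (by exact_mod_cast hNL) _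
  have hg : boundExp C κ * L = 5 * (κ * L) + C * L + 10 * L := by rw [boundExp]; ring
  have hCL : C ≤ C * L := Nat.le_mul_of_pos_right _ hL1
  have hA : ∀ {z : ℤ} {e : ℕ}, z ≤ 2 ^ e → e ≤ boundExp C κ * L →
      (z : ℝ) ≤ 2 ^ (boundExp C κ * L) := fun {z e} h1 h2 => by
    have h3 : z ≤ 2 ^ (boundExp C κ * L) := h1.trans (pow_le_pow_right₀ (by norm_num) h2)
    exact_mod_cast h3
  have hnorm : ∀ {L' : List (ℤ × ℤ)} {w : Fin n → ℤ}, Represents L' (zeroPad w) →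
      (∀ i, |w i| ≤ (2 * (n : ℤ)) ^ κ) → listNorm L' ≤ 2 ^ (L + κ * L) := fun {L' w} h1 h2 => by
    refine (h1.listNorm_le (abs_zeroPad_le (by positivity) h2)).trans ?_
    rw [pow_add]
    exact mul_le_mul (by exact_mod_cast hNL) hκ (by positivity) (by positivity)
  have hprod : vecNorm (prodVec xs ys) ≤ 2 ^ (2 * L + 2 * (κ * L)) := by
    refine (vecNorm_prodVec_le xs ys).trans ?_
    refine (mul_le_mul (hnorm hx hu) (hnorm hy hv) (listNorm_nonneg _) (by positivity)).trans ?_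
    rw [← pow_add]
    exact (congrArg (2 ^ ·) (by ring)).le
  constructor
  case ctx => exact hX
  case one_le_len => rw [hlen]; exact hL1
  case C_ge => exact hC
  case inRange_xs => rw [hN]; exact hx.inRange
  case inRange_ys => rw [hN]; exact hy.inRange
  case norm_xs => exact hA (hnorm hx hu) (by omega)
  case norm_ys => exact hA (hnorm hy hv) (by omega)
  case support =>
    intro i hi
    obtain ⟨k, rfl⟩ := prodVec_zeroPad_ne_zero hx hy (Finsupp.mem_support_iff.1 hi)
    have := k.2
    omega
  case norm_prod =>
    have h1 : 2 * (5 ^ R * vecNorm (prodVec xs ys)) ≤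
        (2 : ℤ) ^ (1 + (3 * R + (2 * L + 2 * (κ * L)))) := by
      rw [pow_add, pow_one, pow_add, pow_mul]
      exact mul_le_mul_of_nonneg_left (mul_le_mul
        (pow_le_pow_left₀ (by norm_num) (by norm_num) _) hprod (vecNorm_nonneg _)
        (by positivity)) (by norm_num)
    have h2 := hA h1 (by omega)
    push_cast at h2
    exact h2
  case one_le_B => exact hB1
  case B_le => exact hBR
  case pow_le =>
    exact pow_le_pow_right₀ (by norm_num) (by omega)
  case modulus_le =>
    rw [hlen]
    have h1 : 4 * (C * B * L * L) ≤ 2 ^ (2 + (C + R + L + L)) := by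
      rw [pow_add, pow_add, pow_add, pow_add]
      have hC2 : C ≤ 2 ^ C := Nat.lt_two_pow_self.le
      have hL2 : L ≤ 2 ^ L := Nat.lt_two_pow_self.le
      gcongr
      norm_num
    have h2 := hA (z := ((4 * (C * B * L * L) : ℕ) : ℤ)) (by exact_mod_cast h1) (by omega)
    push_cast at h2 ⊢
    exact h2

/-- From m ≤ 1 + log R + log (1/δ), the hypothesis on δ makes m polynomial in N, so that the
counters of repetitions and records fit into constantly many words. -/
theorem repetitions_mul_le {m : ℕ} {δ : ℝ} (hn : 0 < n) (hB : B ≤ (2 * n) ^ κ) (hB1 : 2 ≤ B)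
    (hδ : 0 < δ) (hδκ : Real.logb 2 (1 / δ) ≤ (2 * (n : ℝ)) ^ κ)
    (hm : 2 ^ m * δ ≤ 2 * (Nat.clog 2 B : ℝ)) :
    m ≤ 3 * 2 ^ (κ * Nat.clog 2 (2 * n)) ∧
      (5 * m * B : ℝ) ≤ 2 ^ (boundExp C κ * Nat.clog 2 (2 * n)) := by
  have hL1 : 1 ≤ Nat.clog 2 (2 * n) := Nat.clog_pos (by norm_num) (by omega)
  have hR := clog_le_of_le_pow hB
  have hR1 : 1 ≤ Nat.clog 2 B := Nat.clog_pos (by norm_num) hB1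
  have hNL : 2 * n ≤ 2 ^ Nat.clog 2 (2 * n) := Nat.le_pow_clog (by norm_num) _
  have hBR : B ≤ 2 ^ Nat.clog 2 B := Nat.le_pow_clog (by norm_num) _
  set L := Nat.clog 2 (2 * n) with hL
  set R := Nat.clog 2 B with hRdef
  have hκ : (2 * (n : ℝ)) ^ κ ≤ 2 ^ (κ * L) := by
    rw [mul_comm κ, pow_mul]
    exact pow_le_pow_left₀ (by positivity) (by exact_mod_cast hNL) _
  have h1 : (m : ℝ) ≤ 1 + Real.logb 2 R + Real.logb 2 (1 / δ) := by
    have hR0 : (R : ℝ) ≠ 0 := by positivity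
    have h2 : (2 : ℝ) ^ m ≤ 2 * R * (1 / δ) := by
      rw [mul_one_div, le_div_iff₀ hδ]
      exact hm
    have h3 := Real.logb_le_logb_of_le (b := 2) (by norm_num) (by positivity) h2
    rw [Real.logb_mul (by positivity) (by positivity), Real.logb_mul (by norm_num) hR0,
      Real.logb_pow, Real.logb_self_eq_one (by norm_num), mul_one] at h3
    exact h3
  have h4 : Real.logb 2 R ≤ 2 ^ (κ * L) := by
    rw [Real.logb_le_iff_le_rpow (by norm_num) (by positivity)]
    have h5 : R ≤ 2 ^ (2 ^ (κ * L)) :=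
      (hR.trans Nat.lt_two_pow_self.le).trans Nat.lt_two_pow_self.le
    have h6 : (R : ℝ) ≤ 2 ^ (2 ^ (κ * L)) := by exact_mod_cast h5
    rw [← Real.rpow_natCast] at h6
    push_cast at h6
    exact h6
  have h7 : (1 : ℝ) ≤ 2 ^ (κ * L) := one_le_pow₀ (by norm_num)
  have h8 : (m : ℝ) ≤ 3 * 2 ^ (κ * L) := by linarith
  refine ⟨by exact_mod_cast h8, ?_⟩
  have h9 : (B : ℝ) ≤ 2 ^ (κ * L) := by
    have : B ≤ 2 ^ (κ * L) := hBR.trans (Nat.pow_le_pow_right (by norm_num) hR)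
    exact_mod_cast this
  have h10 : boundExp C κ * L = 5 * (κ * L) + C * L + 10 * L := by rw [boundExp]; ring
  calc (5 * m * B : ℝ) ≤ 5 * (3 * 2 ^ (κ * L)) * 2 ^ (κ * L) := by gcongr
    _ ≤ 2 ^ 4 * (2 ^ (κ * L) * 2 ^ (κ * L)) := by
      have : (0 : ℝ) ≤ 2 ^ (κ * L) * 2 ^ (κ * L) := by positivity
      linarith
    _ = 2 ^ (4 + (κ * L + κ * L)) := by rw [pow_add, pow_add]
    _ ≤ _ := pow_le_pow_right₀ (by norm_num) (by omega)

end

/-! ### The whole computation -/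

/-- The constant in the bound for the number of steps. -/
def stepConst (C g c : ℕ) : ℕ :=
  unitCost (wordBound g c + 3) *
    (6000 * C + 105 * (wordBound g c + 1) + 2100 * (c + 41) + 540 * (g + 1) + 1000)

/-- The number of steps in terms of the roundings `L` of `log N` and `R` of `log B`. -/
def stepBound (C L R m H B : ℕ) : ℕ :=
  L + R + m + R * m * (H + 8 * B) * L +
    m * B * (L * L) * (Nat.clog 2 (2 * (C * B * L * L)) + 1)

/-- `stepBound` has one summand each for the set-up, the computation of ⌈log B⌉, that of m, the work
on the lists, and the sieves, transforms, decodings and sorts. All constants go into `stepConst`. -/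
theorem time_le_stepBound {X : Ctx} {C g c L R m H B : ℕ} (hW : X.W = L) (hlen : X.len = L)
    (hterms : X.terms = c * L + 40) (hL : 1 ≤ L) (hR : 1 ≤ R) (hRB : R ≤ B) (hm : 1 ≤ m)
    (hmB : Nat.clog 2 (5 * m * B) ≤ g * L) :
    unitCost (wordBound g c + 1) * ((11 * c + 390) * L) +
      ((R + 1) * (3 * unitCost (wordBound g c + 1)) + ((m + 1) +
        (R * (m * roundCost X (wordBound g c) (H + 4 * B)) +
          m * (paramCost X (wordBound g c) C B m * (2 * B + R))))) ≤
      stepConst C g c * stepBound C L R m H B := by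
  have hU1 : unitCost (wordBound g c + 1) ≤ unitCost (wordBound g c + 3) := unitCost_mono (by omega)
  have hV := one_le_unitCost (wordBound g c + 3)
  unfold roundCost paramCost stepConst stepBound
  rw [hW, hlen, hterms]
  generalize unitCost (wordBound g c + 1) = U at *
  generalize unitCost (wordBound g c + 3) = V at *
  generalize wordBound g c = D
  generalize Nat.clog 2 (5 * m * B) = E at *
  generalize Nat.clog 2 (2 * (C * B * L * L)) = Λ
  set Q := 6000 * C + 105 * (D + 1) + 2100 * (c + 41) + 540 * (g + 1) + 1000 with hQ
  have hLL : L ≤ L * L := Nat.le_mul_of_pos_left _ hL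
  have hterm : c * L + 40 + 1 ≤ (c + 41) * L := by nlinarith
  have e1 : U * ((11 * c + 390) * L) ≤ V * Q * L := by
    rw [mul_assoc]
    exact Nat.mul_le_mul hU1 (Nat.mul_le_mul_right _ (by omega))
  have e2 : (R + 1) * (3 * U) ≤ V * Q * R := by
    calc (R + 1) * (3 * U) ≤ (2 * R) * (3 * V) := by gcongr; omega
      _ = V * 6 * R := by ring
      _ ≤ _ := by gcongr; omega
  have e3 : m + 1 ≤ V * Q * m := by
    calc m + 1 ≤ 1 * 2 * m := by omega
      _ ≤ _ := by gcongr; omega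
  have e4 : R * (m * (100 * ((H + 4 * B + 4) * ((c * L + 40 + 1) * V)))) ≤
      V * Q * (R * m * (H + 8 * B) * L) := by
    calc _ ≤ R * (m * (100 * ((H + 8 * B) * (((c + 41) * L) * V)))) :=
          Nat.mul_le_mul_left _ (Nat.mul_le_mul_left _ (Nat.mul_le_mul_left _
            (Nat.mul_le_mul (by omega) (Nat.mul_le_mul_right _ hterm))))
      _ = V * (100 * (c + 41)) * (R * m * (H + 8 * B) * L) := by ring
      _ ≤ _ := by gcongr; omega
  have e5 : m * (V * (2000 * (C * L * L * (Λ + 1)) + 35 * (D * L + 1) +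
      100 * ((L + 6) * (c * L + 40 + 1)) + 180 * (E + 1)) * (2 * B + R)) ≤
      V * Q * (m * B * (L * L) * (Λ + 1)) := by
    have f1 : 35 * (D * L + 1) ≤ 35 * (D + 1) * (L * L * (Λ + 1)) := by
      rw [mul_assoc]
      refine Nat.mul_le_mul_left _ ?_
      calc D * L + 1 ≤ (D + 1) * L := by linarith
        _ ≤ (D + 1) * (L * L) := by gcongr
        _ ≤ _ := Nat.mul_le_mul_left _ (Nat.le_mul_of_pos_right _ (by omega))
    have f2 : 100 * ((L + 6) * (c * L + 40 + 1)) ≤ 700 * (c + 41) * (L * L * (Λ + 1)) := by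
      calc 100 * ((L + 6) * (c * L + 40 + 1)) ≤ 100 * ((7 * L) * ((c + 41) * L)) := by
            gcongr; omega
        _ = 700 * (c + 41) * (L * L) := by ring
        _ ≤ _ := Nat.mul_le_mul_left _ (Nat.le_mul_of_pos_right _ (by omega))
    have f3 : 180 * (E + 1) ≤ 180 * (g + 1) * (L * L * (Λ + 1)) := by
      rw [mul_assoc]
      refine Nat.mul_le_mul_left _ ?_
      calc E + 1 ≤ (g + 1) * L := by linarith
        _ ≤ (g + 1) * (L * L) := by gcongr
        _ ≤ _ := Nat.mul_le_mul_left _ (Nat.le_mul_of_pos_right _ (by omega))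
    have f4 : 2000 * (C * L * L * (Λ + 1)) = 2000 * C * (L * L * (Λ + 1)) := by ring
    calc _ ≤ m * (V * ((2000 * C + 35 * (D + 1) + 700 * (c + 41) + 180 * (g + 1)) *
          (L * L * (Λ + 1))) * (3 * B)) := by
            refine Nat.mul_le_mul_left _ (Nat.mul_le_mul (Nat.mul_le_mul_left _ ?_) (by omega))
            refine (add_le_add (add_le_add (add_le_add f4.le f1) f2) f3).trans (le_of_eq ?_)
            ring
      _ = V * (3 * (2000 * C + 35 * (D + 1) + 700 * (c + 41) + 180 * (g + 1))) *
          (m * B * (L * L) * (Λ + 1)) := by ring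
      _ ≤ _ := by gcongr; omega
  rw [mul_add, mul_add, mul_add, mul_add]
  linarith

section
variable {C c κ n B : ℕ} {u v : Fin n → ℤ} {xs ys : List (ℤ × ℤ)} {δ : ℝ} (hn : 0 < n)
  (hC : 360000 ≤ C) (hc : 60 * boundExp C κ ≤ c) (hx : Represents xs (zeroPad u))
  (hy : Represents ys (zeroPad v))
  (hu : ∀ i, |u i| ≤ (2 * (n : ℤ)) ^ κ) (hv : ∀ i, |v i| ≤ (2 * (n : ℤ)) ^ κ)
  (hB : B ≤ (2 * n) ^ κ) (hδ : 0 < δ) (hδ1 : δ < 1)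
include hn hC hc hx hy hu hv hB hδ hδ1

open Classical in
-- The R rounds fail with probability at most R 2^(-m), and m is chosen so that R ≤ 2^m δ.
theorem hashAndIterate_ex
    (hcard : C * norm0 (cyclicConv (zeroPad u) (zeroPad v)) < B) :
    ((hashAndIterate C c n xs ys B δ).ex fun w =>
      if Represents w (cyclicConv (zeroPad u) (zeroPad v)) then 0 else 1) ≤ ENNReal.ofReal δ := by
  have hB1 : 1 ≤ B := by omega
  rw [hashAndIterate, Rnd.ex_lift_bind, Rnd.ex_lift_bind, Rnd.ex_lift_bind,
    log2up_val _ _ (by exact_mod_cast hB1), Int.toNat_natCast]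
  obtain ⟨-, hN, hlen, -, hX⟩ := (setup_runs (g := boundExp C κ) (by unfold boundExp; omega) hc hn).1
  generalize (setup c (Nat.clog 2 (2 * n)) (n : ℤ)).val = X at *
  have hI := roundsInput hn hC hx hy hu hv hB hB1 hN hlen hX
  obtain ⟨h1, -, -⟩ := doublings_spec (Nat.clog 2 B) _ δ hδ (le_two_pow_ceil_mul hδ)
  simp only
  generalize (doublings (Nat.clog 2 B) ⌈(Nat.clog 2 B : ℝ) / δ⌉₊ δ).val = m at *
  have key : ∀ m' : ℕ, 1 ≤ m' →
      ((rounds C X xs ys B m' (Nat.clog 2 B) 1 []).ex fun w =>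
        if Represents w (cyclicConv (zeroPad u) (zeroPad v)) then 0 else 1) ≤
      (Nat.clog 2 B : ℕ) * ENNReal.ofReal ((1 / 2) ^ m') := by
    intro m' hm'
    have h2 := rounds_ex hI (PartialSum.nil X.N (prodVec xs ys)) hm' (Nat.clog 2 B)
      (by omega) (by simpa [card_support_prodVec hx hy] using hcard)
    refine le_trans (Rnd.ex_mono _ fun w => ?_) h2
    split_ifs with h3 h4 h4
    · exact le_rfl
    · exact zero_le
    · exact absurd (represents_of_listVec_eq hx hy h4.1 h4.2.1 h4.2.2) h3
    · exact le_rfl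
  rcases Nat.eq_zero_or_pos (Nat.clog 2 B) with h0 | h0
  · have h2 := key 1 le_rfl
    rw [h0] at h2 ⊢
    refine le_trans (le_of_eq rfl) (h2.trans ?_)
    simp
  · have hR : (1 : ℝ) ≤ (Nat.clog 2 B : ℕ) := by exact_mod_cast h0
    have hm : 1 ≤ m := by
      by_contra hm
      have : m = 0 := by omega
      rw [this, pow_zero] at h1
      linarith
    refine (key m hm).trans ?_
    rw [← ENNReal.ofReal_natCast, ← ENNReal.ofReal_mul (by positivity)]
    refine ENNReal.ofReal_le_ofReal ?_
    rw [one_div, inv_pow, ← div_eq_mul_inv, div_le_iff₀ (by positivity)]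
    linarith

theorem hashAndIterate_always (hB3 : 3 ≤ B)
    (hδκ : Real.logb 2 (1 / δ) ≤ (2 * (n : ℝ)) ^ κ) :
    ∃ m : ℕ, 2 ^ m * δ ≤ 2 * (Nat.clog 2 B : ℝ) ∧
      Always (hashAndIterate C c n xs ys B δ)
        (stepConst C (boundExp C κ) c * stepBound C (Nat.clog 2 (2 * n)) (Nat.clog 2 B) m
          (xs.length + ys.length) B) (fun _ => True) := by
  have hL1 : 1 ≤ Nat.clog 2 (2 * n) := Nat.clog_pos (by norm_num) (by omega)
  have hR1 : 1 ≤ Nat.clog 2 B := Nat.clog_pos (by norm_num) (by omega)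
  obtain ⟨h1, h2, h3⟩ := doublings_spec (Nat.clog 2 B) _ δ hδ (le_two_pow_ceil_mul hδ)
  have hm0 : (doublings (Nat.clog 2 B) ⌈(Nat.clog 2 B : ℝ) / δ⌉₊ δ).val ≠ 0 := by
    intro h
    rw [h, pow_zero] at h1
    have : (1 : ℝ) ≤ (Nat.clog 2 B : ℕ) := by exact_mod_cast hR1
    linarith
  have hm2 := h2 hm0
  refine ⟨_, hm2, ?_⟩
  obtain ⟨-, hmB⟩ := repetitions_mul_le (C := C) hn hB (by omega) hδ hδκ hm2
  have hsetup := setup_runs (g := boundExp C κ) (by unfold boundExp; omega) hc hn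
  obtain ⟨hW, hN, hlen, hterms, hX⟩ := hsetup.1
  have hI := roundsInput hn hC hx hy hu hv hB (by omega) hN hlen hX
  set m := (doublings (Nat.clog 2 B) ⌈(Nat.clog 2 B : ℝ) / δ⌉₊ δ).val with hm
  set X := (setup c (Nat.clog 2 (2 * n)) (n : ℤ)).val with hXdef
  have hclog : Nat.clog 2 (5 * m * B) ≤ boundExp C κ * Nat.clog 2 (2 * n) := by
    rw [Nat.clog_le_iff_le_pow (by norm_num)]
    exact_mod_cast hmB
  refine Always.mono ?_ (time_le_stepBound hW hlen hterms hL1 hR1 (clog_le_self B)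
    (Nat.one_le_iff_ne_zero.2 hm0) hclog)
  have hsmall : Small (wordBound (boundExp C κ) c) X.W (B : ℤ) := hX.small_of_le_A (by
    rw [Int.cast_natCast, abs_of_nonneg (by positivity)]
    have : (B : ℝ) ≤ 2 ^ Nat.clog 2 B := by exact_mod_cast hI.B_le
    exact this.trans hI.pow_le)
  have a1 : Runs (setup c (Nat.clog 2 (2 * n)) (n : ℤ)) _ (fun Y => Y = X) := ⟨rfl, hsetup.2⟩
  have a2 := log2up_runs hX.machine (B : ℤ) hsmall (by omega)
  rw [Int.toNat_natCast] at a2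
  have a3 : Runs (doublings (Nat.clog 2 B) ⌈(Nat.clog 2 B : ℝ) / δ⌉₊ δ) (m + 1) (fun k => k = m) :=
    ⟨rfl, h3⟩
  rw [hashAndIterate]
  refine Always.bind (Always.lift a1) ?_
  rintro _ rfl
  refine Always.bind (Always.lift a2) ?_
  rintro _ rfl
  refine Always.bind (Always.lift a3) ?_
  rintro _ rfl
  have a4 := rounds_always hI (Nat.one_le_iff_ne_zero.2 hm0) hmB (Nat.clog 2 B)
    (PartialSum.nil X.N (prodVec xs ys)) (by omega)
    (by rw [roundParam_zero]; have := clog_le_self B; omega)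
  rw [roundParam_zero] at a4
  exact a4

end

/-! ### The bound in terms of real logarithms -/

theorem clog_le_logb_add_one {k : ℕ} (hk : 1 ≤ k) : (Nat.clog 2 k : ℝ) ≤ Real.logb 2 k + 1 := by
  rw [← Real.natCeil_logb_natCast, Nat.cast_ofNat]
  refine (Nat.ceil_lt_add_one (Real.logb_nonneg (by norm_num) ?_)).le
  exact_mod_cast hk

theorem logb_two_le_self {x : ℝ} (hx : 0 < x) : Real.logb 2 x ≤ x := by
  rw [Real.logb_le_iff_le_rpow (by norm_num) hx]
  have h1 := one_add_mul_self_le_rpow_one_add (s := 1) (p := max x 1) (by norm_num)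
    (le_max_right _ _)
  rcases le_total 1 x with h | h
  · rw [max_eq_left h] at h1
    norm_num at h1
    linarith
  · exact h.trans (Real.one_le_rpow (by norm_num) hx.le)

/-- B ≥ 3 keeps log (log B / δ) away from 0: 2^3 ≤ 3^2 gives log B ≥ 3/2, and (3/2)² ≥ 2 gives log
(log B / δ) ≥ 1/2. The roundings in L, R and m are then absorbed by constant factors. -/
theorem stepBound_le {C n B m : ℕ} {δ : ℝ} (hC : 1 ≤ C) (hn : 0 < n) (hB : 3 ≤ B) (hδ : 0 < δ)
    (hδ1 : δ < 1) (hm : 2 ^ m * δ ≤ 2 * (Nat.clog 2 B : ℝ)) (H : ℕ) :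
    (stepBound C (Nat.clog 2 (2 * n)) (Nat.clog 2 B) m H B : ℝ) ≤ (20 * C + 300) *
      ((B * Real.logb 2 (2 * n) ^ 2 * Real.logb 2 (B * Real.logb 2 (2 * n) ^ 2) +
        H * Real.logb 2 (2 * n) * Real.logb 2 B) * Real.logb 2 (Real.logb 2 B / δ)) := by
  have hB' : (3 : ℝ) ≤ B := by exact_mod_cast hB
  have hC' : (1 : ℝ) ≤ C := by exact_mod_cast hC
  have hL := clog_le_logb_add_one (k := 2 * n) (by omega)
  have hR := clog_le_logb_add_one (k := B) (by omega)
  have hL1 : 1 ≤ Nat.clog 2 (2 * n) := Nat.clog_pos (by norm_num) (by omega)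
  have hℓ1 : 1 ≤ Real.logb 2 (2 * n) := by
    rw [Real.le_logb_iff_rpow_le (by norm_num) (by positivity), Real.rpow_one]
    have : (1 : ℝ) ≤ n := by exact_mod_cast hn
    linarith
  have hb1 : 3 / 2 ≤ Real.logb 2 B := by
    have h1 : Real.logb 2 3 ≤ Real.logb 2 B := Real.logb_le_logb_of_le (by norm_num) (by norm_num) hB'
    have h2 : Real.logb 2 (2 ^ 3) ≤ Real.logb 2 (3 ^ 2) :=
      Real.logb_le_logb_of_le (by norm_num) (by norm_num) (by norm_num)
    rw [Real.logb_pow, Real.logb_pow, Real.logb_self_eq_one (by norm_num)] at h2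
    push_cast at h2
    linarith
  push_cast at hL
  set L := Nat.clog 2 (2 * n) with hLdef
  set R := Nat.clog 2 B with hRdef
  set ℓ := Real.logb 2 (2 * n) with hℓ
  set b := Real.logb 2 B with hb
  set P := Real.logb 2 (B * ℓ ^ 2) with hP
  set q := Real.logb 2 (b / δ) with hq
  have hbP : b ≤ P := Real.logb_le_logb_of_le (by norm_num) (by positivity)
    (le_mul_of_one_le_right (by positivity) (one_le_pow₀ hℓ1))
  have hbδ : b ≤ b / δ := le_div_self (by linarith) hδ hδ1.le
  have hq1 : 1 ≤ 2 * q := by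
    have h1 : Real.logb 2 2 ≤ Real.logb 2 ((b / δ) ^ 2) :=
      Real.logb_le_logb_of_le (by norm_num) (by norm_num) (by nlinarith)
    rw [Real.logb_pow, Real.logb_self_eq_one (by norm_num)] at h1
    exact_mod_cast h1
  have hL2 : (L : ℝ) ≤ 2 * ℓ := by linarith
  have hR2 : (R : ℝ) ≤ 2 * b := by linarith
  have hm5 : (m : ℝ) ≤ 5 * q := by
    have h1 : (2 : ℝ) ^ m ≤ 2 ^ 2 * (b / δ) := by
      rw [← mul_div_assoc, le_div_iff₀ hδ]
      linarith
    have h2 := Real.logb_le_logb_of_le (b := 2) (by norm_num) (by positivity) h1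
    rw [Real.logb_mul (by norm_num) (by positivity), Real.logb_pow, Real.logb_pow,
      Real.logb_self_eq_one (by norm_num)] at h2
    push_cast at h2
    linarith
  -- The logarithm of the modulus is that of B log² N up to an additive log C ≤ C and constants; as
  -- P ≥ 1, these are absorbed in the factor C + 6.
  have hΛ : (Nat.clog 2 (2 * (C * B * L * L)) : ℝ) + 1 ≤ (C + 6) * P := by
    have h0 : 1 ≤ 2 * (C * B * L * L) := by
      have : 0 < C * B * L * L := by positivity
      omega
    have h1 := clog_le_logb_add_one h0
    have h2 : Real.logb 2 ((2 * (C * B * L * L) : ℕ) : ℝ) ≤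
        Real.logb 2 (2 ^ 3 * (C * (B * ℓ ^ 2))) := by
      refine Real.logb_le_logb_of_le (by norm_num) (by exact_mod_cast h0) ?_
      push_cast
      calc (2 : ℝ) * (C * B * L * L) ≤ 2 * (C * B * (2 * ℓ) * (2 * ℓ)) := by gcongr
        _ = _ := by ring
    rw [Real.logb_mul (by norm_num) (by positivity), Real.logb_mul (by positivity) (by positivity),
      Real.logb_pow, Real.logb_self_eq_one (by norm_num), ← hP] at h2
    have h3 : Real.logb 2 C ≤ C := logb_two_le_self (by positivity)
    push_cast at h1 h2
    have h4 : (C + 5 : ℝ) ≤ (C + 5) * P := le_mul_of_one_le_right (by positivity) (by linarith)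
    linarith
  set Z := B * ℓ ^ 2 * P with hZ
  have hq0 : 0 ≤ q := by linarith
  have hP0 : 0 ≤ P := by linarith
  have hb0 : 0 ≤ b := by linarith
  have hℓ0 : 0 ≤ ℓ := by linarith
  have hZ1 : ℓ * P * B ≤ Z := by
    have : (0 : ℝ) ≤ ℓ * P * B := by positivity
    rw [hZ]
    nlinarith
  have hℓP : ℓ ≤ ℓ * P := le_mul_of_one_le_right hℓ0 (by linarith)
  have hPℓ : P ≤ ℓ * P := le_mul_of_one_le_left hP0 hℓ1
  have hPB : ℓ * P ≤ ℓ * P * B := le_mul_of_one_le_right (by positivity) (by linarith)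
  have hZ0 : 1 ≤ Z := by linarith
  have hZq : Z ≤ 2 * (Z * q) := by nlinarith
  have e1 : (L : ℝ) ≤ 4 * (Z * q) := by linarith
  have e2 : (R : ℝ) ≤ 4 * (Z * q) := by linarith
  have e3 : (m : ℝ) ≤ 5 * (Z * q) := by
    have : q ≤ Z * q := le_mul_of_one_le_left hq0 hZ0
    linarith
  have e4 : (R * m * (H + 8 * B) * L : ℝ) ≤ 20 * (H * ℓ * b * q) + 160 * (Z * q) := by
    calc (R * m * (H + 8 * B) * L : ℝ) ≤ (2 * b) * (5 * q) * (H + 8 * B) * (2 * ℓ) := by gcongr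
      _ = 20 * (H * ℓ * b * q) + 160 * (ℓ * b * B * q) := by ring
      _ ≤ 20 * (H * ℓ * b * q) + 160 * (ℓ * P * B * q) := by gcongr
      _ ≤ _ := by gcongr
  have e5 : (m * B * (L * L) * (Nat.clog 2 (2 * (C * B * L * L)) + 1) : ℝ) ≤
      20 * (C + 6) * (Z * q) := by
    calc _ ≤ (5 * q) * B * ((2 * ℓ) * (2 * ℓ)) * ((C + 6) * P) := by gcongr
      _ = _ := by rw [hZ]; ring
  have e6 : 0 ≤ H * ℓ * b * q := by positivity
  have e7 : 0 ≤ Z * q := by positivity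
  have e8 : 0 ≤ C * (H * ℓ * b * q) := by positivity
  rw [stepBound]
  push_cast
  rw [add_mul]
  linarith

end SparseConv

theorem mainTheorem2 :
    ∃ C₀ : ℕ, ∀ C : ℕ, C₀ ≤ C → ∀ κ : ℕ, ∃ c₀ : ℕ, ∀ c : ℕ, c₀ ≤ c → ∃ K : ℝ,
      ∀ (n : ℕ) (u v : Fin n → ℤ) (xs ys : List (ℤ × ℤ)) (B : ℕ) (δ : ℝ),
        0 < n →
        SparseConv.Represents xs (SparseConv.zeroPad u) →
        SparseConv.Represents ys (SparseConv.zeroPad v) →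
        (∀ i, |u i| ≤ (2 * (n : ℤ)) ^ κ) → (∀ i, |v i| ≤ (2 * (n : ℤ)) ^ κ) →
        B ≤ (2 * n) ^ κ →
        C * SparseConv.norm0
          (SparseConv.cyclicConv (SparseConv.zeroPad u) (SparseConv.zeroPad v)) < B →
        0 < δ → δ < 1 →
        ENNReal.ofReal (1 - δ) ≤
            (SparseConv.hashAndIterate C c n xs ys B δ).law.toOuterMeasure
              {o | SparseConv.Represents o.val
                (SparseConv.cyclicConv (SparseConv.zeroPad u) (SparseConv.zeroPad v))} ∧
          (3 ≤ B → Real.logb 2 (1 / δ) ≤ (2 * (n : ℝ)) ^ κ →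
            ∀ o ∈ (SparseConv.hashAndIterate C c n xs ys B δ).law.support,
              (o.time : ℝ) ≤ K *
                ((B * Real.logb 2 (2 * n) ^ 2 * Real.logb 2 (B * Real.logb 2 (2 * n) ^ 2) +
                    ((SparseConv.norm0 (SparseConv.zeroPad u) : ℝ) +
                        SparseConv.norm0 (SparseConv.zeroPad v)) *
                      Real.logb 2 (2 * n) * Real.logb 2 B) *
                  Real.logb 2 (Real.logb 2 B / δ))) := by
  -- 360000 is what the count of primes requires, and c ≥ 60 g, with g = `boundExp C κ`, what the
  -- precision requires.
  refine ⟨360000, fun C hC κ => ⟨60 * SparseConv.boundExp C κ, fun c hc =>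
    ⟨SparseConv.stepConst C (SparseConv.boundExp C κ) c * (20 * C + 300), ?_⟩⟩⟩
  intro n u v xs ys B δ hn hx hy hu hv hB hcard hδ hδ1
  refine ⟨SparseConv.Rnd.le_toOuterMeasure _ _ hδ.le
    (SparseConv.hashAndIterate_ex hn hC hc hx hy hu hv hB hδ hδ1 hcard), fun hB3 hδκ o ho => ?_⟩
  obtain ⟨m, hm, hA⟩ :=
    SparseConv.hashAndIterate_always hn hC hc hx hy hu hv hB hδ hδ1 hB3 hδκ
  have h1 : (o.time : ℝ) ≤ _ := Nat.cast_le.2 (hA o ho).2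
  refine h1.trans ?_
  rw [Nat.cast_mul, mul_assoc, hx.length_eq, hy.length_eq, ← Nat.cast_add]
  exact mul_le_mul_of_nonneg_left
    (SparseConv.stepBound_le (by omega) hn hB3 hδ hδ1 hm _) (Nat.cast_nonneg _)
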